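/- **Setting.** Let $(V,\mathsf d)$ be a separable metric space with its Borel $\sigma$-algebra, $E=V\times V$, $\overline\nabla f(x,y)=f(y)-f(x)$, $\pi$ a finite positive Borel measure on $V$, and $(\kappa(x,\cdot))_{x\in V}$ Borel measures on $V$ with $\kappa(x,\{x\})=0$, $\sup_{x}\int (1\wedge \mathsf d^2(x,y))\,\kappa(x,dy)<\infty$, such that $x\mapsto\int f(y)(1\wedge \mathsf d^2(x,y))\,\kappa(x,dy)$ is measurable for every bounded Borel $f$, and such that $\theta_\kappa(dx\,dy)=\pi(dx)\kappa(x,dy)$ is invariant under $(x,y)\mapsto(y,x)$. Let $\phi\in C([0,\infty))\cap C^1((0,\infty))$ be convex with $\min\phi=0$ and $\phi(r)/r\to\infty$ as $r\to\infty$; let $\psi^*:\mathbb R\to[0,\infty)$ be convex, differentiable, even, with $\psi^*(0)=0$, $\psi^*(\xi)/|\xi|\to\infty$ as $|\xi|\to\infty$ and $\psi^*(\xi)/|\xi|^2\to c_0\in(0,\infty)$ as $\xi\to0$, and let $\psi$ be its convex conjugate; let $\alpha:[0,\infty)^2\to[0,\infty)$ be continuous, concave, symmetric and not identically zero. For finite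 positive measures $\rho$ on $V$ and $\sigma$-finite signed measures $\boldsymbol j$ on $E$ (pairs $(\boldsymbol j^+,\boldsymbol j^-)$ of mutually singular $\sigma$-finite measures; $|\boldsymbol j|=\boldsymbol j^++\boldsymbol j^-$) put $$\mathscr E(\rho)=\int_V\phi(u)\,d\pi,\qquad \mathscr D(\rho)=\tfrac12\iint_E \mathrm D_\phi(u(x),u(y))\,\theta_\kappa(dx\,dy)\qquad\text{if }\rho=u\pi,$$ both being $+\infty$ if $\rho\not\ll\pi$, and $$\mathscr R(\rho,\boldsymbol j)=\tfrac12\int_E \psi\Big(\frac{d(2\boldsymbol j)}{d\nu_\rho}\Big)d\nu_\rho+\tfrac12\int_E\psi^\infty\Big(\frac{d(2\boldsymbol j)^\perp}{d|(2\boldsymbol j)^\perp|}\Big)d|(2\boldsymbol j)^\perp| ,$$ where $\psi^\infty$ is the recession function of $\psi$ and $(2\boldsymbol j)^\perp$ the singular part of $2\boldsymbol j$ with respect to $\nu_\rho$. Here $\nu_\rho=\alpha\big(\frac{d\vartheta^-}{d\theta_\kappa},\frac{d\vartheta^+}{d\theta_\kappa}\big)\theta_\kappa+\alpha^\infty\big(\frac{d\vartheta^\perp}{d|\vartheta^\perp|}\big)|\vartheta^\perp|$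 with $\vartheta^-(dx\,dy)=\rho(dx)\kappa(x,dy)$, $\vartheta^+$ its image under $(x,y)\mapsto(y,x)$, $\vartheta^\perp$ the singular part of $(\vartheta^-,\vartheta^+)$ with respect to $\theta_\kappa$ and $\alpha^\infty$ the recession function of $\alpha$; so $\nu_\rho=\alpha(u(x),u(y))\,\theta_\kappa$ if $\rho=u\pi$. The function $\mathrm D_\phi:[0,\infty)^2\to[0,\infty]$ is the lower semicontinuous envelope of the function $\mathrm D^+_\phi$ equal to $\psi^*(\phi'(v)-\phi'(u))\,\alpha(u,v)$ where $\alpha(u,v)>0$, to $0$ at $(0,0)$, and to $+\infty$ elsewhere, with $\phi'(0)=\lim_{r\downarrow0}\phi'(r)\in[-\infty,\infty)$ and $\psi^*(\pm\infty)=+\infty$. **Assume that $\mathrm D_\phi$ is convex.** Fix $T>0$. A pair $(\rho,\boldsymbol j)=(\rho_t,\boldsymbol j_t)_{t\in[0,T]}$ is in $\mathcal{CE}(0,T)$ if the $\rho_t$ are finite positive measures on $V$, $t\mapsto\boldsymbol j_t$ is a measurable family of $\sigma$-finite signed measures on $E$ with $|\boldsymbol j_t|(\{x=y\})=0$ for all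 $t$ and $\int_0^T\iint_E(1\wedge\mathsf d)\,d|\boldsymbol j_t|\,dt<\infty$, and for all $0\le s\le t\le T$ $$\int_V f\,d\rho_t-\int_V f\,d\rho_s=\int_s^t\iint_E\overline\nabla f\,d\boldsymbol j_r\,dr\qquad(\ast)$$ for every bounded Lipschitz $f$. It is in $\mathcal{A}(0,T)$ if moreover $\sup_{t\in[0,T]}\mathscr E(\rho_t)<\infty$ and $\int_0^T(\mathscr R(\rho_t,\boldsymbol j_t)+\mathscr D(\rho_t))\,dt<\infty$, and in $\mathcal{RCE}(0,T)$ if moreover $u=d\rho/d\pi\in L^\infty(0,T;L^\infty(V;\pi))$ and $(\ast)$ holds for all $0\le s\le t\le T$ and all $f\in\mathcal X_2=\{f\in L^\infty(V;\pi):\iint_E|\overline\nabla f|^2\,d\theta_\kappa<\infty\}$. * $(\rho,\boldsymbol j)\in\mathcal{CE}(0,T)$ is a *Dissipative* solution of the $\kappa$-system if $\mathscr E(\rho_0)<\infty$ and $\int_0^t(\mathscr R(\rho_r,\boldsymbol j_r)+\mathscr D(\rho_r))\,dr+\mathscr E(\rho_t)\le\mathscr E(\rho_0)$ for all $t\in[0,T]$.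 * $(\rho,\boldsymbol j)\in\mathcal{RCE}(0,T)$ is a *Reflecting* solution if $\mathscr E(\rho_0)<\infty$ and $\int_s^t(\mathscr R(\rho_r,\boldsymbol j_r)+\mathscr D(\rho_r))\,dr+\mathscr E(\rho_t)=\mathscr E(\rho_s)$ for all $0\le s\le t\le T$. Measures $\mu_n$ converge *setwise* to $\mu$ if $\mu_n(B)\to\mu(B)$ for every measurable $B$; $\sigma$-finite signed measures $\mu_n$ converge *$\sigma$-setwise* to $\mu$ if there is an increasing exhaustion $(A_k)_k$ by measurable sets with $|\mu|(A_k)<\infty$ such that, for every $k$, the restrictions of the $\mu_n$ to $A_k$ are finite signed measures converging setwise to the restriction of $\mu$. **Theorem (Robustness).** Let $a_n:E\to[0,\infty)$, $n\in\mathbb N$, be bounded, measurable and symmetric, with $\sup_n\|a_n\|_{L^\infty(\theta_\kappa)}<\infty$ and $a_n\to1$ $\theta_\kappa$-a.e. Put $\kappa_n(x,dy)=a_n(x,y)\kappa(x,dy)$ (these kernels need not be bounded) and let $\mathscr R^n,\mathscr D^n$ be the functionals obtained from $\kappa_n$ in place of $\kappa$. Let $\rho^n_0,\rho_0$ be finite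 positive measures with finite entropy such that $\rho_0^n\to\rho_0$ setwise and $\mathscr E(\rho_0^n)\to\mathscr E(\rho_0)$. 1. Let $(\rho^n,\boldsymbol j^n)$ be Dissipative solutions of the $\kappa_n$-systems with initial data $\rho^n_0$. Then there are a subsequence and $(\rho,\boldsymbol j)\in\mathcal A(0,T)$ (with respect to $\kappa$) such that, along it, $$\text{(a)}\quad \rho^n_t\to\rho_t\ \text{setwise for all }t\in[0,T],\qquad \boldsymbol j^n_t\,dt\to\boldsymbol j_t\,dt\ \ \sigma\text{-setwise on }[0,T]\times E,$$ and $(\rho,\boldsymbol j)$ is a Dissipative solution of the $\kappa$-system. 2. Let $(\rho^n,\boldsymbol j^n)$ be Reflecting solutions of the $\kappa_n$-systems with initial data $\rho_0^n$ and $\sup_n\sup_{t\in[0,T]}\|d\rho^n_t/d\pi\|_{L^\infty(\pi)}<\infty$. Then there are a subsequence and $(\rho,\boldsymbol j)\in\mathcal A(0,T)$ such that, along it, (a) holds and $$\text{(b)}\quad \int_s^t\mathscr R^n(\rho^n_r,\boldsymbol j^n_r)\,dr\to\int_s^t\mathscr R(\rho_r,\boldsymbol j_r)\,dr,\quad \int_s^t\mathscr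 D^n(\rho^n_r)\,dr\to\int_s^t\mathscr D(\rho_r)\,dr,\quad \mathscr E(\rho^n_t)\to\mathscr E(\rho_t)$$ for all $0\le s\le t\le T$, and $(\rho,\boldsymbol j)$ is a Reflecting solution of the $\kappa$-system. If moreover $\phi$ is strictly convex on $[0,\infty)$, then (a) and (b) hold for the entire sequence $(\rho^n,\boldsymbol j^n)_n$. -/

import Mathlib

open MeasureTheory Filter Topology Set
open scoped NNReal ENNReal

noncomputable section

/-! ### Sigma-finite signed measures and setwise convergences -/

/-- A `σ`-finite signed measure: a pair of mutually singular `σ`-finite positive measures.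
It need not be defined on the whole `σ`-algebra as an extended-real set function. -/
structure SigmaFiniteSignedMeasure (Y : Type*) [MeasurableSpace Y] where
  pos : Measure Y
  neg : Measure Y
  sigmaFinite_pos : SigmaFinite pos
  sigmaFinite_neg : SigmaFinite neg
  mutuallySingular : Measure.MutuallySingular pos neg

/-- The total variation `|μ| = μ⁺ + μ⁻`. -/
def SigmaFiniteSignedMeasure.variation {Y : Type*} [MeasurableSpace Y]
    (μ : SigmaFiniteSignedMeasure Y) : Measure Y :=
  μ.pos + μ.neg

/-- The integral `∫ f dμ = ∫ f dμ⁺ - ∫ f dμ⁻`, meaningful when `f` is `|μ|`-integrable. -/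
def SigmaFiniteSignedMeasure.integral {Y : Type*} [MeasurableSpace Y]
    (μ : SigmaFiniteSignedMeasure Y) (f : Y → ℝ) : ℝ :=
  (∫ y, f y ∂μ.pos) - ∫ y, f y ∂μ.neg

/-- Setwise convergence of finite positive measures. -/
def SetwiseTendsto {Y : Type*} [MeasurableSpace Y]
    (μ : ℕ → FiniteMeasure Y) (ν : FiniteMeasure Y) : Prop :=
  ∀ B : Set Y, MeasurableSet B →
    Tendsto (fun n => (μ n : Measure Y) B) atTop (𝓝 ((ν : Measure Y) B))

/-- `σ`-setwise convergence of the signed measures `μp n - μm n` to `νp - νm`: along some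
exhaustion of finite `|ν|`-measure, all restrictions are finite signed measures which converge
setwise. -/
def SigmaSetwiseTendsto {Y : Type*} [MeasurableSpace Y]
    (μp μm : ℕ → Measure Y) (νp νm : Measure Y) : Prop :=
  ∃ A : ℕ → Set Y, Monotone A ∧ (⋃ k, A k) = univ ∧
    (∀ k, MeasurableSet (A k) ∧ νp (A k) < ∞ ∧ νm (A k) < ∞) ∧
    (∀ n k, μp n (A k) < ∞ ∧ μm n (A k) < ∞) ∧
    ∀ k, ∀ B : Set Y, MeasurableSet B →
      Tendsto (fun n => (μp n (B ∩ A k)).toReal - (μm n (B ∩ A k)).toReal) atTop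
        (𝓝 ((νp (B ∩ A k)).toReal - (νm (B ∩ A k)).toReal))

/-- The measure `μ_t(dy) dt` on `[0,T] × Y` (seen as a measure on `ℝ × Y`) induced by a family
of measures. -/
def timeIntegrated {Y : Type*} [MeasurableSpace Y] (T : ℝ) (μ : ℝ → Measure Y) :
    Measure (ℝ × Y) :=
  (volume.restrict (Icc 0 T)).bind fun t => (μ t).map (Prod.mk t)

/-- `σ`-setwise convergence of the time-integrated fluxes `j^n_t dt` to `j_t dt`
on `[0,T] × Y`. -/
def FluxTendsto {Y : Type*} [MeasurableSpace Y] (T : ℝ)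
    (jn : ℕ → ℝ → SigmaFiniteSignedMeasure Y) (j : ℝ → SigmaFiniteSignedMeasure Y) : Prop :=
  SigmaSetwiseTendsto
    (fun n => timeIntegrated T fun t => (jn n t).pos)
    (fun n => timeIntegrated T fun t => (jn n t).neg)
    (timeIntegrated T fun t => (j t).pos)
    (timeIntegrated T fun t => (j t).neg)

/-! ### Convex functionals and concave transformations of measures -/

/-- The recession function `Υ^∞(z) = lim_{t → ∞} Υ(t z) / t` (the limit exists for convex `Υ`). -/
def convexRecession (Υ : ℝ → ℝ≥0∞) (z : ℝ) : ℝ≥0∞ :=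
  limsup (fun t : ℝ => Υ (t * z) / ENNReal.ofReal t) atTop

/-- `F_Υ(μ | ν) = ∫ Υ(dμ/dν) dν + ∫ Υ^∞(dμ^⊥/d|μ^⊥|) d|μ^⊥|` for the signed measure
`μ = μp - μm`, where `μp` and `μm` are mutually singular, so that `dμ^⊥/d|μ^⊥|` is `1` on the
singular part of `μp` and `-1` on that of `μm`. -/
def convexFunctional {Y : Type*} [MeasurableSpace Y] (Υ : ℝ → ℝ≥0∞) (μp μm ν : Measure Y) :
    ℝ≥0∞ :=
  (∫⁻ y, Υ ((μp.rnDeriv ν y).toReal - (μm.rnDeriv ν y).toReal) ∂ν)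
    + convexRecession Υ 1 * μp.singularPart ν univ
    + convexRecession Υ (-1) * μm.singularPart ν univ

/-- The recession function `α^∞(z) = lim_{t → ∞} α(t z) / t` (the limit exists for concave `α`). -/
def concaveRecession (α : ℝ≥0 × ℝ≥0 → ℝ≥0) (z : ℝ≥0 × ℝ≥0) : ℝ≥0∞ :=
  limsup (fun t : ℝ≥0 => (α (t * z.1, t * z.2) : ℝ≥0∞) / (t : ℝ≥0∞)) atTop

/-- `α[μ₁, μ₂ | γ] = α(dμ/dγ) γ + α^∞(dμ^⊥/d|μ^⊥|) |μ^⊥|` for `μ = (μ₁, μ₂)`, with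
`|μ^⊥| = μ₁^⊥ + μ₂^⊥`. -/
def concaveTransform {Y : Type*} [MeasurableSpace Y] (α : ℝ≥0 × ℝ≥0 → ℝ≥0)
    (μ₁ μ₂ γ : Measure Y) : Measure Y :=
  γ.withDensity (fun y => (α ((μ₁.rnDeriv γ y).toNNReal, (μ₂.rnDeriv γ y).toNNReal) : ℝ≥0∞))
    + (μ₁.singularPart γ + μ₂.singularPart γ).withDensity (fun y => concaveRecession α
        (((μ₁.singularPart γ).rnDeriv (μ₁.singularPart γ + μ₂.singularPart γ) y).toNNReal,
          ((μ₂.singularPart γ).rnDeriv (μ₁.singularPart γ + μ₂.singularPart γ) y).toNNReal))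

/-! ### The evolution system -/

/-- The discrete gradient `(x, y) ↦ f y - f x`. -/
def graphGradient {V : Type*} (f : V → ℝ) (e : V × V) : ℝ := f e.2 - f e.1

/-- The measure `ρ(dx) κ(x, dy)` on `V × V`. -/
def edgeMeasure {V : Type*} [MeasurableSpace V] (ρ : Measure V) (κ : V → Measure V) :
    Measure (V × V) :=
  ρ.bind fun x => (κ x).map (Prod.mk x)

/-- The data of the evolution system: reference measure `π`, jump kernel `κ`,
entropy density `φ` (relevant on `[0,∞)`), dual dissipation density `ψStar`, flux density `α`. -/
structure JumpSystem (V : Type*) [MeasurableSpace V] where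
  π : Measure V
  κ : V → Measure V
  φ : ℝ → ℝ
  ψStar : ℝ → ℝ
  α : ℝ≥0 × ℝ≥0 → ℝ≥0

namespace JumpSystem

section Functionals

variable {V : Type*} [MeasurableSpace V]

/-- The coupling `θ(dx dy) = π(dx) κ(x, dy)`. -/
def θ (S : JumpSystem V) : Measure (V × V) := edgeMeasure S.π S.κ

/-- The density `u = dρ/dπ`. -/
def density (S : JumpSystem V) (ρ : FiniteMeasure V) (x : V) : ℝ≥0∞ :=
  (ρ : Measure V).rnDeriv S.π x

open Classical in
/-- The entropy `∫ φ(dρ/dπ) dπ`, and `+∞` if `ρ` is not absolutely continuous. -/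
def entropy (S : JumpSystem V) (ρ : FiniteMeasure V) : ℝ≥0∞ :=
  if (ρ : Measure V) ≪ S.π then ∫⁻ x, ENNReal.ofReal (S.φ (S.density ρ x).toReal) ∂S.π else ∞

/-- The primal dissipation density `ψ`, the convex conjugate of `ψStar`. -/
def ψ (S : JumpSystem V) (w : ℝ) : ℝ≥0∞ := ⨆ ξ : ℝ, ENNReal.ofReal (w * ξ - S.ψStar ξ)

/-- The edge measure `ν_ρ = α[ϑ⁻, ϑ⁺ | θ]`, with `ϑ⁻(dx dy) = ρ(dx) κ(x, dy)` and `ϑ⁺` its image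
under `(x, y) ↦ (y, x)`. -/
def edgeFlux (S : JumpSystem V) (ρ : FiniteMeasure V) : Measure (V × V) :=
  concaveTransform S.α (edgeMeasure (ρ : Measure V) S.κ)
    ((edgeMeasure (ρ : Measure V) S.κ).map Prod.swap) S.θ

/-- The primal dissipation potential `R(ρ, j) = ½ F_ψ(2 j | ν_ρ)`. -/
def action (S : JumpSystem V) (ρ : FiniteMeasure V) (j : SigmaFiniteSignedMeasure (V × V)) :
    ℝ≥0∞ :=
  2⁻¹ * convexFunctional S.ψ ((2 : ℝ≥0) • j.pos) ((2 : ℝ≥0) • j.neg) (S.edgeFlux ρ)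

/-- `φ'` on `[0,∞)`, with `φ'(0) = lim_{r ↓ 0} φ'(r) ∈ [-∞, ∞)`. -/
def φDeriv (S : JumpSystem V) (u : ℝ≥0) : EReal :=
  if u = 0 then liminf (fun r : ℝ => ((deriv S.φ r : ℝ) : EReal)) (𝓝[>] 0)
  else ((deriv S.φ u : ℝ) : EReal)

/-- `Λ(u, v) = φ'(v) - φ'(u)` off the origin, and `Λ(0, 0) = 0`. -/
def Λ (S : JumpSystem V) (p : ℝ≥0 × ℝ≥0) : EReal :=
  if p = 0 then 0 else S.φDeriv p.2 - S.φDeriv p.1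

/-- The extension of `ψStar` to `[-∞, ∞]` by `ψStar(±∞) = +∞`. -/
def ψStarExt (S : JumpSystem V) (ξ : EReal) : ℝ≥0∞ :=
  if ξ = ⊤ ∨ ξ = ⊥ then ∞ else ENNReal.ofReal (S.ψStar ξ.toReal)

/-- The function `D⁺`, equal to `ψStar(Λ) α` where `α > 0`; where `α` vanishes it is `0` at the
origin and `+∞` elsewhere. -/
def fisherDensityPlus (S : JumpSystem V) (p : ℝ≥0 × ℝ≥0) : ℝ≥0∞ :=
  if 0 < S.α p then S.ψStarExt (S.Λ p) * (S.α p : ℝ≥0∞)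
  else if p = 0 then 0 else ∞

/-- The lower semicontinuous envelope of `D⁺`: its largest lower semicontinuous minorant. -/
def fisherDensity (S : JumpSystem V) (p : ℝ≥0 × ℝ≥0) : ℝ≥0∞ :=
  ⨆ (g : ℝ≥0 × ℝ≥0 → ℝ≥0∞) (_ : LowerSemicontinuous g ∧ ∀ q, g q ≤ S.fisherDensityPlus q), g p

open Classical in
/-- The Fisher information `½ ∬ D(u(x), u(y)) θ(dx dy)` for `ρ = u π`, and `+∞` otherwise. -/
def fisher (S : JumpSystem V) (ρ : FiniteMeasure V) : ℝ≥0∞ :=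
  if (ρ : Measure V) ≪ S.π then
    2⁻¹ * ∫⁻ e, S.fisherDensity ((S.density ρ e.1).toNNReal, (S.density ρ e.2).toNNReal) ∂S.θ
  else ∞

/-- The test functions `φ ∈ L^∞(V; π)` with `∬ |φ(y) - φ(x)|² θ(dx dy) < ∞`. -/
def X₂ (S : JumpSystem V) : Set (V → ℝ) :=
  {f | MemLp f ∞ S.π ∧ ∫⁻ e, ENNReal.ofReal (graphGradient f e ^ 2) ∂S.θ < ∞}

/-- The system with kernel `a(x, y) κ(x, dy)` in place of `κ(x, dy)`. -/
def reweight (S : JumpSystem V) (a : V × V → ℝ) : JumpSystem V :=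
  { S with κ := fun x => (S.κ x).withDensity fun y => ENNReal.ofReal (a (x, y)) }

/-- Admissible multipliers: nonnegative symmetric bounded measurable functions on `V × V`, uniformly
bounded in `L^∞(θ)`, which converge to `1` `θ`-almost everywhere. -/
structure IsApproximation (S : JumpSystem V) (a : ℕ → V × V → ℝ) : Prop where
  measurable : ∀ n, Measurable (a n)
  nonneg : ∀ n e, 0 ≤ a n e
  symm : ∀ n x y, a n (x, y) = a n (y, x)
  bounded : ∀ n, ∃ C : ℝ, ∀ e, a n e ≤ C
  essBounded : ∃ C : ℝ, ∀ n, ∀ᵐ e ∂S.θ, a n e ≤ C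
  tendsto : ∀ᵐ e ∂S.θ, Tendsto (fun n => a n e) atTop (𝓝 1)

end Functionals

section Solutions

variable {V : Type*} [MetricSpace V] [MeasurableSpace V]

/-- The standing assumptions on the reference measure, the kernel, and the three densities. -/
structure Assumptions (S : JumpSystem V) : Prop where
  /- reference measure -/
  finite_π : IsFiniteMeasure S.π
  /- kernel -/
  κ_diag : ∀ x, S.κ x {x} = 0
  κ_bound : ∃ c : ℝ≥0, ∀ x, ∫⁻ y, ENNReal.ofReal (min 1 (dist x y ^ 2)) ∂S.κ x ≤ c
  κ_measurable : ∀ f : V → ℝ, Measurable f → (∃ C, ∀ y, |f y| ≤ C) →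
    Measurable fun x => ∫ y, f y * min 1 (dist x y ^ 2) ∂S.κ x
  detailedBalance : S.θ.map Prod.swap = S.θ
  /- entropy density -/
  φ_continuousOn : ContinuousOn S.φ (Ici 0)
  φ_contDiffOn : ContDiffOn ℝ 1 S.φ (Ioi 0)
  φ_convex : ConvexOn ℝ (Ici 0) S.φ
  φ_min : IsLeast (S.φ '' Ici 0) 0
  φ_superlinear : Tendsto (fun r : ℝ => S.φ r / r) atTop atTop
  /- dual dissipation density -/
  ψStar_nonneg : ∀ ξ, 0 ≤ S.ψStar ξ
  ψStar_convex : ConvexOn ℝ univ S.ψStar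
  ψStar_differentiable : Differentiable ℝ S.ψStar
  ψStar_even : ∀ ξ, S.ψStar (-ξ) = S.ψStar ξ
  ψStar_zero : S.ψStar 0 = 0
  ψStar_superlinear : Tendsto (fun ξ : ℝ => S.ψStar ξ / |ξ|) (cocompact ℝ) atTop
  ψStar_quadratic : ∃ c₀ : ℝ, 0 < c₀ ∧
    Tendsto (fun ξ : ℝ => S.ψStar ξ / |ξ| ^ 2) (𝓝[≠] 0) (𝓝 c₀)
  /- flux density -/
  α_nondegenerate : ∃ p, S.α p ≠ 0
  α_continuous : Continuous S.α
  α_concave : ConcaveOn ℝ≥0 univ S.α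
  α_symm : ∀ u v, S.α (u, v) = S.α (v, u)

/-- The continuity equation on `[0,T]`, tested with bounded Lipschitz functions. -/
structure ContinuityEquation (T : ℝ) (ρ : ℝ → FiniteMeasure V)
    (j : ℝ → SigmaFiniteSignedMeasure (V × V)) : Prop where
  measurable_pos : Measurable fun t : Icc (0 : ℝ) T => (j t).pos
  measurable_neg : Measurable fun t : Icc (0 : ℝ) T => (j t).neg
  diag_null : ∀ t ∈ Icc 0 T, (j t).variation {e | e.1 = e.2} = 0
  moment : ∫⁻ t in Icc 0 T, ∫⁻ e, ENNReal.ofReal (min 1 (dist e.1 e.2)) ∂(j t).variation < ∞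
  equation : ∀ f : V → ℝ, (∃ K, LipschitzWith K f) → (∃ C, ∀ x, |f x| ≤ C) →
    ∀ s t, 0 ≤ s → s ≤ t → t ≤ T →
      (∫ x, f x ∂(ρ t : Measure V)) - ∫ x, f x ∂(ρ s : Measure V)
        = ∫ r in s..t, (j r).integral (graphGradient f)

/-- Solutions of the continuity equation with bounded entropy, finite action and finite Fisher
information. -/
structure FiniteActionCurve (S : JumpSystem V) (T : ℝ) (ρ : ℝ → FiniteMeasure V)
    (j : ℝ → SigmaFiniteSignedMeasure (V × V)) : Prop where
  continuityEquation : ContinuityEquation T ρ j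
  entropy_bounded : ∃ C : ℝ≥0, ∀ t ∈ Icc 0 T, S.entropy (ρ t) ≤ C
  action_fisher_finite : ∫⁻ t in Icc 0 T, (S.action (ρ t) (j t) + S.fisher (ρ t)) < ∞

/-- The reflecting continuity equation: essentially bounded densities, and all test functions
in `X₂`. -/
structure ReflectingContinuityEquation (S : JumpSystem V) (T : ℝ) (ρ : ℝ → FiniteMeasure V)
    (j : ℝ → SigmaFiniteSignedMeasure (V × V)) : Prop where
  finiteAction : S.FiniteActionCurve T ρ j
  density_bounded : ∃ M : ℝ≥0, ∀ᵐ t ∂volume.restrict (Icc 0 T), ∀ᵐ x ∂S.π, S.density (ρ t) x ≤ M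
  equation : ∀ f ∈ S.X₂, ∀ s t, 0 ≤ s → s ≤ t → t ≤ T →
    (∫ x, f x ∂(ρ t : Measure V)) - ∫ x, f x ∂(ρ s : Measure V)
      = ∫ r in s..t, (j r).integral (graphGradient f)

/-- Dissipative solutions: the energy-dissipation inequality holds on every `[0,t]`. -/
structure IsDissipative (S : JumpSystem V) (T : ℝ) (ρ : ℝ → FiniteMeasure V)
    (j : ℝ → SigmaFiniteSignedMeasure (V × V)) : Prop where
  entropy_zero : S.entropy (ρ 0) < ∞
  continuityEquation : ContinuityEquation T ρ j
  energyInequality : ∀ t ∈ Icc 0 T,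
    (∫⁻ r in Icc 0 t, (S.action (ρ r) (j r) + S.fisher (ρ r))) + S.entropy (ρ t)
      ≤ S.entropy (ρ 0)

/-- Reflecting solutions: the reflecting continuity equation and the energy-dissipation balance on
every `[s,t]`. -/
structure IsReflecting (S : JumpSystem V) (T : ℝ) (ρ : ℝ → FiniteMeasure V)
    (j : ℝ → SigmaFiniteSignedMeasure (V × V)) : Prop where
  entropy_zero : S.entropy (ρ 0) < ∞
  reflecting : S.ReflectingContinuityEquation T ρ j
  energyBalance : ∀ s t, 0 ≤ s → s ≤ t → t ≤ T →
    (∫⁻ r in Icc s t, (S.action (ρ r) (j r) + S.fisher (ρ r))) + S.entropy (ρ t)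
      = S.entropy (ρ s)

end Solutions

section Convergence

variable {V : Type*} [MeasurableSpace V]

/-- Setwise convergence of the densities at all times and `σ`-setwise convergence of the
time-integrated fluxes. -/
def CurvesTendsto (T : ℝ)
    (ρn : ℕ → ℝ → FiniteMeasure V) (jn : ℕ → ℝ → SigmaFiniteSignedMeasure (V × V))
    (ρ : ℝ → FiniteMeasure V) (j : ℝ → SigmaFiniteSignedMeasure (V × V)) : Prop :=
  (∀ t ∈ Icc 0 T, SetwiseTendsto (fun n => ρn n t) (ρ t)) ∧ FluxTendsto T jn j

/-- Convergence of the action and of the Fisher information on every `[s,t]`, and of the entropy at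
every time; `Sn n` is the system belonging to the `n`-th curve. -/
structure EnergiesTendsto (Sn : ℕ → JumpSystem V) (S : JumpSystem V) (T : ℝ)
    (ρn : ℕ → ℝ → FiniteMeasure V) (jn : ℕ → ℝ → SigmaFiniteSignedMeasure (V × V))
    (ρ : ℝ → FiniteMeasure V) (j : ℝ → SigmaFiniteSignedMeasure (V × V)) : Prop where
  action : ∀ s t, 0 ≤ s → s ≤ t → t ≤ T →
    Tendsto (fun n => ∫⁻ r in Icc s t, (Sn n).action (ρn n r) (jn n r)) atTop
      (𝓝 (∫⁻ r in Icc s t, S.action (ρ r) (j r)))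
  fisher : ∀ s t, 0 ≤ s → s ≤ t → t ≤ T →
    Tendsto (fun n => ∫⁻ r in Icc s t, (Sn n).fisher (ρn n r)) atTop
      (𝓝 (∫⁻ r in Icc s t, S.fisher (ρ r)))
  entropy : ∀ t ∈ Icc 0 T,
    Tendsto (fun n => (Sn n).entropy (ρn n t)) atTop (𝓝 (S.entropy (ρ t)))

end Convergence

end JumpSystem

end

/-! The argument works with densities. Finite entropy forces `ρ = u π`. Since `ψStar` is finite
everywhere, `ψ` grows superlinearly, so finite action forces the flux to have a density `h` with
respect to `θ`. The action density is then `½ P(2h, a α(u(x), u(y)))`, where the perspective `P(w,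
r) = sup_ξ (w ξ - r ψStar ξ)` is jointly convex and nonincreasing in the mobility `r`. Passing from
`κ` to `κ_n` only multiplies by the weight `a_n`; the reference measure stays fixed, and weights
converging almost everywhere are harmless. The possibly infinite `θ` is replaced by the finite
measure `(1 ∧ d²) θ`, with the flux measured by `h / (1 ∧ d)`.

Compactness. Superlinearity of `φ` makes the densities equi-integrable, and Young's inequality with
a large multiplier transfers this to the fluxes (`BoundedCurves.equiIntegrable_flux`). One
subsequence of fluxes converges weakly in `L¹`; the continuity equation then carries the convergence
of the initial data to every time, without further extraction (`BoundedCurves.exists_subseq`).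

Lower semicontinuity. Entropy, Fisher information and action are integrals of countable suprema of
functions affine in `(u, h)`; for the action, the concave `α` is first replaced by its affine
majorants. Each affine functional passes to the limit, and `lintegral_iSup_ofReal_le_liminf` handles
the supremum. With convergence of the initial entropies, the energy-dissipation inequality passes to
the limit (`exists_dissipative_limit`).

Energy balance. For bounded densities the reflecting equation also passes to the limit, because
short edges contribute uniformly little. The inequality missing for the balance is the chain rule
`E(ρ_s) ≤ E(ρ_t) + ∫ (R + D)` (`ReflectingCurve.densityEntropy_le`). For fixed `r` the truncated
potential `φ'(max ε u_r)` is an admissible test function as soon as `D(ρ_r)` is finite. The tangent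
inequality for `φ` and Young's inequality give an estimate between times `r` and `q` with the
potential frozen at `r`; averaging in `r` over short windows integrates these estimates
(`le_add_setLIntegral_of_forall`). No time derivative is taken. Convexity of `D_φ` enters through
the fact that truncating both arguments from below does not increase `D_φ`.

Given the balances, lower semicontinuity of the three terms and convergence of their sum force each
term to converge. If `φ` is strictly convex, the midpoint of two solutions satisfies the chain rule
inequality, so all convexity inequalities are equalities; this gives uniqueness, hence convergence
of the whole sequence. -/

noncomputable section

set_option linter.unusedSectionVars false

open ProbabilityTheory

/-! ### Weak `L¹` convergence on a finite measure space -/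

section WeakConvergence

variable {X : Type*} [MeasurableSpace X]

/-- Equi-integrability of a family of real functions. -/
structure EquiIntegrable {ι : Type*} (m : Measure X) (g : ι → X → ℝ) : Prop where
  measurable : ∀ i, Measurable (g i)
  le : ∀ ε : ℝ≥0, ε ≠ 0 → ∃ K : ℝ≥0, ∀ i B, MeasurableSet B →
    ∫⁻ x in B, ‖g i x‖ₑ ∂m ≤ K * m B + ε

/-- Weak `L¹` convergence of an equi-integrable sequence, tested on measurable sets. -/
structure WeakTendsto (m : Measure X) (g : ℕ → X → ℝ) (g' : X → ℝ) : Prop where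
  equi : EquiIntegrable m g
  measurable : Measurable g'
  integrable : Integrable g' m
  tendsto : ∀ B, MeasurableSet B →
    Tendsto (fun n => ∫ x in B, g n x ∂m) atTop (𝓝 (∫ x in B, g' x ∂m))

lemma NNReal.mul_div_three_le (x ε : ℝ≥0) : x * (ε / (3 * (x + 1))) ≤ ε / 3 := by
  have h : x * (ε / (3 * (x + 1))) = (x / (x + 1)) * (ε / 3) := by field_simp
  rw [h]
  exact mul_le_of_le_one_left (by positivity) (div_le_one_of_le₀ (by simp) (by positivity))

lemma abs_integral_le_of_lintegral_enorm_le {m : Measure X} {f : X → ℝ} {ε : ℝ≥0}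
    (h : ∫⁻ x, ‖f x‖ₑ ∂m ≤ ε) : |∫ x, f x ∂m| ≤ ε := by
  have := (enorm_integral_le_lintegral_enorm (μ := m) f).trans h
  rw [← Real.norm_eq_abs]
  rwa [← ofReal_norm, ← ENNReal.ofReal_coe_nnreal,
    ENNReal.ofReal_le_ofReal_iff (by positivity)] at this

lemma EquiIntegrable.comp {ι ι' : Type*} {m : Measure X} {g : ι → X → ℝ}
    (hg : EquiIntegrable m g) (σ : ι' → ι) : EquiIntegrable m (fun i => g (σ i)) where
  measurable i := hg.measurable _
  le ε hε := by
    obtain ⟨K, hK⟩ := hg.le ε hε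
    exact ⟨K, fun i => hK (σ i)⟩

namespace EquiIntegrable

variable {ι : Type*} {m : Measure X} [IsFiniteMeasure m] {g : ι → X → ℝ}

lemma bound (hg : EquiIntegrable m g) : ∃ C : ℝ≥0, ∀ i, ∫⁻ x, ‖g i x‖ₑ ∂m ≤ C := by
  obtain ⟨K, hK⟩ := hg.le 1 one_ne_zero
  refine ⟨K * (m univ).toNNReal + 1, fun i => ?_⟩
  have := hK i univ MeasurableSet.univ
  rw [Measure.restrict_univ] at this
  simpa [ENNReal.coe_toNNReal (measure_ne_top m univ)] using this

lemma integrable (hg : EquiIntegrable m g) (i : ι) : Integrable (g i) m := by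
  obtain ⟨C, hC⟩ := hg.bound
  exact ⟨(hg.measurable i).aestronglyMeasurable, (hC i).trans_lt ENNReal.coe_lt_top⟩

/-- Split at the level `η`: by Markov's inequality the set `{|b| ≥ η}` is small, so there the bound
`C` on `b` meets equi-integrability; on the complement `η` multiplies the uniform `L¹` bound. This
is the tool for exchanging a bounded factor for an `L¹`-close one uniformly along the family. -/
lemma exists_mul_le (hg : EquiIntegrable m g) (C ε : ℝ≥0) (hε : ε ≠ 0) :
    ∃ δ : ℝ≥0, δ ≠ 0 ∧ ∀ b : X → ℝ, Measurable b → (∀ᵐ x ∂m, ‖b x‖ₑ ≤ C) →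
      ∫⁻ x, ‖b x‖ₑ ∂m ≤ δ → ∀ i, ∫⁻ x, ‖b x * g i x‖ₑ ∂m ≤ ε := by
  obtain ⟨C₁, hC₁⟩ := hg.bound
  obtain ⟨K, hK⟩ := hg.le (ε / (3 * (C + 1))) (by positivity)
  set η : ℝ≥0 := ε / (3 * (C₁ + 1)) with hη
  have hη0 : η ≠ 0 := by positivity
  refine ⟨η * (ε / (3 * (C * K + 1))), by positivity, fun b hb hbC hbδ i => ?_⟩
  set S : Set X := {x | (η : ℝ≥0∞) ≤ ‖b x‖ₑ} with hS
  have hSm : MeasurableSet S := measurableSet_le measurable_const hb.enorm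
  have hmS : m S ≤ (ε / (3 * (C * K + 1)) : ℝ≥0) := by
    have h1 : (η : ℝ≥0∞) * m S ≤ η * (ε / (3 * (C * K + 1)) : ℝ≥0) :=
      (mul_meas_ge_le_lintegral hb.enorm _).trans (hbδ.trans (by push_cast; rfl))
    exact (ENNReal.mul_le_mul_iff_right (by simpa using hη0) ENNReal.coe_ne_top).1 h1
  have hpart1 : ∫⁻ x in S, ‖b x * g i x‖ₑ ∂m ≤ (ε / 3 : ℝ≥0) + (ε / 3 : ℝ≥0) := by
    calc ∫⁻ x in S, ‖b x * g i x‖ₑ ∂m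
        ≤ ∫⁻ x in S, C * ‖g i x‖ₑ ∂m := by
          refine lintegral_mono_ae (ae_restrict_of_ae ?_)
          filter_upwards [hbC] with x hx
          rw [enorm_mul]; gcongr
      _ = C * ∫⁻ x in S, ‖g i x‖ₑ ∂m := lintegral_const_mul _ (hg.measurable i).enorm
      _ ≤ C * (K * (ε / (3 * (C * K + 1)) : ℝ≥0) + (ε / (3 * (C + 1)) : ℝ≥0)) := by
          gcongr; exact (hK i S hSm).trans (by gcongr)
      _ = ((C * K) * (ε / (3 * (C * K + 1))) + C * (ε / (3 * (C + 1))) : ℝ≥0) := by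
          push_cast; ring
      _ ≤ _ := by
          rw [← ENNReal.coe_add, ENNReal.coe_le_coe]
          exact add_le_add (NNReal.mul_div_three_le _ _) (NNReal.mul_div_three_le _ _)
  have hpart2 : ∫⁻ x in Sᶜ, ‖b x * g i x‖ₑ ∂m ≤ (ε / 3 : ℝ≥0) := by
    calc ∫⁻ x in Sᶜ, ‖b x * g i x‖ₑ ∂m
        ≤ ∫⁻ x in Sᶜ, η * ‖g i x‖ₑ ∂m := by
          refine setLIntegral_mono (by exact (hg.measurable i).enorm.const_mul _) fun x hx => ?_
          rw [enorm_mul]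
          gcongr
          exact (not_le.1 (show ¬ (η : ℝ≥0∞) ≤ ‖b x‖ₑ from hx)).le
      _ = η * ∫⁻ x in Sᶜ, ‖g i x‖ₑ ∂m := lintegral_const_mul _ (hg.measurable i).enorm
      _ ≤ η * C₁ := by gcongr; exact (setLIntegral_le_lintegral _ _).trans (hC₁ i)
      _ ≤ _ := by
          rw [← ENNReal.coe_mul, ENNReal.coe_le_coe, mul_comm]
          exact NNReal.mul_div_three_le _ _
  rw [← lintegral_add_compl _ hSm]
  calc _ ≤ ((ε / 3 : ℝ≥0) : ℝ≥0∞) + (ε / 3 : ℝ≥0) + (ε / 3 : ℝ≥0) := add_le_add hpart1 hpart2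
    _ = ε := by
      rw [← ENNReal.coe_add, ← ENNReal.coe_add]; congr 1
      exact add_thirds ε

lemma integrable_mul (hg : EquiIntegrable m g) {b : X → ℝ} {C : ℝ≥0} (hb : Measurable b)
    (hbC : ∀ᵐ x ∂m, ‖b x‖ₑ ≤ C) (i : ι) : Integrable (fun x => b x * g i x) m := by
  refine (hg.integrable i).bdd_mul (c := C) hb.aestronglyMeasurable ?_
  filter_upwards [hbC] with x hx
  rwa [← ofReal_norm, ← ENNReal.ofReal_coe_nnreal,
    ENNReal.ofReal_le_ofReal_iff (by positivity)] at hx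

end EquiIntegrable

variable {m : Measure X} [IsFiniteMeasure m]

/-- Convergence of the integrals against an `L¹`-dense class of bounded test functions implies
convergence against every bounded function. -/
lemma EquiIntegrable.cauchySeq_of_dense {g : ℕ → X → ℝ} (hg : EquiIntegrable m g) {C : ℝ≥0}
    {b : X → ℝ} (hb : Measurable b) (hbC : ∀ᵐ x ∂m, ‖b x‖ₑ ≤ C)
    (happrox : ∀ δ : ℝ≥0, δ ≠ 0 → ∃ f : X → ℝ, Measurable f ∧ (∀ᵐ x ∂m, ‖f x‖ₑ ≤ C) ∧
      ∫⁻ x, ‖b x - f x‖ₑ ∂m ≤ δ ∧ CauchySeq fun n => ∫ x, f x * g n x ∂m) :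
    CauchySeq fun n => ∫ x, b x * g n x ∂m := by
  rw [Metric.cauchySeq_iff']
  intro ε hε
  lift ε to ℝ≥0 using hε.le
  have hε0 : ε / 4 ≠ 0 := by have : ε ≠ 0 := by rintro rfl; simp at hε
                             positivity
  obtain ⟨δ, hδ, hδb⟩ := hg.exists_mul_le (C + C) (ε / 4) hε0
  obtain ⟨f, hf, hfC, hfb, hfc⟩ := happrox δ hδ
  obtain ⟨N, hN⟩ := Metric.cauchySeq_iff'.1 hfc (ε / 4 : ℝ≥0) (by positivity)
  refine ⟨N, fun n hn => ?_⟩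
  have hdiff : ∀ k, |∫ x, b x * g k x ∂m - ∫ x, f x * g k x ∂m| ≤ (ε / 4 : ℝ≥0) := by
    intro k
    rw [← integral_sub (hg.integrable_mul hb hbC k) (hg.integrable_mul hf hfC k)]
    simp_rw [← sub_mul]
    refine abs_integral_le_of_lintegral_enorm_le (hδb (fun x => b x - f x) (hb.sub hf) ?_ hfb k)
    filter_upwards [hbC, hfC] with x h1 h2
    exact (enorm_sub_le).trans (by push_cast; exact add_le_add h1 h2)
  have h1 := hdiff n
  have h2 := hdiff N
  have h3 := hN n hn
  rw [Real.dist_eq] at h3 ⊢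
  have h4 : ((ε / 4 : ℝ≥0) : ℝ) = (ε : ℝ) / 4 := by simp
  rw [h4] at h1 h2 h3
  rw [abs_le] at h1 h2
  rw [abs_lt] at h3 ⊢
  constructor <;> linarith [h1.1, h1.2, h2.1, h2.2, h3.1, h3.2, (show (0:ℝ) < ε from hε)]

/-- Multiplication of a weakly convergent sequence with bounded functions converging a.e. -/
lemma WeakTendsto.integral_mul {g : ℕ → X → ℝ} {g' : X → ℝ} (h : WeakTendsto m g g') {C : ℝ≥0}
    {b : ℕ → X → ℝ} {b' : X → ℝ} (hb : ∀ n, Measurable (b n)) (hb' : Measurable b')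
    (hbC : ∀ n, ∀ᵐ x ∂m, ‖b n x‖ₑ ≤ C)
    (hlim : ∀ᵐ x ∂m, Tendsto (fun n => b n x) atTop (𝓝 (b' x))) :
    Tendsto (fun n => ∫ x, b n x * g n x ∂m) atTop (𝓝 (∫ x, b' x * g' x ∂m)) := by
  -- The limit joins the family under the index `none`, so that a single `δ` serves it together with
  -- all the `g n`.
  have hequi : EquiIntegrable m (fun o : Option ℕ => o.elim g' g) := by
    refine ⟨fun o => by cases o; exacts [h.measurable, h.equi.measurable _], fun ε hε => ?_⟩
    obtain ⟨K, hK⟩ := h.equi.le ε hε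
    have hac : EquiIntegrable m (fun _ : Unit => g') := by
      refine ⟨fun _ => h.measurable, fun ε hε => ?_⟩
      obtain ⟨δ, hδ, hδ'⟩ := exists_pos_setLIntegral_lt_of_measure_lt (μ := m)
        (f := fun x => ‖g' x‖ₑ) h.integrable.2.ne (ε := ε) (by simpa using hε)
      set I := ∫⁻ x, ‖g' x‖ₑ ∂m with hI
      have hIt : I ≠ ∞ := h.integrable.2.ne
      by_cases hδt : δ = ∞
      · refine ⟨0, fun _ B hB => ?_⟩
        have := hδ' B (by rw [hδt]; exact measure_lt_top m B)
        simpa using this.le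
      -- Sets with `m B < δ` are absorbed by `ε`; on larger sets the full mass `I` is at most `(I /
      -- δ) * m B`.
      refine ⟨(I / δ).toNNReal, fun _ B hB => ?_⟩
      rw [ENNReal.coe_toNNReal (ENNReal.div_ne_top hIt hδ.ne')]
      by_cases hB' : m B < δ
      · exact (hδ' B hB').le.trans le_add_self
      · refine le_add_right ?_
        calc _ ≤ I := setLIntegral_le_lintegral _ _
          _ = I / δ * δ := (ENNReal.div_mul_cancel hδ.ne' hδt).symm
          _ ≤ _ := by gcongr; exact not_lt.1 hB'
    obtain ⟨K', hK'⟩ := hac.le ε hε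
    refine ⟨max K K', fun o B hB => ?_⟩
    cases o with
    | none => exact (hK' () B hB).trans (by gcongr; exact le_max_right _ _)
    | some n => exact (hK n B hB).trans (by gcongr; exact le_max_left _ _)
  have hb'C : ∀ᵐ x ∂m, ‖b' x‖ₑ ≤ C := by
    filter_upwards [hlim, ae_all_iff.2 hbC] with x hx hx2
    exact le_of_tendsto ((continuous_enorm.tendsto _).comp hx) (Eventually.of_forall hx2)
  have hsimple : ∀ s : SimpleFunc X ℝ,
      Tendsto (fun n => ∫ x, s x * g n x ∂m) atTop (𝓝 (∫ x, s x * g' x ∂m)) := by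
    intro s
    have hexp : ∀ f : X → ℝ, Integrable f m → ∫ x, s x * f x ∂m
        = ∑ y ∈ s.range, y * ∫ x in s ⁻¹' {y}, f x ∂m := by
      intro f hf
      have : ∀ x, s x * f x = ∑ y ∈ s.range, y * (s ⁻¹' {y}).indicator f x := by
        intro x
        rw [Finset.sum_eq_single (s x)]
        · simp [indicator]
        · intro y _ hy
          simp [indicator, hy.symm]
        · intro hx; exact absurd (SimpleFunc.mem_range_self s x) hx
      simp_rw [this]
      rw [integral_finsetSum _ fun y _ =>
        (hf.indicator (s.measurableSet_preimage _)).const_mul y]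
      refine Finset.sum_congr rfl fun y _ => ?_
      rw [integral_const_mul, integral_indicator (s.measurableSet_preimage _)]
    simp_rw [hexp _ (h.equi.integrable _)]
    rw [hexp _ h.integrable]
    exact tendsto_finsetSum _ fun y _ => (h.tendsto _ (s.measurableSet_preimage _)).const_mul y
  rw [Metric.tendsto_atTop]
  intro ε hε
  lift ε to ℝ≥0 using hε.le
  have hε0 : ε / 5 ≠ 0 := by
    have : ε ≠ 0 := by rintro rfl; simp at hε
    positivity
  obtain ⟨δ, hδ, hδb⟩ := hequi.exists_mul_le (C + C) (ε / 5) hε0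
  obtain ⟨δ', hδ', hδb'⟩ := hequi.exists_mul_le (C + C + C) (ε / 5) hε0
  -- approximation of `b'` by a bounded simple function
  have hb'int : Integrable b' m := by
    refine Integrable.of_bound (C := C) hb'.aestronglyMeasurable ?_
    filter_upwards [hb'C] with x hx
    rwa [← ofReal_norm, ← ENNReal.ofReal_coe_nnreal,
      ENNReal.ofReal_le_ofReal_iff (by positivity)] at hx
  have hsm := hb'.stronglyMeasurable
  set s : ℕ → SimpleFunc X ℝ := fun k => hsm.approxBounded C k with hs
  have hsb : ∀ k x, ‖s k x‖ₑ ≤ C := fun k x => by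
    rw [← ofReal_norm, ← ENNReal.ofReal_coe_nnreal]
    exact ENNReal.ofReal_le_ofReal (hsm.norm_approxBounded_le (by positivity) k x)
  have hslim : ∀ᵐ x ∂m, Tendsto (fun k => s k x) atTop (𝓝 (b' x)) := by
    refine hsm.tendsto_approxBounded_ae ?_
    filter_upwards [hb'C] with x hx
    rwa [← ofReal_norm, ← ENNReal.ofReal_coe_nnreal,
      ENNReal.ofReal_le_ofReal_iff (by positivity)] at hx
  have hL1 : ∀ (c : ℕ → X → ℝ), (∀ n, Measurable (c n)) → (∀ n, ∀ᵐ x ∂m, ‖c n x‖ₑ ≤ C) →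
      (∀ᵐ x ∂m, Tendsto (fun n => c n x) atTop (𝓝 (b' x))) →
      Tendsto (fun n => ∫⁻ x, ‖c n x - b' x‖ₑ ∂m) atTop (𝓝 0) := by
    intro c hc hcC hcl
    have := tendsto_lintegral_of_dominated_convergence (μ := m)
      (F := fun n x => ‖c n x - b' x‖ₑ) (f := fun _ => 0) (fun _ => (C : ℝ≥0∞) + C)
      (fun n => ((hc n).sub hb').enorm) (fun n => by
        filter_upwards [hcC n, hb'C] with x h1 h2
        exact enorm_sub_le.trans (add_le_add h1 h2))
      (by simp [ENNReal.mul_ne_top, measure_ne_top]) (by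
        filter_upwards [hcl] with x hx
        have h0 := ((hx.sub_const (b' x)).enorm)
        simpa using h0)
    simpa using this
  obtain ⟨k, hk⟩ := ((ENNReal.tendsto_nhds_zero.1
    (hL1 (fun k => s k) (fun k => (s k).measurable) (fun k => ae_of_all _ (hsb k)) hslim)) δ
    (by simpa using pos_iff_ne_zero.2 hδ)).exists
  have hev := (ENNReal.tendsto_nhds_zero.1 (hL1 b hb hbC hlim)) δ (by simpa using pos_iff_ne_zero.2 hδ)
  have hev2 := Metric.tendsto_nhds.1 (hsimple (s k)) (ε / 5 : ℝ≥0) (by positivity)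
  obtain ⟨N, hN⟩ := eventually_atTop.1 (hev.and hev2)
  refine ⟨N, fun n hn => ?_⟩
  obtain ⟨hn1, hn2⟩ := hN n hn
  have hbd2 : ∀ (c d : X → ℝ), (∀ᵐ x ∂m, ‖c x‖ₑ ≤ C) → (∀ᵐ x ∂m, ‖d x‖ₑ ≤ C) →
      ∀ᵐ x ∂m, ‖c x - d x‖ₑ ≤ ((C + C : ℝ≥0) : ℝ≥0∞) := by
    intro c d hc hd
    filter_upwards [hc, hd] with x h1 h2
    exact (enorm_sub_le).trans (by push_cast; exact add_le_add h1 h2)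
  have e1 : |∫ x, b n x * g n x ∂m - ∫ x, b' x * g n x ∂m| ≤ (ε / 5 : ℝ≥0) := by
    rw [← integral_sub (h.equi.integrable_mul (hb n) (hbC n) n)
      (h.equi.integrable_mul hb' hb'C n)]
    simp_rw [← sub_mul]
    exact abs_integral_le_of_lintegral_enorm_le
      (hδb (fun x => b n x - b' x) ((hb n).sub hb') (hbd2 _ _ (hbC n) hb'C) hn1 (some n))
  have e2 : ∀ o : Option ℕ, |∫ x, s k x * o.elim g' g x ∂m - ∫ x, b' x * o.elim g' g x ∂m|
      ≤ (ε / 5 : ℝ≥0) := by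
    intro o
    rw [← integral_sub (hequi.integrable_mul (s k).measurable (ae_of_all _ (hsb k)) o)
      (hequi.integrable_mul hb' hb'C o)]
    simp_rw [← sub_mul]
    exact abs_integral_le_of_lintegral_enorm_le
      (hδb (fun x => s k x - b' x) ((s k).measurable.sub hb')
        (hbd2 _ _ (ae_of_all _ (hsb k)) hb'C) hk o)
  have e3 := e2 (some n)
  have e4 := e2 none
  simp only [Option.elim] at e3 e4
  rw [Real.dist_eq] at hn2 ⊢
  have h4 : ((ε / 5 : ℝ≥0) : ℝ) = (ε : ℝ) / 5 := by simp
  rw [h4] at e1 e3 e4 hn2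
  rw [abs_le] at e1 e3 e4
  rw [abs_lt] at hn2 ⊢
  constructor <;> linarith [e1.1, e1.2, e3.1, e3.2, e4.1, e4.2, hn2.1, hn2.2,
    (show (0:ℝ) < ε from hε)]

/-- The setwise limit of the indefinite integrals of an equi-integrable sequence has a density. -/
lemma EquiIntegrable.exists_weakTendsto {g : ℕ → X → ℝ} (hg : EquiIntegrable m g)
    (hlim : ∀ B, MeasurableSet B → ∃ l, Tendsto (fun n => ∫ x in B, g n x ∂m) atTop (𝓝 l)) :
    ∃ g', WeakTendsto m g g' := by
  classical
  choose! l hl using hlim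
  have habs : ∀ B (ε : ℝ≥0), MeasurableSet B →
      (∀ n, ∫⁻ x in B, ‖g n x‖ₑ ∂m ≤ ε) → |l B| ≤ ε := fun B ε hB h =>
    le_of_tendsto (hl B hB).abs
      (Eventually.of_forall fun n => abs_integral_le_of_lintegral_enorm_le (h n))
  have hunion : ∀ B C, MeasurableSet B → MeasurableSet C → Disjoint B C →
      l (B ∪ C) = l B + l C := by
    intro B C hB hC hd
    refine tendsto_nhds_unique (hl _ (hB.union hC)) (((hl B hB).add (hl C hC)).congr fun n => ?_)
    rw [setIntegral_union hd hC (hg.integrable n).integrableOn (hg.integrable n).integrableOn]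
  have hempty : l ∅ = 0 := by
    refine tendsto_nhds_unique (hl _ MeasurableSet.empty) ?_
    simp
  -- Finite additivity of the setwise limits is immediate. Countable additivity comes from
  -- equi-integrability: the tail of a disjoint union has small measure, hence small integral
  -- uniformly in `n`.
  let s : SignedMeasure X :=
    { measureOf' := fun B => if MeasurableSet B then l B else 0
      empty' := by simp [hempty]
      not_measurable' := fun B hB => by simp [hB]
      m_iUnion' := by
        intro f hf hd
        simp only [hf, MeasurableSet.iUnion hf, if_true]
        have hsum : ∀ F : Finset ℕ, l (⋃ i ∈ F, f i) = ∑ i ∈ F, l (f i) := by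
          intro F
          induction F using Finset.induction_on with
          | empty => simpa using hempty
          | insert a F ha ih =>
            rw [Finset.set_biUnion_insert, hunion _ _ (hf a) (F.measurableSet_biUnion fun i _ => hf i),
              ih, Finset.sum_insert ha]
            rw [disjoint_iUnion₂_right]
            intro i hi
            exact hd (fun h => ha (h ▸ hi))
        have hsm : ∑' i, m (f i) ≠ ∞ := by
          rw [← measure_iUnion hd hf]; exact measure_ne_top _ _
        rw [HasSum, SummationFilter.unconditional_filter, Metric.tendsto_atTop]
        intro ε hε
        lift ε to ℝ≥0 using hε.le
        have hε0 : ε / 3 ≠ 0 := by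
          have : ε ≠ 0 := by rintro rfl; simp at hε
          positivity
        obtain ⟨K, hK⟩ := hg.le (ε / 3) hε0
        have hδ : (0 : ℝ≥0∞) < (ε / (3 * (K + 1)) : ℝ≥0) := by
          have : ε ≠ 0 := by rintro rfl; simp at hε
          rw [ENNReal.coe_pos]; positivity
        obtain ⟨F₀, hF₀⟩ := eventually_atTop.1
          ((ENNReal.tendsto_nhds_zero.1 (ENNReal.tendsto_tsum_compl_atTop_zero hsm)) _ hδ)
        refine ⟨F₀, fun F hF => ?_⟩
        set R : Set X := ⋃ i ∈ (F : Set ℕ)ᶜ, f i with hR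
        have hRm : MeasurableSet R := MeasurableSet.biUnion (to_countable _) fun i _ => hf i
        have hsplit : (⋃ i, f i) = (⋃ i ∈ F, f i) ∪ R := by
          ext x
          simp only [hR, mem_iUnion, mem_union, mem_compl_iff, Finset.mem_coe, exists_prop]
          constructor
          · rintro ⟨i, hi⟩
            by_cases h : i ∈ F
            · exact Or.inl ⟨i, h, hi⟩
            · exact Or.inr ⟨i, h, hi⟩
          · rintro (⟨i, -, hi⟩ | ⟨i, -, hi⟩) <;> exact ⟨i, hi⟩
        have hdisj : Disjoint (⋃ i ∈ F, f i) R := by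
          rw [disjoint_iUnion₂_left]
          intro i hi
          rw [hR, disjoint_iUnion₂_right]
          intro j hj
          exact hd (fun h => hj (h ▸ hi))
        have hmR : m R ≤ (ε / (3 * (K + 1)) : ℝ≥0) := by
          refine le_trans ?_ (hF₀ F hF)
          exact measure_biUnion_le m (to_countable _) _
        have hlR : |l R| ≤ ((ε / 3 + ε / 3 : ℝ≥0) : ℝ) := by
          refine habs R _ hRm fun n => (hK n R hRm).trans ?_
          calc (K : ℝ≥0∞) * m R + (ε / 3 : ℝ≥0)
              ≤ K * (ε / (3 * (K + 1)) : ℝ≥0) + (ε / 3 : ℝ≥0) := by gcongr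
            _ ≤ _ := by
              rw [← ENNReal.coe_mul, ← ENNReal.coe_add, ENNReal.coe_le_coe]
              gcongr
              exact NNReal.mul_div_three_le _ _
        rw [hsplit, hunion _ _ (F.measurableSet_biUnion fun i _ => hf i) hRm hdisj, hsum,
          Real.dist_eq]
        have : ((ε / 3 + ε / 3 : ℝ≥0) : ℝ) = ε / 3 + ε / 3 := by simp
        rw [this] at hlR
        have e : ∑ i ∈ F, l (f i) - (∑ i ∈ F, l (f i) + l R) = - l R := by ring
        rw [e, abs_neg]
        have : (0 : ℝ) < ε := hε
        linarith }
  have hs : ∀ B, MeasurableSet B → s B = l B := fun B hB => if_pos hB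
  have hac : s ≪ᵥ m.toENNRealVectorMeasure := by
    refine VectorMeasure.AbsolutelyContinuous.mk fun B hB h0 => ?_
    rw [Measure.toENNRealVectorMeasure_apply_measurable hB] at h0
    rw [hs B hB, ← abs_nonpos_iff]
    have := habs B 0 hB fun n => by
      rw [Measure.restrict_eq_zero.2 h0]; simp
    simpa using this
  refine ⟨s.rnDeriv m, hg, SignedMeasure.measurable_rnDeriv _ _,
    SignedMeasure.integrable_rnDeriv _ _, fun B hB => ?_⟩
  rw [← withDensityᵥ_apply (SignedMeasure.integrable_rnDeriv _ _) hB,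
    (SignedMeasure.absolutelyContinuous_iff_withDensityᵥ_rnDeriv_eq s m).1 hac, hs B hB]
  exact hl B hB

omit [IsFiniteMeasure m] in
lemma setIntegral_eq_indicator_one_mul (f : X → ℝ) {B : Set X} (hB : MeasurableSet B) :
    ∫ x in B, f x ∂m = ∫ x, B.indicator (fun _ => (1 : ℝ)) x * f x ∂m := by
  rw [← integral_indicator hB]
  refine integral_congr_ae (ae_of_all _ fun x => ?_)
  by_cases hx : x ∈ B <;> simp [hx]

/-- Sequential weak compactness of equi-integrable sequences. -/
lemma EquiIntegrable.exists_subseq [MeasurableSpace.CountablyGenerated X] {g : ℕ → X → ℝ}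
    (hg : EquiIntegrable m g) :
    ∃ σ : ℕ → ℕ, StrictMono σ ∧ ∃ g', WeakTendsto m (fun n => g (σ n)) g' := by
  -- A countable algebra that is dense in measure reduces the extraction to countably many test
  -- sets.
  set 𝒜 : Set (Set X) := generateSetAlgebra (MeasurableSpace.countableGeneratingSet X) with h𝒜
  have h𝒜c : 𝒜.Countable :=
    countable_generateSetAlgebra (MeasurableSpace.countable_countableGeneratingSet)
  have hdense : m.MeasureDense 𝒜 := by
    refine Measure.MeasureDense.of_generateFrom_isSetAlgebra_finite m
      isSetAlgebra_generateSetAlgebra ?_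
    rw [generateFrom_generateSetAlgebra_eq, MeasurableSpace.generateFrom_countableGeneratingSet]
  have : Countable 𝒜 := h𝒜c.to_subtype
  obtain ⟨C, hC⟩ := hg.bound
  -- The diagonal argument is sequential compactness of a countable product of intervals.
  obtain ⟨l, -, σ, hσ, hl⟩ := (isCompact_univ_pi fun _ : 𝒜 => isCompact_Icc (a := -(C : ℝ)) (b := C)).tendsto_subseq
    (x := fun n (A : 𝒜) => ∫ x in (A : Set X), g n x ∂m) (fun n A _ => by
      rw [mem_Icc, ← abs_le]
      exact abs_integral_le_of_lintegral_enorm_le ((setLIntegral_le_lintegral _ _).trans (hC n)))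
  refine ⟨σ, hσ, (hg.comp σ).exists_weakTendsto fun B hB => cauchySeq_tendsto_of_complete ?_⟩
  simp_rw [setIntegral_eq_indicator_one_mul _ hB]
  have hind : ∀ (A : Set X) (x : X), ‖A.indicator (fun _ => (1 : ℝ)) x‖ₑ ≤ (1 : ℝ≥0) := by
    intro A x
    by_cases hx : x ∈ A <;> simp [hx]
  refine (hg.comp σ).cauchySeq_of_dense (C := 1) (measurable_const.indicator hB)
    (ae_of_all _ (hind B)) fun δ hδ => ?_
  obtain ⟨A, hA, hAB⟩ := hdense.approx B hB (measure_ne_top _ _) δ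
    (by exact_mod_cast pos_iff_ne_zero.2 hδ)
  have hAm := hdense.measurable A hA
  refine ⟨A.indicator fun _ => 1, measurable_const.indicator hAm, ae_of_all _ (hind A), ?_, ?_⟩
  · rw [ENNReal.ofReal_coe_nnreal] at hAB
    refine le_trans ?_ hAB.le
    rw [← lintegral_indicator_one (hB.symmDiff hAm)]
    refine lintegral_mono fun x => ?_
    by_cases h1 : x ∈ A <;> by_cases h2 : x ∈ B <;> simp [h1, h2, Set.mem_symmDiff]
  · simp_rw [← setIntegral_eq_indicator_one_mul _ hAm]
    exact ((tendsto_pi_nhds.1 hl) ⟨A, hA⟩).cauchySeq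

/-- Equi-integrable densities for which the integrals of bounded Lipschitz functions converge are
weakly convergent. -/
lemma EquiIntegrable.exists_weakTendsto_of_lipschitz {V : Type*} [PseudoMetricSpace V]
    [MeasurableSpace V] [BorelSpace V] {m : Measure V} [IsFiniteMeasure m] {g : ℕ → V → ℝ}
    (hg : EquiIntegrable m g)
    (hlim : ∀ f : V → ℝ, (∃ K, LipschitzWith K f) → (∃ C, ∀ x, |f x| ≤ C) →
      CauchySeq fun n => ∫ x, f x * g n x ∂m) :
    ∃ g', WeakTendsto m g g' := by
  refine hg.exists_weakTendsto fun B hB => cauchySeq_tendsto_of_complete ?_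
  simp_rw [setIntegral_eq_indicator_one_mul _ hB]
  have hind : ∀ x, ‖B.indicator (fun _ => (1 : ℝ)) x‖ₑ ≤ (1 : ℝ≥0) := by
    intro x
    by_cases hx : x ∈ B <;> simp [hx]
  refine hg.cauchySeq_of_dense (C := 1) (measurable_const.indicator hB) (ae_of_all _ hind)
    fun δ hδ => ?_
  -- Borel sets are approximated from inside by closed sets, and indicators of closed sets are `L¹`
  -- limits of Lipschitz thickened indicators.
  obtain ⟨F, hFB, hF, hmF⟩ := hB.exists_isClosed_sdiff_lt (μ := m) (measure_ne_top _ _)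
    (ε := (δ / 2 : ℝ≥0)) (by simpa using hδ)
  have hthick : Tendsto (fun n : ℕ => ∫⁻ x, ‖F.indicator (fun _ => (1 : ℝ)) x
      - (thickenedIndicator (δ := 1 / ((n : ℝ) + 1)) (by positivity) F x : ℝ)‖ₑ ∂m) atTop (𝓝 0) := by
    have := tendsto_lintegral_of_dominated_convergence (μ := m)
      (F := fun (n : ℕ) x => ‖F.indicator (fun _ => (1 : ℝ)) x
      - (thickenedIndicator (δ := 1 / ((n : ℝ) + 1)) (by positivity) F x : ℝ)‖ₑ)
      (f := fun _ => 0) (fun _ => (1 : ℝ≥0∞) + 1)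
      (fun n => by
        have : Measurable fun x => (thickenedIndicator (δ := 1 / ((n : ℝ) + 1)) (by positivity) F x : ℝ) :=
          ((thickenedIndicator (δ := 1 / ((n : ℝ) + 1)) (by positivity) F).continuous.measurable).coe_nnreal_real
        exact ((measurable_const.indicator hF.measurableSet).sub this).enorm)
      (fun n => ae_of_all _ fun x => enorm_sub_le.trans (add_le_add
        (by by_cases hx : x ∈ F <;> simp [hx]) (by
          rw [← ofReal_norm, ← ENNReal.ofReal_one]
          apply ENNReal.ofReal_le_ofReal
          simp only [NNReal.norm_eq]
          exact_mod_cast thickenedIndicator_le_one _ F x)))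
      (by simp [ENNReal.mul_ne_top, measure_ne_top]) (ae_of_all _ fun x => by
        have h1 := thickenedIndicator_tendsto_indicator_closure
          (δseq := fun n : ℕ => 1 / ((n : ℝ) + 1)) (fun n => by positivity)
          tendsto_one_div_add_atTop_nhds_zero_nat F
        have h2 := (tendsto_pi_nhds.1 h1) x
        rw [hF.closure_eq] at h2
        have h3 : Tendsto (fun n : ℕ => ((thickenedIndicator (δ := 1 / ((n : ℝ) + 1))
          (by positivity) F x : ℝ≥0) : ℝ)) atTop (𝓝 (F.indicator (fun _ => (1 : ℝ)) x)) := by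
          have h4 : ((F.indicator (fun _ => (1 : ℝ≥0)) x : ℝ≥0) : ℝ)
              = F.indicator (fun _ => (1 : ℝ)) x := by
            by_cases hx : x ∈ F <;> simp [hx]
          rw [← h4]
          exact (NNReal.tendsto_coe.2 h2)
        simpa using (h3.const_sub (F.indicator (fun _ => (1 : ℝ)) x)).enorm)
    simpa using this
  obtain ⟨n, hn⟩ := (ENNReal.tendsto_nhds_zero.1 hthick (δ / 2 : ℝ≥0)
    (by simpa using hδ)).exists
  set f := thickenedIndicator (δ := 1 / ((n : ℝ) + 1)) (by positivity) F with hf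
  have hfm : Measurable fun x => (f x : ℝ) := f.continuous.measurable.coe_nnreal_real
  have hf1 : ∀ x, (f x : ℝ) ≤ 1 := fun x => by exact_mod_cast thickenedIndicator_le_one _ F x
  refine ⟨fun x => f x, hfm, ae_of_all _ fun x => ?_, ?_, hlim _ ?_ ⟨1, fun x => ?_⟩⟩
  · rw [← ofReal_norm, ENNReal.coe_one, ← ENNReal.ofReal_one]
    apply ENNReal.ofReal_le_ofReal
    simpa using hf1 x
  · calc ∫⁻ x, ‖B.indicator (fun _ => (1 : ℝ)) x - (f x : ℝ)‖ₑ ∂m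
        ≤ ∫⁻ x, ((B \ F).indicator 1 x + ‖F.indicator (fun _ => (1 : ℝ)) x - (f x : ℝ)‖ₑ) ∂m := by
          refine lintegral_mono fun x => ?_
          have e : B.indicator (fun _ => (1 : ℝ)) x - (f x : ℝ)
            = (B.indicator (fun _ => (1 : ℝ)) x - F.indicator (fun _ => (1 : ℝ)) x)
              + (F.indicator (fun _ => (1 : ℝ)) x - (f x : ℝ)) := by ring
          rw [e]
          refine (enorm_add_le _ _).trans (add_le_add ?_ le_rfl)
          by_cases h1 : x ∈ F
          · simp [h1, hFB h1]
          · by_cases h2 : x ∈ B <;> simp [h1, h2]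
      _ = m (B \ F) + _ := by
          rw [lintegral_add_left (measurable_one.indicator (hB.diff hF.measurableSet)),
            lintegral_indicator_one (hB.diff hF.measurableSet)]
      _ ≤ (δ / 2 : ℝ≥0) + (δ / 2 : ℝ≥0) := add_le_add hmF.le hn
      _ = δ := by rw [← ENNReal.coe_add, add_halves]
  · exact ⟨_, LipschitzWith.comp (Kf := 1) (f := ((↑) : ℝ≥0 → ℝ))
      (LipschitzWith.of_dist_le_mul fun x y => by simp [NNReal.dist_eq, Real.dist_eq])
      (lipschitzWith_thickenedIndicator _ F)⟩
  · rw [abs_of_nonneg (NNReal.coe_nonneg _)]; exact hf1 x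

omit [IsFiniteMeasure m] in
lemma WeakTendsto.comp {g : ℕ → X → ℝ} {g' : X → ℝ} (h : WeakTendsto m g g') {σ : ℕ → ℕ}
    (hσ : Tendsto σ atTop atTop) : WeakTendsto m (fun n => g (σ n)) g' where
  equi := h.equi.comp σ
  measurable := h.measurable
  integrable := h.integrable
  tendsto B hB := (h.tendsto B hB).comp hσ

end WeakConvergence

/-! ### Lower semicontinuity of suprema of linear functionals -/

lemma ENNReal.liminf_add_liminf_le (f g : ℕ → ℝ≥0∞) :
    liminf f atTop + liminf g atTop ≤ liminf (fun n => f n + g n) atTop := by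
  simp only [liminf_eq_iSup_iInf_of_nat]
  rw [ENNReal.iSup_add_iSup_of_monotone]
  · refine iSup_mono fun n => le_iInf₂ fun i hi => ?_
    exact add_le_add (iInf₂_le i hi) (iInf₂_le i hi)
  · exact fun a b hab => biInf_mono fun i hi => le_trans hab hi
  · exact fun a b hab => biInf_mono fun i hi => le_trans hab hi

/-- For finitely many functionals, cut the domain into pieces on each of which one limiting
functional is the largest: there the integral of the maximum is an integral of a single functional,
which converges, and inferior limits are superadditive over the pieces. Monotone convergence then
reaches the countable supremum. -/
lemma lintegral_iSup_ofReal_le_liminf {X ι : Type*} [MeasurableSpace X] [Countable ι]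
    {P : Measure X} {f : ℕ → X → ℝ≥0∞} {L : ι → ℕ → X → ℝ} {L' : ι → X → ℝ}
    (hL : ∀ i n, Integrable (L i n) P) (hL'm : ∀ i, Measurable (L' i))
    (hL' : ∀ i, Integrable (L' i) P)
    (hle : ∀ i n, ∀ᵐ x ∂P, ENNReal.ofReal (L i n x) ≤ f n x)
    (hlim : ∀ i B, MeasurableSet B →
      Tendsto (fun n => ∫ x in B, L i n x ∂P) atTop (𝓝 (∫ x in B, L' i x ∂P))) :
    ∫⁻ x, ⨆ i, ENNReal.ofReal (L' i x) ∂P ≤ liminf (fun n => ∫⁻ x, f n x ∂P) atTop := by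
  classical
  -- a finite family on a measurable set
  have key : ∀ (F : Finset ι) (B : Set X), MeasurableSet B →
      ∫⁻ x in B, ⨆ i ∈ F, ENNReal.ofReal (L' i x) ∂P
        ≤ liminf (fun n => ∫⁻ x in B, f n x ∂P) atTop := by
    intro F
    induction F using Finset.induction_on with
    | empty => intro B hB; simp
    | insert a F ha ih =>
      intro B hB
      set G : X → ℝ≥0∞ := fun x => ⨆ i ∈ F, ENNReal.ofReal (L' i x) with hG
      have hGm : Measurable G := by
        refine Measurable.iSup fun i => Measurable.iSup fun _ => (hL'm i).ennreal_ofReal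
      -- Nonnegativity is required on `D` so that `ENNReal.ofReal` does not truncate and the
      -- integral there is linear in `L' a`.
      set D : Set X := {x | G x ≤ ENNReal.ofReal (L' a x)} ∩ {x | 0 ≤ L' a x} with hD
      have hDm : MeasurableSet D := (measurableSet_le hGm (hL'm a).ennreal_ofReal).inter
        (measurableSet_le measurable_const (hL'm a))
      have hins : ∀ x, ⨆ i ∈ insert a F, ENNReal.ofReal (L' i x)
          = max (ENNReal.ofReal (L' a x)) (G x) := by
        intro x; rw [Finset.iSup_insert]
      simp_rw [hins]
      have h1 : ∫⁻ x in B ∩ D, max (ENNReal.ofReal (L' a x)) (G x) ∂P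
          ≤ liminf (fun n => ∫⁻ x in B ∩ D, f n x ∂P) atTop := by
        have e1 : ∫⁻ x in B ∩ D, max (ENNReal.ofReal (L' a x)) (G x) ∂P
            = ENNReal.ofReal (∫ x in B ∩ D, L' a x ∂P) := by
          rw [ofReal_integral_eq_lintegral_ofReal (hL' a).integrableOn]
          · refine setLIntegral_congr_fun (hB.inter hDm) fun x hx => ?_
            exact max_eq_left hx.2.1
          · exact (ae_restrict_mem (hB.inter hDm)).mono fun x hx => hx.2.2
        rw [e1]
        have h2 : Tendsto (fun n => ENNReal.ofReal (∫ x in B ∩ D, L a n x ∂P)) atTop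
            (𝓝 (ENNReal.ofReal (∫ x in B ∩ D, L' a x ∂P))) :=
          ENNReal.tendsto_ofReal (hlim a _ (hB.inter hDm))
        rw [← h2.liminf_eq]
        refine liminf_le_liminf (Eventually.of_forall fun n => ?_)
        calc ENNReal.ofReal (∫ x in B ∩ D, L a n x ∂P)
            ≤ ENNReal.ofReal (∫ x in B ∩ D, max (L a n x) 0 ∂P) := by
              apply ENNReal.ofReal_le_ofReal
              exact integral_mono (hL a n).integrableOn (hL a n).integrableOn.pos_part
                fun x => le_max_left _ _
          _ = ∫⁻ x in B ∩ D, ENNReal.ofReal (max (L a n x) 0) ∂P :=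
              ofReal_integral_eq_lintegral_ofReal (hL a n).integrableOn.pos_part
                (ae_of_all _ fun x => le_max_right _ _)
          _ ≤ _ := by
              refine lintegral_mono_ae (ae_restrict_of_ae ?_)
              filter_upwards [hle a n] with x hx
              rcases le_total (L a n x) 0 with h | h
              · simp [h]
              · rwa [max_eq_left h]
      have h2 : ∫⁻ x in B \ D, max (ENNReal.ofReal (L' a x)) (G x) ∂P
          ≤ liminf (fun n => ∫⁻ x in B \ D, f n x ∂P) atTop := by
        refine le_trans (le_of_eq ?_) (ih (B \ D) (hB.diff hDm))
        refine setLIntegral_congr_fun (hB.diff hDm) fun x hx => ?_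
        refine max_eq_right ?_
        by_contra hlt
        rw [not_le] at hlt
        refine hx.2 ⟨hlt.le, ?_⟩
        by_contra h0
        simp only [mem_ofPred_eq, not_le] at h0
        rw [ENNReal.ofReal_of_nonpos h0.le] at hlt
        exact absurd hlt (by simp)
      calc ∫⁻ x in B, max (ENNReal.ofReal (L' a x)) (G x) ∂P
          = ∫⁻ x in B ∩ D, max (ENNReal.ofReal (L' a x)) (G x) ∂P
            + ∫⁻ x in B \ D, max (ENNReal.ofReal (L' a x)) (G x) ∂P :=
            (lintegral_inter_add_sdiff _ _ hDm).symm
        _ ≤ liminf (fun n => ∫⁻ x in B ∩ D, f n x ∂P) atTop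
            + liminf (fun n => ∫⁻ x in B \ D, f n x ∂P) atTop := add_le_add h1 h2
        _ ≤ liminf (fun n => ∫⁻ x in B ∩ D, f n x ∂P + ∫⁻ x in B \ D, f n x ∂P) atTop :=
            ENNReal.liminf_add_liminf_le _ _
        _ = _ := by simp_rw [lintegral_inter_add_sdiff _ _ hDm]
  rcases isEmpty_or_nonempty ι with hι | hι
  · simp
  obtain ⟨e, he⟩ := exists_surjective_nat ι
  have hsup : ∀ x, ⨆ i, ENNReal.ofReal (L' i x)
      = ⨆ N : ℕ, ⨆ i ∈ (Finset.range N).image e, ENNReal.ofReal (L' i x) := by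
    intro x
    apply le_antisymm
    · refine iSup_le fun i => ?_
      obtain ⟨k, rfl⟩ := he i
      exact le_iSup_of_le (k + 1) (le_iSup₂_of_le (e k)
        (Finset.mem_image_of_mem _ (Finset.self_mem_range_succ k)) le_rfl)
    · exact iSup_le fun N => iSup₂_le fun i _ => le_iSup (fun i => ENNReal.ofReal (L' i x)) i
  simp_rw [hsup]
  rw [lintegral_iSup]
  · refine iSup_le fun N => ?_
    have := key ((Finset.range N).image e) univ MeasurableSet.univ
    simpa using this
  · exact fun N => Measurable.iSup fun i => Measurable.iSup fun _ => (hL'm i).ennreal_ofReal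
  · intro N M hNM x
    exact biSup_mono fun i hi => Finset.image_subset_image (Finset.range_mono hNM) hi

/-! ### Convex lower semicontinuous functions as suprema of affine functions -/

/-- A convex lower semicontinuous function on the quadrant lies above an affine function that is
almost as large at a given point. -/
lemma exists_affine_le_of_lt_quadrant {F : ℝ≥0 × ℝ≥0 → ℝ≥0∞} (hF : ConvexOn ℝ≥0 univ F)
    (hl : LowerSemicontinuous F) (p : ℝ≥0 × ℝ≥0) {s : ℝ} (hs : 0 ≤ s)
    (hsF : ENNReal.ofReal s < F p) :
    ∃ a b c : ℝ, (∀ q : ℝ≥0 × ℝ≥0, ENNReal.ofReal (a * q.1 + b * q.2 + c) ≤ F q) ∧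
      s ≤ a * p.1 + b * p.2 + c := by
  -- The epigraph is placed in a real vector space, where Hahn–Banach separates it from the point
  -- below the graph.
  set E : Set (ℝ × ℝ × ℝ) := {q | 0 ≤ q.1 ∧ 0 ≤ q.2.1 ∧ 0 ≤ q.2.2 ∧
    F (q.1.toNNReal, q.2.1.toNNReal) ≤ ENNReal.ofReal q.2.2} with hE
  have hEc : Convex ℝ E := by
    rintro ⟨x1, x2, x3⟩ ⟨hx1, hx2, hx3, hx⟩ ⟨y1, y2, y3⟩ ⟨hy1, hy2, hy3, hy⟩ a b ha hb hab
    simp only at hx1 hx2 hx3 hx hy1 hy2 hy3 hy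
    refine ⟨by simp; positivity, by simp; positivity, by simp; positivity, ?_⟩
    simp only [Prod.smul_mk, smul_eq_mul, Prod.mk_add_mk]
    lift a to ℝ≥0 using ha
    lift b to ℝ≥0 using hb
    lift x1 to ℝ≥0 using hx1
    lift x2 to ℝ≥0 using hx2
    lift x3 to ℝ≥0 using hx3
    lift y1 to ℝ≥0 using hy1
    lift y2 to ℝ≥0 using hy2
    lift y3 to ℝ≥0 using hy3
    simp only [← NNReal.coe_mul, ← NNReal.coe_add, Real.toNNReal_coe, ENNReal.ofReal_coe_nnreal]
      at hx hy ⊢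
    have := hF.2 (mem_univ (x1, x2)) (mem_univ (y1, y2)) zero_le zero_le
      (by exact_mod_cast hab)
    refine this.trans ?_
    simp only [ENNReal.smul_def, smul_eq_mul]
    push_cast
    gcongr
  have hEcl : IsClosed E := by
    have h1 : IsClosed {q : (ℝ≥0 × ℝ≥0) × ℝ≥0∞ | F q.1 ≤ q.2} := hl.isClosed_epigraph
    have h2 : Continuous fun q : ℝ × ℝ × ℝ =>
        (((q.1.toNNReal, q.2.1.toNNReal), ENNReal.ofReal q.2.2) : (ℝ≥0 × ℝ≥0) × ℝ≥0∞) := by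
      refine Continuous.prodMk (Continuous.prodMk ?_ ?_) ?_
      · exact continuous_real_toNNReal.comp continuous_fst
      · exact continuous_real_toNNReal.comp (continuous_fst.comp continuous_snd)
      · exact ENNReal.continuous_ofReal.comp (continuous_snd.comp continuous_snd)
    exact (isClosed_le continuous_const continuous_fst).inter
      ((isClosed_le continuous_const (continuous_fst.comp continuous_snd)).inter
      ((isClosed_le continuous_const (continuous_snd.comp continuous_snd)).inter
        (h1.preimage h2)))
  have hp : ((p.1 : ℝ), (p.2 : ℝ), s) ∉ E := by
    rintro ⟨-, -, -, h⟩
    simp only [Real.toNNReal_coe] at h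
    exact absurd h (not_le.2 hsF)
  obtain ⟨f, u, hfu, huf⟩ := geometric_hahn_banach_closed_point hEc hEcl hp
  set a := f (1, 0, 0) with ha
  set b := f (0, 1, 0) with hb
  set d := f (0, 0, 1) with hd
  have hf : ∀ x y z : ℝ, f (x, y, z) = a * x + b * y + d * z := by
    intro x y z
    have : ((x, y, z) : ℝ × ℝ × ℝ) = x • (1, 0, 0) + y • (0, 1, 0) + z • (0, 0, 1) := by simp
    rw [this, map_add, map_add, map_smul, map_smul, map_smul]
    simp only [smul_eq_mul, ha, hb, hd]; ring
  rw [hf] at huf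
  have hfE : ∀ q : ℝ≥0 × ℝ≥0, ∀ r : ℝ, 0 ≤ r → F q ≤ ENNReal.ofReal r →
      a * q.1 + b * q.2 + d * r < u := by
    intro q r hr hqr
    rw [← hf]
    exact hfu _ ⟨q.1.2, q.2.2, hr, by simpa using hqr⟩
  by_cases htop : ∀ q, F q = ∞
  · exact ⟨0, 0, s, fun q => by simp [htop q], by simp⟩
  push Not at htop
  obtain ⟨q₀, hq₀⟩ := htop
  -- `d` is the vertical component of the separating functional. If `d < 0` the hyperplane is the
  -- graph of an affine minorant. If `d = 0` it is vertical and negative wherever `F` is finite, so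
  -- it can be steepened by a factor `k` until it reaches `s` at `p`. The case `d > 0` is impossible
  -- because the epigraph is unbounded upwards.
  rcases lt_trichotomy d 0 with hd0 | hd0 | hd0
  · refine ⟨a / (-d), b / (-d), -u / (-d), fun q => ?_, ?_⟩
    · by_cases hq : F q = ∞
      · simp [hq]
      have h := hfE q (F q).toReal ENNReal.toReal_nonneg (by rw [ENNReal.ofReal_toReal hq])
      rw [← ENNReal.ofReal_toReal hq]
      apply ENNReal.ofReal_le_ofReal
      have e : a / -d * q.1 + b / -d * q.2 + -u / -d = (a * q.1 + b * q.2 - u) / (-d) := by ring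
      rw [e, div_le_iff₀ (by linarith)]
      linarith
    · have e : a / -d * p.1 + b / -d * p.2 + -u / -d = (a * p.1 + b * p.2 - u) / (-d) := by ring
      rw [e, le_div_iff₀ (by linarith)]
      linarith
  · have hpos : 0 < a * p.1 + b * p.2 - u := by rw [hd0] at huf; linarith
    set k := s / (a * p.1 + b * p.2 - u) with hk
    have hk0 : 0 ≤ k := div_nonneg hs hpos.le
    refine ⟨k * a, k * b, - (k * u), fun q => ?_, ?_⟩
    · by_cases hq : F q = ∞
      · simp [hq]
      have h := hfE q (F q).toReal ENNReal.toReal_nonneg (by rw [ENNReal.ofReal_toReal hq])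
      rw [hd0] at h
      rw [ENNReal.ofReal_of_nonpos]
      · exact zero_le
      have e : k * a * q.1 + k * b * q.2 + - (k * u) = k * (a * q.1 + b * q.2 - u) := by ring
      rw [e]
      exact mul_nonpos_of_nonneg_of_nonpos hk0 (by linarith)
    · have e : k * a * p.1 + k * b * p.2 + - (k * u) = k * (a * p.1 + b * p.2 - u) := by ring
      rw [e, hk, div_mul_cancel₀ _ hpos.ne']
  · exfalso
    set M := (F q₀).toReal + |u - a * q₀.1 - b * q₀.2| / d with hM
    have hM0 : (F q₀).toReal ≤ M := le_add_of_nonneg_right (by positivity)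
    have h := hfE q₀ M (ENNReal.toReal_nonneg.trans hM0) (by
      rw [← ENNReal.ofReal_toReal hq₀]; exact ENNReal.ofReal_le_ofReal hM0)
    have h1 : |u - a * q₀.1 - b * q₀.2| ≤ d * M := by
      rw [hM, mul_add, mul_div_cancel₀ _ hd0.ne']
      have : 0 ≤ d * (F q₀).toReal := by positivity
      linarith
    have h2 := le_abs_self (u - a * q₀.1 - b * q₀.2)
    linarith

/-- An affine function on the quadrant. -/
def affineQuadrant (c : ℝ × ℝ × ℝ) (q : ℝ≥0 × ℝ≥0) : ℝ := c.1 * q.1 + c.2.1 * q.2 + c.2.2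

lemma continuous_affineQuadrant (c : ℝ × ℝ × ℝ) : Continuous (affineQuadrant c) := by
  unfold affineQuadrant; fun_prop

/-- By separation `F` is the least upper bound of its affine minorants (cut off at zero), and second
countability extracts a countable subfamily with the same supremum. Countability is what the
integral lower semicontinuity lemma needs; the zero function is retained because `exists_affine_α`
uses it. -/
lemma exists_iSup_affineQuadrant {F : ℝ≥0 × ℝ≥0 → ℝ≥0∞} (hF : ConvexOn ℝ≥0 univ F)
    (hl : LowerSemicontinuous F) :
    ∃ c : ℕ → ℝ × ℝ × ℝ, (∃ i, c i = 0) ∧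
      ∀ q, F q = ⨆ i, ENNReal.ofReal (affineQuadrant (c i) q) := by
  set 𝓕 : Set (ℝ≥0 × ℝ≥0 → ℝ≥0∞) := {f | ∃ c : ℝ × ℝ × ℝ,
    f = (fun q => ENNReal.ofReal (affineQuadrant c q)) ∧ f ≤ F} with h𝓕
  have hlub : IsLUB 𝓕 F := by
    refine ⟨fun f hf => hf.choose_spec.2, fun g hg p => ?_⟩
    refine le_of_forall_lt fun x hx => ?_
    obtain ⟨y, hxy, hyF⟩ := exists_between hx
    have hy : y ≠ ∞ := (hyF.trans_le le_top).ne
    obtain ⟨a, b, c, h1, h2⟩ := exists_affine_le_of_lt_quadrant hF hl p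
      (s := y.toReal) ENNReal.toReal_nonneg (by rwa [ENNReal.ofReal_toReal hy])
    have h3 : (fun q => ENNReal.ofReal (affineQuadrant (a, b, c) q)) ∈ 𝓕 := ⟨(a, b, c), rfl, h1⟩
    refine hxy.trans_le (le_trans ?_ (hg h3 p))
    rw [← ENNReal.ofReal_toReal hy]
    exact ENNReal.ofReal_le_ofReal h2
  obtain ⟨𝓖, h𝓖, h𝓖c, h𝓖l⟩ := exists_countable_lowerSemicontinuous_isLUB (fun f hf => by
    obtain ⟨c, rfl, -⟩ := hf
    exact (ENNReal.continuous_ofReal.comp (continuous_affineQuadrant c)).lowerSemicontinuous) hlub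
  have h0 : (fun q => ENNReal.ofReal (affineQuadrant 0 q)) ∈ 𝓕 :=
    ⟨0, rfl, fun q => by simp [affineQuadrant]⟩
  have h𝓖c' : (insert (fun q => ENNReal.ofReal (affineQuadrant 0 q)) 𝓖).Countable := h𝓖c.insert _
  obtain ⟨e, he⟩ := h𝓖c'.exists_eq_range (insert_nonempty _ _)
  have hmem : ∀ i, e i ∈ 𝓕 := fun i => by
    have : e i ∈ insert (fun q => ENNReal.ofReal (affineQuadrant 0 q)) 𝓖 := he ▸ mem_range_self i
    rcases this with h | h
    · rw [h]; exact h0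
    · exact h𝓖 h
  choose c hc hcF using hmem
  obtain ⟨i₀, hi₀⟩ : ∃ i, e i = (fun q => ENNReal.ofReal (affineQuadrant 0 q)) := by
    have : (fun q => ENNReal.ofReal (affineQuadrant 0 q)) ∈ range e := he ▸ mem_insert _ _
    exact this
  refine ⟨fun i => if i = i₀ then 0 else c i, ⟨i₀, by simp⟩, fun q => ?_⟩
  have hval : ∀ i, ENNReal.ofReal (affineQuadrant (if i = i₀ then 0 else c i) q) = e i q := by
    intro i
    by_cases h : i = i₀
    · rw [if_pos h, h, hi₀]
    · rw [if_neg h, hc i]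
  simp_rw [hval]
  apply le_antisymm
  · have hub : (fun q => ⨆ i, e i q) ∈ upperBounds 𝓖 := by
      intro f hf x
      have : f ∈ range e := he ▸ mem_insert_of_mem _ hf
      obtain ⟨i, rfl⟩ := this
      exact le_iSup (fun i => e i x) i
    exact h𝓖l.2 hub q
  · exact iSup_le fun i => hcF i q

namespace JumpSystem

variable {V : Type*} [MeasurableSpace V]

lemma lowerSemicontinuous_fisherDensity (S : JumpSystem V) :
    LowerSemicontinuous S.fisherDensity := by
  unfold fisherDensity
  exact lowerSemicontinuous_iSup fun g => lowerSemicontinuous_iSup fun hg => hg.1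

lemma fisherDensity_le (S : JumpSystem V) (p : ℝ≥0 × ℝ≥0) :
    S.fisherDensity p ≤ S.fisherDensityPlus p :=
  iSup₂_le fun _ hg => hg.2 p

variable [MetricSpace V] {S : JumpSystem V}

/-! ### The flux density -/

namespace Assumptions

lemma α_concave_le (hS : S.Assumptions) (p q : ℝ≥0 × ℝ≥0) {a b : ℝ≥0} (hab : a + b = 1) :
    a * S.α p + b * S.α q ≤ S.α (a • p + b • q) :=
  hS.α_concave.2 (mem_univ p) (mem_univ q) zero_le zero_le hab

/-- A concave function bounded below on a cone is nondecreasing: `p + q` divides the segment from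
`p` to the remote point `p + q / l`, so `α (p + q) ≥ (1 - l) α p`, and `l → 0`. -/
lemma α_le_add (hS : S.Assumptions) (p q : ℝ≥0 × ℝ≥0) : S.α p ≤ S.α (p + q) := by
  have h : ∀ n : ℕ, (1 - 1 / ((n : ℝ) + 2)) * (S.α p : ℝ) ≤ S.α (p + q) := by
    intro n
    set l : ℝ≥0 := 1 / ((n : ℝ≥0) + 2) with hl
    have hl0 : l ≠ 0 := by positivity
    have hl1 : l ≤ 1 := div_le_one_of_le₀ (by norm_cast; omega) (by positivity)
    have := hS.α_concave_le p (p + l⁻¹ • q) (a := 1 - l) (b := l)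
      (tsub_add_cancel_of_le hl1)
    have e : (1 - l) • p + l • (p + l⁻¹ • q) = p + q := by
      rw [smul_add, smul_smul, mul_inv_cancel₀ hl0, one_smul, ← add_assoc, ← add_smul,
        tsub_add_cancel_of_le hl1, one_smul]
    rw [e] at this
    have h2 : (1 - l) * S.α p ≤ S.α (p + q) := le_trans (le_add_of_nonneg_right zero_le) this
    have h3 : (((1 - l) * S.α p : ℝ≥0) : ℝ) ≤ S.α (p + q) := by exact_mod_cast h2
    rw [NNReal.coe_mul, NNReal.coe_sub hl1] at h3
    simpa [hl] using h3
  have hlim : Tendsto (fun n : ℕ => (1 - 1 / ((n : ℝ) + 2)) * (S.α p : ℝ)) atTop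
      (𝓝 ((1 - 0) * (S.α p : ℝ))) := by
    refine Tendsto.mul_const _ (tendsto_const_nhds.sub ?_)
    refine tendsto_const_nhds.div_atTop (tendsto_atTop_add_const_right _ _ tendsto_natCast_atTop_atTop)
  have := le_of_tendsto hlim (Eventually.of_forall h)
  simp only [sub_zero, one_mul] at this
  exact_mod_cast this

lemma α_mono (hS : S.Assumptions) : Monotone S.α := by
  intro p q hpq
  obtain ⟨r, rfl⟩ : ∃ r, q = p + r := ⟨(q.1 - p.1, q.2 - p.2), by
    ext <;> simp [add_tsub_cancel_of_le hpq.1, add_tsub_cancel_of_le hpq.2]⟩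
  exact hS.α_le_add p r

/-- A point where `α` is nonzero is shrunk towards the origin until it lies below `(u, v)`;
concavity keeps the value positive and monotonicity transfers it. -/
lemma α_pos (hS : S.Assumptions) {u v : ℝ≥0} (hu : 0 < u) (hv : 0 < v) : 0 < S.α (u, v) := by
  obtain ⟨p, hp⟩ := hS.α_nondegenerate
  set l : ℝ≥0 := min 1 (min (u / (p.1 + 1)) (v / (p.2 + 1))) with hl
  have hl0 : 0 < l := by positivity
  have hl1 : l ≤ 1 := min_le_left _ _
  have h1 := hS.α_concave_le p 0 (a := l) (b := 1 - l)
    (add_tsub_cancel_of_le hl1)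
  have h2 : l • p + (1 - l) • (0 : ℝ≥0 × ℝ≥0) ≤ (u, v) := by
    rw [smul_zero, add_zero]
    have hx : ∀ x w : ℝ≥0, w / (x + 1) * x ≤ w := fun x w => by
      rw [div_mul_eq_mul_div]
      exact div_le_of_le_mul₀ (by positivity) (by positivity) (by gcongr; simp)
    constructor
    · calc l * p.1 ≤ u / (p.1 + 1) * p.1 := by
            gcongr; exact (min_le_right _ _).trans (min_le_left _ _)
        _ ≤ u := hx _ _
    · calc l * p.2 ≤ v / (p.2 + 1) * p.2 := by
            gcongr; exact (min_le_right _ _).trans (min_le_right _ _)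
        _ ≤ v := hx _ _
  refine lt_of_lt_of_le ?_ (hS.α_mono h2)
  refine lt_of_lt_of_le ?_ h1
  have : 0 < l * S.α p := mul_pos hl0 (pos_iff_ne_zero.2 hp)
  exact lt_of_lt_of_le this (le_add_of_nonneg_right zero_le)

/-- Concavity along the diagonal ray gives `α (s, s) ≤ s α (1, 1)` for `s ≥ 1`, and monotonicity
compares `(u, v)` with the diagonal. -/
lemma α_le (hS : S.Assumptions) (u v : ℝ≥0) : S.α (u, v) ≤ S.α (1, 1) * (1 + u + v) := by
  set s : ℝ≥0 := 1 + u + v with hs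
  have hs1 : 1 ≤ s := by rw [hs, add_assoc]; exact le_add_of_nonneg_right zero_le
  have hs0 : s ≠ 0 := (zero_lt_one.trans_le hs1).ne'
  have hi : s⁻¹ ≤ 1 := inv_le_one_of_one_le₀ hs1
  have h1 := hS.α_concave_le (s, s) 0 (a := s⁻¹) (b := 1 - s⁻¹)
    (add_tsub_cancel_of_le hi)
  have e : s⁻¹ • ((s, s) : ℝ≥0 × ℝ≥0) + (1 - s⁻¹) • (0 : ℝ≥0 × ℝ≥0) = (1, 1) := by
    ext <;> simp [inv_mul_cancel₀ hs0]
  rw [e] at h1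
  have h2 : s⁻¹ * S.α (s, s) ≤ S.α (1, 1) := le_trans (le_add_of_nonneg_right zero_le) h1
  have h3 : S.α (u, v) ≤ S.α (s, s) := hS.α_mono ⟨by
    show u ≤ s; rw [hs]; exact le_trans (le_add_of_nonneg_left zero_le) (le_add_of_nonneg_right zero_le), by
    show v ≤ s; rw [hs]; exact le_add_of_nonneg_left zero_le⟩
  refine h3.trans ?_
  rw [inv_mul_le_iff₀ (pos_iff_ne_zero.2 hs0)] at h2
  rwa [mul_comm]

/-- The flux density is an infimum of affine functions. -/
lemma exists_affine_α (hS : S.Assumptions) : ∃ c : ℕ → ℝ × ℝ × ℝ,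
    (∀ i p, (S.α p : ℝ) ≤ affineQuadrant (c i) p) ∧
    ∀ p, ∀ ε > 0, ∃ i, affineQuadrant (c i) p < S.α p + ε := by
  set C := S.α (1, 1) with hC
  -- Subtracting from the affine majorant turns the concave `α` into a nonnegative convex function,
  -- to which the representation by affine minorants applies.
  set G : ℝ≥0 × ℝ≥0 → ℝ := fun p => C * (1 + p.1 + p.2) - S.α p with hG
  have hG0 : ∀ p, 0 ≤ G p := fun p => by
    have := hS.α_le p.1 p.2
    have h2 : ((S.α p : ℝ≥0) : ℝ) ≤ (C * (1 + p.1 + p.2) : ℝ≥0) := by exact_mod_cast this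
    push_cast at h2
    simp only [hG]; linarith
  have hconv : ConvexOn ℝ≥0 univ (fun p => ENNReal.ofReal (G p)) := by
    refine ⟨convex_univ, fun p _ q _ a b _ _ hab => ?_⟩
    simp only [ENNReal.smul_def, smul_eq_mul]
    rw [← ENNReal.ofReal_coe_nnreal, ← ENNReal.ofReal_coe_nnreal, ← ENNReal.ofReal_mul (by simp),
      ← ENNReal.ofReal_mul (by simp), ← ENNReal.ofReal_add (mul_nonneg (by simp) (hG0 _))
      (mul_nonneg (by simp) (hG0 _))]
    apply ENNReal.ofReal_le_ofReal
    have h1 : (a • S.α p + b • S.α q : ℝ≥0) ≤ S.α (a • p + b • q) :=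
      hS.α_concave.2 (mem_univ p) (mem_univ q) zero_le zero_le hab
    have h2 : (a : ℝ) * S.α p + b * S.α q ≤ S.α (a • p + b • q) := by exact_mod_cast h1
    have hab' : (a : ℝ) + b = 1 := by exact_mod_cast hab
    simp only [hG, Prod.fst_add, Prod.snd_add, Prod.smul_fst, Prod.smul_snd, smul_eq_mul,
      NNReal.coe_add, NNReal.coe_mul]
    have e : (b : ℝ) = 1 - a := by linarith
    rw [e] at h2 ⊢
    nlinarith
  have hcont : Continuous G := by
    have := hS.α_continuous
    simp only [hG]; fun_prop
  obtain ⟨c, ⟨i₀, hi₀⟩, hc⟩ := exists_iSup_affineQuadrant hconv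
    (ENNReal.continuous_ofReal.comp hcont).lowerSemicontinuous
  refine ⟨fun i => ((C : ℝ) - (c i).1, (C : ℝ) - (c i).2.1, (C : ℝ) - (c i).2.2), fun i p => ?_,
    fun p ε hε => ?_⟩
  · have h1 : ENNReal.ofReal (affineQuadrant (c i) p) ≤ ENNReal.ofReal (G p) := by
      rw [hc p]; exact le_iSup (fun i => ENNReal.ofReal (affineQuadrant (c i) p)) i
    rw [ENNReal.ofReal_le_ofReal_iff (hG0 p)] at h1
    simp only [affineQuadrant, hG] at h1 ⊢
    linarith
  · have key : ∃ i, G p - ε < affineQuadrant (c i) p := by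
      by_cases h : G p - ε < 0
      · exact ⟨i₀, by rw [hi₀]; simpa [affineQuadrant] using h⟩
      push Not at h
      have h2 : ENNReal.ofReal (G p - ε) < ⨆ i, ENNReal.ofReal (affineQuadrant (c i) p) := by
        rw [← hc p, ENNReal.ofReal_lt_ofReal_iff (by linarith)]; linarith
      obtain ⟨i, hi⟩ := lt_iSup_iff.1 h2
      exact ⟨i, (ENNReal.ofReal_lt_ofReal_iff_of_nonneg h).1 hi⟩
    obtain ⟨i, hi⟩ := key
    refine ⟨i, ?_⟩
    simp only [affineQuadrant, hG] at hi ⊢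
    linarith

/-! ### The dual dissipation density -/

lemma ψStar_mono (hS : S.Assumptions) {ξ η : ℝ} (h : |ξ| ≤ |η|) : S.ψStar ξ ≤ S.ψStar η := by
  have habs : ∀ x, S.ψStar |x| = S.ψStar x := fun x => by
    rcases abs_choice x with h | h <;> rw [h]
    exact hS.ψStar_even x
  rw [← habs ξ, ← habs η]
  rcases (abs_nonneg η).eq_or_lt with h0 | h0
  · rw [← h0] at h ⊢
    rw [le_antisymm h (abs_nonneg ξ)]
  set t := |ξ| / |η| with ht
  have ht0 : 0 ≤ t := by positivity
  have ht1 : t ≤ 1 := div_le_one_of_le₀ h (abs_nonneg _)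
  have := hS.ψStar_convex.2 (mem_univ |η|) (mem_univ 0) ht0 (sub_nonneg.2 ht1) (by ring)
  have e : t • |η| + (1 - t) • (0 : ℝ) = |ξ| := by
    simp [ht, div_mul_cancel₀ _ h0.ne']
  rw [e, hS.ψStar_zero] at this
  simp only [smul_eq_mul, mul_zero, add_zero] at this
  nlinarith [hS.ψStar_nonneg |η|]

/-- A zero away from the origin would, by monotonicity in `|ξ|`, make `ψStar` vanish near `0` and
contradict the positive quadratic coefficient `c₀`. -/
lemma ψStar_pos (hS : S.Assumptions) {ξ : ℝ} (h : ξ ≠ 0) : 0 < S.ψStar ξ := by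
  refine lt_of_le_of_ne (hS.ψStar_nonneg ξ) fun h0 => ?_
  obtain ⟨c₀, hc₀, hlim⟩ := hS.ψStar_quadratic
  have : (fun x : ℝ => S.ψStar x / |x| ^ 2) =ᶠ[𝓝[≠] 0] fun _ => 0 := by
    have h1 : ∀ᶠ x : ℝ in 𝓝[≠] 0, |x| < |ξ| :=
      nhdsWithin_le_nhds (continuous_abs.tendsto' 0 0 abs_zero |>.eventually_lt_const (abs_pos.2 h))
    filter_upwards [h1] with x hx
    have := hS.ψStar_mono hx.le
    rw [← h0] at this
    rw [le_antisymm this (hS.ψStar_nonneg x), zero_div]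
  exact hc₀.ne' (tendsto_nhds_unique hlim (tendsto_const_nhds.congr' this.symm))

lemma ψStar_continuous (hS : S.Assumptions) : Continuous S.ψStar := hS.ψStar_differentiable.continuous

/-- Two-sided quadratic bounds on bounded intervals. -/
lemma exists_ψStar_bounds (hS : S.Assumptions) (K : ℝ) : ∃ c C : ℝ, 0 < c ∧ 0 ≤ C ∧
    ∀ ξ, |ξ| ≤ K → c * ξ ^ 2 ≤ S.ψStar ξ ∧ S.ψStar ξ ≤ C * ξ ^ 2 := by
  classical
  obtain ⟨c₀, hc₀, hlim⟩ := hS.ψStar_quadratic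
  -- With the value `c₀` at the origin the quotient is continuous and positive, hence pinched
  -- between positive constants on compact intervals.
  set q : ℝ → ℝ := Function.update (fun ξ => S.ψStar ξ / |ξ| ^ 2) 0 c₀ with hq
  have hqc : Continuous q := by
    rw [continuous_iff_continuousAt]
    intro x
    by_cases hx : x = 0
    · subst hx
      exact continuousAt_update_same.2 hlim
    · rw [hq, continuousAt_update_of_ne hx]
      exact (hS.ψStar_continuous.continuousAt).div (by fun_prop) (by positivity)
  have hqpos : ∀ x, 0 < q x := by
    intro x
    by_cases hx : x = 0
    · simp [hq, hx, hc₀]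
    · rw [hq, Function.update_of_ne hx]
      have := hS.ψStar_pos hx
      positivity
  have hqe : ∀ x, S.ψStar x = q x * x ^ 2 := by
    intro x
    by_cases hx : x = 0
    · simp [hx, hS.ψStar_zero]
    · rw [hq, Function.update_of_ne hx, sq_abs, div_mul_cancel₀ _ (by positivity)]
  by_cases hK : 0 ≤ K
  · have hne : (Icc (-K) K).Nonempty := ⟨0, by simp [hK]⟩
    obtain ⟨x, -, hx⟩ := isCompact_Icc.exists_isMinOn hne hqc.continuousOn
    obtain ⟨y, -, hy⟩ := isCompact_Icc.exists_isMaxOn hne hqc.continuousOn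
    refine ⟨q x, q y, hqpos x, (hqpos y).le, fun ξ hξ => ?_⟩
    rw [hqe ξ]
    have hm : ξ ∈ Icc (-K) K := abs_le.1 hξ
    have h1 : q x ≤ q ξ := hx hm
    have h2 : q ξ ≤ q y := hy hm
    constructor <;> gcongr
  · exact ⟨1, 1, one_pos, zero_le_one, fun ξ hξ => absurd ((abs_nonneg ξ).trans hξ) hK⟩

/-! ### The entropy density -/

lemma φ_nonneg (hS : S.Assumptions) {r : ℝ} (hr : 0 ≤ r) : 0 ≤ S.φ r :=
  hS.φ_min.2 ⟨r, hr, rfl⟩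

lemma φ_differentiableAt (hS : S.Assumptions) {r : ℝ} (hr : 0 < r) : DifferentiableAt ℝ S.φ r :=
  (hS.φ_contDiffOn.differentiableOn one_ne_zero).differentiableAt (Ioi_mem_nhds hr)

lemma φ_tangent (hS : S.Assumptions) {r q : ℝ} (hr : 0 < r) (hq : 0 ≤ q) :
    S.φ r + deriv S.φ r * (q - r) ≤ S.φ q := by
  rcases lt_trichotomy r q with h | h | h
  · have := hS.φ_convex.deriv_le_slope hr.le hq h (hS.φ_differentiableAt hr)
    rw [slope_def_field, le_div_iff₀ (by linarith)] at this
    linarith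
  · simp [h]
  · have := hS.φ_convex.slope_le_deriv hq hr.le h (hS.φ_differentiableAt hr)
    rw [slope_def_field, div_le_iff₀ (by linarith)] at this
    linarith

lemma deriv_φ_mono (hS : S.Assumptions) {r q : ℝ} (hr : 0 < r) (hrq : r ≤ q) :
    deriv S.φ r ≤ deriv S.φ q := by
  rcases hrq.eq_or_lt with h | h
  · rw [h]
  have h1 := hS.φ_tangent hr (hr.trans h).le
  have h2 := hS.φ_tangent (hr.trans h) hr.le
  have h3 : 0 < q - r := by linarith
  nlinarith

lemma continuousOn_deriv_φ (hS : S.Assumptions) : ContinuousOn (deriv S.φ) (Ioi 0) :=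
  hS.φ_contDiffOn.continuousOn_deriv_of_isOpen isOpen_Ioi le_rfl

/-- The derivative of the entropy density, frozen below `ε`. -/
def truncDeriv (_ : S.Assumptions) (ε r : ℝ) : ℝ := deriv S.φ (max ε r)

/-- The entropy density, replaced by its tangent line below `ε`. -/
def truncEntropy (_ : S.Assumptions) (ε r : ℝ) : ℝ :=
  S.φ (max ε r) + deriv S.φ ε * (min ε r - ε)

lemma continuous_truncDeriv (hS : S.Assumptions) {ε : ℝ} (hε : 0 < ε) :
    Continuous (hS.truncDeriv ε) :=
  hS.continuousOn_deriv_φ.comp_continuous (by fun_prop) fun _ => lt_max_of_lt_left hε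

lemma continuous_truncEntropy (hS : S.Assumptions) {ε : ℝ} (hε : 0 < ε) :
    Continuous (hS.truncEntropy ε) := by
  refine Continuous.add ?_ (by fun_prop)
  exact hS.φ_continuousOn.comp_continuous (by fun_prop) fun _ => (lt_max_of_lt_left hε).le

lemma truncEntropy_le (hS : S.Assumptions) {ε q : ℝ} (hε : 0 < ε) (hq : 0 ≤ q) :
    hS.truncEntropy ε q ≤ S.φ q := by
  unfold truncEntropy
  rcases le_total ε q with h | h
  · simp [h]
  · rw [max_eq_left h, min_eq_right h]; exact hS.φ_tangent hε hq

lemma truncEntropy_tangent (hS : S.Assumptions) {ε r q : ℝ} (hε : 0 < ε) :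
    hS.truncDeriv ε r * (q - r) ≤ hS.truncEntropy ε q - hS.truncEntropy ε r := by
  unfold truncEntropy truncDeriv
  rcases le_total ε q with h | h <;> rcases le_total ε r with h' | h' <;>
    simp only [max_eq_right, max_eq_left, min_eq_left, min_eq_right, h, h']
  · have := hS.φ_tangent (hε.trans_le h') (hε.le.trans h); linarith
  · have := hS.φ_tangent hε (hε.le.trans h); linarith
  · have h1 := hS.φ_tangent (hε.trans_le h') hε.le
    have h2 := hS.deriv_φ_mono hε h'
    nlinarith
  · linarith

/-- For `q > 0` the sequence is eventually constant. At `q = 0` its value is `φ(ε) - ε φ'(ε)`, and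
the tangent at `ε` evaluated at `2ε` bounds `ε φ'(ε)` by `φ(2ε) - φ(ε) → 0`; thus `φ'(0) = -∞` does
no harm. -/
lemma tendsto_truncEntropy (hS : S.Assumptions) {q : ℝ} (hq : 0 ≤ q) :
    Tendsto (fun n : ℕ => hS.truncEntropy (1 / ((n : ℝ) + 1)) q) atTop (𝓝 (S.φ q)) := by
  have hlim := tendsto_one_div_add_atTop_nhds_zero_nat (𝕜 := ℝ)
  rcases hq.eq_or_lt with h | h
  · subst h
    have hc : ContinuousWithinAt S.φ (Ici 0) 0 := hS.φ_continuousOn 0 self_mem_Ici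
    have h1 : Tendsto (fun n : ℕ => S.φ (1 / ((n : ℝ) + 1))) atTop (𝓝 (S.φ 0)) :=
      hc.tendsto.comp (tendsto_nhdsWithin_iff.2 ⟨hlim, Eventually.of_forall fun n => by
        rw [mem_Ici]; positivity⟩)
    have h2 : Tendsto (fun n : ℕ => S.φ (2 * (1 / ((n : ℝ) + 1)))) atTop (𝓝 (S.φ 0)) :=
      hc.tendsto.comp (tendsto_nhdsWithin_iff.2 ⟨by simpa using hlim.const_mul 2,
        Eventually.of_forall fun n => by rw [mem_Ici]; positivity⟩)
    have h3 : Tendsto (fun n : ℕ => S.φ (1 / ((n : ℝ) + 1))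
        - (S.φ (2 * (1 / ((n : ℝ) + 1))) - S.φ (1 / ((n : ℝ) + 1)))) atTop (𝓝 (S.φ 0)) := by
      have := h1.sub (h2.sub h1)
      simpa using this
    refine tendsto_of_tendsto_of_tendsto_of_le_of_le h3 tendsto_const_nhds (fun n => ?_)
      (fun n => hS.truncEntropy_le (by positivity) le_rfl)
    have hε : 0 < 1 / ((n : ℝ) + 1) := by positivity
    have := hS.φ_tangent hε (q := 2 * (1 / ((n : ℝ) + 1))) (by positivity)
    simp only [truncEntropy, max_eq_left hε.le, min_eq_right hε.le]
    linarith
  · refine tendsto_const_nhds.congr' ?_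
    filter_upwards [hlim.eventually_lt_const h] with n hn
    rw [truncEntropy, max_eq_right hn.le, min_eq_left hn.le, sub_self, mul_zero, add_zero]

lemma exists_le_add_φ (hS : S.Assumptions) {l : ℝ} (hl : 0 < l) :
    ∃ K : ℝ≥0, ∀ r, 0 ≤ r → r ≤ K + l * S.φ r := by
  obtain ⟨K, hK⟩ := eventually_atTop.1 ((tendsto_atTop.1 hS.φ_superlinear) l⁻¹)
  refine ⟨(max K 1).toNNReal, fun r hr => ?_⟩
  have hK0 : 0 ≤ max K 1 := le_max_of_le_right zero_le_one
  rw [Real.coe_toNNReal _ hK0]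
  have hφ := hS.φ_nonneg hr
  rcases le_total r (max K 1) with h | h
  · have : 0 ≤ l * S.φ r := by positivity
    linarith
  · have hr0 : 0 < r := lt_of_lt_of_le (lt_max_of_lt_right one_pos) h
    have := hK r ((le_max_left _ _).trans h)
    rw [le_div_iff₀ hr0, inv_mul_le_iff₀ hl] at this
    linarith

/-! ### The Fisher information density -/

lemma fisherDensity_diag (hS : S.Assumptions) (v : ℝ≥0) : S.fisherDensity (v, v) = 0 := by
  refine le_antisymm ((S.fisherDensity_le _).trans ?_) zero_le
  have h0 : S.ψStarExt 0 = 0 := by simp [ψStarExt, hS.ψStar_zero]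
  by_cases hv : v = 0
  · subst hv
    have h2 : S.Λ (0, 0) = 0 := by simp [Λ]
    rw [fisherDensityPlus, h2, h0]
    split_ifs <;> simp_all
  · have hp : ((v, v) : ℝ≥0 × ℝ≥0) ≠ 0 := by simp [hv]
    have h1 : S.Λ (v, v) = 0 := by
      rw [Λ, if_neg hp]
      simp only [φDeriv, if_neg hv]
      rw [← EReal.coe_sub, sub_self, EReal.coe_zero]
    rw [fisherDensityPlus, h1, h0, if_pos (hS.α_pos (pos_iff_ne_zero.2 hv) (pos_iff_ne_zero.2 hv))]
    simp

lemma fisherDensityPlus_of_pos (hS : S.Assumptions) {u v : ℝ≥0} (hu : 0 < u) (hv : 0 < v) :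
    S.fisherDensityPlus (u, v)
      = ENNReal.ofReal (S.ψStar (deriv S.φ v - deriv S.φ u)) * S.α (u, v) := by
  have hp : ((u, v) : ℝ≥0 × ℝ≥0) ≠ 0 := by simp [hu.ne']
  rw [fisherDensityPlus, if_pos (hS.α_pos hu hv), Λ, if_neg hp]
  simp only [φDeriv, if_neg hu.ne', if_neg hv.ne']
  rw [← EReal.coe_sub, ψStarExt, if_neg (by simp only [EReal.coe_ne_top, EReal.coe_ne_bot, or_self, not_false_eq_true]),
    EReal.toReal_coe]

/-- On the open quadrant `D⁺` is continuous, so `D⁺` extended by `0` is a lower semicontinuous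
minorant of `D⁺`; the envelope therefore loses nothing there. -/
lemma le_fisherDensity_of_pos (hS : S.Assumptions) {u v : ℝ≥0} (hu : 0 < u) (hv : 0 < v) :
    ENNReal.ofReal (S.ψStar (deriv S.φ v - deriv S.φ u)) * S.α (u, v) ≤ S.fisherDensity (u, v) := by
  set U : Set (ℝ≥0 × ℝ≥0) := {p | (0 : ℝ≥0) < p.1 ∧ (0 : ℝ≥0) < p.2} with hU
  have hU1 : IsOpen {p : ℝ≥0 × ℝ≥0 | (0 : ℝ≥0) < p.1} := isOpen_lt continuous_const continuous_fst
  have hU2 : IsOpen {p : ℝ≥0 × ℝ≥0 | (0 : ℝ≥0) < p.2} := isOpen_lt continuous_const continuous_snd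
  have hUo : IsOpen U := hU1.inter hU2
  have hUm : (u, v) ∈ U := ⟨hu, hv⟩
  set g : ℝ≥0 × ℝ≥0 → ℝ≥0∞ := U.indicator S.fisherDensityPlus with hg
  have hgl : LowerSemicontinuous g := by
    intro p
    by_cases hp : p ∈ U
    · refine ContinuousAt.lowerSemicontinuousAt ?_
      have hev : g =ᶠ[𝓝 p] fun q => ENNReal.ofReal (S.ψStar (deriv S.φ q.2 - deriv S.φ q.1))
          * S.α q := by
        filter_upwards [hUo.mem_nhds hp] with q hq
        rw [hg, indicator_of_mem hq]
        exact hS.fisherDensityPlus_of_pos hq.1 hq.2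
      refine ContinuousAt.congr ?_ hev.symm
      have hd : ∀ x : ℝ≥0, 0 < x → ContinuousAt (deriv S.φ) x := fun x hx =>
        hS.continuousOn_deriv_φ.continuousAt (Ioi_mem_nhds (by exact_mod_cast hx))
      have h1 : ContinuousAt (fun q : ℝ≥0 × ℝ≥0 => deriv S.φ q.1) p :=
        ContinuousAt.comp (f := fun q : ℝ≥0 × ℝ≥0 => (q.1 : ℝ)) (hd _ hp.1) (by fun_prop)
      have h2 : ContinuousAt (fun q : ℝ≥0 × ℝ≥0 => deriv S.φ q.2) p :=
        ContinuousAt.comp (f := fun q : ℝ≥0 × ℝ≥0 => (q.2 : ℝ)) (hd _ hp.2) (by fun_prop)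
      refine ENNReal.Tendsto.mul ?_ (Or.inr ENNReal.coe_ne_top) ?_ (Or.inr ENNReal.ofReal_ne_top)
      · exact (ENNReal.continuous_ofReal.comp hS.ψStar_continuous).continuousAt.comp (h2.sub h1)
      · exact (ENNReal.continuous_coe.comp hS.α_continuous).continuousAt
    · intro y hy
      rw [hg, indicator_of_notMem hp] at hy
      exact absurd hy (not_lt.2 zero_le)
  have hgle : ∀ q, g q ≤ S.fisherDensityPlus q := fun q => indicator_le_self _ _ q
  calc _ = g (u, v) := by
        rw [hg, indicator_of_mem hUm, hS.fisherDensityPlus_of_pos hu hv]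
    _ ≤ _ := le_iSup₂ (f := fun (g : ℝ≥0 × ℝ≥0 → ℝ≥0∞)
        (_ : LowerSemicontinuous g ∧ ∀ q, g q ≤ S.fisherDensityPlus q) => g (u, v)) g ⟨hgl, hgle⟩

/-- The convex function `D`, which vanishes on the diagonal, decreases under `max ε`. -/
lemma fisherDensity_max_le (hS : S.Assumptions) (hconv : ConvexOn ℝ≥0 univ S.fisherDensity)
    (ε u v : ℝ≥0) : S.fisherDensity (max ε u, max ε v) ≤ S.fisherDensity (u, v) := by
  -- Moving from `p` towards a diagonal point, where `D` vanishes, convexity can only decrease `D`.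
  have hseg : ∀ p : ℝ≥0 × ℝ≥0, ∀ w x y : ℝ≥0, ∀ a b : ℝ≥0, a + b = 1 →
      (x, y) = a • p + b • (w, w) → S.fisherDensity (x, y) ≤ S.fisherDensity p := by
    intro p w x y a b hab he
    rw [he]
    refine (hconv.2 (mem_univ p) (mem_univ (w, w)) zero_le zero_le hab).trans ?_
    rw [hS.fisherDensity_diag, smul_zero, add_zero, ENNReal.smul_def, smul_eq_mul]
    refine mul_le_of_le_one_left zero_le ?_
    exact_mod_cast hab ▸ le_add_of_nonneg_right (zero_le (a := b))
  -- If `u ≤ ε ≤ v`, the truncated pair `(ε, v)` lies on the segment from `(u, v)` to `(v, v)`.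
  have hpt : ∀ u v : ℝ≥0, u ≤ ε → ε ≤ v → ∃ a b : ℝ≥0, a + b = 1 ∧ ε = a * u + b * v ∧
      v = a * v + b * v := by
    intro u v hu hv
    rcases (hu.trans hv).eq_or_lt with h | h
    · exact ⟨1, 0, by simp, by simp [le_antisymm hu (h ▸ hv)], by simp⟩
    · have hvu : 0 < v - u := tsub_pos_of_lt h
      have hab : (v - ε) / (v - u) + (ε - u) / (v - u) = 1 := by
        rw [← add_div, tsub_add_tsub_cancel hv hu, div_self hvu.ne']
      refine ⟨(v - ε) / (v - u), (ε - u) / (v - u), hab, ?_, by rw [← add_mul, hab, one_mul]⟩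
      have h1 : ((v - u : ℝ≥0) : ℝ) = v - u := NNReal.coe_sub h.le
      have h2 : ((v - ε : ℝ≥0) : ℝ) = v - ε := NNReal.coe_sub hv
      have h3 : ((ε - u : ℝ≥0) : ℝ) = ε - u := NNReal.coe_sub hu
      have h4 : (v : ℝ) - u ≠ 0 := by rw [← h1]; exact_mod_cast hvu.ne'
      apply NNReal.eq
      push_cast
      rw [h1, h2, h3]
      field_simp
      ring
  rcases le_total ε u with hu | hu <;> rcases le_total ε v with hv | hv <;>
    simp only [max_eq_right, max_eq_left, hu, hv, le_refl]
  · obtain ⟨a, b, hab, h1, h2⟩ := hpt v u hv hu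
    exact hseg (u, v) u _ _ a b hab (by ext1; exacts [h2, h1])
  · obtain ⟨a, b, hab, h1, h2⟩ := hpt u v hu hv
    exact hseg (u, v) v _ _ a b hab (by ext1; exacts [h1, h2])
  · rw [hS.fisherDensity_diag]; exact zero_le

/-- Truncation moves both arguments into the open quadrant, where `D` dominates an explicit formula
even if `φ'(0) = -∞`, and it does not increase `D`. Two consequences follow: the sharp comparison
with the true mobility `α(u, v)` for the chain rule, and a comparison with the constant mobility
`α(ε, ε)` giving unweighted integrability of the truncated potential. -/
lemma le_fisherDensity_max (hS : S.Assumptions) (hconv : ConvexOn ℝ≥0 univ S.fisherDensity)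
    {ε : ℝ≥0} (hε : 0 < ε) (u v : ℝ≥0) :
    ENNReal.ofReal (S.ψStar (hS.truncDeriv ε v - hS.truncDeriv ε u)) * S.α (max ε u, max ε v)
      ≤ S.fisherDensity (u, v) := by
  refine le_trans ?_ (hS.fisherDensity_max_le hconv ε u v)
  have := hS.le_fisherDensity_of_pos (u := max ε u) (v := max ε v) (lt_max_of_lt_left hε)
    (lt_max_of_lt_left hε)
  simpa [truncDeriv, NNReal.coe_max] using this

lemma truncDeriv_mul_α_le (hS : S.Assumptions) (hconv : ConvexOn ℝ≥0 univ S.fisherDensity)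
    {ε : ℝ≥0} (hε : 0 < ε) (u v : ℝ≥0) :
    ENNReal.ofReal (S.ψStar (hS.truncDeriv ε v - hS.truncDeriv ε u)) * S.α (u, v)
      ≤ S.fisherDensity (u, v) := by
  refine le_trans ?_ (hS.le_fisherDensity_max hconv hε u v)
  gcongr
  exact hS.α_mono ⟨le_max_right _ _, le_max_right _ _⟩

lemma truncDeriv_mul_α_diag_le (hS : S.Assumptions) (hconv : ConvexOn ℝ≥0 univ S.fisherDensity)
    {ε : ℝ≥0} (hε : 0 < ε) (u v : ℝ≥0) :
    ENNReal.ofReal (S.ψStar (hS.truncDeriv ε v - hS.truncDeriv ε u)) * S.α (ε, ε)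
      ≤ S.fisherDensity (u, v) := by
  refine le_trans ?_ (hS.le_fisherDensity_max hconv hε u v)
  gcongr
  exact hS.α_mono ⟨le_max_left _ _, le_max_left _ _⟩

end Assumptions

end JumpSystem

/-! ### The truncated distance -/

section TruncDist

variable {V : Type*} [MetricSpace V]

/-- The truncated distance `1 ∧ d`, as a function of edges. -/
def truncDist (e : V × V) : ℝ := min 1 (dist e.1 e.2)

lemma truncDist_nonneg (e : V × V) : 0 ≤ truncDist e := le_min zero_le_one dist_nonneg

lemma truncDist_le_one (e : V × V) : truncDist e ≤ 1 := min_le_left _ _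

lemma truncDist_pos {e : V × V} (h : e.1 ≠ e.2) : 0 < truncDist e :=
  lt_min one_pos (dist_pos.2 h)

lemma truncDist_sq (e : V × V) : truncDist e ^ 2 = min 1 (dist e.1 e.2 ^ 2) := by
  unfold truncDist
  have h0 : 0 ≤ dist e.1 e.2 := dist_nonneg
  rcases le_total 1 (dist e.1 e.2) with h | h
  · rw [min_eq_left h, min_eq_left (by nlinarith)]; norm_num
  · rw [min_eq_right h, min_eq_right (by nlinarith)]

lemma truncDist_swap (e : V × V) : truncDist e.swap = truncDist e := by
  simp [truncDist, dist_comm]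

/-- The Lipschitz bound serves short edges and the sup bound long ones; so bounded Lipschitz
functions can be paired with any flux of finite `1 ∧ d` moment. -/
lemma abs_graphGradient_le {f : V → ℝ} {K : ℝ≥0} {C : ℝ} (hK : LipschitzWith K f)
    (hC : ∀ x, |f x| ≤ C) (e : V × V) : |graphGradient f e| ≤ max (K : ℝ) (2 * C) * truncDist e := by
  have hC0 : 0 ≤ C := (abs_nonneg _).trans (hC e.1)
  unfold graphGradient truncDist
  have h1 : |f e.2 - f e.1| ≤ K * dist e.1 e.2 := by
    rw [← Real.dist_eq, dist_comm e.1]; exact hK.dist_le_mul _ _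
  have h2 : |f e.2 - f e.1| ≤ 2 * C := by
    have := abs_sub (f e.2) (f e.1)
    linarith [hC e.1, hC e.2]
  rcases le_total 1 (dist e.1 e.2) with h | h
  · rw [min_eq_left h, mul_one]; exact h2.trans (le_max_right _ _)
  · rw [min_eq_right h]; exact h1.trans (by gcongr; exact le_max_left _ _)

variable [SecondCountableTopology V] [MeasurableSpace V] [BorelSpace V]

lemma measurable_truncDist : Measurable (truncDist (V := V)) :=
  measurable_const.min measurable_dist

lemma measurable_graphGradient {f : V → ℝ} (hf : Measurable f) : Measurable (graphGradient f) :=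
  (hf.comp measurable_snd).sub (hf.comp measurable_fst)

/-- The edges of truncated length at least `1/(k+1)`, together with the diagonal. -/
def longEdges (V : Type*) [MetricSpace V] (k : ℕ) : Set (V × V) :=
  {e | 1 / ((k : ℝ) + 1) ≤ truncDist e} ∪ {e | e.1 = e.2}

lemma measurableSet_diag : MeasurableSet {e : V × V | e.1 = e.2} :=
  measurableSet_eq_fun measurable_fst measurable_snd

lemma measurableSet_longEdges (k : ℕ) : MeasurableSet (longEdges V k) :=
  (measurableSet_le measurable_const measurable_truncDist).union measurableSet_diag

omit [SecondCountableTopology V] [MeasurableSpace V] [BorelSpace V] in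
lemma monotone_longEdges : Monotone (longEdges V) := by
  intro k l hkl e he
  rcases he with he | he
  · refine Or.inl (le_trans (b := 1 / ((k : ℝ) + 1)) ?_ he)
    apply one_div_le_one_div_of_le (by positivity)
    gcongr
  · exact Or.inr he

omit [SecondCountableTopology V] [MeasurableSpace V] [BorelSpace V] in
lemma exists_mem_longEdges (e : V × V) : ∃ k, e ∈ longEdges V k := by
  by_cases h : e.1 = e.2
  · exact ⟨0, Or.inr h⟩
  · obtain ⟨k, hk⟩ := exists_nat_one_div_lt (truncDist_pos h)
    exact ⟨k, Or.inl hk.le⟩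

end TruncDist

/-! ### The jump kernel and its coupling -/

lemma edgeMeasure_eq_compProd {V : Type*} [MeasurableSpace V] (ρ : Measure V) [SFinite ρ]
    (K : Kernel V V) [IsSFiniteKernel K] : edgeMeasure ρ K = ρ.compProd K := by
  have hm : Measurable fun x => (K x).map (Prod.mk x) := by
    refine Measure.measurable_of_measurable_coe _ fun s hs => ?_
    have : ∀ x, ((K x).map (Prod.mk x)) s = K x (Prod.mk x ⁻¹' s) := fun x =>
      Measure.map_apply measurable_prodMk_left hs
    simp_rw [this]
    exact Kernel.measurable_kernel_prodMk_left hs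
  ext s hs
  rw [edgeMeasure, Measure.bind_apply hs hm.aemeasurable, Measure.compProd_apply hs]
  exact lintegral_congr fun x => Measure.map_apply measurable_prodMk_left hs

namespace JumpSystem

variable {V : Type*} [MetricSpace V] [SecondCountableTopology V] [MeasurableSpace V]
  [BorelSpace V] {S : JumpSystem V}

namespace Assumptions

/-- The finite kernel `(1 ∧ d²(x, y)) κ(x, dy)`. -/
def finiteKernel (hS : S.Assumptions) : Kernel V V where
  toFun x := (S.κ x).withDensity fun y => ENNReal.ofReal (truncDist (x, y) ^ 2)
  measurable' := by
    refine Measure.measurable_of_measurable_coe _ fun B hB => ?_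
    obtain ⟨c, hc⟩ := hS.κ_bound
    have hmeas : ∀ x : V, Measurable fun y : V => truncDist (x, y) := fun x =>
      measurable_truncDist.comp measurable_prodMk_left
    have e : ∀ x, (S.κ x).withDensity (fun y => ENNReal.ofReal (truncDist (x, y) ^ 2)) B
        = ENNReal.ofReal (∫ y, B.indicator (fun _ => (1 : ℝ)) y * min 1 (dist x y ^ 2) ∂S.κ x) := by
      intro x
      have h1 : ∀ y, B.indicator (fun _ => (1 : ℝ)) y * min 1 (dist x y ^ 2)
          = B.indicator (fun y => truncDist (x, y) ^ 2) y := fun y => by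
        by_cases hy : y ∈ B <;> simp [hy, truncDist_sq]
      simp_rw [h1]
      have hint : Integrable (B.indicator (fun y => truncDist (x, y) ^ 2)) (S.κ x) := by
        refine Integrable.indicator ⟨((hmeas x).pow_const 2).aestronglyMeasurable, ?_⟩ hB
        refine lt_of_le_of_lt ?_ ((hc x).trans_lt ENNReal.coe_lt_top)
        refine lintegral_mono fun y => ?_
        rw [Real.enorm_eq_ofReal (by positivity)]
        exact (congrArg ENNReal.ofReal (truncDist_sq (x, y))).le
      rw [ofReal_integral_eq_lintegral_ofReal hint (ae_of_all _ fun y =>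
        indicator_nonneg (fun _ _ => by positivity) _), withDensity_apply _ hB,
        ← lintegral_indicator hB]
      refine lintegral_congr fun y => ?_
      by_cases hy : y ∈ B <;> simp [hy]
    simp_rw [e]
    refine (hS.κ_measurable _ (measurable_const.indicator hB) ⟨1, fun y => ?_⟩).ennreal_ofReal
    by_cases hy : y ∈ B <;> simp [hy]

lemma finiteKernel_apply (hS : S.Assumptions) (x : V) : hS.finiteKernel x
    = (S.κ x).withDensity fun y => ENNReal.ofReal (truncDist (x, y) ^ 2) := rfl

lemma exists_finiteKernel_le (hS : S.Assumptions) :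
    ∃ c : ℝ≥0, ∀ x, hS.finiteKernel x univ ≤ c := by
  obtain ⟨c, hc⟩ := hS.κ_bound
  refine ⟨c, fun x => ?_⟩
  rw [finiteKernel_apply, withDensity_apply _ MeasurableSet.univ, Measure.restrict_univ]
  simp_rw [truncDist_sq]
  exact hc x

instance isFiniteKernel_finiteKernel (hS : S.Assumptions) : IsFiniteKernel hS.finiteKernel := by
  obtain ⟨c, hc⟩ := hS.exists_finiteKernel_le
  exact ⟨c, ENNReal.coe_lt_top, hc⟩

/-- The measurability assumption concerns only the weighted kernel. Dividing the weight out again,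
which is legitimate because `κ x` does not charge `x`, exhibits `κ` as an s-finite kernel and makes
Fubini available. -/
lemma withDensity_finiteKernel (hS : S.Assumptions) (x : V) :
    (hS.finiteKernel x).withDensity (fun y => ENNReal.ofReal ((truncDist (x, y) ^ 2)⁻¹)) = S.κ x := by
  have hmeas : Measurable fun y : V => truncDist (x, y) :=
    measurable_truncDist.comp measurable_prodMk_left
  rw [finiteKernel_apply, ← withDensity_mul _ (by fun_prop) (by fun_prop)]
  conv_rhs => rw [← withDensity_one (μ := S.κ x)]
  refine withDensity_congr_ae ?_
  have : ∀ᵐ y ∂S.κ x, x ≠ y := by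
    rw [ae_iff]; simpa using hS.κ_diag x
  filter_upwards [this] with y hy
  have hp : 0 < truncDist (x, y) := truncDist_pos hy
  rw [Pi.mul_apply, ← ENNReal.ofReal_mul (by positivity), mul_inv_cancel₀ (by positivity)]
  simp

/-- The jump kernel `κ`, as a kernel. -/
def kernel (hS : S.Assumptions) : Kernel V V :=
  hS.finiteKernel.withDensity fun x y => ENNReal.ofReal ((truncDist (x, y) ^ 2)⁻¹)

lemma measurable_ofReal_inv_truncDist :
    Measurable (Function.uncurry fun x y : V => ENNReal.ofReal ((truncDist (x, y) ^ 2)⁻¹)) :=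
  ((measurable_truncDist.pow_const 2).inv).ennreal_ofReal

lemma kernel_apply (hS : S.Assumptions) (x : V) : hS.kernel x = S.κ x := by
  rw [kernel, Kernel.withDensity_apply _ measurable_ofReal_inv_truncDist]
  exact hS.withDensity_finiteKernel x

instance isSFiniteKernel_kernel (hS : S.Assumptions) : IsSFiniteKernel hS.kernel :=
  Kernel.IsSFiniteKernel.withDensity _ fun _ _ => ENNReal.ofReal_ne_top

lemma coe_kernel (hS : S.Assumptions) : ⇑hS.kernel = S.κ := funext hS.kernel_apply

lemma θ_eq (hS : S.Assumptions) : S.θ = S.π.compProd hS.kernel := by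
  have := hS.finite_π
  rw [θ, ← hS.coe_kernel, edgeMeasure_eq_compProd]

lemma lintegral_θ (hS : S.Assumptions) {F : V × V → ℝ≥0∞} (hF : Measurable F) :
    ∫⁻ e, F e ∂S.θ = ∫⁻ x, ∫⁻ y, F (x, y) ∂S.κ x ∂S.π := by
  have := hS.finite_π
  rw [hS.θ_eq, Measure.lintegral_compProd hF]
  simp_rw [hS.kernel_apply]

lemma lintegral_θ_swap (hS : S.Assumptions) {F : V × V → ℝ≥0∞} (hF : Measurable F) :
    ∫⁻ e, F e.swap ∂S.θ = ∫⁻ e, F e ∂S.θ := by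
  conv_rhs => rw [← hS.detailedBalance, lintegral_map hF measurable_swap]

lemma measurePreserving_swap (hS : S.Assumptions) : MeasurePreserving Prod.swap S.θ S.θ :=
  ⟨measurable_swap, hS.detailedBalance⟩

lemma θ_diag (hS : S.Assumptions) : S.θ {e | e.1 = e.2} = 0 := by
  rw [← lintegral_indicator_one measurableSet_diag,
    hS.lintegral_θ (measurable_one.indicator measurableSet_diag), lintegral_eq_zero_iff']
  · refine ae_of_all _ fun x => ?_
    rw [Pi.zero_apply, ← hS.κ_diag x, ← lintegral_indicator_one (measurableSet_singleton x)]
    refine lintegral_congr fun y => ?_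
    by_cases h : x = y
    · simp [h]
    · simp [h, Ne.symm h]
  · have h := (measurable_one (α := ℝ≥0∞) (β := V × V)).indicator (measurableSet_diag (V := V))
    simp_rw [← hS.kernel_apply]
    exact (Measurable.lintegral_kernel_prod_right' h).aemeasurable

lemma ae_ne (hS : S.Assumptions) : ∀ᵐ e ∂S.θ, 0 < truncDist e := by
  have : ∀ᵐ e ∂S.θ, e.1 ≠ e.2 := by
    rw [ae_iff]; simpa using hS.θ_diag
  exact this.mono fun e he => truncDist_pos he

/-- Although `κ x` may have infinite mass, a `π`-null set of starting points carries no `θ`-mass.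
With detailed balance for the end point, densities on `V` may be altered on `π`-null sets without
affecting edge integrals. -/
lemma ae_fst (hS : S.Assumptions) {p : V → Prop} (hp : ∀ᵐ x ∂S.π, p x) :
    ∀ᵐ e ∂S.θ, p e.1 := by
  have hac : S.θ.map Prod.fst ≪ S.π := by
    refine Measure.AbsolutelyContinuous.mk fun N hN h0 => ?_
    rw [Measure.map_apply measurable_fst hN, ← lintegral_indicator_one (measurable_fst hN),
      hS.lintegral_θ (measurable_one.indicator (measurable_fst hN))]
    have e : ∀ x, ∫⁻ y, (Prod.fst ⁻¹' N).indicator (1 : V × V → ℝ≥0∞) (x, y) ∂S.κ x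
        = N.indicator (fun x => S.κ x univ) x := by
      intro x
      by_cases hx : x ∈ N <;> simp [hx]
    simp_rw [e]
    rw [lintegral_indicator hN, Measure.restrict_eq_zero.2 h0, lintegral_zero_measure]
  exact ae_of_ae_map measurable_fst.aemeasurable (hac.ae_le hp)

lemma ae_snd (hS : S.Assumptions) {p : V → Prop} (hp : ∀ᵐ x ∂S.π, p x) :
    ∀ᵐ e ∂S.θ, p e.2 :=
  hS.measurePreserving_swap.quasiMeasurePreserving.ae (hS.ae_fst hp)

/-- The finite measure `(1 ∧ d²) θ`. -/
def finiteθ (_ : S.Assumptions) : Measure (V × V) :=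
  S.θ.withDensity fun e => ENNReal.ofReal (truncDist e ^ 2)

lemma measurable_ofReal_truncDist_sq :
    Measurable fun e : V × V => ENNReal.ofReal (truncDist e ^ 2) :=
  (measurable_truncDist.pow_const 2).ennreal_ofReal

lemma lintegral_finiteθ (hS : S.Assumptions) {F : V × V → ℝ≥0∞} (hF : Measurable F) :
    ∫⁻ e, F e ∂hS.finiteθ = ∫⁻ x, ∫⁻ y, F (x, y) ∂hS.finiteKernel x ∂S.π := by
  rw [finiteθ, lintegral_withDensity_eq_lintegral_mul _ measurable_ofReal_truncDist_sq hF,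
    hS.lintegral_θ (measurable_ofReal_truncDist_sq.mul hF)]
  refine lintegral_congr fun x => ?_
  have h1 : Measurable fun y => ENNReal.ofReal (truncDist (x, y) ^ 2) :=
    measurable_ofReal_truncDist_sq.comp measurable_prodMk_left
  have h2 : Measurable fun y => F (x, y) := hF.comp measurable_prodMk_left
  rw [finiteKernel_apply, lintegral_withDensity_eq_lintegral_mul _ h1 h2]
  rfl

instance isFiniteMeasure_finiteθ (hS : S.Assumptions) : IsFiniteMeasure hS.finiteθ := by
  have := hS.finite_π
  obtain ⟨c, hc⟩ := hS.exists_finiteKernel_le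
  refine ⟨?_⟩
  have h := hS.lintegral_finiteθ measurable_one
  simp only [Pi.one_apply, lintegral_one] at h
  rw [h]
  calc _ ≤ ∫⁻ _, (c : ℝ≥0∞) ∂S.π := lintegral_mono hc
    _ < ∞ := by rw [lintegral_const]; exact ENNReal.mul_lt_top ENNReal.coe_lt_top (measure_lt_top _ _)

lemma withDensity_finiteθ (hS : S.Assumptions) :
    hS.finiteθ.withDensity (fun e => ENNReal.ofReal ((truncDist e ^ 2)⁻¹)) = S.θ := by
  have h1 : Measurable fun e : V × V => ENNReal.ofReal ((truncDist e ^ 2)⁻¹) :=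
    (measurable_truncDist.pow_const 2).inv.ennreal_ofReal
  rw [finiteθ, ← withDensity_mul _ measurable_ofReal_truncDist_sq h1]
  conv_rhs => rw [← withDensity_one (μ := S.θ)]
  refine withDensity_congr_ae ?_
  filter_upwards [hS.ae_ne] with e he
  rw [Pi.mul_apply, ← ENNReal.ofReal_mul (by positivity), mul_inv_cancel₀ (by positivity)]
  simp

lemma sigmaFinite_θ (hS : S.Assumptions) : SigmaFinite S.θ := by
  rw [← hS.withDensity_finiteθ]
  exact SigmaFinite.withDensity_ofReal _

end Assumptions

/-! ### Reweighted systems -/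

/-- Admissible multipliers of the jump kernel. -/
structure Multiplier (a : V × V → ℝ) : Prop where
  measurable : Measurable a
  symm : ∀ e, a e.swap = a e

omit [MetricSpace V] [SecondCountableTopology V] [BorelSpace V] in
lemma IsApproximation.multiplier {a : ℕ → V × V → ℝ} (ha : S.IsApproximation a) (n : ℕ) :
    Multiplier (a n) :=
  ⟨ha.measurable n, fun e => ha.symm n e.2 e.1⟩

omit [MetricSpace V] [SecondCountableTopology V] [BorelSpace V] in
lemma multiplier_one : Multiplier (fun _ : V × V => (1 : ℝ)) :=
  ⟨measurable_const, fun _ => rfl⟩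

omit [MetricSpace V] [SecondCountableTopology V] [BorelSpace V] in
lemma reweight_one (S : JumpSystem V) : S.reweight (fun _ => 1) = S := by
  cases S
  simp [reweight]

namespace Assumptions

/-- Both the multiplier and the density become factors in front of the fixed measure `θ`, so all the
systems are compared on one reference space. -/
lemma edgeMeasure_reweight (hS : S.Assumptions) {a : V × V → ℝ} (ha : Multiplier a)
    {u : V → ℝ≥0} (hu : Measurable u) :
    edgeMeasure (S.π.withDensity fun x => u x) (S.reweight a).κ
      = S.θ.withDensity fun e => ENNReal.ofReal (a e) * u e.1 := by
  have := hS.finite_π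
  have ham : Measurable (Function.uncurry fun x y => ENNReal.ofReal (a (x, y))) :=
    ha.measurable.ennreal_ofReal
  have hum : Measurable fun x => (u x : ℝ≥0∞) := hu.coe_nnreal_ennreal
  set K := hS.kernel.withDensity fun x y => ENNReal.ofReal (a (x, y)) with hK
  have : IsSFiniteKernel K := Kernel.IsSFiniteKernel.withDensity _ fun _ _ => ENNReal.ofReal_ne_top
  have hKe : (S.reweight a).κ = K := by
    funext x
    rw [hK, Kernel.withDensity_apply _ ham, hS.kernel_apply]; rfl
  rw [hKe, edgeMeasure_eq_compProd]
  have hd : Measurable fun e : V × V => ENNReal.ofReal (a e) * u e.1 :=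
    ha.measurable.ennreal_ofReal.mul (hum.comp measurable_fst)
  refine Measure.ext_of_lintegral _ fun F hF => ?_
  rw [Measure.lintegral_compProd hF, lintegral_withDensity_eq_lintegral_mul _ hum
    (Measurable.lintegral_kernel_prod_right' hF), lintegral_withDensity_eq_lintegral_mul _ hd hF,
    hS.lintegral_θ (hd.mul hF)]
  refine lintegral_congr fun x => ?_
  have hF' : Measurable fun y => F (x, y) := hF.comp measurable_prodMk_left
  rw [hK, Pi.mul_apply, Kernel.lintegral_withDensity _ ham x hF',
    hS.kernel_apply, ← lintegral_const_mul']
  · refine lintegral_congr fun y => ?_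
    simp only [Pi.mul_apply]
    ring
  · exact ENNReal.coe_ne_top

lemma θ_reweight (hS : S.Assumptions) {a : V × V → ℝ} (ha : Multiplier a) :
    (S.reweight a).θ = S.θ.withDensity fun e => ENNReal.ofReal (a e) := by
  have := hS.edgeMeasure_reweight ha (u := fun _ => 1) measurable_const
  simpa [θ, reweight] using this

/-- The forward and backward edge measures have densities `u(x)` and `u(y)` with respect to the
reweighted coupling (symmetry of `a` enters for the backward one), so the singular part and the
recession function of `α` disappear. -/
lemma edgeFlux_reweight (hS : S.Assumptions) {a : V × V → ℝ} (ha : Multiplier a)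
    {u : V → ℝ≥0} (hu : Measurable u) {ρ : FiniteMeasure V}
    (hρ : (ρ : Measure V) = S.π.withDensity fun x => u x) :
    (S.reweight a).edgeFlux ρ
      = S.θ.withDensity fun e => ENNReal.ofReal (a e) * S.α (u e.1, u e.2) := by
  have hsf := hS.sigmaFinite_θ
  have ham := ha.measurable.ennreal_ofReal
  have hu1 : Measurable fun e : V × V => (u e.1 : ℝ≥0∞) :=
    hu.coe_nnreal_ennreal.comp measurable_fst
  have hu2 : Measurable fun e : V × V => (u e.2 : ℝ≥0∞) :=
    hu.coe_nnreal_ennreal.comp measurable_snd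
  obtain ⟨θa, hθa⟩ : ∃ θa, θa = (S.reweight a).θ := ⟨_, rfl⟩
  have hθ' := hθa.trans (hS.θ_reweight ha)
  have : SigmaFinite θa := by rw [hθ']; exact SigmaFinite.withDensity_ofReal _
  have h1 : edgeMeasure (ρ : Measure V) (S.reweight a).κ = θa.withDensity fun e => u e.1 := by
    rw [hρ, hS.edgeMeasure_reweight ha hu, hθ', ← withDensity_mul _ ham hu1]; rfl
  have h2 : (edgeMeasure (ρ : Measure V) (S.reweight a).κ).map Prod.swap
      = θa.withDensity fun e => u e.2 := by
    rw [hρ, hS.edgeMeasure_reweight ha hu, hθ', ← withDensity_mul _ ham hu2]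
    refine Measure.ext_of_lintegral _ fun F hF => ?_
    have hm1 : Measurable fun e : V × V => ENNReal.ofReal (a e) * (u e.1 : ℝ≥0∞) := ham.mul hu1
    have hF1 : Measurable fun e : V × V => F e.swap := hF.comp measurable_swap
    rw [lintegral_map hF measurable_swap, lintegral_withDensity_eq_lintegral_mul _ hm1 hF1,
      lintegral_withDensity_eq_lintegral_mul _ (ham.mul hu2) hF,
      ← hS.lintegral_θ_swap ((ham.mul hu2).mul hF)]
    refine lintegral_congr fun e => ?_
    simp [ha.symm]
  have hα : Measurable fun e : V × V => (S.α (u e.1, u e.2) : ℝ≥0∞) :=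
    (hS.α_continuous.measurable.comp ((hu.comp measurable_fst).prodMk
      (hu.comp measurable_snd))).coe_nnreal_ennreal
  rw [edgeFlux, concaveTransform, h2, h1, ← hθa, Measure.singularPart_withDensity,
    Measure.singularPart_withDensity, add_zero, withDensity_zero_left, add_zero]
  have e : (fun e : V × V => ENNReal.ofReal (a e) * (S.α (u e.1, u e.2) : ℝ≥0∞))
      = (fun e => ENNReal.ofReal (a e)) * fun e => (S.α (u e.1, u e.2) : ℝ≥0∞) := rfl
  rw [e, withDensity_mul _ ham hα, ← hθ']
  refine withDensity_congr_ae ?_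
  filter_upwards [Measure.rnDeriv_withDensity θa hu1, Measure.rnDeriv_withDensity θa hu2] with e h3 h4
  rw [h3, h4]
  simp [reweight]

end Assumptions

end JumpSystem

namespace JumpSystem

variable {V : Type*} [MetricSpace V] [SecondCountableTopology V] [MeasurableSpace V]
  [BorelSpace V] {S : JumpSystem V}

/-! ### The perspective function of the primal dissipation density -/

/-- The perspective function `(w, r) ↦ r ψ(w / r)`, written as a supremum. -/
def perspective (S : JumpSystem V) (w r : ℝ) : ℝ≥0∞ :=
  ⨆ ξ : ℝ, ENNReal.ofReal (w * ξ - r * S.ψStar ξ)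

lemma le_perspective (S : JumpSystem V) (w r ξ : ℝ) :
    ENNReal.ofReal (w * ξ - r * S.ψStar ξ) ≤ S.perspective w r :=
  le_iSup (fun ξ : ℝ => ENNReal.ofReal (w * ξ - r * S.ψStar ξ)) ξ

lemma perspective_anti {S : JumpSystem V} (hS : S.Assumptions) {w r r' : ℝ} (h : r ≤ r') :
    S.perspective w r' ≤ S.perspective w r :=
  iSup_mono fun ξ => ENNReal.ofReal_le_ofReal (by have := hS.ψStar_nonneg ξ; gcongr)

/-- Young's inequality for the perspective function. -/
lemma ofReal_abs_mul_le (hS : S.Assumptions) (w ξ r : ℝ) :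
    ENNReal.ofReal (|w| * |ξ|) ≤ S.perspective w r + ENNReal.ofReal (r * S.ψStar ξ) := by
  obtain ⟨η, hη, hη'⟩ : ∃ η, w * η = |w| * |ξ| ∧ S.ψStar η = S.ψStar ξ := by
    rw [← abs_mul]
    rcases abs_choice (w * ξ) with h | h
    · exact ⟨ξ, h.symm, rfl⟩
    · exact ⟨-ξ, by rw [h]; ring, hS.ψStar_even ξ⟩
  calc ENNReal.ofReal (|w| * |ξ|) = ENNReal.ofReal ((w * η - r * S.ψStar η) + r * S.ψStar ξ) := by
        rw [hη, hη']; congr 1; ring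
    _ ≤ ENNReal.ofReal (w * η - r * S.ψStar η) + ENNReal.ofReal (r * S.ψStar ξ) :=
        ENNReal.ofReal_add_le
    _ ≤ _ := by gcongr; exact S.le_perspective _ _ _

lemma perspective_zero_right (S : JumpSystem V) (w : ℝ) :
    S.perspective w 0 = if w = 0 then 0 else ∞ := by
  split_ifs with h
  · simp [perspective, h]
  · refine ENNReal.eq_top_of_forall_nnreal_le ?_
    intro x
    refine le_trans (le_of_eq ?_) (S.le_perspective w 0 (x / w))
    rw [zero_mul, sub_zero, mul_div_cancel₀ _ h, ENNReal.ofReal_coe_nnreal]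

lemma perspective_of_pos (S : JumpSystem V) (w : ℝ) {r : ℝ} (hr : 0 < r) :
    S.perspective w r = ENNReal.ofReal r * S.ψ (w / r) := by
  rw [perspective, ψ, ENNReal.mul_iSup]
  refine iSup_congr fun ξ => ?_
  rw [← ENNReal.ofReal_mul hr.le]
  congr 1
  field_simp

/-- Continuity in `ξ` permits rational slopes. The countable supremum gives measurability and fits
the lower semicontinuity lemma. -/
lemma perspective_eq_iSup_rat (hS : S.Assumptions) (w r : ℝ) :
    S.perspective w r = ⨆ q : ℚ, ENNReal.ofReal (w * q - r * S.ψStar q) := by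
  apply le_antisymm
  · refine iSup_le fun ξ => ?_
    have hc : Continuous fun ξ : ℝ => ENNReal.ofReal (w * ξ - r * S.ψStar ξ) := by
      have := hS.ψStar_continuous
      exact ENNReal.continuous_ofReal.comp (by fun_prop)
    have hcl : IsClosed {ξ : ℝ | ENNReal.ofReal (w * ξ - r * S.ψStar ξ)
        ≤ ⨆ q : ℚ, ENNReal.ofReal (w * q - r * S.ψStar q)} := isClosed_le hc continuous_const
    have hd := Rat.denseRange_cast (𝕜 := ℝ)
    exact hd.induction_on (p := fun ξ : ℝ => ENNReal.ofReal (w * ξ - r * S.ψStar ξ)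
        ≤ ⨆ q : ℚ, ENNReal.ofReal (w * q - r * S.ψStar q)) ξ hcl
      fun q => le_iSup (fun q : ℚ => ENNReal.ofReal (w * q - r * S.ψStar q)) q
  · exact iSup_le fun q => S.le_perspective w r q

lemma measurable_perspective (hS : S.Assumptions) :
    Measurable fun p : ℝ × ℝ => S.perspective p.1 p.2 := by
  simp_rw [perspective_eq_iSup_rat hS]
  refine Measurable.iSup fun q => Measurable.ennreal_ofReal ?_
  exact (measurable_fst.mul_const _).sub (measurable_snd.mul_const _)

lemma measurable_ψ (hS : S.Assumptions) : Measurable S.ψ := by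
  have h : S.ψ = fun w => S.perspective w 1 := by
    funext w; rw [perspective_of_pos S w one_pos]; simp
  rw [h]
  exact (measurable_perspective hS).comp (measurable_id.prodMk measurable_const)

/-- A supremum of functions linear in `(w, r)`, cut off at zero, is jointly convex. Since it also
decreases in `r`, a mobility above the mean is allowed, which is the situation produced by a concave
`α`. -/
lemma perspective_le_half (hS : S.Assumptions) (w₁ w₂ r₁ r₂ r : ℝ) (hr : (r₁ + r₂) / 2 ≤ r) :
    S.perspective ((w₁ + w₂) / 2) r
      ≤ 2⁻¹ * S.perspective w₁ r₁ + 2⁻¹ * S.perspective w₂ r₂ := by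
  refine (perspective_anti hS hr).trans (iSup_le fun ξ => ?_)
  have e : (w₁ + w₂) / 2 * ξ - (r₁ + r₂) / 2 * S.ψStar ξ
      = 2⁻¹ * (w₁ * ξ - r₁ * S.ψStar ξ) + 2⁻¹ * (w₂ * ξ - r₂ * S.ψStar ξ) := by ring
  have h2 : ENNReal.ofReal 2⁻¹ = 2⁻¹ := by
    rw [ENNReal.ofReal_inv_of_pos two_pos]; simp
  rw [e]
  refine ENNReal.ofReal_add_le.trans ?_
  rw [ENNReal.ofReal_mul (by norm_num), ENNReal.ofReal_mul (by norm_num), h2]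
  gcongr <;> exact S.le_perspective _ _ _

/-- Strict convexity of the perspective function in its first variable. -/
lemma eq_of_perspective_half (hS : S.Assumptions) {w₁ w₂ r : ℝ} (hr : 0 ≤ r)
    (h₁ : S.perspective w₁ r ≠ ∞) (h₂ : S.perspective w₂ r ≠ ∞)
    (h : 2⁻¹ * S.perspective w₁ r + 2⁻¹ * S.perspective w₂ r
      ≤ S.perspective ((w₁ + w₂) / 2) r) : w₁ = w₂ := by
  rcases hr.eq_or_lt with h0 | h0
  · subst h0
    rw [perspective_zero_right S] at h₁ h₂
    have e1 : w₁ = 0 := by by_contra hne; simp [hne] at h₁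
    have e2 : w₂ = 0 := by by_contra hne; simp [hne] at h₂
    rw [e1, e2]
  set w := (w₁ + w₂) / 2 with hw
  have hc := hS.ψStar_continuous
  -- a maximiser of the supremum at the midpoint
  obtain ⟨ξ, hξ⟩ : ∃ ξ, ∀ η, w * η - r * S.ψStar η ≤ w * ξ - r * S.ψStar ξ := by
    have hcoer : ∀ᶠ η in cocompact ℝ, w * η - r * S.ψStar η ≤ w * 0 - r * S.ψStar 0 := by
      have hnz : ∀ᶠ η : ℝ in cocompact ℝ, η ≠ 0 := by
        have : ({0} : Set ℝ)ᶜ ∈ cocompact ℝ := isCompact_singleton.compl_mem_cocompact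
        exact this
      filter_upwards [(tendsto_atTop.1 hS.ψStar_superlinear) (|w| / r), hnz] with η hη hη0
      have hpos : 0 < |η| := abs_pos.2 hη0
      rw [le_div_iff₀ hpos, div_mul_eq_mul_div, div_le_iff₀ h0, ← abs_mul] at hη
      have := le_abs_self (w * η)
      rw [hS.ψStar_zero]
      linarith
    exact Continuous.exists_forall_ge' (f := fun η => w * η - r * S.ψStar η) (by fun_prop) 0 hcoer
  have hξ0 : 0 ≤ w * ξ - r * S.ψStar ξ := by have := hξ 0; simpa [hS.ψStar_zero] using this
  have hP : S.perspective w r = ENNReal.ofReal (w * ξ - r * S.ψStar ξ) :=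
    le_antisymm (iSup_le fun η => ENNReal.ofReal_le_ofReal (hξ η)) (S.le_perspective _ _ _)
  set P₁ := (S.perspective w₁ r).toReal with hP₁
  set P₂ := (S.perspective w₂ r).toReal with hP₂
  have hle : ∀ v, S.perspective v r ≠ ∞ → ∀ η, v * η - r * S.ψStar η ≤ (S.perspective v r).toReal := by
    intro v hv η
    have := S.le_perspective v r η
    rw [← ENNReal.ofReal_toReal hv] at this
    exact (ENNReal.ofReal_le_ofReal_iff ENNReal.toReal_nonneg).1 this
  have hsum : P₁ + P₂ ≤ (w₁ * ξ - r * S.ψStar ξ) + (w₂ * ξ - r * S.ψStar ξ) := by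
    rw [hP] at h
    have h3 := ENNReal.toReal_mono ENNReal.ofReal_ne_top h
    rw [ENNReal.toReal_add (ENNReal.mul_ne_top (by simp) h₁) (ENNReal.mul_ne_top (by simp) h₂),
      ENNReal.toReal_mul, ENNReal.toReal_mul, ENNReal.toReal_ofReal hξ0] at h3
    simp only [ENNReal.toReal_inv, ENNReal.toReal_ofNat] at h3
    have hw2 : w * ξ = (w₁ * ξ + w₂ * ξ) / 2 := by rw [hw]; ring
    rw [hw2] at h3
    linarith
  -- Equality at the midpoint makes its maximiser `ξ` optimal for `w₁` and for `w₂` as well;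
  -- differentiability of `ψStar` then determines both from `ξ`.
  have hderiv : ∀ v, (∀ η, v * η - r * S.ψStar η ≤ v * ξ - r * S.ψStar ξ) →
      v = r * deriv S.ψStar ξ := by
    intro v hv
    have hmax : IsLocalMax (fun η => v * η - r * S.ψStar η) ξ := Eventually.of_forall hv
    have hd : HasDerivAt (fun η => v * η - r * S.ψStar η) (v * 1 - r * deriv S.ψStar ξ) ξ :=
      ((hasDerivAt_id ξ).const_mul v).sub ((hS.ψStar_differentiable ξ).hasDerivAt.const_mul r)
    have := hmax.hasDerivAt_eq_zero hd
    linarith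
  rw [hderiv w₁ fun η => by have := hle w₁ h₁ η; have := hle w₂ h₂ ξ; linarith,
    hderiv w₂ fun η => by have := hle w₂ h₂ η; have := hle w₁ h₁ ξ; linarith]

/-- Testing the conjugate with any fixed `ξ` gives `ψ(t z) / t ≥ z ξ - ψStar(ξ) / t`, so the
asymptotic slope exceeds every number. Singular fluxes therefore have infinite action. -/
lemma convexRecession_ψ (S : JumpSystem V) {z : ℝ} (hz : z = 1 ∨ z = -1) :
    convexRecession S.ψ z = ∞ := by
  refine ENNReal.eq_top_of_forall_nnreal_le ?_
  intro x
  obtain ⟨ξ, hξ⟩ : ∃ ξ : ℝ, z * ξ = x + 1 := by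
    rcases hz with h | h
    · exact ⟨x + 1, by rw [h]; ring⟩
    · exact ⟨-(x + 1), by rw [h]; ring⟩
  refine Filter.le_limsup_of_frequently_le ?_ (by isBoundedDefault)
  refine Eventually.frequently ?_
  filter_upwards [eventually_ge_atTop (max 1 (S.ψStar ξ))] with t ht
  have ht0 : 0 < t := lt_of_lt_of_le one_pos ((le_max_left _ _).trans ht)
  rw [ENNReal.le_div_iff_mul_le (Or.inl (by simpa using ht0)) (Or.inl ENNReal.ofReal_ne_top)]
  refine le_trans ?_ (le_iSup (fun ξ : ℝ => ENNReal.ofReal (t * z * ξ - S.ψStar ξ)) ξ)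
  rw [← ENNReal.ofReal_coe_nnreal, ← ENNReal.ofReal_mul (by simp)]
  apply ENNReal.ofReal_le_ofReal
  have h1 : S.ψStar ξ ≤ t := (le_max_right _ _).trans ht
  rw [mul_assoc, hξ]
  nlinarith

/-! ### The functionals in terms of densities -/

namespace Assumptions

/-- The part of `h θ` singular to `k θ` is its restriction to `{k = 0}`. There the infinite
recession cost agrees with the perspective at zero mobility, which is `0` or `∞` according to
whether `h` vanishes; so one formula covers both parts. -/
lemma convexFunctional_withDensity (hS : S.Assumptions) {k : V × V → ℝ≥0} {h : V × V → ℝ}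
    (hk : Measurable k) (hh : Measurable h) :
    convexFunctional S.ψ (S.θ.withDensity fun e => ENNReal.ofReal (h e))
        (S.θ.withDensity fun e => ENNReal.ofReal (-h e)) (S.θ.withDensity fun e => k e)
      = ∫⁻ e, S.perspective (h e) (k e) ∂S.θ := by
  have hsf := hS.sigmaFinite_θ
  have hkm : Measurable fun e => (k e : ℝ≥0∞) := hk.coe_nnreal_ennreal
  set ν := S.θ.withDensity fun e => (k e : ℝ≥0∞) with hν
  have hνsf : SigmaFinite ν := SigmaFinite.withDensity _
  set Z : Set (V × V) := {e | k e = 0} with hZ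
  have hZm : MeasurableSet Z := hk (measurableSet_singleton 0)
  have hνZ : ν Z = 0 := by
    rw [hν, withDensity_apply _ hZm]
    refine (setLIntegral_congr_fun hZm (g := fun _ => 0) fun e he => ?_).trans (by simp)
    simp [show k e = 0 from he]
  -- Lebesgue decomposition of a measure with a density
  have hdec : ∀ p : V × V → ℝ, Measurable p →
      (S.θ.withDensity fun e => ENNReal.ofReal (p e)).rnDeriv ν
        =ᵐ[ν] (fun e => ENNReal.ofReal (p e) / k e) ∧
      (S.θ.withDensity fun e => ENNReal.ofReal (p e)).singularPart ν
        = (S.θ.withDensity fun e => ENNReal.ofReal (p e)).restrict Z := by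
    intro p hp
    have hq : Measurable fun e => ENNReal.ofReal (p e) / (k e : ℝ≥0∞) := hp.ennreal_ofReal.div hkm
    have hsing : ((S.θ.withDensity fun e => ENNReal.ofReal (p e)).restrict Z) ⟂ₘ ν :=
      ⟨Zᶜ, hZm.compl, by simp [Measure.restrict_apply hZm.compl], by simpa using hνZ⟩
    have hadd : (S.θ.withDensity fun e => ENNReal.ofReal (p e))
        = (S.θ.withDensity fun e => ENNReal.ofReal (p e)).restrict Z
          + ν.withDensity (fun e => ENNReal.ofReal (p e) / k e) := by
      rw [hν, ← withDensity_mul _ hkm hq, restrict_withDensity hZm, ← withDensity_indicator hZm,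
        ← withDensity_add_left (hp.ennreal_ofReal.indicator hZm)]
      congr 1
      funext e
      by_cases he : k e = 0
      · have : e ∈ Z := he
        simp [this, he]
      · have : e ∉ Z := he
        simp only [Pi.add_apply, indicator_of_notMem this, Pi.mul_apply, zero_add]
        rw [ENNReal.mul_div_cancel (by simpa using he) ENNReal.coe_ne_top]
    exact ⟨(Measure.eq_rnDeriv hq hsing hadd).symm, (Measure.eq_singularPart hq hsing hadd).symm⟩
  obtain ⟨hp1, hp2⟩ := hdec h hh
  obtain ⟨hm1, hm2⟩ := hdec (fun e => -h e) hh.neg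
  rw [convexFunctional, hp2, hm2, convexRecession_ψ S (Or.inl rfl), convexRecession_ψ S (Or.inr rfl)]
  have hpers : Measurable fun e => S.perspective (h e) (k e) :=
    (measurable_perspective hS).comp (hh.prodMk hk.coe_nnreal_real)
  have h1 : ∫⁻ y, S.ψ ((((S.θ.withDensity fun e => ENNReal.ofReal (h e)).rnDeriv ν y).toReal
      - ((S.θ.withDensity fun e => ENNReal.ofReal (-h e)).rnDeriv ν y).toReal)) ∂ν
      = ∫⁻ e in Zᶜ, S.perspective (h e) (k e) ∂S.θ := by
    have hψm : Measurable fun e => S.ψ (h e / k e) :=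
      (measurable_ψ hS).comp (hh.div hk.coe_nnreal_real)
    calc _ = ∫⁻ e, S.ψ (h e / k e) ∂ν := by
          refine lintegral_congr_ae ?_
          filter_upwards [hp1, hm1] with e he1 he2
          rw [he1, he2]
          congr 1
          rw [ENNReal.toReal_div, ENNReal.toReal_div, ENNReal.coe_toReal, ENNReal.toReal_ofReal',
            ENNReal.toReal_ofReal', ← sub_div]
          congr 1
          rcases le_total 0 (h e) with h0 | h0
          · rw [max_eq_left h0, max_eq_right (by linarith), sub_zero]
          · rw [max_eq_right h0, max_eq_left (by linarith)]; ring
      _ = ∫⁻ e, k e * S.ψ (h e / k e) ∂S.θ := by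
          rw [hν, lintegral_withDensity_eq_lintegral_mul _ hkm hψm]; rfl
      _ = ∫⁻ e, Zᶜ.indicator (fun e => S.perspective (h e) (k e)) e ∂S.θ := by
          refine lintegral_congr fun e => ?_
          by_cases he : k e = 0
          · have : e ∉ Zᶜ := fun h => h he
            simp [this, he]
          · have : e ∈ Zᶜ := he
            rw [indicator_of_mem this, perspective_of_pos S _ (by
              exact_mod_cast pos_iff_ne_zero.2 he), ENNReal.ofReal_coe_nnreal]
      _ = _ := lintegral_indicator hZm.compl _
  have h2 : ∞ * ((S.θ.withDensity fun e => ENNReal.ofReal (h e)).restrict Z) univ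
      + ∞ * ((S.θ.withDensity fun e => ENNReal.ofReal (-h e)).restrict Z) univ
      = ∫⁻ e in Z, S.perspective (h e) (k e) ∂S.θ := by
    have hsum : Measurable fun e => ENNReal.ofReal (h e) + ENNReal.ofReal (-h e) :=
      hh.ennreal_ofReal.add hh.neg.ennreal_ofReal
    rw [Measure.restrict_apply_univ, Measure.restrict_apply_univ, withDensity_apply _ hZm,
      withDensity_apply _ hZm, ← mul_add, ← lintegral_add_left hh.ennreal_ofReal,
      ← lintegral_const_mul _ hsum]
    refine setLIntegral_congr_fun hZm fun e he => ?_
    have he' : k e = 0 := he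
    simp only [he', NNReal.coe_zero, perspective_zero_right S]
    split_ifs with h0
    · simp [h0]
    · rw [ENNReal.top_mul]
      rcases lt_or_gt_of_ne h0 with hlt | hlt
      · intro hz
        have := (add_eq_zero.1 hz).2
        simp at this; linarith
      · intro hz
        have := (add_eq_zero.1 hz).1
        simp at this; linarith
  rw [add_assoc, h1, h2, add_comm, lintegral_add_compl _ hZm]

/-- The action in terms of densities. -/
lemma action_reweight (hS : S.Assumptions) {a : V × V → ℝ} (ha : Multiplier a)
    {u : V → ℝ≥0} (hu : Measurable u) {ρ : FiniteMeasure V}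
    (hρ : (ρ : Measure V) = S.π.withDensity fun x => u x)
    {j : SigmaFiniteSignedMeasure (V × V)} {h : V × V → ℝ} (hh : Measurable h)
    (hp : j.pos = S.θ.withDensity fun e => ENNReal.ofReal (h e))
    (hn : j.neg = S.θ.withDensity fun e => ENNReal.ofReal (-h e)) :
    (S.reweight a).action ρ j
      = 2⁻¹ * ∫⁻ e, S.perspective (2 * h e) ((a e).toNNReal * S.α (u e.1, u e.2)) ∂S.θ := by
  have hα : Measurable fun e : V × V => S.α (u e.1, u e.2) :=
    hS.α_continuous.measurable.comp ((hu.comp measurable_fst).prodMk (hu.comp measurable_snd))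
  have hk : Measurable fun e => (a e).toNNReal * S.α (u e.1, u e.2) :=
    ha.measurable.real_toNNReal.mul hα
  have hsm : ∀ p : V × V → ℝ, Measurable p → (2 : ℝ≥0) • S.θ.withDensity (fun e => ENNReal.ofReal (p e))
      = S.θ.withDensity fun e => ENNReal.ofReal (2 * p e) := by
    intro p hp
    rw [show ((2 : ℝ≥0) • S.θ.withDensity fun e => ENNReal.ofReal (p e))
      = (2 : ℝ≥0∞) • S.θ.withDensity fun e => ENNReal.ofReal (p e) from rfl,
      ← withDensity_smul _ hp.ennreal_ofReal]
    congr 1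
    funext e
    rw [Pi.smul_apply, smul_eq_mul, ENNReal.ofReal_mul two_pos.le]; simp
  have key := hS.convexFunctional_withDensity hk (hh.const_mul 2)
  rw [action, hS.edgeFlux_reweight ha hu hρ, hp, hn, hsm h hh, hsm (fun e => -h e) hh.neg]
  have e1 : (fun e => ENNReal.ofReal (2 * -h e)) = fun e => ENNReal.ofReal (-(2 * h e)) := by
    funext e; ring_nf
  have e2 : (fun e : V × V => ENNReal.ofReal (a e) * (S.α (u e.1, u e.2) : ℝ≥0∞))
      = fun e => (((a e).toNNReal * S.α (u e.1, u e.2) : ℝ≥0) : ℝ≥0∞) := by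
    funext e; push_cast; rfl
  rw [e1, e2]
  change 2⁻¹ * convexFunctional S.ψ _ _ _ = _
  rw [key]
  simp

/-- A flux of finite action is absolutely continuous. -/
lemma absolutelyContinuous_of_action_ne_top (hS : S.Assumptions) {a : V × V → ℝ} (ha : Multiplier a)
    {u : V → ℝ≥0} (hu : Measurable u) {ρ : FiniteMeasure V}
    (hρ : (ρ : Measure V) = S.π.withDensity fun x => u x)
    {j : SigmaFiniteSignedMeasure (V × V)} (hj : (S.reweight a).action ρ j ≠ ∞) :
    j.pos ≪ S.θ ∧ j.neg ≪ S.θ := by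
  have hsf := hS.sigmaFinite_θ
  have := j.sigmaFinite_pos
  have := j.sigmaFinite_neg
  set ν := (S.reweight a).edgeFlux ρ with hν
  have hνe := hS.edgeFlux_reweight ha hu hρ
  have hνθ : ν ≪ S.θ := by rw [hν, hνe]; exact withDensity_absolutelyContinuous _ _
  have hα : Measurable fun e : V × V => S.α (u e.1, u e.2) :=
    hS.α_continuous.measurable.comp ((hu.comp measurable_fst).prodMk (hu.comp measurable_snd))
  have hνsf : SigmaFinite ν := by
    have e2 : (fun e : V × V => ENNReal.ofReal (a e) * (S.α (u e.1, u e.2) : ℝ≥0∞))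
        = fun e => (((a e).toNNReal * S.α (u e.1, u e.2) : ℝ≥0) : ℝ≥0∞) := by
      funext e; push_cast; rfl
    rw [hν, hνe, e2]
    exact SigmaFinite.withDensity _
  have h1 : (S.reweight a).action ρ j = 2⁻¹ * convexFunctional S.ψ ((2 : ℝ≥0) • j.pos)
    ((2 : ℝ≥0) • j.neg) ν := rfl
  have hz : ∀ μ : Measure (V × V), SigmaFinite μ → ∞ * ((2 : ℝ≥0) • μ).singularPart ν univ ≠ ∞ →
      μ ≪ S.θ := by
    intro μ hμ hne
    have h0 : ((2 : ℝ≥0) • μ).singularPart ν univ = 0 := by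
      by_contra h
      exact hne (ENNReal.top_mul h)
    rw [Measure.measure_univ_eq_zero, Measure.singularPart_smul] at h0
    have h2 : μ.singularPart ν = 0 := by
      have h3 : (2 : ℝ≥0∞) • μ.singularPart ν = 0 := h0
      ext s hs
      have h4 := congrArg (fun m : Measure (V × V) => m s) h3
      simpa using h4
    exact ((Measure.singularPart_eq_zero _ _).1 h2).trans hνθ
  have hfin : convexFunctional S.ψ ((2 : ℝ≥0) • j.pos) ((2 : ℝ≥0) • j.neg) ν ≠ ∞ := by
    intro h
    rw [h1, h] at hj
    exact hj (ENNReal.mul_top (by simp))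
  rw [convexFunctional, convexRecession_ψ S (Or.inl rfl), convexRecession_ψ S (Or.inr rfl)] at hfin
  rw [ENNReal.add_ne_top, ENNReal.add_ne_top] at hfin
  exact ⟨hz _ j.sigmaFinite_pos hfin.1.2, hz _ j.sigmaFinite_neg hfin.2⟩

lemma density_ae_eq (hS : S.Assumptions) {u : V → ℝ≥0} (hu : Measurable u) {ρ : FiniteMeasure V}
    (hρ : (ρ : Measure V) = S.π.withDensity fun x => u x) :
    S.density ρ =ᵐ[S.π] fun x => (u x : ℝ≥0∞) := by
  have := hS.finite_π
  have := Measure.rnDeriv_withDensity S.π hu.coe_nnreal_ennreal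
  rw [← hρ] at this
  exact this

lemma entropy_eq (hS : S.Assumptions) {u : V → ℝ≥0} (hu : Measurable u) {ρ : FiniteMeasure V}
    (hρ : (ρ : Measure V) = S.π.withDensity fun x => u x) :
    S.entropy ρ = ∫⁻ x, ENNReal.ofReal (S.φ (u x)) ∂S.π := by
  have hac : (ρ : Measure V) ≪ S.π := by rw [hρ]; exact withDensity_absolutelyContinuous _ _
  rw [entropy, if_pos hac]
  refine lintegral_congr_ae ?_
  filter_upwards [hS.density_ae_eq hu hρ] with x hx
  rw [hx]; simp

lemma fisher_reweight (hS : S.Assumptions) {a : V × V → ℝ} (ha : Multiplier a)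
    {u : V → ℝ≥0} (hu : Measurable u) {ρ : FiniteMeasure V}
    (hρ : (ρ : Measure V) = S.π.withDensity fun x => u x) :
    (S.reweight a).fisher ρ
      = 2⁻¹ * ∫⁻ e, ENNReal.ofReal (a e) * S.fisherDensity (u e.1, u e.2) ∂S.θ := by
  have hac : (ρ : Measure V) ≪ S.π := by rw [hρ]; exact withDensity_absolutelyContinuous _ _
  have hac' : (ρ : Measure V) ≪ (S.reweight a).π := hac
  rw [fisher, if_pos hac', hS.θ_reweight ha]
  have hD : Measurable fun e : V × V => S.fisherDensity (u e.1, u e.2) :=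
    S.lowerSemicontinuous_fisherDensity.measurable.comp
      ((hu.comp measurable_fst).prodMk (hu.comp measurable_snd))
  congr 1
  calc _ = ∫⁻ e, S.fisherDensity (u e.1, u e.2) ∂(S.θ.withDensity fun e => ENNReal.ofReal (a e)) := by
        refine lintegral_congr_ae ?_
        have h1 := (withDensity_absolutelyContinuous S.θ fun e => ENNReal.ofReal (a e)).ae_le
          (hS.ae_fst (hS.density_ae_eq hu hρ))
        have h2 := (withDensity_absolutelyContinuous S.θ fun e => ENNReal.ofReal (a e)).ae_le
          (hS.ae_snd (hS.density_ae_eq hu hρ))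
        filter_upwards [h1, h2] with e h1 h2
        have h1' : (S.reweight a).density ρ e.1 = u e.1 := h1
        have h2' : (S.reweight a).density ρ e.2 = u e.2 := h2
        rw [h1', h2', ENNReal.toNNReal_coe, ENNReal.toNNReal_coe]
        rfl
    _ = _ := by rw [lintegral_withDensity_eq_lintegral_mul _ ha.measurable.ennreal_ofReal hD]; rfl

end Assumptions

end JumpSystem

/-! ### Signed measures with a density -/

lemma ae_eq_zero_or_eq_zero_of_mutuallySingular {Y : Type*} [MeasurableSpace Y] {m : Measure Y}
    {p q : Y → ℝ≥0} (hp : Measurable p) (hq : Measurable q)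
    (h : (m.withDensity fun y => p y) ⟂ₘ (m.withDensity fun y => q y)) :
    ∀ᵐ y ∂m, p y = 0 ∨ q y = 0 := by
  obtain ⟨s, hs, h1, h2⟩ := h
  rw [withDensity_apply_eq_zero hp.coe_nnreal_ennreal] at h1
  rw [withDensity_apply_eq_zero hq.coe_nnreal_ennreal] at h2
  have := measure_union_null h1 h2
  rw [ae_iff]
  refine measure_mono_null (fun y hy => ?_) this
  simp only [mem_ofPred_eq, not_or] at hy
  by_cases hys : y ∈ s
  · exact Or.inl ⟨by simpa using hy.1, hys⟩
  · exact Or.inr ⟨by simpa using hy.2, hys⟩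

lemma integral_withDensity_ofReal {Y : Type*} [MeasurableSpace Y] {m : Measure Y} {h : Y → ℝ}
    (hh : Measurable h) (f : Y → ℝ) :
    ∫ y, f y ∂(m.withDensity fun y => ENNReal.ofReal (h y)) = ∫ y, max (h y) 0 * f y ∂m := by
  rw [integral_withDensity_eq_integral_toReal_smul hh.ennreal_ofReal
    (ae_of_all _ fun _ => ENNReal.ofReal_lt_top)]
  simp [ENNReal.toReal_ofReal']

lemma SigmaFiniteSignedMeasure.integral_eq_of_density {Y : Type*} [MeasurableSpace Y]
    {j : SigmaFiniteSignedMeasure Y} {m : Measure Y} {h f : Y → ℝ} (hh : Measurable h)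
    (hp : j.pos = m.withDensity fun y => ENNReal.ofReal (h y))
    (hn : j.neg = m.withDensity fun y => ENNReal.ofReal (-h y)) (hf : Measurable f)
    (hint : Integrable (fun y => f y * h y) m) : j.integral f = ∫ y, f y * h y ∂m := by
  have hbd : ∀ g : Y → ℝ, Measurable g → (∀ y, |g y| ≤ |h y|) → Integrable (fun y => g y * f y) m := by
    intro g hg hgh
    refine hint.mono (hg.mul hf).aestronglyMeasurable (ae_of_all _ fun y => ?_)
    rw [norm_mul, norm_mul, mul_comm]
    gcongr
    exact hgh y
  rw [integral, hp, hn, integral_withDensity_ofReal hh f,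
    integral_withDensity_ofReal (h := fun y => -h y) hh.neg f, ← integral_sub]
  · refine integral_congr_ae (ae_of_all _ fun y => ?_)
    simp only
    rw [← sub_mul, mul_comm]
    congr 1
    rcases le_total 0 (h y) with h0 | h0
    · rw [max_eq_left h0, max_eq_right (by linarith), sub_zero]
    · rw [max_eq_right h0, max_eq_left (by linarith)]; ring
  · refine hbd _ (hh.max measurable_const) fun y => ?_
    rw [abs_of_nonneg (le_max_right _ _)]
    exact max_le (le_abs_self _) (abs_nonneg _)
  · refine hbd _ (hh.neg.max measurable_const) fun y => ?_
    rw [abs_of_nonneg (le_max_right _ _)]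
    exact max_le (neg_le_abs _) (abs_nonneg _)

lemma SigmaFiniteSignedMeasure.lintegral_variation_of_density {Y : Type*} [MeasurableSpace Y]
    {j : SigmaFiniteSignedMeasure Y} {m : Measure Y} {h : Y → ℝ} (hh : Measurable h)
    (hp : j.pos = m.withDensity fun y => ENNReal.ofReal (h y))
    (hn : j.neg = m.withDensity fun y => ENNReal.ofReal (-h y)) {F : Y → ℝ≥0∞}
    (hF : Measurable F) : ∫⁻ y, F y ∂j.variation = ∫⁻ y, ‖h y‖ₑ * F y ∂m := by
  have h1 : Measurable fun y => ENNReal.ofReal (-h y) := hh.neg.ennreal_ofReal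
  rw [variation, lintegral_add_measure, hp, hn,
    lintegral_withDensity_eq_lintegral_mul _ hh.ennreal_ofReal hF,
    lintegral_withDensity_eq_lintegral_mul _ h1 hF,
    ← lintegral_add_left (hh.ennreal_ofReal.mul hF)]
  refine lintegral_congr fun y => ?_
  simp only [Pi.mul_apply]
  rw [← add_mul, ← ofReal_norm, Real.norm_eq_abs]
  congr 1
  rcases le_total 0 (h y) with h0 | h0
  · rw [abs_of_nonneg h0, ENNReal.ofReal_of_nonpos (p := -h y) (by linarith), add_zero]
  · rw [abs_of_nonpos h0, ENNReal.ofReal_of_nonpos h0, zero_add]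

/-! ### Measurability of families of measures -/

/-- Closed sets form a generating π-system, and the mass of a closed set is a limit of integrals of
Lipschitz thickened indicators. -/
lemma measurable_of_lipschitz {ι V : Type*} [MeasurableSpace ι] [PseudoMetricSpace V]
    [MeasurableSpace V] [BorelSpace V] {ρ : ι → FiniteMeasure V}
    (h : ∀ f : V → ℝ, (∃ K, LipschitzWith K f) → (∃ C, ∀ x, |f x| ≤ C) →
      Measurable fun i => ∫ x, f x ∂(ρ i : Measure V)) :
    Measurable fun i => (ρ i : Measure V) := by
  refine Measurable.measure_of_isPiSystem (S := {s : Set V | IsClosed s})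
    (by rw [BorelSpace.measurable_eq (α := V), borel_eq_generateFrom_isClosed])
    isPiSystem_isClosed (fun F hF => ?_) ?_
  · have hF' : IsClosed F := hF
    set f : ℕ → V → ℝ≥0 := fun n => thickenedIndicator (δ := 1 / ((n : ℝ) + 1)) (by positivity) F
    have hlim : ∀ i, Tendsto (fun n => ∫⁻ x, (f n x : ℝ≥0∞) ∂(ρ i : Measure V)) atTop
        (𝓝 ((ρ i : Measure V) F)) := fun i =>
      tendsto_lintegral_thickenedIndicator_of_isClosed _ hF' (fun n => by positivity)
        tendsto_one_div_add_atTop_nhds_zero_nat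
    refine measurable_of_tendsto_metrizable (f := fun n i => ∫⁻ x, (f n x : ℝ≥0∞) ∂(ρ i : Measure V))
      (fun n => ?_) (tendsto_pi_nhds.2 hlim)
    have hfm : Measurable fun x => (f n x : ℝ) :=
      ((thickenedIndicator (δ := 1 / ((n : ℝ) + 1)) (by positivity) F).continuous.measurable).coe_nnreal_real
    have hf1 : ∀ x, (f n x : ℝ) ≤ 1 := fun x => by exact_mod_cast thickenedIndicator_le_one _ F x
    have e : ∀ i, ∫⁻ x, (f n x : ℝ≥0∞) ∂(ρ i : Measure V)
        = ENNReal.ofReal (∫ x, (f n x : ℝ) ∂(ρ i : Measure V)) := by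
      intro i
      rw [ofReal_integral_eq_lintegral_ofReal]
      · simp
      · exact Integrable.of_bound (C := 1) hfm.aestronglyMeasurable
          (ae_of_all _ fun x => by rw [Real.norm_eq_abs, abs_of_nonneg (NNReal.coe_nonneg _)]; exact hf1 x)
      · exact ae_of_all _ fun x => NNReal.coe_nonneg _
    simp_rw [e]
    refine (h _ ⟨_, LipschitzWith.comp (Kf := 1) (f := ((↑) : ℝ≥0 → ℝ))
      (LipschitzWith.of_dist_le_mul fun x y => by simp [NNReal.dist_eq, Real.dist_eq])
      (lipschitzWith_thickenedIndicator (δ := 1 / ((n : ℝ) + 1)) (by positivity) F)⟩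
        ⟨1, fun x => ?_⟩).ennreal_ofReal
    rw [Function.comp_apply, abs_of_nonneg (NNReal.coe_nonneg _)]; exact hf1 x
  · have e : ∀ i, (ρ i : Measure V) univ = ENNReal.ofReal (∫ _, (1 : ℝ) ∂(ρ i : Measure V)) := by
      intro i
      rw [integral_const, smul_eq_mul, mul_one, Measure.real, ENNReal.ofReal_toReal (measure_ne_top _ _)]
    simp_rw [e]
    exact (h (fun _ => 1) ⟨0, LipschitzWith.const 1⟩ ⟨1, fun _ => by simp⟩).ennreal_ofReal

namespace JumpSystem

variable {V : Type*} [MetricSpace V] [SecondCountableTopology V] [MeasurableSpace V]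
  [BorelSpace V] {S : JumpSystem V}

namespace Assumptions

/-- Joint measurability of the densities of a measurable family of measures of finite moment. -/
lemma exists_measurable_density (hS : S.Assumptions) {μ : ℝ → Measure (V × V)} (hμ : Measurable μ)
    (hdiag : ∀ t, μ t {e | e.1 = e.2} = 0) :
    ∃ (p : ℝ → V × V → ℝ≥0) (G : Set ℝ), Measurable (Function.uncurry p) ∧ MeasurableSet G ∧
      (∀ t ∈ G, μ t = S.θ.withDensity fun e => p t e) ∧
      ∀ t, ∫⁻ e, ENNReal.ofReal (truncDist e) ∂(μ t) < ∞ → μ t ≪ S.θ → t ∈ G := by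
  have hdm : Measurable fun e : V × V => ENNReal.ofReal (truncDist e) :=
    measurable_truncDist.ennreal_ofReal
  set W : ℝ → ℝ≥0∞ := fun t => ∫⁻ e, ENNReal.ofReal (truncDist e) ∂(μ t) with hW
  have hWm : Measurable W := (Measure.measurable_lintegral hdm).comp hμ
  -- The weight `1 ∧ d` and the normalisation `1 + W t` turn the family into a finite kernel, for
  -- which a jointly measurable Radon–Nikodym derivative exists. Times with `W t = ∞` receive the
  -- zero measure and are excluded from `G`.
  have hKm : Measurable fun t => (μ t).withDensity fun e => (1 + W t)⁻¹ * ENNReal.ofReal (truncDist e) := by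
    refine Measure.measurable_of_measurable_coe _ fun B hB => ?_
    have e : ∀ t, (μ t).withDensity (fun e => (1 + W t)⁻¹ * ENNReal.ofReal (truncDist e)) B
        = (1 + W t)⁻¹ * ∫⁻ e, B.indicator (fun e => ENNReal.ofReal (truncDist e)) e ∂(μ t) := by
      intro t
      rw [withDensity_apply _ hB, lintegral_const_mul _ hdm, lintegral_indicator hB]
    simp_rw [e]
    exact (hWm.const_add 1).inv.mul ((Measure.measurable_lintegral (hdm.indicator hB)).comp hμ)
  set K : Kernel ℝ (V × V) := ⟨_, hKm⟩ with hK
  have hKa : ∀ t, K t = (μ t).withDensity fun e => (1 + W t)⁻¹ * ENNReal.ofReal (truncDist e) :=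
    fun t => rfl
  have hKfin : IsFiniteKernel K := by
    refine ⟨1, ENNReal.one_lt_top, fun t => ?_⟩
    rw [hKa, withDensity_apply _ MeasurableSet.univ, Measure.restrict_univ, lintegral_const_mul _ hdm,
      mul_comm, ← div_eq_mul_inv]
    exact ENNReal.div_le_of_le_mul (by rw [one_mul]; exact le_add_self)
  set M : Kernel ℝ (V × V) := Kernel.const ℝ hS.finiteθ with hM
  set r := Kernel.rnDeriv K M with hr
  have hrm : Measurable (Function.uncurry r) := Kernel.measurable_rnDeriv K M
  -- Undoing the weight divides by `1 ∧ d`, while the reference `finiteθ` contributes `(1 ∧ d)²`; a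
  -- single factor `1 ∧ d` is left.
  refine ⟨fun t e => (r t e * (1 + W t) * ENNReal.ofReal (truncDist e)).toNNReal,
    {t | W t < ∞} ∩ {t | K t ≪ M t}, ?_, ?_, ?_, ?_⟩
  · refine Measurable.ennreal_toNNReal ((hrm.mul ((hWm.comp measurable_fst).const_add 1)).mul
      (hdm.comp measurable_snd))
  · exact (measurableSet_lt hWm measurable_const).inter
      (Kernel.measurableSet_absolutelyContinuous K M)
  · rintro t ⟨hWt, hac⟩
    have hWt' : W t < ∞ := hWt
    have hac' : K t ≪ M t := hac
    have h1W : 1 + W t ≠ ∞ := by simp [hWt'.ne]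
    have hdec := Kernel.withDensity_rnDeriv_eq hac'
    have hrt : Measurable (r t) := hrm.comp measurable_prodMk_left
    have hKt : K t = hS.finiteθ.withDensity (r t) := by
      rw [← hdec, Kernel.withDensity_apply _ hrm, hM, Kernel.const_apply]
    have hinv : Measurable fun e : V × V => (1 + W t) * ENNReal.ofReal (truncDist e)⁻¹ :=
      (measurable_truncDist.inv.ennreal_ofReal).const_mul _
    have hμt : μ t = (K t).withDensity fun e => (1 + W t) * ENNReal.ofReal (truncDist e)⁻¹ := by
      rw [hKa, ← withDensity_mul _ (hdm.const_mul _) hinv]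
      conv_lhs => rw [← withDensity_one (μ := μ t)]
      refine withDensity_congr_ae ?_
      have hne : ∀ᵐ e ∂(μ t), e.1 ≠ e.2 := by
        rw [ae_iff]; simpa using hdiag t
      filter_upwards [hne] with e he
      have hp := truncDist_pos he
      simp only [Pi.mul_apply, Pi.one_apply]
      rw [mul_mul_mul_comm, ENNReal.inv_mul_cancel (by simp) h1W, ← ENNReal.ofReal_mul hp.le,
        mul_inv_cancel₀ hp.ne']
      simp
    rw [hμt, hKt, finiteθ, ← withDensity_mul _ measurable_ofReal_truncDist_sq hrt,
      ← withDensity_mul _ (measurable_ofReal_truncDist_sq.mul hrt) hinv]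
    have hfin : ∀ᵐ e ∂S.θ, r t e < ∞ := by
      have h1 : ∀ᵐ e ∂hS.finiteθ, r t e < ∞ := by
        have := Kernel.rnDeriv_lt_top K M (a := t)
        rwa [hM, Kernel.const_apply] at this
      have hac2 : S.θ ≪ hS.finiteθ := by
        conv_lhs => rw [← hS.withDensity_finiteθ]
        exact withDensity_absolutelyContinuous _ _
      exact hac2.ae_le h1
    refine withDensity_congr_ae ?_
    filter_upwards [hfin, hS.ae_ne] with e he hp
    simp only [Pi.mul_apply]
    rw [ENNReal.coe_toNNReal (by
      exact ENNReal.mul_ne_top (ENNReal.mul_ne_top he.ne h1W) ENNReal.ofReal_ne_top)]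
    have e1 : ENNReal.ofReal (truncDist e ^ 2) * ENNReal.ofReal (truncDist e)⁻¹
        = ENNReal.ofReal (truncDist e) := by
      rw [← ENNReal.ofReal_mul (by positivity)]
      congr 1
      field_simp
    rw [← e1]; ring
  · intro t ht hac
    refine ⟨ht, ?_⟩
    have h1 : K t ≪ μ t := by rw [hKa]; exact withDensity_absolutelyContinuous _ _
    have h2 : S.θ ≪ hS.finiteθ := by
      conv_lhs => rw [← hS.withDensity_finiteθ]
      exact withDensity_absolutelyContinuous _ _
    show K t ≪ M t
    rw [hM, Kernel.const_apply]
    exact (h1.trans hac).trans h2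

end Assumptions

end JumpSystem

/-! ### Jointly measurable densities of curves and fluxes -/

namespace JumpSystem

variable {V : Type*} [MetricSpace V] [SecondCountableTopology V] [MeasurableSpace V]
  [BorelSpace V] {S : JumpSystem V}

/-- Jointly measurable densities of a curve and of its flux. -/
structure Represents (S : JumpSystem V) (T : ℝ) (ρ : ℝ → FiniteMeasure V)
    (j : ℝ → SigmaFiniteSignedMeasure (V × V)) (u : ℝ → V → ℝ≥0) (h : ℝ → V × V → ℝ) : Prop where
  measurable_u : Measurable (Function.uncurry u)
  measurable_h : Measurable (Function.uncurry h)
  ρ_eq : ∀ t ∈ Icc 0 T, (ρ t : Measure V) = S.π.withDensity fun x => u t x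
  pos_eq : ∀ᵐ t ∂volume.restrict (Icc 0 T),
    (j t).pos = S.θ.withDensity fun e => ENNReal.ofReal (h t e)
  neg_eq : ∀ᵐ t ∂volume.restrict (Icc 0 T),
    (j t).neg = S.θ.withDensity fun e => ENNReal.ofReal (-h t e)
  moment : ∫⁻ t in Icc 0 T, ∫⁻ e, ‖h t e‖ₑ * ENNReal.ofReal (truncDist e) ∂S.θ < ∞

lemma continuityEquation_moment_lt_top {T : ℝ} {ρ : ℝ → FiniteMeasure V}
    {j : ℝ → SigmaFiniteSignedMeasure (V × V)} (hc : ContinuityEquation T ρ j) :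
    ∫⁻ t in Icc 0 T, ∫⁻ e, ENNReal.ofReal (truncDist e) ∂(j t).variation < ∞ :=
  hc.moment

/-- The flux densities of a curve of finite action. -/
lemma Assumptions.exists_flux_density (hS : S.Assumptions) {a : V × V → ℝ} (ha : Multiplier a) {T : ℝ}
    (hT : 0 ≤ T) {ρ : ℝ → FiniteMeasure V} {j : ℝ → SigmaFiniteSignedMeasure (V × V)}
    (hc : ContinuityEquation T ρ j)
    (hρ : ∀ t ∈ Icc 0 T, (ρ t : Measure V) ≪ S.π)
    (hE : ∫⁻ t in Icc 0 T, ((S.reweight a).action (ρ t) (j t) + (S.reweight a).fisher (ρ t)) < ∞) :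
    ∃ h : ℝ → V × V → ℝ, Measurable (Function.uncurry h) ∧
      (∀ᵐ t ∂volume.restrict (Icc 0 T),
        (j t).pos = S.θ.withDensity fun e => ENNReal.ofReal (h t e)) ∧
      (∀ᵐ t ∂volume.restrict (Icc 0 T),
        (j t).neg = S.θ.withDensity fun e => ENNReal.ofReal (-h t e)) ∧
      ∫⁻ t in Icc 0 T, ∫⁻ e, ‖h t e‖ₑ * ENNReal.ofReal (truncDist e) ∂S.θ < ∞ := by
  have := hS.finite_π
  have hdm : Measurable fun e : V × V => ENNReal.ofReal (truncDist e) :=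
    measurable_truncDist.ennreal_ofReal
  -- Freezing the curve outside `[0,T]` extends the measurability given there to all of `ℝ`.
  set j' : ℝ → SigmaFiniteSignedMeasure (V × V) := fun t => j (projIcc 0 T hT t) with hj'
  have hproj : Measurable (projIcc 0 T hT) := continuous_projIcc.measurable
  have hjj : ∀ t ∈ Icc 0 T, j' t = j t := fun t ht => by
    simp only [hj', projIcc_of_mem hT ht]
  have hpm : Measurable fun t => (j' t).pos := hc.measurable_pos.comp hproj
  have hnm : Measurable fun t => (j' t).neg := hc.measurable_neg.comp hproj
  have hdiag : ∀ t, (j' t).variation {e | e.1 = e.2} = 0 := fun t =>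
    hc.diag_null _ (projIcc 0 T hT t).2
  have hpd : ∀ t, (j' t).pos {e | e.1 = e.2} = 0 := fun t => by
    have := hdiag t
    rw [SigmaFiniteSignedMeasure.variation, Measure.add_apply, add_eq_zero] at this
    exact this.1
  have hnd : ∀ t, (j' t).neg {e | e.1 = e.2} = 0 := fun t => by
    have := hdiag t
    rw [SigmaFiniteSignedMeasure.variation, Measure.add_apply, add_eq_zero] at this
    exact this.2
  obtain ⟨p, Gp, hpmeas, hGp, hp, hGp'⟩ := hS.exists_measurable_density hpm hpd
  obtain ⟨q, Gq, hqmeas, hGq, hq, hGq'⟩ := hS.exists_measurable_density hnm hnd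
  set W : ℝ → ℝ≥0∞ := fun t => ∫⁻ e, ENNReal.ofReal (truncDist e) ∂(j' t).variation with hW
  have hWeq : ∀ t, W t = ∫⁻ e, ENNReal.ofReal (truncDist e) ∂(j' t).pos
      + ∫⁻ e, ENNReal.ofReal (truncDist e) ∂(j' t).neg := fun t => by
    rw [hW]; exact lintegral_add_measure _ _ _
  have hWm : Measurable W := by
    rw [show W = _ from funext hWeq]
    exact ((Measure.measurable_lintegral hdm).comp hpm).add
      ((Measure.measurable_lintegral hdm).comp hnm)
  have hWint : ∫⁻ t in Icc 0 T, W t < ∞ := by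
    refine lt_of_le_of_lt (le_of_eq ?_) (continuityEquation_moment_lt_top hc)
    refine setLIntegral_congr_fun measurableSet_Icc fun t ht => ?_
    simp only [hW, hjj t ht]
  have hWae : ∀ᵐ t ∂volume.restrict (Icc 0 T), W t < ∞ := ae_lt_top hWm hWint.ne
  -- times at which the flux is singular form a null set
  set B : Set ℝ := Icc 0 T ∩ ({t | W t < ∞} ∩ (Gp ∩ Gq)ᶜ) with hB
  have hBm : MeasurableSet B := measurableSet_Icc.inter
    ((measurableSet_lt hWm measurable_const).inter (hGp.inter hGq).compl)
  have hBtop : ∀ t ∈ B, (S.reweight a).action (ρ t) (j t) = ∞ := by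
    rintro t ⟨ht, hWt, hG⟩
    by_contra hne
    have hρt : (ρ t : Measure V) = S.π.withDensity fun x => ((S.density (ρ t) x).toNNReal : ℝ≥0∞) := by
      conv_lhs => rw [← Measure.withDensity_rnDeriv_eq _ _ (hρ t ht)]
      refine withDensity_congr_ae ?_
      filter_upwards [Measure.rnDeriv_lt_top (ρ t : Measure V) S.π] with x hx
      rw [density, ENNReal.coe_toNNReal hx.ne]
    have hum : Measurable fun x => (S.density (ρ t) x).toNNReal :=
      (Measure.measurable_rnDeriv _ _).ennreal_toNNReal
    obtain ⟨h1, h2⟩ := hS.absolutelyContinuous_of_action_ne_top ha hum hρt hne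
    rw [← hjj t ht] at h1 h2
    have hWt' : W t < ∞ := hWt
    rw [hWeq, ENNReal.add_lt_top] at hWt'
    exact hG ⟨hGp' t hWt'.1 h1, hGq' t hWt'.2 h2⟩
  have hB0 : volume B = 0 := by
    by_contra hne
    have h1 : ∫⁻ t in B, ∞ ≤ ∫⁻ t in Icc 0 T,
        ((S.reweight a).action (ρ t) (j t) + (S.reweight a).fisher (ρ t)) := by
      refine le_trans (setLIntegral_mono' hBm fun t ht => ?_) (lintegral_mono_set inter_subset_left)
      rw [hBtop t ht]; exact le_add_right le_rfl
    rw [setLIntegral_const, ENNReal.top_mul hne] at h1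
    exact (h1.trans_lt hE).ne rfl
  have hGae : ∀ᵐ t ∂volume.restrict (Icc 0 T), t ∈ Gp ∩ Gq := by
    have h1 : ∀ᵐ t ∂volume.restrict (Icc 0 T), t ∉ B :=
      ae_restrict_of_ae (measure_eq_zero_iff_ae_notMem.1 hB0)
    filter_upwards [h1, hWae, ae_restrict_mem measurableSet_Icc] with t h1 h2 h3
    by_contra hG
    exact h1 ⟨h3, h2, hG⟩
  -- By mutual singularity `p` and `q` are almost nowhere positive simultaneously, so they are the
  -- positive and negative parts of the difference.
  set h : ℝ → V × V → ℝ := fun t e => (p t e : ℝ) - q t e with hh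
  have hhm : Measurable (Function.uncurry h) := hpmeas.coe_nnreal_real.sub hqmeas.coe_nnreal_real
  have hboth : ∀ᵐ t ∂volume.restrict (Icc 0 T),
      (j t).pos = S.θ.withDensity (fun e => ENNReal.ofReal (h t e)) ∧
      (j t).neg = S.θ.withDensity (fun e => ENNReal.ofReal (-h t e)) := by
    filter_upwards [hGae, ae_restrict_mem measurableSet_Icc] with t hG ht
    have e1 := hp t hG.1
    have e2 := hq t hG.2
    rw [hjj t ht] at e1 e2
    have hs := (j t).mutuallySingular
    rw [e1, e2] at hs
    have h0 := ae_eq_zero_or_eq_zero_of_mutuallySingular (hpmeas.comp measurable_prodMk_left)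
      (hqmeas.comp measurable_prodMk_left) hs
    constructor
    · rw [e1]
      refine withDensity_congr_ae ?_
      filter_upwards [h0] with e he
      simp only [Function.comp, Function.uncurry_apply_pair] at he
      rcases he with he | he <;> simp [hh, he]
    · rw [e2]
      refine withDensity_congr_ae ?_
      filter_upwards [h0] with e he
      simp only [Function.comp, Function.uncurry_apply_pair] at he
      rcases he with he | he <;> simp [hh, he]
  refine ⟨h, hhm, hboth.mono fun _ h => h.1, hboth.mono fun _ h => h.2, ?_⟩
  refine lt_of_le_of_lt (le_of_eq ?_) hWint
  refine lintegral_congr_ae ?_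
  filter_upwards [hboth, ae_restrict_mem measurableSet_Icc] with t ht htm
  simp only [hW, hjj t htm]
  rw [SigmaFiniteSignedMeasure.lintegral_variation_of_density
    (hhm.comp measurable_prodMk_left) ht.1 ht.2 hdm]
  rfl

/-- The measure `dt θ` on `[0,T] × V × V`. -/
def timeθ (S : JumpSystem V) (T : ℝ) : Measure (ℝ × V × V) := (volume.restrict (Icc 0 T)).prod S.θ

lemma Assumptions.integrable_mul_flux (hS : S.Assumptions) {T : ℝ} {h : ℝ → V × V → ℝ}
    (hh : Measurable (Function.uncurry h))
    (hmom : ∫⁻ t in Icc 0 T, ∫⁻ e, ‖h t e‖ₑ * ENNReal.ofReal (truncDist e) ∂S.θ < ∞)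
    {F : ℝ × V × V → ℝ} (hF : Measurable F) {C : ℝ} (hC : ∀ p, |F p| ≤ C * truncDist p.2) :
    Integrable (fun p => F p * h p.1 p.2) (S.timeθ T) := by
  have hsf := hS.sigmaFinite_θ
  have hdm : Measurable fun e : V × V => ENNReal.ofReal (truncDist e) :=
    measurable_truncDist.ennreal_ofReal
  refine ⟨(hF.mul hh).aestronglyMeasurable, ?_⟩
  have hm : Measurable fun p : ℝ × V × V => ‖h p.1 p.2‖ₑ * ENNReal.ofReal (truncDist p.2) :=
    (hh.enorm).mul (hdm.comp measurable_snd)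
  calc ∫⁻ p, ‖F p * h p.1 p.2‖ₑ ∂S.timeθ T
      ≤ ∫⁻ p, ENNReal.ofReal C * (‖h p.1 p.2‖ₑ * ENNReal.ofReal (truncDist p.2)) ∂S.timeθ T := by
        refine lintegral_mono fun p => ?_
        rw [enorm_mul, mul_comm ‖h _ _‖ₑ, ← mul_assoc, ← ENNReal.ofReal_mul' (truncDist_nonneg _)]
        gcongr
        rw [← ofReal_norm]
        exact ENNReal.ofReal_le_ofReal (hC p)
    _ = ENNReal.ofReal C * ∫⁻ t in Icc 0 T, ∫⁻ e, ‖h t e‖ₑ * ENNReal.ofReal (truncDist e) ∂S.θ := by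
        rw [lintegral_const_mul _ hm, timeθ, lintegral_prod _ hm.aemeasurable]
    _ < ∞ := ENNReal.mul_lt_top ENNReal.ofReal_lt_top hmom

lemma Assumptions.restrict_timeθ (hS : S.Assumptions) {T s t : ℝ} (hs : 0 ≤ s) (ht : t ≤ T) :
    (S.timeθ T).restrict (Icc s t ×ˢ univ) = (volume.restrict (Icc s t)).prod S.θ := by
  have hsf := hS.sigmaFinite_θ
  rw [timeθ, ← Measure.prod_restrict, Measure.restrict_univ,
    Measure.restrict_restrict measurableSet_Icc, inter_eq_left.2 (Icc_subset_Icc hs ht)]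

lemma Assumptions.setIntegral_timeθ (hS : S.Assumptions) {T s t : ℝ} (hs : 0 ≤ s) (hst : s ≤ t)
    (ht : t ≤ T) {F : ℝ × V × V → ℝ} (hF : IntegrableOn F (Icc s t ×ˢ univ) (S.timeθ T)) :
    ∫ r in s..t, ∫ e, F (r, e) ∂S.θ = ∫ p in Icc s t ×ˢ univ, F p ∂S.timeθ T := by
  have hsf := hS.sigmaFinite_θ
  rw [IntegrableOn, hS.restrict_timeθ hs ht] at hF
  rw [hS.restrict_timeθ hs ht, integral_prod _ hF, intervalIntegral.integral_of_le hst,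
    integral_Icc_eq_integral_Ioc]

lemma Assumptions.setLIntegral_timeθ (hS : S.Assumptions) {T s t : ℝ} (hs : 0 ≤ s)
    (ht : t ≤ T) {F : ℝ × V × V → ℝ≥0∞} (hF : Measurable F) :
    ∫⁻ p in Icc s t ×ˢ univ, F p ∂S.timeθ T = ∫⁻ r in Icc s t, ∫⁻ e, F (r, e) ∂S.θ := by
  have hsf := hS.sigmaFinite_θ
  rw [hS.restrict_timeθ hs ht, lintegral_prod _ hF.aemeasurable]

/-- The integrand of the action, in terms of the densities. -/
def actionDensity (S : JumpSystem V) (a : V × V → ℝ) (u : ℝ → V → ℝ≥0) (h : ℝ → V × V → ℝ)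
    (p : ℝ × V × V) : ℝ≥0∞ :=
  2⁻¹ * S.perspective (2 * h p.1 p.2) ((a p.2).toNNReal * S.α (u p.1 p.2.1, u p.1 p.2.2))

/-- The integrand of the Fisher information, in terms of the densities. -/
def fisherTerm (S : JumpSystem V) (a : V × V → ℝ) (u : ℝ → V → ℝ≥0) (p : ℝ × V × V) : ℝ≥0∞ :=
  2⁻¹ * (ENNReal.ofReal (a p.2) * S.fisherDensity (u p.1 p.2.1, u p.1 p.2.2))

lemma measurable_edge_values {u : ℝ → V → ℝ≥0} (hu : Measurable (Function.uncurry u)) :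
    Measurable fun p : ℝ × V × V => (u p.1 p.2.1, u p.1 p.2.2) :=
  (hu.comp (measurable_fst.prodMk (measurable_fst.comp measurable_snd))).prodMk
    (hu.comp (measurable_fst.prodMk (measurable_snd.comp measurable_snd)))

lemma Assumptions.measurable_perspective_comp (hS : S.Assumptions) {X : Type*} [MeasurableSpace X]
    {f g : X → ℝ} (hf : Measurable f) (hg : Measurable g) :
    Measurable fun x => S.perspective (f x) (g x) :=
  (measurable_perspective hS).comp (hf.prodMk hg)

lemma Assumptions.measurable_actionDensity (hS : S.Assumptions) {a : V × V → ℝ}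
    (ha : Measurable a) {u : ℝ → V → ℝ≥0} {h : ℝ → V × V → ℝ}
    (hu : Measurable (Function.uncurry u)) (hh : Measurable (Function.uncurry h)) :
    Measurable (S.actionDensity a u h) := by
  have h0 : Measurable fun p : ℝ × V × V => 2 * h p.1 p.2 :=
    Measurable.const_mul (f := fun p : ℝ × V × V => h p.1 p.2) hh 2
  have h1 : Measurable fun p : ℝ × V × V =>
      (((a p.2).toNNReal : ℝ) * (S.α (u p.1 p.2.1, u p.1 p.2.2) : ℝ)) :=
    ((ha.comp measurable_snd).real_toNNReal.coe_nnreal_real).mul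
      (hS.α_continuous.measurable.comp (measurable_edge_values hu)).coe_nnreal_real
  exact (hS.measurable_perspective_comp h0 h1).const_mul 2⁻¹

lemma measurable_fisherTerm {a : V × V → ℝ}
    (ha : Measurable a) {u : ℝ → V → ℝ≥0} (hu : Measurable (Function.uncurry u)) :
    Measurable (S.fisherTerm a u) := by
  have h1 : Measurable fun p : ℝ × V × V =>
      ENNReal.ofReal (a p.2) * S.fisherDensity (u p.1 p.2.1, u p.1 p.2.2) :=
    ((ha.comp measurable_snd).ennreal_ofReal).mul
      (S.lowerSemicontinuous_fisherDensity.measurable.comp (measurable_edge_values hu))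
  exact h1.const_mul 2⁻¹

namespace Represents

variable {T : ℝ} {ρ : ℝ → FiniteMeasure V} {j : ℝ → SigmaFiniteSignedMeasure (V × V)}
  {u : ℝ → V → ℝ≥0} {h : ℝ → V × V → ℝ} {a : V × V → ℝ}

lemma action_eq (hR : Represents S T ρ j u h) (hS : S.Assumptions) (ha : Multiplier a)
     :
    ∀ᵐ r ∂volume.restrict (Icc 0 T), (S.reweight a).action (ρ r) (j r)
      = ∫⁻ e, S.actionDensity a u h (r, e) ∂S.θ := by
  filter_upwards [hR.pos_eq, hR.neg_eq, ae_restrict_mem measurableSet_Icc] with r hp hn hr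
  have h0 : Measurable fun e => 2 * h r e :=
    Measurable.const_mul (f := fun e => h r e) (hR.measurable_h.comp measurable_prodMk_left) 2
  have h2 : Measurable fun e : V × V => (((a e).toNNReal : ℝ) * (S.α (u r e.1, u r e.2) : ℝ)) :=
    (ha.measurable.real_toNNReal.coe_nnreal_real).mul
      (hS.α_continuous.measurable.comp
        ((measurable_edge_values hR.measurable_u).comp measurable_prodMk_left)).coe_nnreal_real
  have h1 := hS.measurable_perspective_comp h0 h2
  rw [hS.action_reweight ha (hR.measurable_u.comp measurable_prodMk_left) (hR.ρ_eq r hr)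
    (hR.measurable_h.comp measurable_prodMk_left) hp hn]
  simp only [actionDensity]
  rw [lintegral_const_mul _ h1]
  rfl

lemma fisher_eq (hR : Represents S T ρ j u h) (hS : S.Assumptions) (ha : Multiplier a)
    {r : ℝ} (hr : r ∈ Icc 0 T) : (S.reweight a).fisher (ρ r)
      = ∫⁻ e, S.fisherTerm a u (r, e) ∂S.θ := by
  have h1 : Measurable fun e => ENNReal.ofReal (a e) * S.fisherDensity (u r e.1, u r e.2) :=
    ha.measurable.ennreal_ofReal.mul (S.lowerSemicontinuous_fisherDensity.measurable.comp
      ((measurable_edge_values hR.measurable_u).comp measurable_prodMk_left))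
  rw [hS.fisher_reweight ha (hR.measurable_u.comp measurable_prodMk_left) (hR.ρ_eq r hr)]
  simp only [fisherTerm]
  rw [lintegral_const_mul _ h1]
  rfl

lemma entropy_eq (hR : Represents S T ρ j u h) (hS : S.Assumptions) {r : ℝ} (hr : r ∈ Icc 0 T) :
    S.entropy (ρ r) = ∫⁻ x, ENNReal.ofReal (S.φ (u r x)) ∂S.π :=
  hS.entropy_eq (hR.measurable_u.comp measurable_prodMk_left) (hR.ρ_eq r hr)

lemma lintegral_action (hR : Represents S T ρ j u h) (hS : S.Assumptions) (ha : Multiplier a)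
    {s t : ℝ} (hs : 0 ≤ s) (ht : t ≤ T) :
    ∫⁻ r in Icc s t, (S.reweight a).action (ρ r) (j r)
      = ∫⁻ p in Icc s t ×ˢ univ, S.actionDensity a u h p ∂S.timeθ T := by
  rw [hS.setLIntegral_timeθ hs ht
    (hS.measurable_actionDensity ha.measurable hR.measurable_u hR.measurable_h)]
  exact lintegral_congr_ae (ae_restrict_of_ae_restrict_of_subset (Icc_subset_Icc hs ht)
    (hR.action_eq hS ha))

lemma lintegral_fisher (hR : Represents S T ρ j u h) (hS : S.Assumptions) (ha : Multiplier a)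
    {s t : ℝ} (hs : 0 ≤ s) (ht : t ≤ T) :
    ∫⁻ r in Icc s t, (S.reweight a).fisher (ρ r)
      = ∫⁻ p in Icc s t ×ˢ univ, S.fisherTerm a u p ∂S.timeθ T := by
  rw [hS.setLIntegral_timeθ hs ht (measurable_fisherTerm ha.measurable hR.measurable_u)]
  exact setLIntegral_congr_fun measurableSet_Icc fun r hr =>
    hR.fisher_eq hS ha (Icc_subset_Icc hs ht hr)

lemma lintegral_add (hR : Represents S T ρ j u h) (hS : S.Assumptions) (ha : Multiplier a)
    {s t : ℝ} (hs : 0 ≤ s) (ht : t ≤ T) :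
    ∫⁻ r in Icc s t, ((S.reweight a).action (ρ r) (j r) + (S.reweight a).fisher (ρ r))
      = (∫⁻ p in Icc s t ×ˢ univ, S.actionDensity a u h p ∂S.timeθ T)
        + ∫⁻ p in Icc s t ×ˢ univ, S.fisherTerm a u p ∂S.timeθ T := by
  have hsf := hS.sigmaFinite_θ
  have hm := hS.measurable_actionDensity ha.measurable hR.measurable_u hR.measurable_h
  rw [← hR.lintegral_action hS ha hs ht, ← hR.lintegral_fisher hS ha hs ht]
  -- The action is known to be a measurable function of time only up to a null set, through its
  -- expression by densities.
  refine lintegral_add_left' ?_ _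
  refine AEMeasurable.congr (f := fun r => ∫⁻ e, S.actionDensity a u h (r, e) ∂S.θ)
    (Measurable.lintegral_prod_right' hm).aemeasurable ?_
  filter_upwards [ae_restrict_of_ae_restrict_of_subset (Icc_subset_Icc hs ht)
    (hR.action_eq hS ha)] with r hr using hr.symm

lemma integral_eq (hR : Represents S T ρ j u h) {r : ℝ} (hr : r ∈ Icc 0 T) (f : V → ℝ) :
    ∫ x, f x ∂(ρ r : Measure V) = ∫ x, f x * u r x ∂S.π := by
  have hu : Measurable (u r) := hR.measurable_u.comp measurable_prodMk_left
  rw [hR.ρ_eq r hr, integral_withDensity_eq_integral_smul hu]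
  simp [NNReal.smul_def, mul_comm]

/-- The time integral of the flux tested with `F`, in terms of the densities. -/
lemma integral_flux_eq (hR : Represents S T ρ j u h) (hS : S.Assumptions) {s t : ℝ}
    (hs : 0 ≤ s) (hst : s ≤ t) (ht : t ≤ T) {F : V × V → ℝ} (hF : Measurable F)
    (hint : IntegrableOn (fun p => F p.2 * h p.1 p.2) (Icc s t ×ˢ univ) (S.timeθ T)) :
    ∫ r in s..t, (j r).integral F
      = ∫ p in Icc s t ×ˢ univ, F p.2 * h p.1 p.2 ∂S.timeθ T := by
  have hsf := hS.sigmaFinite_θ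
  rw [← hS.setIntegral_timeθ hs hst ht hint]
  rw [IntegrableOn, hS.restrict_timeθ hs ht] at hint
  rw [intervalIntegral.integral_of_le hst, intervalIntegral.integral_of_le hst,
    ← integral_Icc_eq_integral_Ioc, ← integral_Icc_eq_integral_Ioc]
  refine integral_congr_ae ?_
  filter_upwards [ae_restrict_of_ae_restrict_of_subset (Icc_subset_Icc hs ht) hR.pos_eq,
    ae_restrict_of_ae_restrict_of_subset (Icc_subset_Icc hs ht) hR.neg_eq,
    hint.prod_right_ae] with r hp hn hi
  exact SigmaFiniteSignedMeasure.integral_eq_of_density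
    (hR.measurable_h.comp measurable_prodMk_left) hp hn hF hi

end Represents

lemma Assumptions.exists_measurable_u (hS : S.Assumptions) {ρ : ℝ → FiniteMeasure V}
    (hm : Measurable fun t => (ρ t : Measure V)) (hb : ∃ C : ℝ≥0, ∀ t, (ρ t : Measure V) univ ≤ C)
    (hac : ∀ t, (ρ t : Measure V) ≪ S.π) :
    ∃ u : ℝ → V → ℝ≥0, Measurable (Function.uncurry u) ∧
      ∀ t, (ρ t : Measure V) = S.π.withDensity fun x => u t x := by
  have := hS.finite_π
  obtain ⟨C, hC⟩ := hb
  let κ : Kernel ℝ V := ⟨fun t => (ρ t : Measure V), hm⟩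
  have hκ : IsFiniteKernel κ := ⟨C, ENNReal.coe_lt_top, hC⟩
  let η : Kernel ℝ V := Kernel.const ℝ S.π
  refine ⟨fun t x => (Kernel.rnDeriv κ η t x).toNNReal,
    (Kernel.measurable_rnDeriv κ η).ennreal_toNNReal, fun t => ?_⟩
  conv_lhs => rw [← Measure.withDensity_rnDeriv_eq _ _ (hac t)]
  refine withDensity_congr_ae ?_
  have h1 : Kernel.rnDeriv κ η t =ᵐ[S.π] (ρ t : Measure V).rnDeriv S.π :=
    Kernel.rnDeriv_eq_rnDeriv_measure
  filter_upwards [h1, Measure.rnDeriv_lt_top (ρ t : Measure V) S.π] with x hx hx'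
  rw [hx, ENNReal.coe_toNNReal hx'.ne]

/-- Measurability of `t ↦ ρ t` is not part of the continuity equation, but the equation makes `t ↦ ∫
f dρ t` continuous for bounded Lipschitz `f`, which suffices. The kernel Radon–Nikodym derivative
then yields a jointly measurable density. -/
lemma Assumptions.exists_represents (hS : S.Assumptions) {a : V × V → ℝ} (ha : Multiplier a)
    {T : ℝ} (hT : 0 ≤ T) {ρ : ℝ → FiniteMeasure V} {j : ℝ → SigmaFiniteSignedMeasure (V × V)}
    (hc : ContinuityEquation T ρ j)
    (hρ : ∀ t ∈ Icc 0 T, (ρ t : Measure V) ≪ S.π)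
    (hE : ∫⁻ t in Icc 0 T, ((S.reweight a).action (ρ t) (j t) + (S.reweight a).fisher (ρ t)) < ∞) :
    ∃ u h, Represents S T ρ j u h := by
  obtain ⟨h, hhm, hp, hn, hmom⟩ := hS.exists_flux_density ha hT hc hρ hE
  have hsf := hS.sigmaFinite_θ
  set ρ' : ℝ → FiniteMeasure V := fun t => ρ (projIcc 0 T hT t) with hρ'
  have hrep : ∀ f : V → ℝ, (∃ K, LipschitzWith K f) → (∃ C, ∀ x, |f x| ≤ C) →
      Measurable fun t => ∫ x, f x ∂(ρ' t : Measure V) := by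
    rintro f ⟨K, hK⟩ ⟨C, hC⟩
    have hbd : ∀ p : ℝ × V × V, |graphGradient f p.2| ≤ max (K : ℝ) (2 * C) * truncDist p.2 :=
      fun p => abs_graphGradient_le hK hC p.2
    have hgm : Measurable (graphGradient f) := measurable_graphGradient hK.continuous.measurable
    have hint := hS.integrable_mul_flux hhm hmom (hgm.comp measurable_snd) hbd
    have hii : Integrable (fun r => ∫ e, graphGradient f e * h r e ∂S.θ) (volume.restrict (Icc 0 T)) :=
      hint.integral_prod_left
    have hcont : ContinuousOn (fun t => ∫ x, f x ∂(ρ t : Measure V)) (Icc 0 T) := by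
      have h1 : ∀ t ∈ Icc 0 T, ∫ x, f x ∂(ρ t : Measure V)
          = (∫ x, f x ∂(ρ 0 : Measure V)) + ∫ r in (0 : ℝ)..t, ∫ e, graphGradient f e * h r e ∂S.θ := by
        intro t ht
        have h2 := hc.equation f ⟨K, hK⟩ ⟨C, hC⟩ 0 t le_rfl ht.1 ht.2
        rw [sub_eq_iff_eq_add'] at h2
        rw [h2]
        congr 1
        rw [intervalIntegral.integral_of_le ht.1, intervalIntegral.integral_of_le ht.1,
          ← integral_Icc_eq_integral_Ioc, ← integral_Icc_eq_integral_Ioc]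
        refine integral_congr_ae ?_
        have hsub := Icc_subset_Icc (le_refl (0 : ℝ)) ht.2
        filter_upwards [ae_restrict_of_ae_restrict_of_subset hsub hp,
          ae_restrict_of_ae_restrict_of_subset hsub hn,
          ae_restrict_of_ae_restrict_of_subset hsub hint.prod_right_ae] with r hp hn hi
        exact SigmaFiniteSignedMeasure.integral_eq_of_density
          (hhm.comp measurable_prodMk_left) hp hn hgm hi
      refine ContinuousOn.congr ?_ h1
      refine continuousOn_const.add ?_
      have h3 := intervalIntegral.continuousOn_primitive_interval (μ := volume) (a := 0) (b := T)
        (f := fun r => ∫ e, graphGradient f e * h r e ∂S.θ) (by rw [uIcc_of_le hT]; exact hii)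
      rwa [uIcc_of_le hT] at h3
    have h4 := hcont.comp_continuous (continuous_subtype_val.comp continuous_projIcc)
      (fun t => (projIcc 0 T hT t).2)
    exact h4.measurable
  -- Testing with constants shows conservation of mass, which supplies the uniform bound for a
  -- finite kernel.
  have hmass : ∀ t ∈ Icc 0 T, (ρ t : Measure V) univ = (ρ 0 : Measure V) univ := by
    intro t ht
    have h2 := hc.equation (fun _ => 1) ⟨0, LipschitzWith.const 1⟩ ⟨1, fun x => by simp⟩ 0 t le_rfl
      ht.1 ht.2
    have h3 : graphGradient (fun _ : V => (1 : ℝ)) = fun _ => 0 := by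
      ext e; simp [graphGradient]
    rw [h3] at h2
    simp only [SigmaFiniteSignedMeasure.integral, integral_zero, sub_self,
      intervalIntegral.integral_zero, integral_const, smul_eq_mul, mul_one, sub_eq_zero,
      Measure.real] at h2
    exact (ENNReal.toReal_eq_toReal_iff' (measure_ne_top _ _) (measure_ne_top _ _)).1 h2
  obtain ⟨u, hum, hu⟩ := hS.exists_measurable_u (ρ := ρ') (measurable_of_lipschitz hrep)
    ⟨(ρ 0).mass, fun t => by
      rw [hmass _ (projIcc 0 T hT t).2]; simp⟩ (fun t => hρ _ (projIcc 0 T hT t).2)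
  refine ⟨u, h, hum, hhm, fun t ht => ?_, hp, hn, hmom⟩
  rw [← hu t]
  simp only [hρ', projIcc_of_mem hT ht]

end JumpSystem

/-! ### The continuity equation and setwise convergence in density form -/

namespace JumpSystem

variable {V : Type*} [MetricSpace V] [SecondCountableTopology V] [MeasurableSpace V]
  [BorelSpace V] {S : JumpSystem V}

/-- The continuity equation in terms of densities. -/
structure DensityCurve (S : JumpSystem V) (T : ℝ) (u : ℝ → V → ℝ≥0) (h : ℝ → V × V → ℝ) :
    Prop where
  measurable_u : Measurable (Function.uncurry u)
  measurable_h : Measurable (Function.uncurry h)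
  mass : ∀ t ∈ Icc 0 T, ∫⁻ x, u t x ∂S.π < ∞
  moment : ∫⁻ t in Icc 0 T, ∫⁻ e, ‖h t e‖ₑ * ENNReal.ofReal (truncDist e) ∂S.θ < ∞
  equation : ∀ f : V → ℝ, (∃ K, LipschitzWith K f) → (∃ C, ∀ x, |f x| ≤ C) →
    ∀ s t, 0 ≤ s → s ≤ t → t ≤ T →
      (∫ x, f x * u t x ∂S.π) - ∫ x, f x * u s x ∂S.π
        = ∫ p in Icc s t ×ˢ univ, graphGradient f p.2 * h p.1 p.2 ∂S.timeθ T

lemma Assumptions.integrable_graphGradient_mul (hS : S.Assumptions) {T : ℝ} {h : ℝ → V × V → ℝ}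
    (hh : Measurable (Function.uncurry h))
    (hmom : ∫⁻ t in Icc 0 T, ∫⁻ e, ‖h t e‖ₑ * ENNReal.ofReal (truncDist e) ∂S.θ < ∞)
    {f : V → ℝ} (hf : ∃ K, LipschitzWith K f) (hb : ∃ C, ∀ x, |f x| ≤ C) :
    Integrable (fun p => graphGradient f p.2 * h p.1 p.2) (S.timeθ T) := by
  obtain ⟨K, hK⟩ := hf
  obtain ⟨C, hC⟩ := hb
  exact hS.integrable_mul_flux hh hmom
    ((measurable_graphGradient hK.continuous.measurable).comp measurable_snd)
    fun p => abs_graphGradient_le hK hC p.2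

lemma Represents.densityCurve {T : ℝ} {ρ : ℝ → FiniteMeasure V}
    {j : ℝ → SigmaFiniteSignedMeasure (V × V)} {u : ℝ → V → ℝ≥0} {h : ℝ → V × V → ℝ}
    (hR : Represents S T ρ j u h) (hS : S.Assumptions) (hc : ContinuityEquation T ρ j) :
    DensityCurve S T u h where
  measurable_u := hR.measurable_u
  measurable_h := hR.measurable_h
  mass t ht := by
    have h1 : (ρ t : Measure V) univ < ∞ := measure_lt_top _ _
    rwa [hR.ρ_eq t ht, withDensity_apply _ MeasurableSet.univ, Measure.restrict_univ] at h1
  moment := hR.moment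
  equation f hf hb s t hs hst ht := by
    have hi := hS.integrable_graphGradient_mul hR.measurable_h hR.moment hf hb
    rw [← hR.integral_flux_eq hS hs hst ht
      (measurable_graphGradient hf.choose_spec.continuous.measurable) hi.integrableOn,
      ← hR.integral_eq ⟨hs, hst.trans ht⟩, ← hR.integral_eq ⟨hs.trans hst, ht⟩]
    exact hc.equation f hf hb s t hs hst ht

/-- The signed measure with a given density. -/
def signedOfDensity (hS : S.Assumptions) (h : V × V → ℝ) (hh : Measurable h) :
    SigmaFiniteSignedMeasure (V × V) where
  pos := S.θ.withDensity fun e => ENNReal.ofReal (h e)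
  neg := S.θ.withDensity fun e => ENNReal.ofReal (-h e)
  sigmaFinite_pos := have := hS.sigmaFinite_θ; SigmaFinite.withDensity_ofReal _
  sigmaFinite_neg := have := hS.sigmaFinite_θ; SigmaFinite.withDensity_ofReal _
  mutuallySingular := by
    refine ⟨{e | h e ≤ 0}, measurableSet_le hh measurable_const, ?_, ?_⟩
    · rw [withDensity_apply _ (measurableSet_le hh measurable_const)]
      refine (setLIntegral_congr_fun (measurableSet_le hh measurable_const)
        fun e he => ENNReal.ofReal_of_nonpos he).trans (by simp)
    · rw [withDensity_apply _ (measurableSet_le hh measurable_const).compl]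
      refine (setLIntegral_congr_fun (measurableSet_le hh measurable_const).compl
        fun e he => ENNReal.ofReal_of_nonpos ?_).trans (by simp)
      simp only [mem_compl_iff, mem_ofPred_eq, not_le] at he
      linarith

lemma Assumptions.measurable_withDensity (hS : S.Assumptions) {F : ℝ → V × V → ℝ≥0∞}
    (hF : Measurable (Function.uncurry F)) : Measurable fun t => S.θ.withDensity (F t) := by
  have hsf := hS.sigmaFinite_θ
  refine Measure.measurable_of_measurable_coe _ fun B hB => ?_
  simp_rw [withDensity_apply _ hB, ← lintegral_indicator hB]
  have h1 : Measurable fun p : ℝ × V × V => B.indicator (F p.1) p.2 := by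
    have : (fun p : ℝ × V × V => B.indicator (F p.1) p.2)
        = (Prod.snd ⁻¹' B).indicator (Function.uncurry F) := by
      ext p; by_cases hp : p.2 ∈ B <;> simp [Function.uncurry, hp, indicator]
    rw [this]
    exact hF.indicator (measurable_snd hB)
  exact Measurable.lintegral_prod_right' h1

/-- A curve in density form comes from a curve of measures. -/
lemma DensityCurve.exists_represents {T : ℝ} {u : ℝ → V → ℝ≥0} {h : ℝ → V × V → ℝ}
    (hc : DensityCurve S T u h) (hS : S.Assumptions) (hT : 0 ≤ T) :
    ∃ ρ j, Represents S T ρ j u h ∧ ContinuityEquation T ρ j := by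
  have hut : ∀ t, Measurable (u t) := fun t => hc.measurable_u.comp measurable_prodMk_left
  have hht : ∀ t, Measurable (h t) := fun t => hc.measurable_h.comp measurable_prodMk_left
  have hfin : ∀ t, IsFiniteMeasure (S.π.withDensity fun x => (u (projIcc 0 T hT t) x : ℝ≥0∞)) :=
    fun t => isFiniteMeasure_withDensity (hc.mass _ (projIcc 0 T hT t).2).ne
  set ρ : ℝ → FiniteMeasure V := fun t => ⟨_, hfin t⟩ with hρ
  set j : ℝ → SigmaFiniteSignedMeasure (V × V) := fun t => signedOfDensity hS (h t) (hht t) with hj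
  have hR : Represents S T ρ j u h := by
    refine ⟨hc.measurable_u, hc.measurable_h, fun t ht => ?_, ae_of_all _ fun t => rfl,
      ae_of_all _ fun t => rfl, hc.moment⟩
    simp only [hρ, FiniteMeasure.toMeasure_mk, projIcc_of_mem hT ht]
  have hm1 : Measurable fun p : ℝ × V × V => ENNReal.ofReal (h p.1 p.2) :=
    Measurable.ennreal_ofReal hc.measurable_h
  have hm2 : Measurable fun p : ℝ × V × V => ENNReal.ofReal (-h p.1 p.2) :=
    Measurable.ennreal_ofReal (Measurable.neg hc.measurable_h)
  refine ⟨ρ, j, hR, ⟨?_, ?_, fun t ht => ?_, ?_, ?_⟩⟩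
  · exact (hS.measurable_withDensity (F := fun t e => ENNReal.ofReal (h t e)) hm1).comp
      measurable_subtype_coe
  · exact (hS.measurable_withDensity (F := fun t e => ENNReal.ofReal (-h t e)) hm2).comp
      measurable_subtype_coe
  · rw [SigmaFiniteSignedMeasure.variation, Measure.add_apply]
    exact add_eq_zero.2 ⟨withDensity_absolutelyContinuous _ _ hS.θ_diag,
      withDensity_absolutelyContinuous _ _ hS.θ_diag⟩
  · refine lt_of_le_of_lt (le_of_eq ?_) hc.moment
    refine lintegral_congr fun t => ?_
    exact SigmaFiniteSignedMeasure.lintegral_variation_of_density (hht t) rfl rfl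
      measurable_truncDist.ennreal_ofReal
  · intro f hf hb s t hs hst ht
    have hi := hS.integrable_graphGradient_mul hc.measurable_h hc.moment hf hb
    rw [hR.integral_flux_eq hS hs hst ht
      (measurable_graphGradient hf.choose_spec.continuous.measurable) hi.integrableOn,
      hR.integral_eq ⟨hs, hst.trans ht⟩, hR.integral_eq ⟨hs.trans hst, ht⟩]
    exact hc.equation f hf hb s t hs hst ht

lemma Assumptions.timeIntegrated_eq (hS : S.Assumptions) {T : ℝ} {μ : ℝ → Measure (V × V)}
    {F : ℝ → V × V → ℝ≥0∞} (hF : Measurable (Function.uncurry F))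
    (hμ : ∀ᵐ t ∂volume.restrict (Icc 0 T), μ t = S.θ.withDensity (F t)) :
    timeIntegrated T μ = (S.timeθ T).withDensity fun p => F p.1 p.2 := by
  have hsf := hS.sigmaFinite_θ
  have hFt : ∀ t, Measurable (F t) := fun t => hF.comp measurable_prodMk_left
  have h1 : timeIntegrated T μ = timeIntegrated T fun t => S.θ.withDensity (F t) := by
    unfold timeIntegrated Measure.bind
    congr 1
    refine Measure.map_congr ?_
    filter_upwards [hμ] with t ht
    rw [ht]
  have key : ∀ B, MeasurableSet B → ∀ t, ((S.θ.withDensity (F t)).map (Prod.mk t)) B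
      = ∫⁻ e, B.indicator (fun p => F p.1 p.2) (t, e) ∂S.θ := by
    intro B hB t
    have hB' : MeasurableSet (Prod.mk t ⁻¹' B) := measurable_prodMk_left hB
    rw [Measure.map_apply measurable_prodMk_left hB, withDensity_apply _ hB',
      ← lintegral_indicator hB']
    rfl
  have hm : Measurable fun t => (S.θ.withDensity (F t)).map (Prod.mk t) := by
    refine Measure.measurable_of_measurable_coe _ fun B hB => ?_
    simp_rw [key B hB]
    exact Measurable.lintegral_prod_right' (f := B.indicator fun p : ℝ × V × V => F p.1 p.2)
      (Measurable.indicator hF hB)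
  rw [h1]
  ext B hB
  have hI : AEMeasurable (B.indicator fun p : ℝ × V × V => F p.1 p.2)
    ((volume.restrict (Icc 0 T)).prod S.θ) := (Measurable.indicator hF hB).aemeasurable
  rw [timeIntegrated, Measure.bind_apply hB hm.aemeasurable, withDensity_apply _ hB,
    ← lintegral_indicator hB, timeθ, lintegral_prod _ hI]
  exact lintegral_congr fun t => key B hB t

/-- Convergence of flux densities gives `σ`-setwise convergence of the fluxes. -/
lemma Assumptions.fluxTendsto (hS : S.Assumptions) {T : ℝ}
    {ρn : ℕ → ℝ → FiniteMeasure V} {jn : ℕ → ℝ → SigmaFiniteSignedMeasure (V × V)}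
    {un : ℕ → ℝ → V → ℝ≥0} {hn : ℕ → ℝ → V × V → ℝ}
    (hRn : ∀ n, Represents S T (ρn n) (jn n) (un n) (hn n))
    {ρ : ℝ → FiniteMeasure V} {j : ℝ → SigmaFiniteSignedMeasure (V × V)}
    {u : ℝ → V → ℝ≥0} {h : ℝ → V × V → ℝ} (hR : Represents S T ρ j u h)
    (hlim : ∀ k B, MeasurableSet B → Tendsto
      (fun n => ∫ p in B ∩ univ ×ˢ longEdges V k, hn n p.1 p.2 ∂S.timeθ T) atTop
      (𝓝 (∫ p in B ∩ univ ×ˢ longEdges V k, h p.1 p.2 ∂S.timeθ T))) :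
    FluxTendsto T jn j := by
  have hsf := hS.sigmaFinite_θ
  have hA : ∀ k, MeasurableSet ((univ : Set ℝ) ×ˢ longEdges V k) := fun k =>
    MeasurableSet.univ.prod (measurableSet_longEdges k)
  have hpos : ∀ {ρ : ℝ → FiniteMeasure V} {j : ℝ → SigmaFiniteSignedMeasure (V × V)}
    {u : ℝ → V → ℝ≥0} {h : ℝ → V × V → ℝ}, Represents S T ρ j u h →
      (timeIntegrated T fun t => (j t).pos)
        = (S.timeθ T).withDensity fun p => ENNReal.ofReal (h p.1 p.2) := fun {ρ j u h} hR =>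
    hS.timeIntegrated_eq (F := fun t e => ENNReal.ofReal (h t e))
      (Measurable.ennreal_ofReal hR.measurable_h) hR.pos_eq
  have hneg : ∀ {ρ : ℝ → FiniteMeasure V} {j : ℝ → SigmaFiniteSignedMeasure (V × V)}
    {u : ℝ → V → ℝ≥0} {h : ℝ → V × V → ℝ}, Represents S T ρ j u h →
      (timeIntegrated T fun t => (j t).neg)
        = (S.timeθ T).withDensity fun p => ENNReal.ofReal (-h p.1 p.2) := fun {ρ j u h} hR =>
    hS.timeIntegrated_eq (F := fun t e => ENNReal.ofReal (-h t e))
      (Measurable.ennreal_ofReal (Measurable.neg hR.measurable_h)) hR.neg_eq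
  have hint : ∀ {ρ : ℝ → FiniteMeasure V} {j : ℝ → SigmaFiniteSignedMeasure (V × V)}
    {u : ℝ → V → ℝ≥0} {h : ℝ → V × V → ℝ}, Represents S T ρ j u h → ∀ k,
      IntegrableOn (fun p : ℝ × V × V => h p.1 p.2) (univ ×ˢ longEdges V k) (S.timeθ T) := by
    intro ρ j u h hR k
    have hne : ∀ᵐ p ∂S.timeθ T, 0 < truncDist p.2 :=
      Measure.quasiMeasurePreserving_snd.ae (p := fun e : V × V => 0 < truncDist e) hS.ae_ne
    -- The diagonal included in `longEdges` is `θ`-null, so this cut-off agrees almost everywhere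
    -- with its indicator; being at most `(k + 1)(1 ∧ d)`, it is controlled by the moment of the
    -- flux.
    set F : ℝ × V × V → ℝ := fun p => if 1 / ((k : ℝ) + 1) ≤ truncDist p.2 then 1 else 0 with hFd
    have hFm : Measurable F := Measurable.ite
      (measurableSet_le measurable_const (measurable_truncDist.comp measurable_snd))
      measurable_const measurable_const
    have h1 := hS.integrable_mul_flux hR.measurable_h hR.moment hFm (C := (k : ℝ) + 1) (by
      intro p
      simp only [hFd]
      split_ifs with hp
      · rw [abs_one]
        rwa [div_le_iff₀' (by positivity)] at hp
      · rw [abs_zero]; have := truncDist_nonneg p.2; positivity)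
    rw [← integrable_indicator_iff (hA k)]
    refine h1.congr ?_
    filter_upwards [hne] with p hp
    have hnd : p.2.1 ≠ p.2.2 := fun h => by
      rw [truncDist, h, dist_self] at hp; simp at hp
    simp only [hFd, indicator, mem_prod, mem_univ, true_and, longEdges, mem_union, mem_ofPred_eq,
      hnd, or_false]
    split_ifs <;> simp
  have hfinite : ∀ {ρ : ℝ → FiniteMeasure V} {j : ℝ → SigmaFiniteSignedMeasure (V × V)}
    {u : ℝ → V → ℝ≥0} {h : ℝ → V × V → ℝ}, Represents S T ρ j u h → ∀ k,
      ((S.timeθ T).withDensity fun p => ENNReal.ofReal (h p.1 p.2)) (univ ×ˢ longEdges V k) < ∞ ∧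
      ((S.timeθ T).withDensity fun p => ENNReal.ofReal (-h p.1 p.2)) (univ ×ˢ longEdges V k) < ∞ := by
    intro ρ j u h hR k
    rw [withDensity_apply _ (hA k), withDensity_apply _ (hA k)]
    exact ⟨(hint hR k).lintegral_lt_top, (hint hR k).neg.lintegral_lt_top⟩
  have hdiff : ∀ {ρ : ℝ → FiniteMeasure V} {j : ℝ → SigmaFiniteSignedMeasure (V × V)}
    {u : ℝ → V → ℝ≥0} {h : ℝ → V × V → ℝ}, Represents S T ρ j u h → ∀ k B, MeasurableSet B →
      (((S.timeθ T).withDensity fun p => ENNReal.ofReal (h p.1 p.2))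
        (B ∩ univ ×ˢ longEdges V k)).toReal
      - (((S.timeθ T).withDensity fun p => ENNReal.ofReal (-h p.1 p.2))
        (B ∩ univ ×ˢ longEdges V k)).toReal
      = ∫ p in B ∩ univ ×ˢ longEdges V k, h p.1 p.2 ∂S.timeθ T := by
    intro ρ j u h hR k B hB
    rw [withDensity_apply _ (hB.inter (hA k)), withDensity_apply _ (hB.inter (hA k)),
      integral_eq_lintegral_pos_part_sub_lintegral_neg_part
        ((hint hR k).mono_set inter_subset_right)]
  unfold FluxTendsto
  simp only [hpos hR, hneg hR, hpos (hRn _), hneg (hRn _)]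
  refine ⟨fun k => univ ×ˢ longEdges V k, fun k l hkl => prod_mono_right (monotone_longEdges hkl), ?_,
    fun k => ⟨hA k, hfinite hR k⟩, fun n k => hfinite (hRn n) k, fun k B hB => ?_⟩
  · rw [eq_univ_iff_forall]
    intro p
    obtain ⟨k, hk⟩ := exists_mem_longEdges p.2
    exact mem_iUnion.2 ⟨k, mem_univ _, hk⟩
  · simp_rw [hdiff hR k B hB, hdiff (hRn _) k B hB]
    exact hlim k B hB

lemma setwiseTendsto_of_density {m : Measure V} {ρn : ℕ → FiniteMeasure V} {ρ : FiniteMeasure V}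
    {un : ℕ → V → ℝ≥0} {u : V → ℝ≥0} (hun : ∀ n, Measurable (un n)) (hu : Measurable u)
    (hn : ∀ n, (ρn n : Measure V) = m.withDensity fun x => un n x)
    (h : (ρ : Measure V) = m.withDensity fun x => u x) :
    SetwiseTendsto ρn ρ ↔ ∀ B, MeasurableSet B →
      Tendsto (fun n => ∫ x in B, (un n x : ℝ) ∂m) atTop (𝓝 (∫ x in B, (u x : ℝ) ∂m)) := by
  have key : ∀ {ρ : FiniteMeasure V} {u : V → ℝ≥0}, Measurable u →
      (ρ : Measure V) = m.withDensity (fun x => u x) → ∀ B, MeasurableSet B →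
      ∫ x in B, (u x : ℝ) ∂m = ((ρ : Measure V) B).toReal := by
    intro ρ u hu hρ B hB
    rw [hρ, withDensity_apply _ hB, integral_eq_lintegral_of_nonneg_ae
      (ae_of_all _ fun x => NNReal.coe_nonneg _) hu.coe_nnreal_real.aestronglyMeasurable]
    simp
  refine forall₂_congr fun B hB => ?_
  simp_rw [key hu h B hB, key (hun _) (hn _) B hB]
  rw [ENNReal.tendsto_toReal_iff (fun n => measure_ne_top _ _) (measure_ne_top _ _)]

end JumpSystem

/-! ### The finite reference measure and weak convergence along edges -/

namespace JumpSystem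

variable {V : Type*} [MetricSpace V] [SecondCountableTopology V] [MeasurableSpace V]
  [BorelSpace V] {S : JumpSystem V}

namespace Assumptions

/-- The finite measure `(1 ∧ d²) dt θ` on `[0,T] × V × V`. -/
def finiteTimeθ (hS : S.Assumptions) (T : ℝ) : Measure (ℝ × V × V) :=
  (volume.restrict (Icc 0 T)).prod hS.finiteθ

instance isFiniteMeasure_finiteTimeθ (hS : S.Assumptions) (T : ℝ) :
    IsFiniteMeasure (hS.finiteTimeθ T) := by
  unfold finiteTimeθ; infer_instance

lemma finiteTimeθ_eq (hS : S.Assumptions) (T : ℝ) : hS.finiteTimeθ T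
    = (S.timeθ T).withDensity fun p => ENNReal.ofReal (truncDist p.2 ^ 2) := by
  have hsf := hS.sigmaFinite_θ
  rw [finiteTimeθ, timeθ, finiteθ,
    prod_withDensity_right (ν := S.θ) measurable_ofReal_truncDist_sq]

lemma ae_timeθ_pos (hS : S.Assumptions) (T : ℝ) : ∀ᵐ p ∂S.timeθ T, 0 < truncDist p.2 :=
  have := hS.sigmaFinite_θ
  Measure.quasiMeasurePreserving_snd.ae (p := fun e : V × V => 0 < truncDist e) hS.ae_ne

lemma ae_finiteTimeθ (hS : S.Assumptions) {T : ℝ} {P : ℝ × V × V → Prop}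
    (h : ∀ᵐ p ∂S.timeθ T, P p) : ∀ᵐ p ∂hS.finiteTimeθ T, P p := by
  rw [finiteTimeθ_eq]
  exact (withDensity_absolutelyContinuous _ _).ae_le h

lemma timeθ_eq (hS : S.Assumptions) (T : ℝ) : S.timeθ T
    = (hS.finiteTimeθ T).withDensity fun p => ENNReal.ofReal ((truncDist p.2 ^ 2)⁻¹) := by
  have hsf := hS.sigmaFinite_θ
  have h1 : Measurable fun e : V × V => ENNReal.ofReal ((truncDist e ^ 2)⁻¹) :=
    (measurable_truncDist.pow_const 2).inv.ennreal_ofReal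
  rw [finiteTimeθ, timeθ, ← hS.withDensity_finiteθ, prod_withDensity_right h1]

lemma measurable_truncDist_sq_snd : Measurable fun p : ℝ × V × V => truncDist p.2 ^ 2 :=
  (measurable_truncDist.comp measurable_snd).pow_const 2

lemma lintegral_finiteTimeθ (hS : S.Assumptions) (T : ℝ) {F : ℝ × V × V → ℝ≥0∞}
    (hF : Measurable F) {B : Set (ℝ × V × V)} (hB : MeasurableSet B) :
    ∫⁻ p in B, F p ∂hS.finiteTimeθ T
      = ∫⁻ p in B, ENNReal.ofReal (truncDist p.2 ^ 2) * F p ∂S.timeθ T := by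
  rw [finiteTimeθ_eq, restrict_withDensity hB,
    lintegral_withDensity_eq_lintegral_mul _ measurable_truncDist_sq_snd.ennreal_ofReal hF]
  rfl

lemma integral_timeθ (hS : S.Assumptions) (T : ℝ) (F : ℝ × V × V → ℝ) :
    ∫ p, F p ∂S.timeθ T = ∫ p, (truncDist p.2 ^ 2)⁻¹ * F p ∂hS.finiteTimeθ T := by
  have hm : Measurable fun p : ℝ × V × V => ENNReal.ofReal ((truncDist p.2 ^ 2)⁻¹) :=
    measurable_truncDist_sq_snd.inv.ennreal_ofReal
  rw [hS.timeθ_eq, integral_withDensity_eq_integral_toReal_smul hm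
    (ae_of_all _ fun _ => ENNReal.ofReal_lt_top)]
  refine integral_congr_ae (ae_of_all _ fun p => ?_)
  simp only [smul_eq_mul]
  rw [ENNReal.toReal_ofReal (inv_nonneg.2 (sq_nonneg _))]

lemma finiteθ_eq_compProd (hS : S.Assumptions) : hS.finiteθ = S.π.compProd hS.finiteKernel := by
  have := hS.finite_π
  ext B hB
  rw [← lintegral_indicator_one hB, hS.lintegral_finiteθ (measurable_one.indicator hB),
    ← lintegral_indicator_one hB, Measure.lintegral_compProd (measurable_one.indicator hB)]

lemma map_swap_finiteθ (hS : S.Assumptions) : MeasurePreserving Prod.swap hS.finiteθ hS.finiteθ := by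
  refine ⟨measurable_swap, ?_⟩
  ext B hB
  rw [Measure.map_apply measurable_swap hB, ← lintegral_indicator_one (measurable_swap hB),
    ← lintegral_indicator_one hB, finiteθ,
    lintegral_withDensity_eq_lintegral_mul _ measurable_ofReal_truncDist_sq
      (measurable_one.indicator hB),
    lintegral_withDensity_eq_lintegral_mul _ measurable_ofReal_truncDist_sq
      (measurable_one.indicator (measurable_swap hB)),
    ← hS.lintegral_θ_swap (measurable_ofReal_truncDist_sq.mul (measurable_one.indicator hB))]
  refine lintegral_congr fun e => ?_
  simp only [Pi.mul_apply, truncDist_swap]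
  rfl

/-- The weighted kernel has uniformly bounded mass, and detailed balance passes the bound to the
second endpoint. Integral bounds at the vertices thus become integral bounds on edges. -/
lemma exists_lintegral_fst_le (hS : S.Assumptions) : ∃ c : ℝ≥0,
    (∀ F : V → ℝ≥0∞, Measurable F → ∫⁻ e, F e.1 ∂hS.finiteθ ≤ c * ∫⁻ x, F x ∂S.π) ∧
    (∀ F : V → ℝ≥0∞, Measurable F → ∫⁻ e, F e.2 ∂hS.finiteθ ≤ c * ∫⁻ x, F x ∂S.π) := by
  obtain ⟨c, hc⟩ := hS.exists_finiteKernel_le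
  have h1 : ∀ F : V → ℝ≥0∞, Measurable F → ∫⁻ e, F e.1 ∂hS.finiteθ ≤ c * ∫⁻ x, F x ∂S.π := by
    intro F hF
    have hF1 : Measurable fun e : V × V => F e.1 := hF.comp measurable_fst
    rw [hS.lintegral_finiteθ hF1, ← lintegral_const_mul _ hF]
    refine lintegral_mono fun x => ?_
    simp only [lintegral_const]
    rw [mul_comm]
    gcongr
    exact hc x
  refine ⟨c, h1, fun F hF => ?_⟩
  have hF2 : Measurable fun e : V × V => F e.2 := hF.comp measurable_snd
  rw [← hS.map_swap_finiteθ.lintegral_comp hF2]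
  exact h1 F hF

/-- Disintegration writes the edge integral over `B` as the integral of `w` against the bounded
function `b`, the weighted kernel mass of the sections of `B`, which is an admissible test function
for weak `L¹` convergence. -/
lemma tendsto_setIntegral_fst (hS : S.Assumptions) {w : ℕ → V → ℝ} {w' : V → ℝ}
    (hw : WeakTendsto S.π w w') {B : Set (V × V)} (hB : MeasurableSet B) :
    Tendsto (fun n => ∫ e in B, w n e.1 ∂hS.finiteθ) atTop (𝓝 (∫ e in B, w' e.1 ∂hS.finiteθ)) := by
  have := hS.finite_π
  obtain ⟨c, hc⟩ := hS.exists_finiteKernel_le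
  obtain ⟨c', hc', -⟩ := hS.exists_lintegral_fst_le
  set b : V → ℝ := fun x => (hS.finiteKernel x (Prod.mk x ⁻¹' B)).toReal with hb
  have hbm : Measurable b := (Kernel.measurable_kernel_prodMk_left hB).ennreal_toReal
  have key : ∀ f : V → ℝ, Measurable f → Integrable f S.π →
      ∫ e in B, f e.1 ∂hS.finiteθ = ∫ x, b x * f x ∂S.π := by
    intro f hfm hf
    have hint : Integrable (fun e : V × V => f e.1) hS.finiteθ := by
      refine ⟨(hfm.comp measurable_fst).aestronglyMeasurable, ?_⟩
      refine lt_of_le_of_lt (hc' (fun x => ‖f x‖ₑ) hfm.enorm) ?_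
      exact ENNReal.mul_lt_top ENNReal.coe_lt_top hf.2
    rw [← integral_indicator hB, hS.finiteθ_eq_compProd, Measure.integral_compProd]
    · refine integral_congr_ae (ae_of_all _ fun x => ?_)
      have : ∀ y, B.indicator (fun e : V × V => f e.1) (x, y)
          = (Prod.mk x ⁻¹' B).indicator (fun _ => f x) y := fun y => rfl
      simp only [this]
      rw [integral_indicator_const _ (measurable_prodMk_left hB)]
      simp [hb, Measure.real]
    · rw [← hS.finiteθ_eq_compProd]
      exact hint.indicator hB
  simp_rw [key _ (hw.equi.measurable _) (hw.equi.integrable _), key _ hw.measurable hw.integrable]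
  refine hw.integral_mul (C := c) (fun _ => hbm) hbm (fun _ => ae_of_all _ fun x => ?_)
    (ae_of_all _ fun x => tendsto_const_nhds)
  rw [← ofReal_norm, Real.norm_of_nonneg ENNReal.toReal_nonneg]
  refine (ENNReal.ofReal_toReal_le).trans ((measure_mono (subset_univ _)).trans (hc x))

lemma tendsto_setIntegral_snd (hS : S.Assumptions) {w : ℕ → V → ℝ} {w' : V → ℝ}
    (hw : WeakTendsto S.π w w') {B : Set (V × V)} (hB : MeasurableSet B) :
    Tendsto (fun n => ∫ e in B, w n e.2 ∂hS.finiteθ) atTop (𝓝 (∫ e in B, w' e.2 ∂hS.finiteθ)) := by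
  have key : ∀ f : V → ℝ, ∫ e in B, f e.2 ∂hS.finiteθ
      = ∫ e in Prod.swap ⁻¹' B, f e.1 ∂hS.finiteθ := fun f =>
    (hS.map_swap_finiteθ.setIntegral_preimage_emb
      (MeasurableEquiv.prodComm (α := V) (β := V)).measurableEmbedding (fun e => f e.2) B).symm
  simp_rw [key]
  exact hS.tendsto_setIntegral_fst hw (measurable_swap hB)

lemma exists_coe_le_add_φ (hS : S.Assumptions) {l : ℝ≥0} (hl : l ≠ 0) :
    ∃ K : ℝ≥0, ∀ v : ℝ≥0, (v : ℝ≥0∞) ≤ K + l * ENNReal.ofReal (S.φ v) := by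
  obtain ⟨K, hK⟩ := hS.exists_le_add_φ (l := l) (by positivity)
  refine ⟨K, fun v => ?_⟩
  have := ENNReal.ofReal_le_ofReal (hK v (NNReal.coe_nonneg _))
  rwa [ENNReal.ofReal_add (by positivity) (mul_nonneg (by positivity)
    (hS.φ_nonneg (NNReal.coe_nonneg _))), ENNReal.ofReal_mul (by positivity),
    ENNReal.ofReal_coe_nnreal, ENNReal.ofReal_coe_nnreal, ENNReal.ofReal_coe_nnreal] at this

/-- De la Vallée-Poussin: bounded entropy gives equi-integrability. -/
lemma equiIntegrable_of_entropy (hS : S.Assumptions) {X ι : Type*} [MeasurableSpace X]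
    {m : Measure X} {w : ι → X → ℝ≥0} (hw : ∀ i, Measurable (w i)) {E : ℝ≥0}
    (hE : ∀ i, ∫⁻ x, ENNReal.ofReal (S.φ (w i x)) ∂m ≤ E) :
    EquiIntegrable m fun i x => (w i x : ℝ) where
  measurable i := (hw i).coe_nnreal_real
  le ε hε := by
    -- The coefficient in front of the entropy is chosen so that the bound `E` contributes at most
    -- `ε`.
    obtain ⟨K, hK⟩ := hS.exists_coe_le_add_φ (l := ε / (E + 1)) (by positivity)
    refine ⟨K, fun i B hB => ?_⟩
    calc ∫⁻ x in B, ‖(w i x : ℝ)‖ₑ ∂m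
        ≤ ∫⁻ x in B, (K + (ε / (E + 1) : ℝ≥0) * ENNReal.ofReal (S.φ (w i x))) ∂m := by
          refine lintegral_mono fun x => ?_
          simpa using hK (w i x)
      _ = K * m B + (ε / (E + 1) : ℝ≥0) * ∫⁻ x in B, ENNReal.ofReal (S.φ (w i x)) ∂m := by
          rw [lintegral_add_left measurable_const, lintegral_const_mul' _ _ ENNReal.coe_ne_top]
          simp
      _ ≤ K * m B + ε := by
          gcongr
          calc ((ε / (E + 1) : ℝ≥0) : ℝ≥0∞) * ∫⁻ x in B, ENNReal.ofReal (S.φ (w i x)) ∂m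
              ≤ (ε / (E + 1) : ℝ≥0) * E := by
                gcongr; exact (setLIntegral_le_lintegral _ _).trans (hE i)
            _ ≤ ε := by
                rw [← ENNReal.coe_mul, ENNReal.coe_le_coe, div_mul_eq_mul_div]
                exact div_le_of_le_mul₀ (by positivity) (by positivity)
                  (mul_le_mul_of_nonneg_left (by simp) (by positivity))

end Assumptions

lemma lintegral_finiteTimeθ_le (hS : S.Assumptions) {T : ℝ} {pr : V × V → V} (hpr : Measurable pr)
    {c : ℝ≥0} (hle : ∀ F : V → ℝ≥0∞, Measurable F →
      ∫⁻ e, F (pr e) ∂hS.finiteθ ≤ c * ∫⁻ x, F x ∂S.π)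
    {F : ℝ → V → ℝ≥0∞} (hF : Measurable (Function.uncurry F)) {E : ℝ≥0}
    (hE : ∀ t ∈ Icc 0 T, ∫⁻ x, F t x ∂S.π ≤ E) :
    ∫⁻ p, F p.1 (pr p.2) ∂hS.finiteTimeθ T ≤ (c * E * T.toNNReal : ℝ≥0) := by
  have hm : Measurable fun p : ℝ × V × V => F p.1 (pr p.2) :=
    hF.comp (measurable_fst.prodMk (hpr.comp measurable_snd))
  rw [Assumptions.finiteTimeθ, lintegral_prod _ hm.aemeasurable]
  calc ∫⁻ t in Icc 0 T, ∫⁻ e, F t (pr e) ∂hS.finiteθ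
      ≤ ∫⁻ _ in Icc 0 T, (c * E : ℝ≥0∞) := by
        refine setLIntegral_mono' measurableSet_Icc fun t ht => ?_
        refine (hle (F t) (hF.comp measurable_prodMk_left)).trans ?_
        gcongr
        exact hE t ht
    _ = _ := by
        rw [setLIntegral_const, Real.volume_Icc, sub_zero, ENNReal.coe_mul, ENNReal.coe_mul]
        rfl

/-- Weak convergence at every time gives weak convergence along the edges. -/
lemma weakTendsto_finiteTimeθ (hS : S.Assumptions) {T : ℝ} {pr : V × V → V}
    (hpr : Measurable pr) {c : ℝ≥0} (hle : ∀ F : V → ℝ≥0∞, Measurable F →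
      ∫⁻ e, F (pr e) ∂hS.finiteθ ≤ c * ∫⁻ x, F x ∂S.π)
    (hlim : ∀ (w : ℕ → V → ℝ) (w' : V → ℝ), WeakTendsto S.π w w' → ∀ B : Set (V × V),
      MeasurableSet B → Tendsto (fun n => ∫ e in B, w n (pr e) ∂hS.finiteθ) atTop
        (𝓝 (∫ e in B, w' (pr e) ∂hS.finiteθ)))
    {un : ℕ → ℝ → V → ℝ≥0} {u : ℝ → V → ℝ≥0} (hun : ∀ n, Measurable (Function.uncurry (un n)))
    (hu : Measurable (Function.uncurry u)) {E : ℝ≥0}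
    (hE : ∀ n, ∀ t ∈ Icc 0 T, ∫⁻ x, ENNReal.ofReal (S.φ (un n t x)) ∂S.π ≤ E)
    (hE' : ∀ t ∈ Icc 0 T, ∫⁻ x, ENNReal.ofReal (S.φ (u t x)) ∂S.π ≤ E)
    (hw : ∀ t ∈ Icc 0 T, WeakTendsto S.π (fun n x => (un n t x : ℝ)) fun x => u t x) :
    WeakTendsto (hS.finiteTimeθ T) (fun n p => (un n p.1 (pr p.2) : ℝ))
      fun p => u p.1 (pr p.2) := by
  have := hS.finite_π
  have hφm : Measurable fun r : ℝ≥0 => ENNReal.ofReal (S.φ r) :=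
    (hS.φ_continuousOn.comp_continuous (NNReal.continuous_coe)
      fun r => r.2).measurable.ennreal_ofReal
  have hem : ∀ {v : ℝ → V → ℝ≥0}, Measurable (Function.uncurry v) →
      Measurable fun p : ℝ × V × V => v p.1 (pr p.2) := fun hv =>
    hv.comp (measurable_fst.prodMk (hpr.comp measurable_snd))
  have hall : EquiIntegrable (hS.finiteTimeθ T)
      (fun (o : Option ℕ) p => ((o.elim u un) p.1 (pr p.2) : ℝ)) := by
    refine hS.equiIntegrable_of_entropy (fun o => hem (by cases o; exacts [hu, hun _])) fun o =>
      lintegral_finiteTimeθ_le (E := E) hS hpr hle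
        (F := fun t x => ENNReal.ofReal (S.φ ((o.elim u un) t x))) ?_ ?_
    · cases o
      exacts [hφm.comp hu, hφm.comp (hun _)]
    · cases o
      exacts [hE', hE _]
  have hallt : ∀ t ∈ Icc 0 T, EquiIntegrable S.π (fun (o : Option ℕ) x => ((o.elim u un) t x : ℝ)) := by
    intro t ht
    refine hS.equiIntegrable_of_entropy (fun o => by
      cases o
      exacts [hu.comp measurable_prodMk_left, (hun _).comp measurable_prodMk_left])
      (E := E) fun o => by
        cases o
        exacts [hE' t ht, hE _ t ht]
  obtain ⟨K, hK⟩ := hS.exists_coe_le_add_φ (l := 1) one_ne_zero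
  have hmass : ∀ v : V → ℝ≥0, ∫⁻ x, ENNReal.ofReal (S.φ (v x)) ∂S.π ≤ E →
      ∫⁻ x, v x ∂S.π ≤ K * S.π univ + E := by
    intro v hv
    calc ∫⁻ x, v x ∂S.π ≤ ∫⁻ x, (K + ENNReal.ofReal (S.φ (v x))) ∂S.π :=
          lintegral_mono fun x => by simpa using hK (v x)
      _ ≤ _ := by
          rw [lintegral_add_left measurable_const, lintegral_const]
          gcongr
  refine ⟨hall.comp some, hall.measurable none, hall.integrable none, fun B hB => ?_⟩
  have key : ∀ v : ℝ → V → ℝ≥0, Measurable (Function.uncurry v) →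
      Integrable (fun p : ℝ × V × V => (v p.1 (pr p.2) : ℝ)) (hS.finiteTimeθ T) →
      ∫ p in B, (v p.1 (pr p.2) : ℝ) ∂hS.finiteTimeθ T
        = ∫ t in Icc 0 T, ∫ e in Prod.mk t ⁻¹' B, (v t (pr e) : ℝ) ∂hS.finiteθ := by
    intro v hv hi
    rw [← integral_indicator hB, Assumptions.finiteTimeθ, integral_prod _ (hi.indicator hB)]
    refine integral_congr_ae (ae_of_all _ fun t => ?_)
    simp only
    rw [← integral_indicator (measurable_prodMk_left hB)]
    rfl
  simp_rw [key _ (hun _) (hall.integrable (some _)), key _ hu (hall.integrable none)]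
  -- At each fixed time the edge integrals over the time section of `B` converge; the uniform mass
  -- bound dominates in time.
  refine tendsto_integral_filter_of_dominated_convergence
    (fun _ => (c * (K * S.π univ + E)).toReal) ?_ ?_ ?_ ?_
  · refine Eventually.of_forall fun n => ?_
    have h1 : ∀ t, ∫ e in Prod.mk t ⁻¹' B, (un n t (pr e) : ℝ) ∂hS.finiteθ
        = ∫ e, B.indicator (fun p => (un n p.1 (pr p.2) : ℝ)) (t, e) ∂hS.finiteθ := by
      intro t
      rw [← integral_indicator (measurable_prodMk_left hB)]
      rfl
    simp_rw [h1]
    exact (((((hem (hun n)).coe_nnreal_real).indicator hB).stronglyMeasurable).integral_prod_right'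
      (ν := hS.finiteθ)).aestronglyMeasurable
  · refine Eventually.of_forall fun n => ?_
    filter_upwards [ae_restrict_mem measurableSet_Icc] with t ht
    have hfin : c * (K * S.π univ + E) ≠ ∞ := by finiteness
    have h1 : ∫⁻ e in Prod.mk t ⁻¹' B, ‖(un n t (pr e) : ℝ)‖ₑ ∂hS.finiteθ
        ≤ c * (K * S.π univ + E) := by
      refine (setLIntegral_le_lintegral _ _).trans ?_
      simp only [Real.enorm_eq_ofReal (NNReal.coe_nonneg _), ENNReal.ofReal_coe_nnreal]
      have hmt : Measurable (un n t) := (hun n).comp measurable_prodMk_left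
      refine (hle (fun x => (un n t x : ℝ≥0∞)) hmt.coe_nnreal_ennreal).trans ?_
      gcongr
      exact hmass _ (hE n t ht)
    have h2 := (enorm_integral_le_lintegral_enorm _).trans h1
    rw [← ofReal_norm] at h2
    exact (ENNReal.ofReal_le_iff_le_toReal hfin).1 h2
  · exact integrable_const _
  · filter_upwards [ae_restrict_mem measurableSet_Icc] with t ht
    exact hlim _ _ (hw t ht) _ (measurable_prodMk_left hB)

end JumpSystem

/-! ### Equi-integrability of densities and fluxes -/

namespace JumpSystem

variable {V : Type*} [MetricSpace V] [SecondCountableTopology V] [MeasurableSpace V]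
  [BorelSpace V] {S : JumpSystem V}

/-- A sequence of curves in density form with uniformly bounded entropy and action. -/
structure BoundedCurves (S : JumpSystem V) (T : ℝ) (C E : ℝ≥0) (a : ℕ → V × V → ℝ)
    (u : ℕ → ℝ → V → ℝ≥0) (h : ℕ → ℝ → V × V → ℝ) : Prop where
  multiplier : ∀ n, Multiplier (a n)
  le : ∀ n, ∀ᵐ e ∂S.θ, a n e ≤ C
  curve : ∀ n, DensityCurve S T (u n) (h n)
  entropy : ∀ n, ∀ t ∈ Icc 0 T, ∫⁻ x, ENNReal.ofReal (S.φ (u n t x)) ∂S.π ≤ E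
  action : ∀ n, ∫⁻ p, S.actionDensity (a n) (u n) (h n) p ∂S.timeθ T ≤ E

/-- Weak convergence of the densities at every time, along the edges, and of the fluxes. -/
structure DensitiesTendsto (hS : S.Assumptions) (T : ℝ) (un : ℕ → ℝ → V → ℝ≥0)
    (hn : ℕ → ℝ → V × V → ℝ) (u : ℝ → V → ℝ≥0) (h : ℝ → V × V → ℝ) : Prop where
  density : ∀ t ∈ Icc 0 T, WeakTendsto S.π (fun n x => (un n t x : ℝ)) fun x => u t x
  flux : WeakTendsto (hS.finiteTimeθ T) (fun n p => hn n p.1 p.2 / truncDist p.2)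
    fun p => h p.1 p.2 / truncDist p.2
  fst : WeakTendsto (hS.finiteTimeθ T) (fun n p => (un n p.1 p.2.1 : ℝ)) fun p => u p.1 p.2.1
  snd : WeakTendsto (hS.finiteTimeθ T) (fun n p => (un n p.1 p.2.2 : ℝ)) fun p => u p.1 p.2.2

lemma Assumptions.measurable_ofReal_φ (hS : S.Assumptions) :
    Measurable fun r : ℝ≥0 => ENNReal.ofReal (S.φ r) :=
  (hS.φ_continuousOn.comp_continuous NNReal.continuous_coe fun r => r.2).measurable.ennreal_ofReal

/-- A pointwise bound of the flux by the action and the mobility. -/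
lemma Assumptions.flux_mul_le (hS : S.Assumptions) (l R : ℝ≥0) : ∃ K : ℝ≥0, ∀ (C : ℝ≥0)
    (a : V × V → ℝ) (u : ℝ → V → ℝ≥0) (h : ℝ → V × V → ℝ) (p : ℝ × V × V) (ξ : ℝ), a p.2 ≤ C →
    |ξ| ≤ R → l * (‖h p.1 p.2‖ₑ * ‖ξ‖ₑ) ≤ S.actionDensity a u h p
      + (K * C) * (ENNReal.ofReal (ξ ^ 2) * (1 + u p.1 p.2.1 + u p.1 p.2.2)) := by
  obtain ⟨c, C', -, hC'0, hC'⟩ := hS.exists_ψStar_bounds (l * R)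
  -- The constant combines the quadratic bound of `ψStar` on `[-l R, l R]` with the linear growth of
  -- `α`. Young's inequality is applied to `2 h` and the slope `l ξ`.
  refine ⟨(C' * l ^ 2).toNNReal * S.α (1, 1), fun C a u h p ξ hp hξ => ?_⟩
  set r : ℝ≥0 := (a p.2).toNNReal * S.α (u p.1 p.2.1, u p.1 p.2.2) with hr
  have hrle : r ≤ C * (S.α (1, 1) * (1 + u p.1 p.2.1 + u p.1 p.2.2)) := by
    rw [hr]; gcongr
    · exact Real.toNNReal_le_iff_le_coe.2 hp
    · exact hS.α_le _ _
  have hψ : S.ψStar (l * ξ) ≤ C' * (l * ξ) ^ 2 := (hC' _ (by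
    rw [abs_mul, abs_of_nonneg l.coe_nonneg]; gcongr)).2
  have h1 := ofReal_abs_mul_le hS (2 * h p.1 p.2) (l * ξ) r
  have h2 : ENNReal.ofReal (r * S.ψStar (l * ξ)) ≤
      ((C' * l ^ 2).toNNReal * S.α (1, 1) * C : ℝ≥0) *
        (ENNReal.ofReal (ξ ^ 2) * (1 + u p.1 p.2.1 + u p.1 p.2.2)) := by
    have e : ENNReal.ofReal (ξ ^ 2) = ((ξ ^ 2).toNNReal : ℝ≥0∞) := rfl
    rw [e]
    rw [show (1 : ℝ≥0∞) = ((1 : ℝ≥0) : ℝ≥0∞) from rfl]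
    rw [← ENNReal.coe_add, ← ENNReal.coe_add, ← ENNReal.coe_mul, ← ENNReal.coe_mul]
    refine ENNReal.ofReal_le_of_le_toReal ?_
    rw [ENNReal.coe_toReal]
    push_cast
    rw [Real.coe_toNNReal _ (by positivity), Real.coe_toNNReal _ (by positivity)]
    have hr' : (r : ℝ) ≤ C * (S.α (1, 1) * (1 + u p.1 p.2.1 + u p.1 p.2.2)) := by exact_mod_cast hrle
    calc (r : ℝ) * S.ψStar (l * ξ)
        ≤ (C * (S.α (1, 1) * (1 + u p.1 p.2.1 + u p.1 p.2.2))) * (C' * (l * ξ) ^ 2) :=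
          mul_le_mul hr' hψ (hS.ψStar_nonneg _) (by positivity)
      _ = _ := by ring
  have h3 : S.perspective (2 * h p.1 p.2) r = 2 * S.actionDensity a u h p := by
    rw [actionDensity, ← mul_assoc, ENNReal.mul_inv_cancel two_ne_zero ENNReal.ofNat_ne_top, one_mul,
      hr, NNReal.coe_mul]
  have h4 : ENNReal.ofReal (|2 * h p.1 p.2| * |(l : ℝ) * ξ|)
      = 2 * (l * (‖h p.1 p.2‖ₑ * ‖ξ‖ₑ)) := by
    rw [abs_mul, abs_mul, abs_of_nonneg l.coe_nonneg, ← ofReal_norm, ← ofReal_norm,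
      Real.norm_eq_abs, Real.norm_eq_abs,
      ← ENNReal.ofReal_mul (abs_nonneg _), ← ENNReal.ofReal_coe_nnreal (p := l),
      ← ENNReal.ofReal_mul l.coe_nonneg, abs_two,
      show (2 : ℝ≥0∞) = ENNReal.ofReal 2 by simp, ← ENNReal.ofReal_mul (by positivity)]
    congr 1; ring
  rw [h3, h4] at h1
  have h5 := h1.trans (add_le_add_right h2 _)
  rw [← ENNReal.coe_mul]
  refine (ENNReal.mul_le_mul_iff_right two_ne_zero ENNReal.ofNat_ne_top).1 (h5.trans ?_)
  rw [mul_add (2 : ℝ≥0∞)]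
  refine add_le_add le_rfl ?_
  rw [two_mul]
  exact le_add_right le_rfl

namespace BoundedCurves

variable {T : ℝ} {C E : ℝ≥0} {a : ℕ → V × V → ℝ} {u : ℕ → ℝ → V → ℝ≥0} {h : ℕ → ℝ → V × V → ℝ}

lemma equiIntegrable_edge (H : BoundedCurves S T C E a u h) (hS : S.Assumptions) :
    EquiIntegrable (hS.finiteTimeθ T) (fun n p => (u n p.1 p.2.1 : ℝ)) ∧
    EquiIntegrable (hS.finiteTimeθ T) (fun n p => (u n p.1 p.2.2 : ℝ)) := by
  obtain ⟨c, hc1, hc2⟩ := hS.exists_lintegral_fst_le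
  have hφ : ∀ n, Measurable (Function.uncurry fun t x => ENNReal.ofReal (S.φ (u n t x))) := fun n =>
    hS.measurable_ofReal_φ.comp (H.curve n).measurable_u
  constructor
  · exact hS.equiIntegrable_of_entropy
      (fun n => (measurable_fst.comp (measurable_edge_values (H.curve n).measurable_u)))
      fun n => lintegral_finiteTimeθ_le hS measurable_fst hc1 (hφ n) (H.entropy n)
  · exact hS.equiIntegrable_of_entropy
      (fun n => (measurable_snd.comp (measurable_edge_values (H.curve n).measurable_u)))
      fun n => lintegral_finiteTimeθ_le hS measurable_snd hc2 (hφ n) (H.entropy n)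

lemma equiIntegrable_density (H : BoundedCurves S T C E a u h) (hS : S.Assumptions) {t : ℝ}
    (ht : t ∈ Icc 0 T) : EquiIntegrable S.π (fun n x => (u n t x : ℝ)) :=
  hS.equiIntegrable_of_entropy (fun n => (H.curve n).measurable_u.comp measurable_prodMk_left)
    fun n => H.entropy n t ht

/-- Young's inequality with slope `l (1 ∧ d)` bounds `l` times the flux by the action plus a
mobility term carrying the weight `(1 ∧ d)²`. A large `l` makes the share of the action small on
every set, and the mobility inherits equi-integrability from the densities at the two endpoints. -/
lemma equiIntegrable_flux (H : BoundedCurves S T C E a u h) (hS : S.Assumptions) :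
    EquiIntegrable (hS.finiteTimeθ T) (fun n p => h n p.1 p.2 / truncDist p.2) := by
  have hsf := hS.sigmaFinite_θ
  have hgm : ∀ n, Measurable fun p : ℝ × V × V => h n p.1 p.2 / truncDist p.2 := fun n =>
    Measurable.div (H.curve n).measurable_h (measurable_truncDist.comp measurable_snd)
  refine ⟨hgm, fun ε hε => ?_⟩
  -- Chosen so that `E / l ≤ ε / 2`; the auxiliary `ε'` keeps the mobility error within the other
  -- half.
  set l : ℝ≥0 := 2 * E / ε + 1 with hl
  have hl0 : l ≠ 0 := by positivity
  obtain ⟨K, hK⟩ := hS.flux_mul_le l 1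
  set ε' : ℝ≥0 := l * ε / (4 * (K * C + 1)) with hε'
  have hε'0 : ε' ≠ 0 := by positivity
  obtain ⟨h1, h2⟩ := H.equiIntegrable_edge hS
  obtain ⟨K₁, hK₁⟩ := h1.le ε' hε'0
  obtain ⟨K₂, hK₂⟩ := h2.le ε' hε'0
  refine ⟨K * C * (1 + K₁ + K₂) / l, fun n B hB => ?_⟩
  have hu1 : Measurable fun p : ℝ × V × V => (u n p.1 p.2.1 : ℝ≥0∞) :=
    (measurable_fst.comp (measurable_edge_values (H.curve n).measurable_u)).coe_nnreal_ennreal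
  have hu2 : Measurable fun p : ℝ × V × V => (u n p.1 p.2.2 : ℝ≥0∞) :=
    (measurable_snd.comp (measurable_edge_values (H.curve n).measurable_u)).coe_nnreal_ennreal
  have hsum : Measurable fun p : ℝ × V × V => (1 + u n p.1 p.2.1 + u n p.1 p.2.2 : ℝ≥0∞) :=
    (measurable_const.add hu1).add hu2
  have hAm := hS.measurable_actionDensity (H.multiplier n).measurable (H.curve n).measurable_u
    (H.curve n).measurable_h
  set m := hS.finiteTimeθ T with hm
  have hae : ∀ᵐ p ∂S.timeθ T, a n p.2 ≤ C :=
    Measure.quasiMeasurePreserving_snd.ae (p := fun e : V × V => a n e ≤ C) (H.le n)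
  have e1 : l * ∫⁻ p in B, ‖h n p.1 p.2 / truncDist p.2‖ₑ ∂m
      ≤ E + (K * C) * ∫⁻ p in B, (1 + u n p.1 p.2.1 + u n p.1 p.2.2) ∂m := by
    rw [hS.lintegral_finiteTimeθ T (hgm n).enorm hB, hS.lintegral_finiteTimeθ T hsum hB,
      ← lintegral_const_mul' _ _ ENNReal.coe_ne_top,
      ← lintegral_const_mul' _ _ (by finiteness)]
    calc ∫⁻ p in B, l * (ENNReal.ofReal (truncDist p.2 ^ 2) * ‖h n p.1 p.2 / truncDist p.2‖ₑ)
          ∂S.timeθ T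
        ≤ ∫⁻ p in B, (S.actionDensity (a n) (u n) (h n) p + (K * C) *
          (ENNReal.ofReal (truncDist p.2 ^ 2) * (1 + u n p.1 p.2.1 + u n p.1 p.2.2)))
          ∂S.timeθ T := by
          refine lintegral_mono_ae (ae_restrict_of_ae ?_)
          filter_upwards [hae, hS.ae_timeθ_pos T] with p hp hpos
          refine le_trans (le_of_eq ?_) (hK C (a n) (u n) (h n) p (truncDist p.2) hp (by
            rw [abs_of_pos hpos]; exact truncDist_le_one _))
          congr 1
          rw [← ofReal_norm, ← ofReal_norm, ← ofReal_norm, norm_div, Real.norm_of_nonneg hpos.le,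
            ← ENNReal.ofReal_mul (by positivity), ← ENNReal.ofReal_mul (by positivity)]
          congr 1
          field_simp
      _ = _ := lintegral_add_left hAm _
      _ ≤ _ := by
          gcongr
          exact (setLIntegral_le_lintegral _ _).trans (H.action n)
  have e2 : ∫⁻ p in B, (1 + u n p.1 p.2.1 + u n p.1 p.2.2 : ℝ≥0∞) ∂m
      ≤ m B + (K₁ * m B + ε') + (K₂ * m B + ε') := by
    rw [lintegral_add_right _ hu2, lintegral_add_right _ hu1]
    have h1 := hK₁ n B hB
    have h2 := hK₂ n B hB
    simp only [Real.enorm_eq_ofReal (NNReal.coe_nonneg _), ENNReal.ofReal_coe_nnreal] at h1 h2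
    gcongr
    simp
  have hmB : m B ≠ ∞ := measure_ne_top _ _
  have e3 := e1.trans (add_le_add_right (mul_le_mul_right e2 (K * C : ℝ≥0∞)) _)
  refine (ENNReal.mul_le_mul_iff_right (a := (l : ℝ≥0∞)) (by exact_mod_cast hl0)
    ENNReal.coe_ne_top).1 (e3.trans ?_)
  lift m B to ℝ≥0 using hmB with M hM
  norm_cast
  rw [← NNReal.coe_le_coe]
  push_cast
  have hl' : (l : ℝ) = 2 * E / ε + 1 := by rw [hl]; push_cast; ring
  have hε0 : (0 : ℝ) < ε := by positivity
  have hE : (E : ℝ) ≤ l * ε / 2 := by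
    rw [hl']; field_simp; linarith
  have hε'2 : (K : ℝ) * C * (2 * ε') ≤ l * ε / 2 := by
    rw [hε']; push_cast
    rw [show (K : ℝ) * C * (2 * (l * ε / (4 * (K * C + 1))))
      = (K * C / (K * C + 1)) * (l * ε / 2) by field_simp; ring]
    exact mul_le_of_le_one_left (by positivity) (div_le_one_of_le₀ (by linarith) (by positivity))
  have hlpos : (0 : ℝ) < l := by positivity
  have : (l : ℝ) * (K * C * (1 + K₁ + K₂) / l * M + ε)
      = K * C * (1 + K₁ + K₂) * M + l * ε := by field_simp
  rw [this]
  nlinarith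

end BoundedCurves

end JumpSystem

/-! ### Lower semicontinuity of weighted convex integrals -/

section Affine

variable {X : Type*} [MeasurableSpace X] {m : Measure X}

lemma EquiIntegrable.affineQuadrant {ι : Type*} {u v : ι → X → ℝ≥0}
    (hu : EquiIntegrable m fun n x => (u n x : ℝ)) (hv : EquiIntegrable m fun n x => (v n x : ℝ))
    (c : ℝ × ℝ × ℝ) : EquiIntegrable m fun n x => affineQuadrant c (u n x, v n x) where
  measurable n := by
    unfold _root_.affineQuadrant
    have h1 := hu.measurable n
    have h2 := hv.measurable n
    fun_prop
  le ε hε := by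
    set M : ℝ≥0 := ‖c.1‖₊ + ‖c.2.1‖₊ + 1 with hM
    obtain ⟨K₁, h₁⟩ := hu.le (ε / M) (by positivity)
    obtain ⟨K₂, h₂⟩ := hv.le (ε / M) (by positivity)
    refine ⟨‖c.2.2‖₊ + ‖c.1‖₊ * K₁ + ‖c.2.1‖₊ * K₂, fun n B hB => ?_⟩
    have hum := (hu.measurable n).enorm
    have hvm := (hv.measurable n).enorm
    calc ∫⁻ x in B, ‖_root_.affineQuadrant c (u n x, v n x)‖ₑ ∂m
        ≤ ∫⁻ x in B, (‖c.1‖ₑ * ‖(u n x : ℝ)‖ₑ + ‖c.2.1‖ₑ * ‖(v n x : ℝ)‖ₑ + ‖c.2.2‖ₑ) ∂m := by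
          refine lintegral_mono fun x => ?_
          unfold _root_.affineQuadrant
          rw [← enorm_mul, ← enorm_mul]
          exact (enorm_add_le _ _).trans (add_le_add_left (enorm_add_le _ _) _)
      _ = ‖c.1‖ₑ * ∫⁻ x in B, ‖(u n x : ℝ)‖ₑ ∂m
          + ‖c.2.1‖ₑ * ∫⁻ x in B, ‖(v n x : ℝ)‖ₑ ∂m + ‖c.2.2‖ₑ * m B := by
          rw [lintegral_add_right _ measurable_const, lintegral_add_right _ (hvm.const_mul _),
            lintegral_const_mul _ hum, lintegral_const_mul _ hvm]
          simp
      _ ≤ ‖c.1‖ₑ * (K₁ * m B + (ε / M : ℝ≥0))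
          + ‖c.2.1‖ₑ * (K₂ * m B + (ε / M : ℝ≥0)) + ‖c.2.2‖ₑ * m B := by
          gcongr
          exacts [h₁ n B hB, h₂ n B hB]
      _ = ((‖c.2.2‖₊ + ‖c.1‖₊ * K₁ + ‖c.2.1‖₊ * K₂ : ℝ≥0) : ℝ≥0∞) * m B
          + ((‖c.1‖₊ + ‖c.2.1‖₊) * (ε / M) : ℝ≥0) := by
          simp only [enorm_eq_nnnorm]
          push_cast
          ring
      _ ≤ _ := by
          gcongr
          rw [mul_div_assoc', div_le_iff₀ (by positivity), mul_comm]
          gcongr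
          simp [hM]

lemma WeakTendsto.affineQuadrant [IsFiniteMeasure m] {un vn : ℕ → X → ℝ≥0} {u v : X → ℝ≥0}
    (hu : WeakTendsto m (fun n x => (un n x : ℝ)) fun x => u x)
    (hv : WeakTendsto m (fun n x => (vn n x : ℝ)) fun x => v x) (c : ℝ × ℝ × ℝ) :
    WeakTendsto m (fun n x => affineQuadrant c (un n x, vn n x))
      fun x => affineQuadrant c (u x, v x) where
  equi := hu.equi.affineQuadrant hv.equi c
  measurable := by
    unfold _root_.affineQuadrant
    have h1 := hu.measurable
    have h2 := hv.measurable
    fun_prop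
  integrable := by
    unfold _root_.affineQuadrant
    exact ((hu.integrable.const_mul _).add (hv.integrable.const_mul _)).add (integrable_const _)
  tendsto B hB := by
    have key : ∀ {u v : X → ℝ≥0}, Integrable (fun x => (u x : ℝ)) m →
        Integrable (fun x => (v x : ℝ)) m →
        ∫ x in B, _root_.affineQuadrant c (u x, v x) ∂m
          = c.1 * (∫ x in B, (u x : ℝ) ∂m) + c.2.1 * (∫ x in B, (v x : ℝ) ∂m)
            + ∫ _ in B, c.2.2 ∂m := by
      intro u v h1 h2
      unfold _root_.affineQuadrant
      have e1 : IntegrableOn (fun x => c.1 * (u x : ℝ)) B m := h1.integrableOn.const_mul _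
      have e2 : IntegrableOn (fun x => c.2.1 * (v x : ℝ)) B m := h2.integrableOn.const_mul _
      have e3 : IntegrableOn (fun x => c.1 * (u x : ℝ) + c.2.1 * (v x : ℝ)) B m := e1.add e2
      simp only
      rw [integral_add e3 (integrable_const _), integral_add e1 e2, integral_const_mul,
        integral_const_mul]
    rw [key hu.integrable hv.integrable]
    simp_rw [key (hu.equi.integrable _) (hv.equi.integrable _)]
    exact (((hu.tendsto B hB).const_mul _).add
      ((hv.tendsto B hB).const_mul _)).add tendsto_const_nhds

/-- The localisation to `A` is needed because the weights of interest blow up at the diagonal and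
are bounded only on long edges. -/
lemma tendsto_setIntegral_indicator_mul [IsFiniteMeasure m] {g : ℕ → X → ℝ} {g' : X → ℝ}
    (hg : WeakTendsto m g g') {w : ℕ → X → ℝ} {w' : X → ℝ} (hw : ∀ n, Measurable (w n))
    (hw' : Measurable w') (hlim : ∀ᵐ x ∂m, Tendsto (fun n => w n x) atTop (𝓝 (w' x)))
    {A : Set X} (hA : MeasurableSet A) {C : ℝ≥0}
    (hC : ∀ n, ∀ᵐ x ∂m, x ∈ A → ‖w n x‖ₑ ≤ C) {B : Set X} (hB : MeasurableSet B) :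
    Tendsto (fun n => ∫ x in B, A.indicator (w n) x * g n x ∂m) atTop
      (𝓝 (∫ x in B, A.indicator w' x * g' x ∂m)) := by
  have key : ∀ w g : X → ℝ, ∫ x in B, A.indicator w x * g x ∂m
      = ∫ x, (B ∩ A).indicator w x * g x ∂m := by
    intro w g
    rw [← integral_indicator hB]
    refine integral_congr_ae (ae_of_all _ fun x => ?_)
    by_cases hx : x ∈ B <;> by_cases hx' : x ∈ A <;> simp [hx, hx']
  simp_rw [key]
  refine hg.integral_mul (C := C) (fun n => (hw n).indicator (hB.inter hA))
    (hw'.indicator (hB.inter hA)) (fun n => ?_) ?_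
  · filter_upwards [hC n] with x hx
    by_cases hxA : x ∈ B ∩ A
    · rw [indicator_of_mem hxA]; exact hx hxA.2
    · rw [indicator_of_notMem hxA]; simp
  · filter_upwards [hlim] with x hx
    by_cases hxA : x ∈ B ∩ A
    · simpa [indicator_of_mem hxA] using hx
    · simp [indicator_of_notMem hxA]

/-- Lower semicontinuity of weighted convex integrals under weak convergence. -/
lemma lintegral_mul_comp_le_liminf [IsFiniteMeasure m] {F : ℝ≥0 × ℝ≥0 → ℝ≥0∞}
    (hF : ConvexOn ℝ≥0 univ F) (hl : LowerSemicontinuous F) {un vn : ℕ → X → ℝ≥0} {u v : X → ℝ≥0}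
    (hu : WeakTendsto m (fun n x => (un n x : ℝ)) fun x => u x)
    (hv : WeakTendsto m (fun n x => (vn n x : ℝ)) fun x => v x)
    {w : ℕ → X → ℝ} {w' : X → ℝ} (hw : ∀ n, Measurable (w n)) (hw0 : ∀ n x, 0 ≤ w n x)
    (hw' : Measurable w') (hw'0 : ∀ x, 0 ≤ w' x)
    (hlim : ∀ᵐ x ∂m, Tendsto (fun n => w n x) atTop (𝓝 (w' x)))
    {A : ℕ → Set X} (hA : ∀ k, MeasurableSet (A k)) (hAex : ∀ x, ∃ k, x ∈ A k)
    (hC : ∀ k, ∃ C : ℝ≥0, (∀ n, ∀ᵐ x ∂m, x ∈ A k → ‖w n x‖ₑ ≤ C) ∧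
      ∀ᵐ x ∂m, x ∈ A k → ‖w' x‖ₑ ≤ C) :
    ∫⁻ x, ENNReal.ofReal (w' x) * F (u x, v x) ∂m
      ≤ liminf (fun n => ∫⁻ x, ENNReal.ofReal (w n x) * F (un n x, vn n x) ∂m) atTop := by
  obtain ⟨c, ⟨i₀, hi₀⟩, hc⟩ := exists_iSup_affineQuadrant hF hl
  choose C hC hC' using hC
  -- The index pairs an affine minorant with a localisation set: each term has a bounded weight and
  -- is linear in the densities, and the supremum over both indices restores the full integrand.
  set L : ℕ × ℕ → ℕ → X → ℝ := fun i n x =>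
    (A i.2).indicator (w n) x * affineQuadrant (c i.1) (un n x, vn n x) with hL
  set L' : ℕ × ℕ → X → ℝ := fun i x =>
    (A i.2).indicator w' x * affineQuadrant (c i.1) (u x, v x) with hL'
  have hW := fun i => hu.affineQuadrant hv (c i)
  refine le_trans (le_of_eq ?_) (lintegral_iSup_ofReal_le_liminf (ι := ℕ × ℕ)
    (f := fun n x => ENNReal.ofReal (w n x) * F (un n x, vn n x))
    (L := L) (L' := L') (fun i n => ?_) (fun i => ?_) (fun i => ?_) (fun i n => ?_)
    (fun i B hB => ?_))
  · refine lintegral_congr fun x => ?_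
    rw [hc, ENNReal.mul_iSup]
    simp_rw [← ENNReal.ofReal_mul (hw'0 x)]
    refine le_antisymm (iSup_le fun i => ?_) (iSup_le fun i => ?_)
    · obtain ⟨k, hk⟩ := hAex x
      refine le_trans (le_of_eq ?_) (le_iSup _ (i, k))
      simp only [hL', indicator_of_mem hk]
    · by_cases hx : x ∈ A i.2
      · refine le_trans (le_of_eq ?_) (le_iSup _ i.1)
        simp only [hL', indicator_of_mem hx]
      · simp [hL', indicator_of_notMem hx]
  · refine (hW i.1).equi.integrable_mul (C := C i.2) ((hw n).indicator (hA _)) ?_ n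
    filter_upwards [hC i.2 n] with x hx
    by_cases hxA : x ∈ A i.2
    · rw [indicator_of_mem hxA]; exact hx hxA
    · rw [indicator_of_notMem hxA]; simp
  · exact (hw'.indicator (hA _)).mul (hW i.1).measurable
  · refine (hW i.1).integrable.bdd_mul (c := C i.2) (hw'.indicator (hA _)).aestronglyMeasurable ?_
    filter_upwards [hC' i.2] with x hx
    by_cases hxA : x ∈ A i.2
    · rw [indicator_of_mem hxA]
      have := hx hxA
      rwa [← ofReal_norm, ← ENNReal.ofReal_coe_nnreal,
        ENNReal.ofReal_le_ofReal_iff (by positivity)] at this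
    · rw [indicator_of_notMem hxA]; simp
  · refine ae_of_all _ fun x => ?_
    by_cases hx : x ∈ A i.2
    · simp only [hL, indicator_of_mem hx]
      rw [ENNReal.ofReal_mul (hw0 n x), hc]
      gcongr
      exact le_iSup (fun i => ENNReal.ofReal (affineQuadrant (c i) (un n x, vn n x))) i.1
    · simp [hL, indicator_of_notMem hx]
  · exact tendsto_setIntegral_indicator_mul (hW i.1) hw hw' hlim (hA _) (hC i.2) hB

end Affine

namespace JumpSystem

variable {V : Type*} [MetricSpace V] [SecondCountableTopology V] [MeasurableSpace V]
  [BorelSpace V] {S : JumpSystem V}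

/-- Lower semicontinuity of the entropy. -/
lemma Assumptions.lintegral_φ_le_liminf (hS : S.Assumptions) {X : Type*} [MeasurableSpace X]
    {m : Measure X} [IsFiniteMeasure m] {un : ℕ → X → ℝ≥0} {u : X → ℝ≥0}
    (hu : WeakTendsto m (fun n x => (un n x : ℝ)) fun x => u x) :
    ∫⁻ x, ENNReal.ofReal (S.φ (u x)) ∂m
      ≤ liminf (fun n => ∫⁻ x, ENNReal.ofReal (S.φ (un n x)) ∂m) atTop := by
  have hF : ConvexOn ℝ≥0 univ fun p : ℝ≥0 × ℝ≥0 => ENNReal.ofReal (S.φ p.1) := by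
    refine ⟨convex_univ, fun p _ q _ a b _ _ hab => ?_⟩
    have h1 := hS.φ_convex.2 (mem_Ici.2 p.1.coe_nonneg) (mem_Ici.2 q.1.coe_nonneg) a.coe_nonneg b.coe_nonneg
      (by rw [← NNReal.coe_one, ← hab]; rfl)
    have ha : a • ENNReal.ofReal (S.φ p.1) = ENNReal.ofReal (a * S.φ p.1) := by
      rw [ENNReal.ofReal_mul a.coe_nonneg, ENNReal.ofReal_coe_nnreal]; rfl
    have hb : b • ENNReal.ofReal (S.φ q.1) = ENNReal.ofReal (b * S.φ q.1) := by
      rw [ENNReal.ofReal_mul b.coe_nonneg, ENNReal.ofReal_coe_nnreal]; rfl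
    simp only [ha, hb]
    rw [← ENNReal.ofReal_add (mul_nonneg a.coe_nonneg (hS.φ_nonneg p.1.coe_nonneg))
      (mul_nonneg b.coe_nonneg (hS.φ_nonneg q.1.coe_nonneg))]
    refine ENNReal.ofReal_le_ofReal ?_
    simpa using h1
  have hc : Continuous fun p : ℝ≥0 × ℝ≥0 => ENNReal.ofReal (S.φ p.1) :=
    ENNReal.continuous_ofReal.comp (hS.φ_continuousOn.comp_continuous
      (NNReal.continuous_coe.comp continuous_fst) fun p => p.1.2)
  have := lintegral_mul_comp_le_liminf hF hc.lowerSemicontinuous hu hu (w := fun _ _ => 1)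
    (w' := fun _ => 1) (fun _ => measurable_const) (fun _ _ => zero_le_one) measurable_const
    (fun _ => zero_le_one) (ae_of_all _ fun _ => tendsto_const_nhds) (A := fun _ => univ)
    (fun _ => MeasurableSet.univ) (fun _ => ⟨0, mem_univ _⟩) (fun _ => ⟨1, by simp, by simp⟩)
  simpa using this

end JumpSystem

/-! ### Subsequential limits of bounded curves -/

namespace JumpSystem

variable {V : Type*} [MetricSpace V] [SecondCountableTopology V] [MeasurableSpace V]
  [BorelSpace V] {S : JumpSystem V}

/-- Integrals over time strips as integrals of flux densities against the finite measure. -/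
lemma Assumptions.integral_flux_eq (hS : S.Assumptions) {T : ℝ} {B : Set (ℝ × V × V)}
    (hB : MeasurableSet B) (F : ℝ × V × V → ℝ) (h : ℝ → V × V → ℝ) :
    ∫ p in B, F p * h p.1 p.2 ∂S.timeθ T
      = ∫ p, B.indicator (fun p => F p / truncDist p.2) p * (h p.1 p.2 / truncDist p.2)
          ∂hS.finiteTimeθ T := by
  rw [← integral_indicator hB, hS.integral_timeθ]
  refine integral_congr_ae ?_
  filter_upwards [hS.ae_finiteTimeθ (hS.ae_timeθ_pos T)] with p hp
  by_cases hpB : p ∈ B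
  · simp only [indicator_of_mem hpB]
    field_simp
  · simp [indicator_of_notMem hpB]

/-- The flux density associated with a weak limit. -/
lemma Assumptions.moment_lt_top (hS : S.Assumptions) {T : ℝ} {g : ℝ × V × V → ℝ}
    (hg : Measurable g) (hi : Integrable g (hS.finiteTimeθ T)) :
    ∫⁻ t in Icc 0 T, ∫⁻ e, ‖truncDist e * g (t, e)‖ₑ * ENNReal.ofReal (truncDist e) ∂S.θ < ∞ := by
  have hsf := hS.sigmaFinite_θ
  have hm : Measurable fun p : ℝ × V × V =>
      ‖truncDist p.2 * g (p.1, p.2)‖ₑ * ENNReal.ofReal (truncDist p.2) :=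
    (((measurable_truncDist.comp measurable_snd).mul hg).enorm).mul
      (measurable_truncDist.comp measurable_snd).ennreal_ofReal
  have h1 : ∫⁻ p, ‖g p‖ₑ ∂hS.finiteTimeθ T < ∞ := hi.2
  rw [← setLIntegral_univ, hS.lintegral_finiteTimeθ T hg.enorm MeasurableSet.univ,
    setLIntegral_univ] at h1
  refine lt_of_le_of_lt (le_of_eq ?_) h1
  rw [timeθ, ← lintegral_prod _ hm.aemeasurable]
  refine lintegral_congr fun p => ?_
  rw [← ofReal_norm, ← ofReal_norm, ← ENNReal.ofReal_mul (norm_nonneg _),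
    ← ENNReal.ofReal_mul (sq_nonneg _), norm_mul, Real.norm_of_nonneg (truncDist_nonneg _)]
  congr 1; ring

namespace BoundedCurves

variable {T : ℝ} {C E : ℝ≥0} {a : ℕ → V × V → ℝ} {u : ℕ → ℝ → V → ℝ≥0} {h : ℕ → ℝ → V × V → ℝ}

/-- The continuity equation passes to the limit. -/
lemma tendsto_integral_flux (hS : S.Assumptions) {σ : ℕ → ℕ} {g : ℝ × V × V → ℝ}
    (hg : WeakTendsto (hS.finiteTimeθ T) (fun n p => h (σ n) p.1 p.2 / truncDist p.2) g)
    {f : V → ℝ} (hf : ∃ K, LipschitzWith K f) (hb : ∃ C, ∀ x, |f x| ≤ C) (s t : ℝ) :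
    Tendsto (fun n => ∫ p in Icc s t ×ˢ univ, graphGradient f p.2 * h (σ n) p.1 p.2 ∂S.timeθ T)
      atTop (𝓝 (∫ p, (Icc s t ×ˢ univ).indicator
        (fun p => graphGradient f p.2 / truncDist p.2) p * g p ∂hS.finiteTimeθ T)) := by
  obtain ⟨K, hK⟩ := hf
  obtain ⟨C, hC⟩ := hb
  have hB : MeasurableSet (Icc s t ×ˢ (univ : Set (V × V))) :=
    measurableSet_Icc.prod MeasurableSet.univ
  simp_rw [hS.integral_flux_eq hB]
  have hm : Measurable ((Icc s t ×ˢ (univ : Set (V × V))).indicator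
      fun p : ℝ × V × V => graphGradient f p.2 / truncDist p.2) :=
    (((measurable_graphGradient hK.continuous.measurable).comp measurable_snd).div
      (measurable_truncDist.comp measurable_snd)).indicator hB
  refine hg.integral_mul (C := (max (K : ℝ) (2 * C)).toNNReal) (fun _ => hm) hm
    (fun _ => ?_) (ae_of_all _ fun _ => tendsto_const_nhds)
  filter_upwards [hS.ae_finiteTimeθ (hS.ae_timeθ_pos T)] with p hp
  rw [← ofReal_norm]
  refine ENNReal.ofReal_le_ofReal ?_
  by_cases hpB : p ∈ Icc s t ×ˢ (univ : Set (V × V))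
  · rw [indicator_of_mem hpB, norm_div, Real.norm_of_nonneg hp.le, div_le_iff₀ hp]
    exact abs_graphGradient_le hK hC p.2
  · rw [indicator_of_notMem hpB, norm_zero]
    exact le_max_of_le_left (NNReal.coe_nonneg _)

/-- Only the fluxes require extraction. The continuity equation expresses `∫ f u_n(t)` through the
initial datum and the flux, so it converges for every bounded Lipschitz `f` and every `t` along the
same subsequence; equi-integrability upgrades this to weak `L¹` convergence at each time. -/
theorem exists_subseq (H : BoundedCurves S T C E a u h) (hS : S.Assumptions) (hT : 0 ≤ T)
    {u₀ : V → ℝ≥0} (hu₀ : Measurable u₀)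
    (h0 : ∀ B, MeasurableSet B →
      Tendsto (fun n => ∫ x in B, (u n 0 x : ℝ) ∂S.π) atTop (𝓝 (∫ x in B, (u₀ x : ℝ) ∂S.π)))
    (h0i : Integrable (fun x => (u₀ x : ℝ)) S.π) :
    ∃ (σ : ℕ → ℕ) (u' : ℝ → V → ℝ≥0) (h' : ℝ → V × V → ℝ), StrictMono σ ∧
      DensityCurve S T u' h' ∧ DensitiesTendsto hS T (fun n => u (σ n)) (fun n => h (σ n)) u' h' := by
  have := hS.finite_π
  have hsf := hS.sigmaFinite_θ
  have hut : ∀ n t, Measurable (u n t) := fun n t =>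
    (H.curve n).measurable_u.comp measurable_prodMk_left
  have hw0 : WeakTendsto S.π (fun n x => (u n 0 x : ℝ)) fun x => u₀ x :=
    ⟨H.equiIntegrable_density hS (left_mem_Icc.2 hT), hu₀.coe_nnreal_real, h0i, h0⟩
  obtain ⟨σ, hσ, g, hg⟩ := (H.equiIntegrable_flux hS).exists_subseq
  have hw0' := hw0.comp hσ.tendsto_atTop
  have heq : ∀ f : V → ℝ, (∃ K, LipschitzWith K f) → (∃ C, ∀ x, |f x| ≤ C) → ∀ t ∈ Icc 0 T, ∀ n,
      ∫ x, f x * u (σ n) t x ∂S.π = (∫ x, f x * u (σ n) 0 x ∂S.π)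
        + ∫ p in Icc 0 t ×ˢ univ, graphGradient f p.2 * h (σ n) p.1 p.2 ∂S.timeθ T := by
    intro f hf hb t ht n
    rw [← (H.curve (σ n)).equation f hf hb 0 t le_rfl ht.1 ht.2]
    ring
  have hlim0 : ∀ f : V → ℝ, (∃ K, LipschitzWith K f) → (∃ C, ∀ x, |f x| ≤ C) →
      Tendsto (fun n => ∫ x, f x * u (σ n) 0 x ∂S.π) atTop (𝓝 (∫ x, f x * u₀ x ∂S.π)) := by
    rintro f ⟨K, hK⟩ ⟨C, hC⟩
    refine hw0'.integral_mul (C := C.toNNReal) (fun _ => hK.continuous.measurable)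
      hK.continuous.measurable (fun _ => ae_of_all _ fun x => ?_)
      (ae_of_all _ fun x => tendsto_const_nhds)
    rw [← ofReal_norm]
    exact ENNReal.ofReal_le_ofReal (hC x)
  -- weak limits at every time
  have hex : ∀ t ∈ Icc 0 T, ∃ w, WeakTendsto S.π (fun n x => (u (σ n) t x : ℝ)) w := by
    intro t ht
    refine ((H.equiIntegrable_density hS ht).comp σ).exists_weakTendsto_of_lipschitz
      fun f hf hb => ?_
    simp_rw [heq f hf hb t ht]
    exact ((hlim0 f hf hb).add (tendsto_integral_flux hS hg hf hb 0 t)).cauchySeq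
  choose! w hw using hex
  have hw_nonneg : ∀ t ∈ Icc 0 T, 0 ≤ᵐ[S.π] w t := by
    intro t ht
    refine ae_nonneg_of_forall_setIntegral_nonneg (hw t ht).integrable fun B hB _ => ?_
    exact ge_of_tendsto' ((hw t ht).tendsto B hB) fun n =>
      setIntegral_nonneg hB fun x _ => NNReal.coe_nonneg _
  set pr : ℝ → ℝ := fun t => projIcc 0 T hT t with hpr
  have hprm : ∀ t, pr t ∈ Icc 0 T := fun t => (projIcc 0 T hT t).2
  have hprme : Measurable pr := measurable_subtype_coe.comp continuous_projIcc.measurable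
  have hfin : ∀ t, IsFiniteMeasure (S.π.withDensity fun x => ENNReal.ofReal (w (pr t) x)) := fun t =>
    isFiniteMeasure_withDensity_ofReal (hw _ (hprm t)).integrable.2
  set ρ : ℝ → FiniteMeasure V := fun t => ⟨_, hfin t⟩ with hρ
  have hρapp : ∀ t B, MeasurableSet B →
      ((ρ t : Measure V) B).toReal = ∫ x in B, w (pr t) x ∂S.π := by
    intro t B hB
    rw [hρ, FiniteMeasure.toMeasure_mk, withDensity_apply _ hB,
      integral_eq_lintegral_of_nonneg_ae (ae_restrict_of_ae (hw_nonneg _ (hprm t)))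
        (hw _ (hprm t)).measurable.aestronglyMeasurable]
  have hset : ∀ t B, MeasurableSet B →
      Tendsto (fun n => ∫ x in B, (u (σ n) (pr t) x : ℝ) ∂S.π) atTop
        (𝓝 ((ρ t : Measure V) B).toReal) := by
    intro t B hB
    rw [hρapp t B hB]
    exact (hw _ (hprm t)).tendsto B hB
  have hum : ∀ n, Measurable fun p : ℝ × V => (u (σ n) (pr p.1) p.2 : ℝ) := fun n =>
    ((H.curve (σ n)).measurable_u.comp ((hprme.comp measurable_fst).prodMk measurable_snd)).coe_nnreal_real
  -- The limits were chosen separately at each time; measurability in `t` survives because masses of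
  -- sets are pointwise limits of measurable functions.
  have hρm : Measurable fun t => (ρ t : Measure V) := by
    refine Measure.measurable_of_measurable_coe _ fun B hB => ?_
    have h1 : Measurable fun t => ((ρ t : Measure V) B).toReal := by
      refine measurable_of_tendsto_metrizable (f := fun n t => ∫ x in B, (u (σ n) (pr t) x : ℝ) ∂S.π)
        (fun n => ?_) (tendsto_pi_nhds.2 fun t => hset t B hB)
      exact ((hum n).stronglyMeasurable.integral_prod_right' (ν := S.π.restrict B)).measurable
    have h2 := h1.ennreal_ofReal
    simpa only [ENNReal.ofReal_toReal (measure_ne_top _ B)] using h2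
  obtain ⟨Cb, hCb⟩ := (H.equiIntegrable_flux hS).bound
  have hmass : ∃ C : ℝ≥0, ∀ t, (ρ t : Measure V) univ ≤ C := by
    obtain ⟨K, hK⟩ := hS.exists_coe_le_add_φ (l := 1) one_ne_zero
    refine ⟨K * (S.π univ).toNNReal + E, fun t => ?_⟩
    have h1 := hset t univ MeasurableSet.univ
    rw [← ENNReal.ofReal_toReal (measure_ne_top (ρ t : Measure V) univ)]
    refine ENNReal.ofReal_le_of_le_toReal ?_
    refine le_of_tendsto' h1 fun n => ?_
    rw [Measure.restrict_univ, integral_eq_lintegral_of_nonneg_ae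
      (ae_of_all _ fun x => NNReal.coe_nonneg _) (hut _ _).coe_nnreal_real.aestronglyMeasurable]
    refine ENNReal.toReal_mono ENNReal.coe_ne_top ?_
    simp only [ENNReal.ofReal_coe_nnreal]
    push_cast
    rw [ENNReal.coe_toNNReal (measure_ne_top S.π univ)]
    calc ∫⁻ x, u (σ n) (pr t) x ∂S.π
        ≤ ∫⁻ x, (K + ENNReal.ofReal (S.φ (u (σ n) (pr t) x))) ∂S.π :=
          lintegral_mono fun x => by simpa using hK _
      _ ≤ _ := by
          rw [lintegral_add_left measurable_const, lintegral_const]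
          gcongr
          exact H.entropy _ _ (hprm t)
  obtain ⟨u', hu'm, hu'⟩ := hS.exists_measurable_u hρm hmass
    (fun t => withDensity_absolutelyContinuous _ _)
  have hu't : ∀ t, Measurable (u' t) := fun t => hu'm.comp measurable_prodMk_left
  have hu'w : ∀ t ∈ Icc 0 T, (fun x => (u' t x : ℝ)) =ᵐ[S.π] w t := by
    intro t ht
    have hpt : pr t = t := by simp only [hpr, projIcc_of_mem hT ht]
    have h1 : S.π.withDensity (fun x => (u' t x : ℝ≥0∞))
        = S.π.withDensity fun x => ENNReal.ofReal (w t x) := by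
      rw [← hu' t, hρ, FiniteMeasure.toMeasure_mk, hpt]
    have h2 := (withDensity_eq_iff_of_sigmaFinite (hu't t).coe_nnreal_ennreal.aemeasurable
      (hw t ht).measurable.ennreal_ofReal.aemeasurable).1 h1
    filter_upwards [h2, hw_nonneg t ht] with x hx hx0
    have h3 := congrArg ENNReal.toReal hx
    rwa [ENNReal.coe_toReal, ENNReal.toReal_ofReal hx0] at h3
  have hdens : ∀ t ∈ Icc 0 T, WeakTendsto S.π (fun n x => (u (σ n) t x : ℝ)) fun x => u' t x := by
    intro t ht
    refine ⟨(hw t ht).equi, (hu't t).coe_nnreal_real, (hw t ht).integrable.congr (hu'w t ht).symm,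
      fun B hB => ?_⟩
    rw [integral_congr_ae (ae_restrict_of_ae (hu'w t ht))]
    exact (hw t ht).tendsto B hB
  have hent : ∀ t ∈ Icc 0 T, ∫⁻ x, ENNReal.ofReal (S.φ (u' t x)) ∂S.π ≤ E := fun t ht =>
    (hS.lintegral_φ_le_liminf (hdens t ht)).trans
      (liminf_le_of_le (by isBoundedDefault) fun b hb => by
        obtain ⟨n, hn⟩ := hb.exists
        exact hn.trans (H.entropy _ t ht))
  -- The weak limit was taken of `h / (1 ∧ d)`, so the weight is multiplied back.
  set h' : ℝ → V × V → ℝ := fun t e => truncDist e * g (t, e) with hh'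
  have hh'm : Measurable (Function.uncurry h') :=
    (measurable_truncDist.comp measurable_snd).mul hg.measurable
  have hgh' : (fun p : ℝ × V × V => h' p.1 p.2 / truncDist p.2) =ᵐ[hS.finiteTimeθ T] g := by
    filter_upwards [hS.ae_finiteTimeθ (hS.ae_timeθ_pos T)] with p hp
    simp only [hh']
    field_simp
  have hflux : WeakTendsto (hS.finiteTimeθ T) (fun n p => h (σ n) p.1 p.2 / truncDist p.2)
      fun p => h' p.1 p.2 / truncDist p.2 := by
    refine ⟨hg.equi, Measurable.div hh'm (measurable_truncDist.comp measurable_snd),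
      hg.integrable.congr hgh'.symm, fun B hB => ?_⟩
    rw [integral_congr_ae (ae_restrict_of_ae hgh')]
    exact hg.tendsto B hB
  obtain ⟨c, hc1, hc2⟩ := hS.exists_lintegral_fst_le
  refine ⟨σ, u', h', hσ, ⟨hu'm, hh'm, fun t ht => ?_, hS.moment_lt_top hg.measurable hg.integrable,
    fun f hf hb s t hs hst ht => ?_⟩, hdens, hflux, ?_, ?_⟩
  · have := (hdens t ht).integrable.2
    simpa [HasFiniteIntegral] using this
  · have h1 : ∀ t ∈ Icc 0 T, Tendsto (fun n => ∫ x, f x * u (σ n) t x ∂S.π) atTop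
        (𝓝 (∫ x, f x * u' t x ∂S.π)) := by
      intro t ht
      obtain ⟨K, hK⟩ := hf
      obtain ⟨C, hC⟩ := hb
      refine (hdens t ht).integral_mul (C := C.toNNReal) (fun _ => hK.continuous.measurable)
        hK.continuous.measurable (fun _ => ae_of_all _ fun x => ?_)
        (ae_of_all _ fun x => tendsto_const_nhds)
      rw [← ofReal_norm]
      exact ENNReal.ofReal_le_ofReal (hC x)
    have h2 := (h1 t ⟨hs.trans hst, ht⟩).sub (h1 s ⟨hs, hst.trans ht⟩)
    simp_rw [(H.curve _).equation f hf hb s t hs hst ht] at h2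
    have hB : MeasurableSet (Icc s t ×ˢ (univ : Set (V × V))) :=
      measurableSet_Icc.prod MeasurableSet.univ
    rw [tendsto_nhds_unique h2 (tendsto_integral_flux hS hflux hf hb s t)]
    exact (hS.integral_flux_eq hB _ h').symm
  · exact weakTendsto_finiteTimeθ hS measurable_fst hc1
      (fun w w' hw B hB => hS.tendsto_setIntegral_fst hw hB) (fun n => (H.curve _).measurable_u) hu'm
      (fun n => H.entropy _) hent hdens
  · exact weakTendsto_finiteTimeθ hS measurable_snd hc2
      (fun w w' hw B hB => hS.tendsto_setIntegral_snd hw hB) (fun n => (H.curve _).measurable_u) hu'm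
      (fun n => H.entropy _) hent hdens

end BoundedCurves

end JumpSystem

/-! ### Lower semicontinuity of Fisher information and action -/

lemma WeakTendsto.restrict {X : Type*} [MeasurableSpace X] {m : Measure X} {g : ℕ → X → ℝ}
    {g' : X → ℝ} (h : WeakTendsto m g g') {B : Set X} (hB : MeasurableSet B) :
    WeakTendsto (m.restrict B) g g' where
  equi := ⟨h.equi.measurable, fun ε hε => by
    obtain ⟨K, hK⟩ := h.equi.le ε hε
    refine ⟨K, fun n A hA => ?_⟩
    rw [Measure.restrict_restrict hA, Measure.restrict_apply hA]
    exact hK n _ (hA.inter hB)⟩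
  measurable := h.measurable
  integrable := h.integrable.integrableOn
  tendsto A hA := by
    rw [Measure.restrict_restrict hA]
    exact h.tendsto _ (hA.inter hB)

namespace JumpSystem

variable {V : Type*} [MetricSpace V] [SecondCountableTopology V] [MeasurableSpace V]
  [BorelSpace V] {S : JumpSystem V}

/-- Measurable multipliers, bounded above and converging to `1`. -/
structure MultiplierTendsto (S : JumpSystem V) (C : ℝ≥0) (a : ℕ → V × V → ℝ) : Prop where
  measurable : ∀ n, Measurable (a n)
  le : ∀ n, ∀ᵐ e ∂S.θ, a n e ≤ C
  tendsto : ∀ᵐ e ∂S.θ, Tendsto (fun n => a n e) atTop (𝓝 1)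

/-- The weight of the multiplier `a` relative to the finite reference measure. -/
def edgeWeight (a : V × V → ℝ) (p : ℝ × V × V) : ℝ := max (a p.2) 0 / (2 * truncDist p.2 ^ 2)

lemma edgeWeight_nonneg (a : V × V → ℝ) (p : ℝ × V × V) : 0 ≤ edgeWeight a p :=
  div_nonneg (le_max_right _ _) (by positivity)

lemma measurable_edgeWeight {a : V × V → ℝ} (ha : Measurable a) : Measurable (edgeWeight a) :=
  ((ha.comp measurable_snd).max measurable_const).div
    (((measurable_truncDist.comp measurable_snd).pow_const 2).const_mul 2)

lemma enorm_edgeWeight_le {a : V × V → ℝ} {C : ℝ≥0} {p : ℝ × V × V} (ha : a p.2 ≤ C) {k : ℕ}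
    (hp : p.2 ∈ longEdges V k) : ‖edgeWeight a p‖ₑ ≤ (C * (k + 1) ^ 2 : ℝ≥0) := by
  rw [Real.enorm_eq_ofReal (edgeWeight_nonneg _ _), ← ENNReal.ofReal_coe_nnreal]
  refine ENNReal.ofReal_le_ofReal ?_
  push_cast
  unfold edgeWeight
  rcases hp with hp | hp
  · have hp' : 1 / ((k : ℝ) + 1) ≤ truncDist p.2 := hp
    have h0 : (0 : ℝ) < 1 / ((k : ℝ) + 1) := by positivity
    have h1 : 0 < truncDist p.2 := h0.trans_le hp'
    rw [div_le_iff₀ (by positivity)] at hp' ⊢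
    have h2 : (1 : ℝ) ≤ ((k : ℝ) + 1) ^ 2 * truncDist p.2 ^ 2 := by
      rw [← mul_pow, mul_comm]; exact one_le_pow₀ hp'
    have h3 : max (a p.2) 0 ≤ C := max_le ha C.coe_nonneg
    nlinarith [C.coe_nonneg]
  · have : truncDist p.2 = 0 := by
      have hp' : p.2.1 = p.2.2 := hp
      rw [truncDist, hp', dist_self]; simp
    rw [this]
    simp only [ne_eq, OfNat.ofNat_ne_zero, not_false_eq_true, zero_pow, mul_zero, div_zero]
    positivity

lemma ofReal_sq_mul_edgeWeight (a : V × V → ℝ) {p : ℝ × V × V} (hp : 0 < truncDist p.2) :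
    ENNReal.ofReal (truncDist p.2 ^ 2) * ENNReal.ofReal (edgeWeight a p)
      = 2⁻¹ * ENNReal.ofReal (a p.2) := by
  have h2 : (2⁻¹ : ℝ≥0∞) = ENNReal.ofReal 2⁻¹ := by
    rw [ENNReal.ofReal_inv_of_pos two_pos]; simp
  have h3 : ENNReal.ofReal (a p.2) = ENNReal.ofReal (max (a p.2) 0) := by
    rcases le_total (a p.2) 0 with h | h
    · rw [max_eq_right h, ENNReal.ofReal_of_nonpos h, ENNReal.ofReal_zero]
    · rw [max_eq_left h]
  rw [h2, h3, ← ENNReal.ofReal_mul (by positivity), ← ENNReal.ofReal_mul (by positivity), edgeWeight]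
  congr 1
  field_simp

namespace MultiplierTendsto

variable {C : ℝ≥0} {a : ℕ → V × V → ℝ}

lemma ae_le (ha : MultiplierTendsto S C a) (hS : S.Assumptions) (T : ℝ) (n : ℕ) :
    ∀ᵐ p ∂hS.finiteTimeθ T, a n p.2 ≤ C :=
  have := hS.sigmaFinite_θ
  hS.ae_finiteTimeθ (Measure.quasiMeasurePreserving_snd.ae (p := fun e : V × V => a n e ≤ C) (ha.le n))

lemma ae_tendsto (ha : MultiplierTendsto S C a) (hS : S.Assumptions) (T : ℝ) :
    ∀ᵐ p ∂hS.finiteTimeθ T, Tendsto (fun n => edgeWeight (a n) p) atTop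
      (𝓝 (edgeWeight (fun _ => 1) p)) := by
  have := hS.sigmaFinite_θ
  have h1 : ∀ᵐ p ∂S.timeθ T, Tendsto (fun n => a n p.2) atTop (𝓝 1) :=
    Measure.quasiMeasurePreserving_snd.ae
      (p := fun e : V × V => Tendsto (fun n => a n e) atTop (𝓝 1)) ha.tendsto
  filter_upwards [hS.ae_finiteTimeθ h1] with p hp
  exact (hp.max tendsto_const_nhds).div_const _

end MultiplierTendsto

namespace DensitiesTendsto

variable {T : ℝ} {C : ℝ≥0} {a : ℕ → V × V → ℝ} {un : ℕ → ℝ → V → ℝ≥0}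
  {hn : ℕ → ℝ → V × V → ℝ} {u : ℝ → V → ℝ≥0} {h : ℝ → V × V → ℝ} {hS : S.Assumptions}

/-- With respect to the finite reference measure, `D(u(x), u(y))` carries the weight `edgeWeight (a
n)`, bounded on long edges and convergent almost everywhere, so the result on weighted convex
integrals applies. -/
lemma fisher_le_liminf (H : DensitiesTendsto hS T un hn u h)
    (hconv : ConvexOn ℝ≥0 univ S.fisherDensity) (ha : MultiplierTendsto S C a)
    (hun : ∀ n, Measurable (Function.uncurry (un n))) (hu : Measurable (Function.uncurry u))
    {B : Set (ℝ × V × V)} (hB : MeasurableSet B) :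
    ∫⁻ p in B, S.fisherTerm (fun _ => 1) u p ∂S.timeθ T
      ≤ liminf (fun n => ∫⁻ p in B, S.fisherTerm (a n) (un n) p ∂S.timeθ T) atTop := by
  have key : ∀ {a : V × V → ℝ} {u : ℝ → V → ℝ≥0}, Measurable a → Measurable (Function.uncurry u) →
      ∫⁻ p in B, S.fisherTerm a u p ∂S.timeθ T
        = ∫⁻ p in B, ENNReal.ofReal (edgeWeight a p)
            * S.fisherDensity (u p.1 p.2.1, u p.1 p.2.2) ∂hS.finiteTimeθ T := by
    intro a u ha hu
    have hm : Measurable fun p : ℝ × V × V => ENNReal.ofReal (edgeWeight a p)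
            * S.fisherDensity (u p.1 p.2.1, u p.1 p.2.2) :=
      (measurable_edgeWeight ha).ennreal_ofReal.mul
        (S.lowerSemicontinuous_fisherDensity.measurable.comp (measurable_edge_values hu))
    rw [hS.lintegral_finiteTimeθ T hm hB]
    refine lintegral_congr_ae (ae_restrict_of_ae ?_)
    filter_upwards [hS.ae_timeθ_pos T] with p hp
    rw [fisherTerm, ← mul_assoc, ← mul_assoc, ofReal_sq_mul_edgeWeight a hp]
  rw [key measurable_const hu]
  simp_rw [key (ha.measurable _) (hun _)]
  refine lintegral_mul_comp_le_liminf hconv S.lowerSemicontinuous_fisherDensity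
    (H.fst.restrict hB) (H.snd.restrict hB) (fun n => measurable_edgeWeight (ha.measurable n))
    (fun n => edgeWeight_nonneg _) (measurable_edgeWeight measurable_const) (edgeWeight_nonneg _)
    (ae_restrict_of_ae (ha.ae_tendsto hS T)) (A := fun k => univ ×ˢ longEdges V k)
    (fun k => MeasurableSet.univ.prod (measurableSet_longEdges k))
    (fun p => ?_) (fun k => ⟨max C 1 * (k + 1) ^ 2, fun n => ?_, ae_of_all _ fun p hp => ?_⟩)
  · obtain ⟨k, hk⟩ := exists_mem_longEdges p.2
    exact ⟨k, mem_univ _, hk⟩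
  · filter_upwards [ae_restrict_of_ae (ha.ae_le hS T n)] with p hp hpk
    exact enorm_edgeWeight_le (hp.trans (by push_cast; exact le_max_left _ _)) hpk.2
  · exact enorm_edgeWeight_le (by push_cast; exact le_max_right _ _) hp.2

/-- The perspective is a supremum over rational `ξ`, but its mobility term is not linear in the
density. Since `ψStar ≥ 0` enters with a minus sign, affine majorants of `α` give lower bounds
linear in `(h, u)`, and the infimum over the majorants recovers `α` in the limiting integrand. -/
lemma action_le_liminf (H : DensitiesTendsto hS T un hn u h)
    (ha : MultiplierTendsto S C a)
    (hun : ∀ n, Measurable (Function.uncurry (un n))) (hu : Measurable (Function.uncurry u))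
    (hhn : ∀ n, Measurable (Function.uncurry (hn n))) (hh : Measurable (Function.uncurry h))
    {B : Set (ℝ × V × V)} (hB : MeasurableSet B) :
    ∫⁻ p in B, S.actionDensity (fun _ => 1) u h p ∂S.timeθ T
      ≤ liminf (fun n => ∫⁻ p in B, S.actionDensity (a n) (un n) (hn n) p ∂S.timeθ T) atTop := by
  obtain ⟨c, hc, hc'⟩ := hS.exists_affine_α
  have hinv : Measurable fun p : ℝ × V × V => ENNReal.ofReal ((truncDist p.2 ^ 2)⁻¹) :=
    Assumptions.measurable_truncDist_sq_snd.inv.ennreal_ofReal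
  have key : ∀ {a : V × V → ℝ} {u : ℝ → V → ℝ≥0} {h : ℝ → V × V → ℝ}, Measurable a →
      Measurable (Function.uncurry u) → Measurable (Function.uncurry h) →
      ∫⁻ p in B, S.actionDensity a u h p ∂S.timeθ T
        = ∫⁻ p in B, ENNReal.ofReal ((truncDist p.2 ^ 2)⁻¹) * S.actionDensity a u h p
            ∂hS.finiteTimeθ T := by
    intro a u h ha hu hh
    have hm : Measurable fun p => ENNReal.ofReal ((truncDist p.2 ^ 2)⁻¹) * S.actionDensity a u h p :=
      hinv.mul (hS.measurable_actionDensity ha hu hh)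
    rw [hS.lintegral_finiteTimeθ T hm hB]
    refine lintegral_congr_ae (ae_restrict_of_ae ?_)
    filter_upwards [hS.ae_timeθ_pos T] with p hp
    rw [← mul_assoc, ← ENNReal.ofReal_mul (by positivity), mul_inv_cancel₀ (by positivity)]
    simp
  rw [key measurable_const hu hh]
  simp_rw [key (ha.measurable _) (hun _) (hhn _)]
  set A : ℕ → Set (ℝ × V × V) := fun k => univ ×ˢ longEdges V k with hA
  have hAm : ∀ k, MeasurableSet (A k) := fun k =>
    MeasurableSet.univ.prod (measurableSet_longEdges k)
  -- The index consists of the slope `ξ`, the affine majorant of `α` and the truncation to long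
  -- edges. The factor `1 / (1 ∧ d)²` from the change of measure is shared between `ξ` and `h` in
  -- the first term and absorbed by `edgeWeight` in the second.
  set L : (V × V → ℝ) → (ℝ → V → ℝ≥0) → (ℝ → V × V → ℝ) → ℚ × ℕ × ℕ → ℝ × V × V → ℝ :=
    fun a u h i p => (A i.2.2).indicator (fun p => (i.1 : ℝ) / truncDist p.2) p
        * (h p.1 p.2 / truncDist p.2)
      - S.ψStar i.1 * ((A i.2.2).indicator (edgeWeight a) p
        * affineQuadrant (c i.2.1) (u p.1 p.2.1, u p.1 p.2.2)) with hL
  have hWm : ∀ ξ : ℝ, Measurable fun p : ℝ × V × V => ξ / truncDist p.2 := fun ξ =>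
    measurable_const.div (measurable_truncDist.comp measurable_snd)
  have hWb : ∀ (ξ : ℝ) (k : ℕ) (p : ℝ × V × V), p ∈ A k →
      ‖ξ / truncDist p.2‖ₑ ≤ (‖ξ‖₊ * (k + 1) : ℝ≥0) := by
    intro ξ k p hp
    rw [← ofReal_norm, ← ENNReal.ofReal_coe_nnreal]
    refine ENNReal.ofReal_le_ofReal ?_
    push_cast
    rw [norm_div, Real.norm_of_nonneg (truncDist_nonneg _)]
    rcases hp.2 with hp | hp
    · have hp' : 1 / ((k : ℝ) + 1) ≤ truncDist p.2 := hp
      have h0 : (0 : ℝ) < 1 / ((k : ℝ) + 1) := by positivity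
      have h1 : 0 < truncDist p.2 := h0.trans_le hp'
      rw [div_le_iff₀ (by positivity)] at hp' ⊢
      nlinarith [norm_nonneg ξ]
    · have : truncDist p.2 = 0 := by
        have hp' : p.2.1 = p.2.2 := hp
        rw [truncDist, hp', dist_self]; simp
      rw [this, div_zero]; positivity
  have hG := H.flux.restrict hB
  have hQ := fun i => (H.fst.restrict hB).affineQuadrant (H.snd.restrict hB) (c i)
  set P := (hS.finiteTimeθ T).restrict B with hP
  have hale : ∀ n, ∀ᵐ p ∂P, a n p.2 ≤ C := fun n => ae_restrict_of_ae (ha.ae_le hS T n)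
  have hmul1 : ∀ (g : ℝ × V × V → ℝ), Integrable g P → ∀ (ξ : ℝ) k,
      Integrable (fun p => (A k).indicator (fun p => ξ / truncDist p.2) p * g p) P := by
    intro g hg ξ k
    refine hg.bdd_mul (c := ‖ξ‖₊ * (k + 1)) ((hWm ξ).indicator (hAm k)).aestronglyMeasurable
      (ae_of_all _ fun p => ?_)
    by_cases hp : p ∈ A k
    · rw [indicator_of_mem hp]
      have := hWb ξ k p hp
      rw [← ofReal_norm, ← ENNReal.ofReal_coe_nnreal,
        ENNReal.ofReal_le_ofReal_iff (by positivity)] at this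
      exact_mod_cast this
    · rw [indicator_of_notMem hp, norm_zero]; positivity
  have hmul2 : ∀ (C : ℝ≥0) (a : V × V → ℝ) (g : ℝ × V × V → ℝ), Measurable a →
      (∀ᵐ p ∂P, a p.2 ≤ C) → Integrable g P → ∀ k,
      Integrable (fun p => (A k).indicator (edgeWeight a) p * g p) P := by
    intro C a g ham hac hg k
    refine hg.bdd_mul (c := C * (k + 1) ^ 2)
      ((measurable_edgeWeight ham).indicator (hAm k)).aestronglyMeasurable ?_
    filter_upwards [hac] with p hpa
    by_cases hp : p ∈ A k
    · rw [indicator_of_mem hp]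
      have := enorm_edgeWeight_le hpa hp.2
      rw [← ofReal_norm, ← ENNReal.ofReal_coe_nnreal,
        ENNReal.ofReal_le_ofReal_iff (by positivity)] at this
      exact_mod_cast this
    · rw [indicator_of_notMem hp, norm_zero]; positivity
  have hlow : ∀ (a : V × V → ℝ) (u : ℝ → V → ℝ≥0) (h : ℝ → V × V → ℝ) (i : ℚ × ℕ × ℕ)
      (p : ℝ × V × V), 0 < truncDist p.2 →
      ENNReal.ofReal (L a u h i p)
        ≤ ENNReal.ofReal ((truncDist p.2 ^ 2)⁻¹) * S.actionDensity a u h p := by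
    intro a u h i p hp
    by_cases hpA : p ∈ A i.2.2
    · have h2 : (2⁻¹ : ℝ≥0∞) = ENNReal.ofReal 2⁻¹ := by
        rw [ENNReal.ofReal_inv_of_pos two_pos]; simp
      have h1 := S.le_perspective (2 * h p.1 p.2) ((a p.2).toNNReal * S.α (u p.1 p.2.1, u p.1 p.2.2))
        (i.1 : ℝ)
      rw [actionDensity, ← mul_assoc]
      refine le_trans ?_ (mul_le_mul_right h1 _)
      rw [h2, ← ENNReal.ofReal_mul (by positivity), ← ENNReal.ofReal_mul (by positivity)]
      refine ENNReal.ofReal_le_ofReal ?_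
      simp only [hL, indicator_of_mem hpA, edgeWeight, Real.coe_toNNReal']
      have h3 := hc i.2.1 (u p.1 p.2.1, u p.1 p.2.2)
      have h4 : S.ψStar i.1 * (max (a p.2) 0 / (2 * truncDist p.2 ^ 2)
            * S.α (u p.1 p.2.1, u p.1 p.2.2))
          ≤ S.ψStar i.1 * (max (a p.2) 0 / (2 * truncDist p.2 ^ 2)
            * affineQuadrant (c i.2.1) (u p.1 p.2.1, u p.1 p.2.2)) := by
        refine mul_le_mul_of_nonneg_left (mul_le_mul_of_nonneg_left h3 ?_) (hS.ψStar_nonneg _)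
        exact div_nonneg (le_max_right _ _) (by positivity)
      refine (sub_le_sub_left h4 _).trans (le_of_eq ?_)
      field_simp
    · simp [hL, indicator_of_notMem hpA]
  refine le_trans (lintegral_mono_ae ?_) (lintegral_iSup_ofReal_le_liminf (ι := ℚ × ℕ × ℕ)
    (f := fun n p => ENNReal.ofReal ((truncDist p.2 ^ 2)⁻¹) * S.actionDensity (a n) (un n) (hn n) p)
    (L := fun i n => L (a n) (un n) (hn n) i) (L' := fun i => L (fun _ => 1) u h i)
    (fun i n => ?_) (fun i => ?_) (fun i => ?_) (fun i n => ?_) (fun i D hD => ?_))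
  · filter_upwards [ae_restrict_of_ae (hS.ae_finiteTimeθ (hS.ae_timeθ_pos T))] with p hp
    obtain ⟨k, hk⟩ := exists_mem_longEdges p.2
    have hpA : p ∈ A k := ⟨mem_univ _, hk⟩
    have h2 : (2⁻¹ : ℝ≥0∞) = ENNReal.ofReal 2⁻¹ := by
      rw [ENNReal.ofReal_inv_of_pos two_pos]; simp
    rw [actionDensity, perspective_eq_iSup_rat hS, ← mul_assoc, ENNReal.mul_iSup]
    refine iSup_le fun ξ => ?_
    rw [h2, ← ENNReal.ofReal_mul (by positivity), ← ENNReal.ofReal_mul (by positivity)]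
    by_cases htop : (⨆ i, ENNReal.ofReal (L (fun _ => 1) u h i p)) = ∞
    · rw [htop]; exact le_top
    rw [ENNReal.ofReal_le_iff_le_toReal htop]
    refine le_of_forall_pos_le_add fun ε hε => ?_
    set q : ℝ≥0 × ℝ≥0 := (u p.1 p.2.1, u p.1 p.2.2) with hq
    set d : ℝ := S.ψStar ξ * (1 / (2 * truncDist p.2 ^ 2)) with hd
    have hd0 : 0 ≤ d := mul_nonneg (hS.ψStar_nonneg _) (by positivity)
    -- The error in `α` is later multiplied by `d`; the `+ 1` covers `d = 0`.
    obtain ⟨i, hi⟩ := hc' q (ε / (d + 1)) (by positivity)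
    have h5 : L (fun _ => 1) u h (ξ, i, k) p
        ≤ (⨆ i, ENNReal.ofReal (L (fun _ => 1) u h i p)).toReal :=
      (ENNReal.ofReal_le_iff_le_toReal htop).1
        (le_iSup (fun i => ENNReal.ofReal (L (fun _ => 1) u h i p)) (ξ, i, k))
    have h6 : L (fun _ => 1) u h (ξ, i, k) p
        = (ξ : ℝ) * h p.1 p.2 / truncDist p.2 ^ 2 - d * affineQuadrant (c i) q := by
      simp only [hL, indicator_of_mem hpA, edgeWeight, hd]
      rw [max_eq_left zero_le_one, ← hq]
      field_simp
    have h7 : d * affineQuadrant (c i) q ≤ d * S.α q + ε := by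
      have h8 : d * affineQuadrant (c i) q ≤ d * (S.α q + ε / (d + 1)) :=
        mul_le_mul_of_nonneg_left hi.le hd0
      have h9 : d * (ε / (d + 1)) ≤ ε := by
        rw [mul_div_assoc', div_le_iff₀ (by positivity)]
        nlinarith
      nlinarith
    have h10 : (truncDist p.2 ^ 2)⁻¹ * 2⁻¹ * (2 * h p.1 p.2 * ξ
        - (1 : ℝ).toNNReal * S.α q * S.ψStar ξ)
        = (ξ : ℝ) * h p.1 p.2 / truncDist p.2 ^ 2 - d * S.α q := by
      rw [hd, Real.toNNReal_one]
      push_cast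
      field_simp
    rw [h10]
    linarith
  · exact (hmul1 _ (hG.equi.integrable n) _ _).sub
      ((hmul2 C _ _ (ha.measurable n) (hale n) ((hQ _).equi.integrable n) _).const_mul _)
  · exact (((hWm _).indicator (hAm _)).mul hG.measurable).sub
      ((((measurable_edgeWeight measurable_const).indicator (hAm _)).mul
        (hQ _).measurable).const_mul _)
  · exact (hmul1 _ hG.integrable _ _).sub ((hmul2 1 _ _ measurable_const
      (ae_of_all _ fun p => by simp) (hQ _).integrable _).const_mul _)
  · filter_upwards [ae_restrict_of_ae (hS.ae_finiteTimeθ (hS.ae_timeθ_pos T))] with p hp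
    exact hlow _ _ _ _ _ hp
  · have e1 := tendsto_setIntegral_indicator_mul hG (w := fun _ p => (i.1 : ℝ) / truncDist p.2)
      (w' := fun p => (i.1 : ℝ) / truncDist p.2) (fun _ => hWm _) (hWm _)
      (ae_of_all _ fun _ => tendsto_const_nhds) (hAm i.2.2) (C := ‖(i.1 : ℝ)‖₊ * (i.2.2 + 1))
      (fun _ => ae_of_all _ fun p hp => hWb _ _ p hp) hD
    have e2 := tendsto_setIntegral_indicator_mul (hQ i.2.1) (w := fun n => edgeWeight (a n))
      (w' := edgeWeight fun _ => 1) (fun n => measurable_edgeWeight (ha.measurable n))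
      (measurable_edgeWeight measurable_const) (ae_restrict_of_ae (ha.ae_tendsto hS T))
      (hAm i.2.2) (C := C * (i.2.2 + 1) ^ 2) (fun n => by
        filter_upwards [hale n] with p hp hpk
        exact enorm_edgeWeight_le hp hpk.2) hD
    have e3 := e1.sub (e2.const_mul (S.ψStar i.1))
    have hsplit : ∀ (C : ℝ≥0) (a : V × V → ℝ) (u : ℝ → V → ℝ≥0) (h : ℝ → V × V → ℝ), Measurable a →
        (∀ᵐ p ∂P, a p.2 ≤ C) → Integrable (fun p => h p.1 p.2 / truncDist p.2) P →
        Integrable (fun p => affineQuadrant (c i.2.1) (u p.1 p.2.1, u p.1 p.2.2)) P →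
        ∫ p in D, L a u h i p ∂P
          = (∫ p in D, (A i.2.2).indicator (fun p => (i.1 : ℝ) / truncDist p.2) p
              * (h p.1 p.2 / truncDist p.2) ∂P)
            - S.ψStar i.1 * ∫ p in D, (A i.2.2).indicator (edgeWeight a) p
              * affineQuadrant (c i.2.1) (u p.1 p.2.1, u p.1 p.2.2) ∂P := by
      intro C a u h ham hac h1 h2
      rw [← integral_const_mul]
      exact integral_sub (hmul1 _ h1 _ _).integrableOn
        ((hmul2 C _ _ ham hac h2 _).const_mul _).integrableOn
    rw [hsplit 1 (fun _ => 1) u h measurable_const (ae_of_all _ fun p => by simp) hG.integrable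
      (hQ _).integrable]
    simp_rw [fun n => hsplit C (a n) (un n) (hn n) (ha.measurable n) (hale n)
      (hG.equi.integrable n) ((hQ i.2.1).equi.integrable n)]
    exact e3

end DensitiesTendsto

end JumpSystem

/-! ### Stability of dissipative solutions -/

namespace JumpSystem

variable {V : Type*} [MetricSpace V] [SecondCountableTopology V] [MeasurableSpace V]
  [BorelSpace V] {S : JumpSystem V}

/-- The entropy of a density. -/
def densityEntropy (S : JumpSystem V) (u : V → ℝ≥0) : ℝ≥0∞ := ∫⁻ x, ENNReal.ofReal (S.φ (u x)) ∂S.π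

/-- The action of a curve in density form over `[s,t]`. -/
def actionOn (S : JumpSystem V) (T : ℝ) (a : V × V → ℝ) (u : ℝ → V → ℝ≥0) (h : ℝ → V × V → ℝ)
    (s t : ℝ) : ℝ≥0∞ :=
  ∫⁻ p in Icc s t ×ˢ univ, S.actionDensity a u h p ∂S.timeθ T

/-- The Fisher information of a curve in density form over `[s,t]`. -/
def fisherOn (S : JumpSystem V) (T : ℝ) (a : V × V → ℝ) (u : ℝ → V → ℝ≥0) (s t : ℝ) : ℝ≥0∞ :=
  ∫⁻ p in Icc s t ×ˢ univ, S.fisherTerm a u p ∂S.timeθ T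

/-- Dissipative solutions in density form. -/
structure DissipativeCurve (S : JumpSystem V) (T : ℝ) (a : V × V → ℝ) (u : ℝ → V → ℝ≥0)
    (h : ℝ → V × V → ℝ) : Prop where
  curve : DensityCurve S T u h
  entropy_zero : S.densityEntropy (u 0) < ∞
  inequality : ∀ t ∈ Icc 0 T,
    S.actionOn T a u h 0 t + S.fisherOn T a u 0 t + S.densityEntropy (u t) ≤ S.densityEntropy (u 0)

section Solutions

variable {T : ℝ} {ρ : ℝ → FiniteMeasure V} {j : ℝ → SigmaFiniteSignedMeasure (V × V)}
  {u : ℝ → V → ℝ≥0} {h : ℝ → V × V → ℝ} {a : V × V → ℝ}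

lemma IsDissipative.exists_represents (hD : (S.reweight a).IsDissipative T ρ j) (hS : S.Assumptions)
    (ha : Multiplier a) (hT : 0 ≤ T) : ∃ u h, Represents S T ρ j u h := by
  have h0 : S.entropy (ρ 0) < ∞ := hD.entropy_zero
  refine hS.exists_represents ha hT hD.continuityEquation (fun t ht => ?_) ?_
  · have h1 : S.entropy (ρ t) < ∞ :=
      (le_add_left le_rfl).trans_lt ((hD.energyInequality t ht).trans_lt h0)
    unfold entropy at h1
    by_contra hne
    rw [if_neg hne] at h1
    exact h1.ne rfl
  · exact (le_add_right le_rfl).trans_lt ((hD.energyInequality T (right_mem_Icc.2 hT)).trans_lt h0)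

lemma Represents.dissipativeCurve (hR : Represents S T ρ j u h)
    (hD : (S.reweight a).IsDissipative T ρ j) (hS : S.Assumptions) (ha : Multiplier a) (hT : 0 ≤ T) :
    DissipativeCurve S T a u h := by
  have he : ∀ t ∈ Icc 0 T, S.densityEntropy (u t) = (S.reweight a).entropy (ρ t) := fun t ht =>
    (hR.entropy_eq hS ht).symm
  refine ⟨hR.densityCurve hS hD.continuityEquation, ?_, fun t ht => ?_⟩
  · rw [he 0 (left_mem_Icc.2 hT)]; exact hD.entropy_zero
  · rw [he 0 (left_mem_Icc.2 hT), he t ht, actionOn, fisherOn,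
      ← hR.lintegral_add hS ha le_rfl ht.2]
    exact hD.energyInequality t ht

lemma Represents.finiteActionCurve (hR : Represents S T ρ j u h) (hc : ContinuityEquation T ρ j)
    (hD : DissipativeCurve S T (fun _ => 1) u h) (hS : S.Assumptions) (hT : 0 ≤ T) :
    S.FiniteActionCurve T ρ j ∧ S.IsDissipative T ρ j := by
  have h0 : (0 : ℝ) ∈ Icc 0 T := left_mem_Icc.2 hT
  have hl : ∀ t ∈ Icc 0 T, (∫⁻ r in Icc 0 t, (S.action (ρ r) (j r) + S.fisher (ρ r)))
      + S.entropy (ρ t) ≤ S.entropy (ρ 0) := by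
    intro t ht
    have h1 := hR.lintegral_add hS multiplier_one le_rfl ht.2
    rw [reweight_one] at h1
    rw [h1, hR.entropy_eq hS ht, hR.entropy_eq hS h0]
    exact hD.inequality t ht
  have he0 : S.entropy (ρ 0) < ∞ := by
    rw [hR.entropy_eq hS h0]; exact hD.entropy_zero
  refine ⟨⟨hc, ⟨(S.entropy (ρ 0)).toNNReal, fun t ht => ?_⟩, ?_⟩, he0, hc, hl⟩
  · rw [ENNReal.coe_toNNReal he0.ne]
    exact (le_add_left le_rfl).trans (hl t ht)
  · exact (le_add_right le_rfl).trans_lt ((hl T (right_mem_Icc.2 hT)).trans_lt he0)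

end Solutions

section Limits

variable {T : ℝ} {C : ℝ≥0} {a : ℕ → V × V → ℝ} {un : ℕ → ℝ → V → ℝ≥0}
  {hn : ℕ → ℝ → V × V → ℝ} {u : ℝ → V → ℝ≥0} {h : ℝ → V × V → ℝ} {hS : S.Assumptions}

lemma DensitiesTendsto.tendsto_flux (H : DensitiesTendsto hS T un hn u h) (k : ℕ)
    {B : Set (ℝ × V × V)} (hB : MeasurableSet B) : Tendsto
      (fun n => ∫ p in B ∩ univ ×ˢ longEdges V k, hn n p.1 p.2 ∂S.timeθ T) atTop
      (𝓝 (∫ p in B ∩ univ ×ˢ longEdges V k, h p.1 p.2 ∂S.timeθ T)) := by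
  have hA : MeasurableSet (B ∩ univ ×ˢ longEdges V k) :=
    hB.inter (MeasurableSet.univ.prod (measurableSet_longEdges k))
  have key := fun h => hS.integral_flux_eq (T := T) hA (fun _ => 1) h
  simp only [one_mul] at key
  rw [key]
  simp_rw [key]
  have hm : Measurable ((B ∩ univ ×ˢ longEdges V k).indicator
      fun p : ℝ × V × V => 1 / truncDist p.2) :=
    (measurable_const.div (measurable_truncDist.comp measurable_snd)).indicator hA
  refine H.flux.integral_mul (C := k + 1) (fun _ => hm) hm (fun _ => ?_)
    (ae_of_all _ fun _ => tendsto_const_nhds)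
  filter_upwards [hS.ae_finiteTimeθ (hS.ae_timeθ_pos T)] with p hp
  rw [← ofReal_norm, ← ENNReal.ofReal_coe_nnreal]
  refine ENNReal.ofReal_le_ofReal ?_
  push_cast
  by_cases hpB : p ∈ B ∩ univ ×ˢ longEdges V k
  · rw [indicator_of_mem hpB, norm_div, Real.norm_of_nonneg hp.le, norm_one, div_le_iff₀ hp]
    rcases hpB.2.2 with h1 | h1
    · have h1' : 1 / ((k : ℝ) + 1) ≤ truncDist p.2 := h1
      rwa [div_le_iff₀' (by positivity)] at h1'
    · have h1' : p.2.1 = p.2.2 := h1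
      rw [truncDist, h1', dist_self] at hp; simp at hp
  · rw [indicator_of_notMem hpB, norm_zero]; positivity

lemma DensitiesTendsto.actionOn_le (H : DensitiesTendsto hS T un hn u h)
    (ha : MultiplierTendsto S C a) (hc : ∀ n, DensityCurve S T (un n) (hn n))
    (hc' : DensityCurve S T u h) (s t : ℝ) : S.actionOn T (fun _ => 1) u h s t
      ≤ liminf (fun n => S.actionOn T (a n) (un n) (hn n) s t) atTop :=
  H.action_le_liminf ha (fun n => (hc n).measurable_u) hc'.measurable_u
    (fun n => (hc n).measurable_h) hc'.measurable_h (measurableSet_Icc.prod MeasurableSet.univ)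

lemma DensitiesTendsto.fisherOn_le (H : DensitiesTendsto hS T un hn u h)
    (hconv : ConvexOn ℝ≥0 univ S.fisherDensity) (ha : MultiplierTendsto S C a)
    (hc : ∀ n, DensityCurve S T (un n) (hn n)) (hc' : DensityCurve S T u h) (s t : ℝ) :
    S.fisherOn T (fun _ => 1) u s t ≤ liminf (fun n => S.fisherOn T (a n) (un n) s t) atTop :=
  H.fisher_le_liminf hconv ha (fun n => (hc n).measurable_u) hc'.measurable_u
    (measurableSet_Icc.prod MeasurableSet.univ)

lemma DensitiesTendsto.entropy_le (H : DensitiesTendsto hS T un hn u h) {t : ℝ} (ht : t ∈ Icc 0 T) :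
    S.densityEntropy (u t) ≤ liminf (fun n => S.densityEntropy (un n t)) atTop :=
  have := hS.finite_π
  hS.lintegral_φ_le_liminf (H.density t ht)

lemma BoundedCurves.of_dissipative (hT : 0 ≤ T) (hm : ∀ n, Multiplier (a n))
    (hle : ∀ n, ∀ᵐ e ∂S.θ, a n e ≤ C) (hD : ∀ n, DissipativeCurve S T (a n) (un n) (hn n)) {E : ℝ≥0}
    (hE : ∀ n, S.densityEntropy (un n 0) ≤ E) (hsf : SigmaFinite S.θ) :
    BoundedCurves S T C E a un hn := by
  refine ⟨hm, hle, fun n => (hD n).curve, fun n t ht =>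
    (le_add_left le_rfl).trans (((hD n).inequality t ht).trans (hE n)), fun n => ?_⟩
  have h1 := ((hD n).inequality T (right_mem_Icc.2 hT)).trans (hE n)
  rw [add_assoc] at h1
  refine le_trans (le_of_eq ?_) ((le_add_right le_rfl).trans h1)
  have : (S.timeθ T).restrict (Icc 0 T ×ˢ univ) = S.timeθ T := by
    rw [timeθ, ← Measure.prod_restrict, Measure.restrict_univ,
      Measure.restrict_restrict measurableSet_Icc, inter_self]
  rw [actionOn, this]

/-- Compactness of sequences of dissipative solutions and stability of the energy-dissipation
inequality. -/
theorem exists_dissipative_limit (hS : S.Assumptions) (hconv : ConvexOn ℝ≥0 univ S.fisherDensity)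
    (hT : 0 ≤ T) (hm : ∀ n, Multiplier (a n)) (ha : MultiplierTendsto S C a)
    (hD : ∀ n, DissipativeCurve S T (a n) (un n) (hn n)) {u₀ : V → ℝ≥0} (hu₀ : Measurable u₀)
    (hu₀i : Integrable (fun x => (u₀ x : ℝ)) S.π)
    (h0 : ∀ B, MeasurableSet B →
      Tendsto (fun n => ∫ x in B, (un n 0 x : ℝ) ∂S.π) atTop (𝓝 (∫ x in B, (u₀ x : ℝ) ∂S.π)))
    (hE : Tendsto (fun n => S.densityEntropy (un n 0)) atTop (𝓝 (S.densityEntropy u₀)))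
    (hE₀ : S.densityEntropy u₀ < ∞) :
    ∃ (σ : ℕ → ℕ) (u' : ℝ → V → ℝ≥0) (h' : ℝ → V × V → ℝ), StrictMono σ ∧
      DensitiesTendsto hS T (fun n => un (σ n)) (fun n => hn (σ n)) u' h' ∧
      DissipativeCurve S T (fun _ => 1) u' h' ∧ (u' 0 =ᵐ[S.π] u₀) := by
  have hfin := hS.finite_π
  obtain ⟨E, hEle⟩ : ∃ E : ℝ≥0, ∀ n, S.densityEntropy (un n 0) ≤ E := by
    have h1 : Tendsto (fun n => (S.densityEntropy (un n 0)).toNNReal) atTop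
        (𝓝 (S.densityEntropy u₀).toNNReal) := (ENNReal.tendsto_toNNReal hE₀.ne).comp hE
    obtain ⟨E, hE⟩ := h1.bddAbove_range
    refine ⟨E, fun n => ?_⟩
    rw [← ENNReal.coe_toNNReal (hD n).entropy_zero.ne]
    exact ENNReal.coe_le_coe.2 (hE ⟨n, rfl⟩)
  have hB := BoundedCurves.of_dissipative hT hm ha.le hD hEle hS.sigmaFinite_θ
  obtain ⟨σ, u', h', hσ, hc, hH⟩ := hB.exists_subseq hS hT hu₀ h0 hu₀i
  have h00 : (0 : ℝ) ∈ Icc 0 T := left_mem_Icc.2 hT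
  have heq : u' 0 =ᵐ[S.π] u₀ := by
    have h1 : (fun x => (u' 0 x : ℝ)) =ᵐ[S.π] fun x => (u₀ x : ℝ) := by
      refine Integrable.ae_eq_of_forall_setIntegral_eq _ _ (hH.density 0 h00).integrable hu₀i
        fun B hB _ => ?_
      exact tendsto_nhds_unique ((hH.density 0 h00).tendsto B hB) ((h0 B hB).comp hσ.tendsto_atTop)
    filter_upwards [h1] with x hx
    exact_mod_cast hx
  have hent : S.densityEntropy (u' 0) = S.densityEntropy u₀ := by
    refine lintegral_congr_ae ?_
    filter_upwards [heq] with x hx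
    rw [hx]
  have ha' : MultiplierTendsto S C fun n => a (σ n) :=
    ⟨fun n => ha.measurable _, fun n => ha.le _, by
      filter_upwards [ha.tendsto] with e he using he.comp hσ.tendsto_atTop⟩
  refine ⟨σ, u', h', hσ, hH, ⟨hc, by rwa [hent], fun t ht => ?_⟩, heq⟩
  have h1 := hH.actionOn_le ha' (fun n => (hD _).curve) hc 0 t
  have h2 := hH.fisherOn_le hconv ha' (fun n => (hD _).curve) hc 0 t
  have h3 := hH.entropy_le ht
  -- Inferior limits are superadditive, each approximate curve satisfies the inequality, and the
  -- right-hand side converges because the initial entropies do.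
  calc _ ≤ _ := add_le_add (add_le_add h1 h2) h3
    _ ≤ _ := add_le_add_left (ENNReal.liminf_add_liminf_le _ _) _
    _ ≤ _ := ENNReal.liminf_add_liminf_le _ _
    _ ≤ liminf (fun n => S.densityEntropy (un (σ n) 0)) atTop :=
        liminf_le_liminf (Eventually.of_forall fun n => (hD _).inequality t ht)
    _ = S.densityEntropy (u' 0) := by
        rw [hent]; exact (hE.comp hσ.tendsto_atTop).liminf_eq

lemma DensitiesTendsto.curvesTendsto (H : DensitiesTendsto hS T un hn u h)
    {ρn : ℕ → ℝ → FiniteMeasure V} {jn : ℕ → ℝ → SigmaFiniteSignedMeasure (V × V)}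
    (hRn : ∀ n, Represents S T (ρn n) (jn n) (un n) (hn n))
    {ρ : ℝ → FiniteMeasure V} {j : ℝ → SigmaFiniteSignedMeasure (V × V)}
    (hR : Represents S T ρ j u h) : CurvesTendsto T ρn jn ρ j := by
  refine ⟨fun t ht => ?_, hS.fluxTendsto hRn hR fun k B hB => H.tendsto_flux k hB⟩
  exact (setwiseTendsto_of_density (fun n => (hRn n).measurable_u.comp measurable_prodMk_left)
    (hR.measurable_u.comp measurable_prodMk_left) (fun n => (hRn n).ρ_eq t ht) (hR.ρ_eq t ht)).2
    (H.density t ht).tendsto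

end Limits

end JumpSystem

/-! ### Stability of the reflecting continuity equation -/

namespace JumpSystem

variable {V : Type*} [MetricSpace V] [SecondCountableTopology V] [MeasurableSpace V]
  [BorelSpace V] {S : JumpSystem V}

/-- The reflecting continuity equation in density form. -/
def ReflectingEquation (S : JumpSystem V) (T : ℝ) (u : ℝ → V → ℝ≥0) (h : ℝ → V × V → ℝ) : Prop :=
  ∀ f : V → ℝ, Measurable f → (∃ K, ∀ x, |f x| ≤ K) →
    ∫⁻ e, ENNReal.ofReal (graphGradient f e ^ 2) ∂S.θ < ∞ → ∀ s t, 0 ≤ s → s ≤ t → t ≤ T →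
      (∫ x, f x * u t x ∂S.π) - ∫ x, f x * u s x ∂S.π
        = ∫ p in Icc s t ×ˢ univ, graphGradient f p.2 * h p.1 p.2 ∂S.timeθ T

/-- Estimate of the flux of a test function with square-integrable gradient. -/
lemma Assumptions.lintegral_flux_le (hS : S.Assumptions) (l K M C : ℝ≥0) : ∃ K' : ℝ≥0,
    ∀ (T : ℝ) (a : V × V → ℝ) (u : ℝ → V → ℝ≥0) (h : ℝ → V × V → ℝ) (f : V → ℝ),
    Measurable a → (∀ᵐ e ∂S.θ, a e ≤ C) → Measurable (Function.uncurry u) →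
    Measurable (Function.uncurry h) → (∀ t x, u t x ≤ M) → Measurable f → (∀ x, |f x| ≤ K) →
    ∀ D, MeasurableSet D → l * ∫⁻ p in D, ‖graphGradient f p.2 * h p.1 p.2‖ₑ ∂S.timeθ T
      ≤ ∫⁻ p, S.actionDensity a u h p ∂S.timeθ T
        + K' * ∫⁻ p in D, ENNReal.ofReal (graphGradient f p.2 ^ 2) ∂S.timeθ T := by
  have hsf := hS.sigmaFinite_θ
  obtain ⟨K', hK'⟩ := hS.flux_mul_le l (2 * K)
  refine ⟨K' * C * (1 + M + M), fun T a u h f ha haC hu hh huM hf hfK D hD => ?_⟩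
  have hAm := hS.measurable_actionDensity ha hu hh
  have hac : ∀ᵐ p ∂S.timeθ T, a p.2 ≤ C :=
    Measure.quasiMeasurePreserving_snd.ae (p := fun e : V × V => a e ≤ C) haC
  rw [← lintegral_const_mul' _ _ ENNReal.coe_ne_top, ← lintegral_const_mul' _ _ ENNReal.coe_ne_top]
  refine le_trans ?_ (add_le_add_left (setLIntegral_le_lintegral D _) _)
  rw [← lintegral_add_left hAm]
  refine lintegral_mono_ae (ae_restrict_of_ae ?_)
  filter_upwards [hac] with p hp
  have h1 := hK' C a u h p (graphGradient f p.2) hp (by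
    unfold graphGradient
    have e1 := hfK p.2.1
    have e2 := hfK p.2.2
    push_cast
    rw [abs_le] at *
    constructor <;> linarith [e1.1, e1.2, e2.1, e2.2])
  rw [enorm_mul, mul_comm ‖graphGradient f p.2‖ₑ]
  refine h1.trans (add_le_add le_rfl ?_)
  have h2 : (1 + u p.1 p.2.1 + u p.1 p.2.2 : ℝ≥0∞) ≤ ((1 + M + M : ℝ≥0) : ℝ≥0∞) := by
    push_cast
    gcongr <;> exact huM _ _
  calc (K' * C : ℝ≥0∞) * (ENNReal.ofReal (graphGradient f p.2 ^ 2)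
        * (1 + u p.1 p.2.1 + u p.1 p.2.2))
      ≤ (K' * C : ℝ≥0∞) * (ENNReal.ofReal (graphGradient f p.2 ^ 2) * (1 + M + M : ℝ≥0)) := by
        gcongr
    _ = _ := by push_cast; ring

lemma Assumptions.lintegral_timeθ_snd (hS : S.Assumptions) {T : ℝ} {F : V × V → ℝ≥0∞}
    (hF : Measurable F) : ∫⁻ p, F p.2 ∂S.timeθ T = ENNReal.ofReal T * ∫⁻ e, F e ∂S.θ := by
  have hsf := hS.sigmaFinite_θ
  have hm : Measurable fun p : ℝ × V × V => F p.2 := hF.comp measurable_snd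
  rw [timeθ, lintegral_prod _ hm.aemeasurable]
  simp only
  rw [lintegral_const, Measure.restrict_apply_univ,
    Real.volume_Icc, sub_zero, mul_comm]

/-- Bounded densities give bounded mobility, so Young's inequality controls the pairing by the
action and the square integral of the gradient. No Lipschitz regularity of the test function is
needed. -/
lemma Assumptions.integrable_flux (hS : S.Assumptions) {T : ℝ} {C M : ℝ≥0} {a : V × V → ℝ}
    {u : ℝ → V → ℝ≥0} {h : ℝ → V × V → ℝ} {f : V → ℝ} (ha : Measurable a)
    (haC : ∀ᵐ e ∂S.θ, a e ≤ C) (hu : Measurable (Function.uncurry u))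
    (hh : Measurable (Function.uncurry h)) (huM : ∀ t x, u t x ≤ M)
    (hA : ∫⁻ p, S.actionDensity a u h p ∂S.timeθ T < ∞) (hf : Measurable f) (hb : ∃ K, ∀ x, |f x| ≤ K)
    (hf2 : ∫⁻ e, ENNReal.ofReal (graphGradient f e ^ 2) ∂S.θ < ∞) :
    Integrable (fun p => graphGradient f p.2 * h p.1 p.2) (S.timeθ T) := by
  obtain ⟨K, hK⟩ := hb
  have hgm := measurable_graphGradient hf
  refine ⟨((hgm.comp measurable_snd).mul hh).aestronglyMeasurable, ?_⟩
  obtain ⟨K', hK'⟩ := hS.lintegral_flux_le (V := V) 1 K.toNNReal M C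
  have h1 := hK' T a u h f ha haC hu hh huM hf (fun x => (hK x).trans (Real.le_coe_toNNReal K)) univ
    MeasurableSet.univ
  rw [ENNReal.coe_one, one_mul, setLIntegral_univ, setLIntegral_univ] at h1
  refine h1.trans_lt ?_
  rw [hS.lintegral_timeθ_snd (F := fun e => ENNReal.ofReal (graphGradient f e ^ 2))
    (hgm.pow_const 2).ennreal_ofReal]
  exact ENNReal.add_lt_top.2 ⟨hA, ENNReal.mul_lt_top ENNReal.coe_lt_top
    (ENNReal.mul_lt_top ENNReal.ofReal_lt_top hf2)⟩

/-- The reflecting continuity equation passes to the limit. -/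
lemma DensitiesTendsto.reflectingEquation {hS : S.Assumptions} {T : ℝ} {C M E : ℝ≥0}
    {a : ℕ → V × V → ℝ} {un : ℕ → ℝ → V → ℝ≥0} {hn : ℕ → ℝ → V × V → ℝ} {u : ℝ → V → ℝ≥0}
    {h : ℝ → V × V → ℝ} (H : DensitiesTendsto hS T un hn u h)
    (ha : ∀ n, Measurable (a n)) (haC : ∀ n, ∀ᵐ e ∂S.θ, a n e ≤ C)
    (hun : ∀ n, Measurable (Function.uncurry (un n)))
    (hhn : ∀ n, Measurable (Function.uncurry (hn n))) (hu : Measurable (Function.uncurry u))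
    (hh : Measurable (Function.uncurry h)) (hunM : ∀ n t x, un n t x ≤ M) (huM : ∀ t x, u t x ≤ M)
    (hA : ∀ n, ∫⁻ p, S.actionDensity (a n) (un n) (hn n) p ∂S.timeθ T ≤ E)
    (hA' : ∫⁻ p, S.actionDensity (fun _ => 1) u h p ∂S.timeθ T ≤ E)
    (heq : ∀ n, ReflectingEquation S T (un n) (hn n)) : ReflectingEquation S T u h := by
  have hfin := hS.finite_π
  rintro f hf ⟨K, hK⟩ hf2 s t hs hst ht
  have hgm := measurable_graphGradient hf
  have hlim : ∀ t ∈ Icc 0 T, Tendsto (fun n => ∫ x, f x * un n t x ∂S.π) atTop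
      (𝓝 (∫ x, f x * u t x ∂S.π)) := by
    intro t ht
    refine (H.density t ht).integral_mul (C := K.toNNReal) (fun _ => hf) hf
      (fun _ => ae_of_all _ fun x => ?_) (ae_of_all _ fun x => tendsto_const_nhds)
    rw [← ofReal_norm]
    exact ENNReal.ofReal_le_ofReal (hK x)
  have h1 := (hlim t ⟨hs.trans hst, ht⟩).sub (hlim s ⟨hs, hst.trans ht⟩)
  simp_rw [heq _ f hf ⟨K, hK⟩ hf2 s t hs hst ht] at h1
  refine tendsto_nhds_unique h1 ?_
  set B : Set (ℝ × V × V) := Icc s t ×ˢ univ with hB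
  have hBm : MeasurableSet B := measurableSet_Icc.prod MeasurableSet.univ
  set A : ℕ → Set (ℝ × V × V) := fun k => univ ×ˢ longEdges V k with hAd
  have hAm : ∀ k, MeasurableSet (A k) := fun k =>
    MeasurableSet.univ.prod (measurableSet_longEdges k)
  have hin := fun n => hS.integrable_flux (ha n) (haC n) (hun n) (hhn n) (hunM n)
    ((hA n).trans_lt ENNReal.coe_lt_top) hf ⟨K, hK⟩ hf2
  have hi' := hS.integrable_flux (C := 1) measurable_const (ae_of_all _ fun _ => by simp) hu hh huM
    (hA'.trans_lt ENNReal.coe_lt_top) hf ⟨K, hK⟩ hf2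
  -- uniform smallness of the flux through short edges
  have htail : ∀ ε : ℝ≥0, ε ≠ 0 → ∃ k,
      (∀ n, |∫ p in B \ A k, graphGradient f p.2 * hn n p.1 p.2 ∂S.timeθ T| ≤ ε) ∧
      |∫ p in B \ A k, graphGradient f p.2 * h p.1 p.2 ∂S.timeθ T| ≤ ε := by
    intro ε hε
    -- On short edges the action contributes at most `E` and the gradient term is made at most `1`;
    -- division by `l` yields `ε`.
    set l : ℝ≥0 := (E + 1) / ε with hl
    have hl0 : l ≠ 0 := by positivity
    obtain ⟨K₁, hK₁⟩ := hS.lintegral_flux_le (V := V) l K.toNNReal M (max C 1)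
    have h2 : ∫⁻ p, ENNReal.ofReal (graphGradient f p.2 ^ 2) ∂S.timeθ T ≠ ∞ := by
      rw [hS.lintegral_timeθ_snd (F := fun e => ENNReal.ofReal (graphGradient f e ^ 2))
        (hgm.pow_const 2).ennreal_ofReal]
      exact (ENNReal.mul_lt_top ENNReal.ofReal_lt_top hf2).ne
    have hg2m : Measurable fun p : ℝ × V × V => ENNReal.ofReal (graphGradient f p.2 ^ 2) :=
      ((hgm.comp measurable_snd).pow_const 2).ennreal_ofReal
    have h3 : Tendsto (fun k => ∫⁻ p in (A k)ᶜ, ENNReal.ofReal (graphGradient f p.2 ^ 2)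
        ∂S.timeθ T) atTop (𝓝 0) := by
      have h4 : Tendsto (fun k => ∫⁻ p, (A k)ᶜ.indicator
          (fun p => ENNReal.ofReal (graphGradient f p.2 ^ 2)) p ∂S.timeθ T) atTop
          (𝓝 (∫⁻ p, 0 ∂S.timeθ T)) := by
        refine tendsto_lintegral_of_dominated_convergence
          (fun p => ENNReal.ofReal (graphGradient f p.2 ^ 2)) (fun k => hg2m.indicator (hAm k).compl)
          (fun k => ae_of_all _ fun p => indicator_le_self _ _ _) h2 (ae_of_all _ fun p => ?_)
        obtain ⟨k₀, hk₀⟩ := exists_mem_longEdges p.2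
        refine tendsto_const_nhds.congr' ?_
        filter_upwards [eventually_ge_atTop k₀] with k hk
        rw [indicator_of_notMem]
        exact fun hp => hp ⟨mem_univ _, monotone_longEdges hk hk₀⟩
      simpa [lintegral_indicator (hAm _).compl] using h4
    obtain ⟨k, hk⟩ := ((ENNReal.tendsto_atTop_zero.1 h3) (((K₁ + 1 : ℝ≥0) : ℝ≥0∞)⁻¹)
      (ENNReal.inv_pos.2 ENNReal.coe_ne_top))
    have hk := hk k le_rfl
    have hfin : ∀ (a : V × V → ℝ) (u : ℝ → V → ℝ≥0) (h : ℝ → V × V → ℝ), Measurable a →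
        (∀ᵐ e ∂S.θ, a e ≤ (max C 1 : ℝ≥0)) → Measurable (Function.uncurry u) →
        Measurable (Function.uncurry h) → (∀ t x, u t x ≤ M) →
        ∫⁻ p, S.actionDensity a u h p ∂S.timeθ T ≤ E →
        |∫ p in B \ A k, graphGradient f p.2 * h p.1 p.2 ∂S.timeθ T| ≤ ε := by
      intro a u h ha haC hu hh huM hAE
      refine abs_integral_le_of_lintegral_enorm_le ?_
      have h5 := hK₁ T a u h f ha haC hu hh huM hf
        (fun x => (hK x).trans (Real.le_coe_toNNReal K)) (B \ A k) (hBm.diff (hAm k))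
      refine (ENNReal.mul_le_mul_iff_right (a := (l : ℝ≥0∞)) (by exact_mod_cast hl0)
        ENNReal.coe_ne_top).1 (h5.trans ?_)
      have h6 : (K₁ : ℝ≥0∞) * ∫⁻ p in B \ A k, ENNReal.ofReal (graphGradient f p.2 ^ 2) ∂S.timeθ T
          ≤ 1 := by
        calc _ ≤ ((K₁ + 1 : ℝ≥0) : ℝ≥0∞) * ((K₁ + 1 : ℝ≥0) : ℝ≥0∞)⁻¹ := by
              gcongr
              · exact le_self_add
              · exact (lintegral_mono_set (fun p hp => hp.2)).trans hk
          _ ≤ 1 := ENNReal.mul_inv_le_one _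
      refine (add_le_add hAE h6).trans ?_
      rw [← ENNReal.coe_mul, hl, div_mul_cancel₀ _ hε]
      simp
    refine ⟨k, fun n => hfin (a n) (un n) (hn n) (ha n) ?_ (hun n) (hhn n) (hunM n) (hA n),
      hfin (fun _ => 1) u h measurable_const (ae_of_all _ fun _ => by simp) hu hh huM hA'⟩
    filter_upwards [haC n] with e he
    exact he.trans (by push_cast; exact le_max_left _ _)
  -- On long edges the quotient of the gradient by `1 ∧ d` is bounded although `f` need not be
  -- Lipschitz, so weak convergence of the fluxes applies.
  have hlong : ∀ k, Tendsto (fun n => ∫ p in B ∩ A k, graphGradient f p.2 * hn n p.1 p.2 ∂S.timeθ T)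
      atTop (𝓝 (∫ p in B ∩ A k, graphGradient f p.2 * h p.1 p.2 ∂S.timeθ T)) := by
    intro k
    rw [hS.integral_flux_eq (hBm.inter (hAm k))]
    simp_rw [hS.integral_flux_eq (hBm.inter (hAm k))]
    have hm : Measurable ((B ∩ A k).indicator
        fun p : ℝ × V × V => graphGradient f p.2 / truncDist p.2) :=
      ((hgm.comp measurable_snd).div
        (measurable_truncDist.comp measurable_snd)).indicator (hBm.inter (hAm k))
    refine H.flux.integral_mul (C := (2 * K.toNNReal) * (k + 1)) (fun _ => hm) hm (fun _ => ?_)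
      (ae_of_all _ fun _ => tendsto_const_nhds)
    filter_upwards [hS.ae_finiteTimeθ (hS.ae_timeθ_pos T)] with p hp
    rw [← ofReal_norm, ← ENNReal.ofReal_coe_nnreal]
    refine ENNReal.ofReal_le_ofReal ?_
    push_cast
    have hK0 : 0 ≤ K := (abs_nonneg _).trans (hK p.2.1)
    rw [Real.coe_toNNReal _ hK0]
    by_cases hpB : p ∈ B ∩ A k
    · rw [indicator_of_mem hpB, norm_div, Real.norm_of_nonneg hp.le, div_le_iff₀ hp]
      have h5 : ‖graphGradient f p.2‖ ≤ 2 * K := by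
        unfold graphGradient
        have e1 := hK p.2.1
        have e2 := hK p.2.2
        rw [Real.norm_eq_abs]
        rw [abs_le] at *
        constructor <;> linarith [e1.1, e1.2, e2.1, e2.2]
      rcases hpB.2.2 with h1 | h1
      · have h1' : 1 / ((k : ℝ) + 1) ≤ truncDist p.2 := h1
        rw [div_le_iff₀' (by positivity)] at h1'
        nlinarith
      · have h1' : p.2.1 = p.2.2 := h1
        rw [truncDist, h1', dist_self] at hp; simp at hp
    · rw [indicator_of_notMem hpB, norm_zero]; positivity
  rw [Metric.tendsto_atTop]
  intro ε hε
  obtain ⟨k, hk1, hk2⟩ := htail (ε / 4).toNNReal (by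
    rw [ne_eq, Real.toNNReal_eq_zero]; linarith)
  rw [Real.coe_toNNReal _ (by linarith)] at hk1 hk2
  obtain ⟨N, hN⟩ := Metric.tendsto_atTop.1 (hlong k) (ε / 4) (by linarith)
  refine ⟨N, fun n hnN => ?_⟩
  have e1 := integral_inter_add_sdiff (hAm k) ((hin n).integrableOn (s := B))
  have e2 := integral_inter_add_sdiff (hAm k) (hi'.integrableOn (s := B))
  have e3 := hN n hnN
  rw [Real.dist_eq] at e3 ⊢
  rw [← e1, ← e2]
  have e4 := hk1 n
  rw [abs_lt] at *
  rw [abs_le] at *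
  constructor <;> linarith [e3.1, e3.2, e4.1, e4.2, hk2.1, hk2.2]

end JumpSystem

/-! ### Integrating local one-sided estimates in time -/

section Averaging

variable {s t : ℝ}

lemma setLIntegral_comp_add_right (f : ℝ → ℝ≥0∞) (a b d : ℝ) :
    ∫⁻ r in Icc a (b - d), f (r + d) = ∫⁻ r in Icc (a + d) b, f r := by
  rw [← lintegral_indicator measurableSet_Icc, ← lintegral_indicator measurableSet_Icc,
    ← lintegral_add_right_eq_self (μ := volume) ((Icc (a + d) b).indicator f) d]
  refine lintegral_congr fun r => ?_
  have : r ∈ Icc a (b - d) ↔ r + d ∈ Icc (a + d) b := by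
    simp only [mem_Icc, add_le_add_iff_right, le_sub_iff_add_le]
  by_cases hr : r ∈ Icc a (b - d)
  · rw [indicator_of_mem hr, indicator_of_mem (this.1 hr)]
  · rw [indicator_of_notMem hr, indicator_of_notMem fun h => hr (this.2 h)]

/-- By Fubini, a point `z` belongs to the windows `[r, r + d]` for `r` in a set of length at most
`d`. -/
lemma lintegral_window_le {R : ℝ → ℝ≥0∞} (hR : Measurable R) (s t d : ℝ) :
    ∫⁻ r in Icc s (t - d), ∫⁻ z in Icc r (r + d), R z
      ≤ ENNReal.ofReal d * ∫⁻ z in Icc s t, R z := by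
  set A : Set (ℝ × ℝ) := {p | s ≤ p.1 ∧ p.1 ≤ t - d ∧ p.1 ≤ p.2 ∧ p.2 ≤ p.1 + d} with hA
  have hAm : MeasurableSet A := by
    refine (measurableSet_le measurable_const measurable_fst).inter
      ((measurableSet_le measurable_fst measurable_const).inter
      ((measurableSet_le measurable_fst measurable_snd).inter
      (measurableSet_le measurable_snd (measurable_fst.add_const d))))
  have hm : Measurable fun p : ℝ × ℝ => A.indicator (fun p => R p.2) p :=
    (hR.comp measurable_snd).indicator hAm
  calc ∫⁻ r in Icc s (t - d), ∫⁻ z in Icc r (r + d), R z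
      = ∫⁻ r, ∫⁻ z, A.indicator (fun p => R p.2) (r, z) := by
        rw [← lintegral_indicator measurableSet_Icc]
        refine lintegral_congr fun r => ?_
        by_cases hr : r ∈ Icc s (t - d)
        · rw [indicator_of_mem hr, ← lintegral_indicator measurableSet_Icc]
          refine lintegral_congr fun z => ?_
          by_cases hz : z ∈ Icc r (r + d)
          · rw [indicator_of_mem hz, indicator_of_mem (show (r, z) ∈ A from
              ⟨hr.1, hr.2, hz.1, hz.2⟩)]
          · rw [indicator_of_notMem hz, indicator_of_notMem fun h => hz ⟨h.2.2.1, h.2.2.2⟩]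
        · rw [indicator_of_notMem hr]
          symm
          refine (lintegral_congr fun z => ?_).trans lintegral_zero
          exact indicator_of_notMem (fun h => hr ⟨h.1, h.2.1⟩) _
    _ = ∫⁻ z, ∫⁻ r, A.indicator (fun p => R p.2) (r, z) :=
        lintegral_lintegral_swap hm.aemeasurable
    _ ≤ ∫⁻ z, (Icc s t).indicator (fun z => ENNReal.ofReal d * R z) z := by
        refine lintegral_mono fun z => ?_
        by_cases hz : z ∈ Icc s t
        · rw [indicator_of_mem hz]
          calc ∫⁻ r, A.indicator (fun p => R p.2) (r, z)
              ≤ ∫⁻ r, (Icc (z - d) z).indicator (fun _ => R z) r := by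
                refine lintegral_mono fun r => ?_
                by_cases hr : (r, z) ∈ A
                · have h1 : z ≤ r + d := hr.2.2.2
                  rw [indicator_of_mem hr, indicator_of_mem (show r ∈ Icc (z - d) z from
                    ⟨by linarith, hr.2.2.1⟩)]
                · rw [indicator_of_notMem hr]; exact zero_le
            _ = _ := by
                rw [lintegral_indicator measurableSet_Icc, setLIntegral_const, Real.volume_Icc,
                  mul_comm, sub_sub_cancel]
        · rw [indicator_of_notMem hz]
          refine le_of_eq ((lintegral_congr fun r => ?_).trans lintegral_zero)
          refine indicator_of_notMem (fun h => hz ?_) _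
          obtain ⟨h1, h2, h3, h4⟩ := h
          simp only at h1 h2 h3 h4
          exact ⟨by linarith, by linarith⟩
    _ = _ := by
        rw [lintegral_indicator measurableSet_Icc, lintegral_const_mul _ hR]

lemma measurable_window {k : ℝ → ℝ → ℝ≥0∞} (hk : Measurable (Function.uncurry k)) (s t d : ℝ) :
    Measurable fun r => ∫⁻ z in Icc r (r + d) ∩ Icc s t, k r z := by
  set A : Set (ℝ × ℝ) := {p | p.1 ≤ p.2 ∧ p.2 ≤ p.1 + d ∧ s ≤ p.2 ∧ p.2 ≤ t} with hA
  have hAm : MeasurableSet A := by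
    refine (measurableSet_le measurable_fst measurable_snd).inter
      ((measurableSet_le measurable_snd (measurable_fst.add_const d)).inter
      ((measurableSet_le measurable_const measurable_snd).inter
      (measurableSet_le measurable_snd measurable_const)))
  have h1 : ∀ r, ∫⁻ z in Icc r (r + d) ∩ Icc s t, k r z
      = ∫⁻ z, A.indicator (Function.uncurry k) (r, z) := by
    intro r
    rw [← lintegral_indicator (measurableSet_Icc.inter measurableSet_Icc)]
    refine lintegral_congr fun z => ?_
    by_cases hz : z ∈ Icc r (r + d) ∩ Icc s t
    · rw [indicator_of_mem hz, indicator_of_mem (show (r, z) ∈ A from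
        ⟨hz.1.1, hz.1.2, hz.2.1, hz.2.2⟩)]
      rfl
    · rw [indicator_of_notMem hz, indicator_of_notMem fun h => hz ⟨⟨h.1, h.2.1⟩, h.2.2⟩]
  simp_rw [h1]
  exact Measurable.lintegral_prod_right' (hk.indicator hAm)

/-- Local one-sided estimates along a curve integrate to a global one. -/
lemma le_add_setLIntegral_of_forall (hst : s < t) {e R D : ℝ → ℝ≥0∞} {k : ℝ → ℝ → ℝ≥0∞} {B C : ℝ≥0}
    (hR : Measurable R) (hD : Measurable D)
    (hk : Measurable (Function.uncurry k)) (heB : ∀ r, e r ≤ B) (he : Measurable e)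
    (hRi : ∫⁻ r in Icc s t, R r ≠ ∞) (hDi : ∫⁻ r in Icc s t, D r ≠ ∞)
    (h1 : ∀ᵐ r ∂volume.restrict (Icc s t), ∀ q ∈ Icc r t,
      e r ≤ e q + ∫⁻ z in Icc r q, (R z + k r z))
    (h2 : ∀ r ∈ Icc s t, ∀ z ∈ Icc s t, k r z ≤ C * D r)
    (h3 : ∀ r ∈ Icc s t, D r ≠ ∞ → ∀ η : ℝ≥0, η ≠ 0 → ∃ δ > 0, ∀ z ∈ Icc r (r + δ), z ≤ t →
      k r z ≤ D r + η)
    (h4 : ∀ η : ℝ≥0, η ≠ 0 → ∃ δ > 0, ∀ z ∈ Icc s (s + δ), z ≤ t → e s ≤ e z + η) :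
    e s ≤ e t + ((∫⁻ r in Icc s t, R r) + ∫⁻ r in Icc s t, D r) := by
  -- The local estimate is used with `q = r + d` and integrated in `r`: the integrals of `e` cancel
  -- except on layers of length `d` at the two ends. After division by `d`, the windows of `R`
  -- integrate to at most `∫ R` and the window averages of `k r` tend to at most `D r`. The choice
  -- of `d` keeps the two layers disjoint.
  set d : ℕ → ℝ := fun n => (t - s) / (n + 2) with hd
  have hts : 0 < t - s := sub_pos.2 hst
  have hd0 : ∀ n, 0 < d n := fun n => by positivity
  have hdle : ∀ n, 2 * d n ≤ t - s := fun n => by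
    simp only [hd]
    rw [mul_div_assoc', div_le_iff₀ (by positivity)]
    have : (0 : ℝ) ≤ n := n.cast_nonneg
    nlinarith
  have hdlim : Tendsto d atTop (𝓝 0) := by
    have h := (tendsto_const_div_atTop_nhds_zero_nat (t - s)).comp (tendsto_add_atTop_nat 2)
    refine h.congr fun n => ?_
    simp [hd]
  set g : ℕ → ℝ → ℝ≥0∞ := fun n r => ∫⁻ z in Icc r (r + d n) ∩ Icc s t, k r z with hg
  have hgm : ∀ n, Measurable (g n) := fun n => measurable_window hk s t (d n)
  have hvol : ∀ a b : ℝ, volume (Icc a b) = ENNReal.ofReal (b - a) := fun _ _ => Real.volume_Icc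
  -- the averaged inequality
  have hB1 : ∀ n, ∫⁻ r in Ico s (s + d n), e r ≤ (∫⁻ r in Icc (t - d n) t, e r)
      + ENNReal.ofReal (d n) * (∫⁻ r in Icc s t, R r) + ∫⁻ r in Icc s t, g n r := by
    intro n
    have hdn := hd0 n
    have hdl := hdle n
    have hsub : Icc s (t - d n) ⊆ Icc s t := Icc_subset_Icc le_rfl (by linarith)
    have e1 : ∫⁻ r in Icc s (t - d n), e r ≤ (∫⁻ r in Icc (s + d n) t, e r)
        + ENNReal.ofReal (d n) * (∫⁻ r in Icc s t, R r) + ∫⁻ r in Icc s t, g n r := by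
      calc ∫⁻ r in Icc s (t - d n), e r
          ≤ ∫⁻ r in Icc s (t - d n), (e (r + d n) + (∫⁻ z in Icc r (r + d n), R z) + g n r) := by
            refine lintegral_mono_ae ?_
            filter_upwards [ae_restrict_of_ae_restrict_of_subset hsub h1,
              ae_restrict_mem measurableSet_Icc] with r hr hrm
            refine (hr (r + d n) ⟨by linarith, by linarith [hrm.2]⟩).trans (le_of_eq ?_)
            rw [lintegral_add_left hR, ← add_assoc]
            congr 1
            simp only [hg]
            rw [inter_eq_left.2]
            exact Icc_subset_Icc hrm.1 (by linarith [hrm.2])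
        _ = (∫⁻ r in Icc s (t - d n), e (r + d n))
            + (∫⁻ r in Icc s (t - d n), ∫⁻ z in Icc r (r + d n), R z)
            + ∫⁻ r in Icc s (t - d n), g n r := by
            have hed : Measurable fun r => e (r + d n) := he.comp (measurable_add_const _)
            rw [lintegral_add_right _ (hgm n), lintegral_add_left hed]
        _ ≤ _ := by
            rw [setLIntegral_comp_add_right]
            gcongr
            exact lintegral_window_le hR s t (d n)
    have e2 : ∫⁻ r in Icc s (t - d n), e r
        = (∫⁻ r in Ico s (s + d n), e r) + ∫⁻ r in Icc (s + d n) (t - d n), e r := by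
      rw [← lintegral_union measurableSet_Icc, Ico_union_Icc_eq_Icc (by linarith) (by linarith)]
      exact Set.disjoint_left.2 fun r hr hr' => absurd hr.2 (not_lt.2 hr'.1)
    have e3 : ∫⁻ r in Icc (s + d n) t, e r
        ≤ (∫⁻ r in Icc (t - d n) t, e r) + ∫⁻ r in Icc (s + d n) (t - d n), e r := by
      refine le_trans (lintegral_mono_set ?_) (lintegral_union_le _ _ _)
      intro r hr
      rcases le_total r (t - d n) with h | h
      exacts [Or.inr ⟨hr.1, h⟩, Or.inl ⟨h, hr.2⟩]
    -- The common middle part may be cancelled because the uniform bound `B` makes it finite.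
    have e4 : ∫⁻ r in Icc (s + d n) (t - d n), e r ≠ ∞ := by
      refine ((setLIntegral_mono' measurableSet_Icc fun r _ => heB r).trans_lt ?_).ne
      rw [setLIntegral_const, hvol]
      exact ENNReal.mul_lt_top ENNReal.coe_lt_top ENNReal.ofReal_lt_top
    rw [e2] at e1
    refine (ENNReal.add_le_add_iff_right e4).1 (e1.trans ((add_le_add_left
      (add_le_add_left e3 _) _).trans (le_of_eq ?_)))
    ring
  -- Near `t` the local estimate itself, with `q = t`, plays the role of upper semicontinuity of
  -- `e`; `k` is replaced by its crude bound `C * D`.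
  have hB2 : ∀ n, ∫⁻ r in Icc (t - d n) t, e r
      ≤ ENNReal.ofReal (d n) * (e t + ((∫⁻ r in Icc (t - d n) t, R r)
        + C * ∫⁻ r in Icc (t - d n) t, D r)) := by
    intro n
    have hdn := hd0 n
    have hdl := hdle n
    have hsub : Icc (t - d n) t ⊆ Icc s t := Icc_subset_Icc (by linarith) le_rfl
    calc ∫⁻ r in Icc (t - d n) t, e r
        ≤ ∫⁻ r in Icc (t - d n) t, ((e t + ∫⁻ r in Icc (t - d n) t, R r)
            + ENNReal.ofReal (d n) * (C * D r)) := by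
          refine lintegral_mono_ae ?_
          filter_upwards [ae_restrict_of_ae_restrict_of_subset hsub h1,
            ae_restrict_mem measurableSet_Icc] with r hr hrm
          refine (hr t ⟨hrm.2, le_rfl⟩).trans ?_
          rw [lintegral_add_left hR, add_assoc]
          gcongr
          · exact hrm.1
          · refine (setLIntegral_mono' measurableSet_Icc fun z hz =>
              h2 r (hsub hrm) z (hsub ⟨hrm.1.trans hz.1, hz.2⟩)).trans ?_
            rw [setLIntegral_const, hvol, mul_comm]
            gcongr
            linarith [hrm.1]
      _ = _ := by
          rw [lintegral_add_left measurable_const, setLIntegral_const, hvol, sub_sub_cancel,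
            lintegral_const_mul _ (hD.const_mul _), lintegral_const_mul _ hD]
          ring
  have hmain : ∀ η : ℝ≥0, η ≠ 0 → ∀ᶠ n in atTop, e s ≤ e t + (((∫⁻ r in Icc (t - d n) t, R r)
      + C * ∫⁻ r in Icc (t - d n) t, D r) + (∫⁻ r in Icc s t, R r)
      + (∫⁻ r in Icc s t, (ENNReal.ofReal (d n))⁻¹ * g n r) + η) := by
    intro η hη
    -- In the initial layer only one-sided lower semicontinuity of `e` at `s` is needed.
    obtain ⟨δ, hδ, h⟩ := h4 η hη
    filter_upwards [hdlim.eventually (gt_mem_nhds hδ)] with n hn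
    have hdn := hd0 n
    have hdl := hdle n
    have hne : ENNReal.ofReal (d n) ≠ 0 := by simpa using hdn
    have e1 : ENNReal.ofReal (d n) * e s
        ≤ (∫⁻ r in Ico s (s + d n), e r) + ENNReal.ofReal (d n) * η := by
      calc ENNReal.ofReal (d n) * e s = ∫⁻ _ in Ico s (s + d n), e s := by
            rw [setLIntegral_const, Real.volume_Ico, add_sub_cancel_left, mul_comm]
        _ ≤ ∫⁻ r in Ico s (s + d n), (e r + η) := by
            refine setLIntegral_mono' measurableSet_Ico fun r hr => ?_
            exact h r ⟨hr.1, by linarith [hr.2]⟩ (by linarith [hr.2])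
        _ = _ := by
            rw [lintegral_add_left he, setLIntegral_const, Real.volume_Ico, add_sub_cancel_left,
              mul_comm (η : ℝ≥0∞)]
    refine (ENNReal.mul_le_mul_iff_right hne ENNReal.ofReal_ne_top).1 (e1.trans ?_)
    have e2 : ∫⁻ r in Icc s t, g n r = ENNReal.ofReal (d n)
        * ∫⁻ r in Icc s t, (ENNReal.ofReal (d n))⁻¹ * g n r := by
      rw [lintegral_const_mul _ (hgm n), ← mul_assoc,
        ENNReal.mul_inv_cancel hne ENNReal.ofReal_ne_top, one_mul]
    refine (add_le_add_left ((hB1 n).trans (add_le_add_left (add_le_add_left (hB2 n) _) _)) _).trans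
      (le_of_eq ?_)
    rw [e2]
    ring
  -- Reverse Fatou: `C * D` dominates, and the upper semicontinuity of `k r` from the right at `r`
  -- bounds the pointwise superior limit by `D r`.
  have hG : limsup (fun n => ∫⁻ r in Icc s t, (ENNReal.ofReal (d n))⁻¹ * g n r) atTop
      ≤ ∫⁻ r in Icc s t, D r := by
    have hgle : ∀ n, ∀ r, ∀ c : ℝ≥0∞, (∀ z ∈ Icc r (r + d n) ∩ Icc s t, k r z ≤ c) →
        (ENNReal.ofReal (d n))⁻¹ * g n r ≤ c := by
      intro n r c hc
      have hne : ENNReal.ofReal (d n) ≠ 0 := by simpa using hd0 n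
      rw [mul_comm, ← div_eq_mul_inv, ENNReal.div_le_iff hne ENNReal.ofReal_ne_top]
      refine (setLIntegral_mono' (measurableSet_Icc.inter measurableSet_Icc) hc).trans ?_
      rw [setLIntegral_const]
      gcongr
      refine (measure_mono inter_subset_left).trans (le_of_eq ?_)
      rw [hvol, add_sub_cancel_left]
    refine (limsup_lintegral_le (fun r => C * D r) (fun n => (hgm n).const_mul _) (fun n => ?_)
      ?_).trans ?_
    · filter_upwards [ae_restrict_mem measurableSet_Icc] with r hr
      exact hgle n r _ fun z hz => h2 r hr z hz.2
    · rw [lintegral_const_mul _ hD]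
      exact ENNReal.mul_ne_top ENNReal.coe_ne_top hDi
    · refine lintegral_mono_ae ?_
      filter_upwards [ae_restrict_mem measurableSet_Icc, ae_lt_top hD hDi] with r hr hDr
      refine ENNReal.le_of_forall_pos_le_add fun η hη _ => ?_
      obtain ⟨δ, hδ, h⟩ := h3 r hr hDr.ne η hη.ne'
      refine limsup_le_of_le (by isBoundedDefault) ?_
      filter_upwards [hdlim.eventually (gt_mem_nhds hδ)] with n hn
      exact hgle n r _ fun z hz => h z ⟨hz.1.1, by linarith [hz.1.2]⟩ hz.2.2
  have hsmall : ∀ F : ℝ → ℝ≥0∞, ∫⁻ r in Icc s t, F r ≠ ∞ →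
      Tendsto (fun n => ∫⁻ r in Icc (t - d n) t, F r) atTop (𝓝 0) := by
    intro F hF
    have hv : Tendsto (fun n => (volume.restrict (Icc s t)) (Icc (t - d n) t)) atTop (𝓝 0) := by
      refine tendsto_of_tendsto_of_tendsto_of_le_of_le tendsto_const_nhds (h := fun n =>
        ENNReal.ofReal (d n)) (by simpa using ENNReal.tendsto_ofReal hdlim) (fun n => zero_le)
        fun n => ?_
      refine (Measure.restrict_apply_le _ _).trans (le_of_eq ?_)
      rw [hvol, sub_sub_cancel]
    have h5 := tendsto_setLIntegral_zero hF hv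
    refine h5.congr fun n => ?_
    rw [Measure.restrict_restrict measurableSet_Icc, inter_eq_left.2]
    exact Icc_subset_Icc (by linarith [hdle n, hd0 n]) le_rfl
  refine ENNReal.le_of_forall_pos_le_add fun η hη _ => ?_
  have hη3 : η / 3 ≠ 0 := by positivity
  have hηpos : (0 : ℝ≥0∞) < (η / 3 : ℝ≥0) := by exact_mod_cast pos_iff_ne_zero.2 hη3
  have hlim1 : Tendsto (fun n => (∫⁻ r in Icc (t - d n) t, R r)
      + C * ∫⁻ r in Icc (t - d n) t, D r) atTop (𝓝 0) := by
    have := (hsmall R hRi).add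
      (ENNReal.Tendsto.const_mul (a := (C : ℝ≥0∞)) (hsmall D hDi) (Or.inr ENNReal.coe_ne_top))
    simpa using this
  have hlim2 : ∀ᶠ n in atTop, ∫⁻ r in Icc s t, (ENNReal.ofReal (d n))⁻¹ * g n r
      < (∫⁻ r in Icc s t, D r) + (η / 3 : ℝ≥0) :=
    eventually_lt_of_limsup_lt (hG.trans_lt (ENNReal.lt_add_right hDi hηpos.ne'))
  obtain ⟨n, hn1, hn2, hn3⟩ := ((hmain _ hη3).and (hlim2.and
    (hlim1.eventually (gt_mem_nhds hηpos)))).exists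
  refine hn1.trans ?_
  have e3 : (η : ℝ≥0∞) = (η / 3 : ℝ≥0) + (η / 3 : ℝ≥0) + (η / 3 : ℝ≥0) := by
    rw [← ENNReal.coe_add, ← ENNReal.coe_add]
    congr 1
    rw [← NNReal.coe_inj]
    push_cast
    ring
  rw [e3]
  refine (add_le_add_right (add_le_add_left (add_le_add (add_le_add_left hn3.le _) hn2.le) _)
    _).trans (le_of_eq ?_)
  ring

end Averaging

lemma EquiIntegrable.of_bounded {X ι : Type*} [MeasurableSpace X] {m : Measure X} {g : ι → X → ℝ}
    (hg : ∀ i, Measurable (g i)) {M : ℝ≥0} (hM : ∀ i x, ‖g i x‖ₑ ≤ M) : EquiIntegrable m g := by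
  refine ⟨hg, fun ε _ => ⟨M, fun i B _ => ?_⟩⟩
  refine (lintegral_mono fun x => hM i x).trans ?_
  rw [setLIntegral_const]
  exact le_self_add

/-! ### Weak continuity in time and semicontinuity of the mobility -/

namespace JumpSystem

variable {V : Type*} [MetricSpace V] [SecondCountableTopology V] [MeasurableSpace V]
  [BorelSpace V] {S : JumpSystem V} {T : ℝ} {M : ℝ≥0} {u : ℝ → V → ℝ≥0} {h : ℝ → V × V → ℝ}

lemma DensityCurve.continuousOn_integral (hc : DensityCurve S T u h) (hS : S.Assumptions)
    (hT : 0 ≤ T) {f : V → ℝ} (hf : ∃ K, LipschitzWith K f) (hb : ∃ C, ∀ x, |f x| ≤ C) :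
    ContinuousOn (fun t => ∫ x, f x * u t x ∂S.π) (Icc 0 T) := by
  have hsf := hS.sigmaFinite_θ
  have hint := hS.integrable_graphGradient_mul hc.measurable_h hc.moment hf hb
  have hii : Integrable (fun r => ∫ e, graphGradient f e * h r e ∂S.θ) (volume.restrict (Icc 0 T)) :=
    Integrable.integral_prod_left (f := fun p : ℝ × V × V => graphGradient f p.2 * h p.1 p.2) hint
  have h1 : ∀ t ∈ Icc 0 T, ∫ x, f x * u t x ∂S.π
      = (∫ x, f x * u 0 x ∂S.π) + ∫ r in (0 : ℝ)..t, ∫ e, graphGradient f e * h r e ∂S.θ := by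
    intro t ht
    have h2 := hc.equation f hf hb 0 t le_rfl ht.1 ht.2
    rw [← hS.setIntegral_timeθ le_rfl ht.1 ht.2
      (F := fun p => graphGradient f p.2 * h p.1 p.2) hint.integrableOn] at h2
    linarith
  refine ContinuousOn.congr ?_ h1
  have h3 := intervalIntegral.continuousOn_primitive_interval (a := 0) (b := T) (μ := volume)
    (f := fun r => ∫ e, graphGradient f e * h r e ∂S.θ) (by rwa [uIcc_of_le hT])
  rw [uIcc_of_le hT] at h3
  exact continuousOn_const.add h3

/-- Bounded solutions of the continuity equation are weakly continuous in time. -/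
lemma DensityCurve.weakTendsto (hc : DensityCurve S T u h) (hS : S.Assumptions)
    (hM : ∀ t x, u t x ≤ M) {z : ℕ → ℝ} {r : ℝ} (hz : ∀ n, z n ∈ Icc 0 T) (hr : r ∈ Icc 0 T)
    (hlim : Tendsto z atTop (𝓝 r)) : WeakTendsto S.π (fun n x => (u (z n) x : ℝ)) fun x => u r x := by
  have hfin := hS.finite_π
  have hT : 0 ≤ T := hr.1.trans hr.2
  have hut : ∀ t, Measurable (u t) := fun t => hc.measurable_u.comp measurable_prodMk_left
  have hbd : ∀ t x, ‖(u t x : ℝ)‖ₑ ≤ M := fun t x => by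
    rw [← ofReal_norm, Real.norm_of_nonneg (u t x).coe_nonneg, ENNReal.ofReal_coe_nnreal]
    exact_mod_cast hM t x
  -- Interleaving `z` with the constant time `r` produces one weakly convergent sequence; its odd
  -- subsequence identifies the limit as `u r`.
  set y : ℕ → ℝ := fun n => if Even n then z (n / 2) else r with hy
  have hyz : ∀ n, y (2 * n) = z n := fun n => by simp [hy]
  have hyr : ∀ n, y (2 * n + 1) = r := fun n => by simp [hy]
  have hyT : ∀ n, y n ∈ Icc 0 T := fun n => by
    simp only [hy]; split_ifs; exacts [hz _, hr]
  have hylim : Tendsto y atTop (𝓝 r) := by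
    have h1 : Tendsto (fun n => z (n / 2)) atTop (𝓝 r) :=
      hlim.comp (Nat.tendsto_div_const_atTop two_ne_zero)
    exact Tendsto.if' h1 tendsto_const_nhds
  have hequi : EquiIntegrable S.π fun n x => (u (y n) x : ℝ) :=
    EquiIntegrable.of_bounded (fun n => (hut _).coe_nnreal_real) fun n x => hbd _ x
  obtain ⟨g, hg⟩ := hequi.exists_weakTendsto_of_lipschitz fun f hf hb => by
    have h1 := (hc.continuousOn_integral hS hT hf hb) r hr
    exact (h1.tendsto.comp (tendsto_nhdsWithin_iff.2
      ⟨hylim, Eventually.of_forall hyT⟩)).cauchySeq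
  have h2 := hg.comp (σ := fun n => 2 * n) (tendsto_atTop_mono (fun n => show n ≤ 2 * n by omega) tendsto_id)
  have h3 := hg.comp (σ := fun n => 2 * n + 1)
    (tendsto_atTop_mono (fun n => show n ≤ 2 * n + 1 by omega) tendsto_id)
  simp only [hyz] at h2
  simp only [hyr] at h3
  refine ⟨h2.equi, (hut r).coe_nnreal_real, h3.equi.integrable 0, fun B hB => ?_⟩
  rw [tendsto_nhds_unique tendsto_const_nhds (h3.tendsto B hB)]
  exact h2.tendsto B hB

lemma DensityCurve.weakTendsto_edges (hc : DensityCurve S T u h) (hS : S.Assumptions)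
    (hM : ∀ t x, u t x ≤ M) {z : ℕ → ℝ} {r : ℝ} (hz : ∀ n, z n ∈ Icc 0 T) (hr : r ∈ Icc 0 T)
    (hlim : Tendsto z atTop (𝓝 r)) :
    WeakTendsto hS.finiteθ (fun n e => (u (z n) e.1 : ℝ)) (fun e => u r e.1) ∧
    WeakTendsto hS.finiteθ (fun n e => (u (z n) e.2 : ℝ)) (fun e => u r e.2) := by
  have hw := hc.weakTendsto hS hM hz hr hlim
  have hut : ∀ t, Measurable fun x => (u t x : ℝ) := fun t =>
    (hc.measurable_u.comp measurable_prodMk_left).coe_nnreal_real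
  have hbd : ∀ t x, ‖(u t x : ℝ)‖ₑ ≤ M := fun t x => by
    rw [← ofReal_norm, Real.norm_of_nonneg (u t x).coe_nonneg, ENNReal.ofReal_coe_nnreal]
    exact_mod_cast hM t x
  have hm1 : ∀ t, Measurable fun e : V × V => (u t e.1 : ℝ) := fun t => (hut t).comp measurable_fst
  have hm2 : ∀ t, Measurable fun e : V × V => (u t e.2 : ℝ) := fun t => (hut t).comp measurable_snd
  have e1 : EquiIntegrable hS.finiteθ fun (t : ℝ) (e : V × V) => (u t e.1 : ℝ) :=
    EquiIntegrable.of_bounded hm1 fun t e => hbd t _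
  have e2 : EquiIntegrable hS.finiteθ fun (t : ℝ) (e : V × V) => (u t e.2 : ℝ) :=
    EquiIntegrable.of_bounded hm2 fun t e => hbd t _
  exact ⟨⟨e1.comp z, hm1 r, e1.integrable r, fun B hB => hS.tendsto_setIntegral_fst hw hB⟩,
    ⟨e2.comp z, hm2 r, e2.integrable r, fun B hB => hS.tendsto_setIntegral_snd hw hB⟩⟩

/-- The tangent inequality for the truncated entropy of two bounded densities. -/
lemma Assumptions.lintegral_truncEntropy_le (hS : S.Assumptions) {ε : ℝ≥0} (hε : 0 < ε)
    {β : ℝ} (hβ : ∀ r : ℝ≥0, 0 ≤ hS.truncEntropy ε r + β) {v w : V → ℝ≥0} (hv : Measurable v)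
    (hw : Measurable w) (hvM : ∀ x, v x ≤ M) (hwM : ∀ x, w x ≤ M) :
    ∫⁻ x, ENNReal.ofReal (hS.truncEntropy ε (v x) + β) ∂S.π
      ≤ ∫⁻ x, ENNReal.ofReal (hS.truncEntropy ε (w x) + β) ∂S.π
        + ENNReal.ofReal |(∫ x, hS.truncDeriv ε (v x) * w x ∂S.π)
          - ∫ x, hS.truncDeriv ε (v x) * v x ∂S.π| := by
  have hfin := hS.finite_π
  have hε' : (0 : ℝ) < ε := hε
  have hbd : ∀ F : ℝ → ℝ, Continuous F → ∃ K, ∀ r : ℝ≥0, r ≤ M → ‖F r‖ ≤ K := by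
    intro F hF
    obtain ⟨K, hK⟩ := (isCompact_Icc (a := (0 : ℝ)) (b := M)).exists_bound_of_continuousOn
      hF.continuousOn
    exact ⟨K, fun r hr => hK r ⟨r.coe_nonneg, by exact_mod_cast hr⟩⟩
  have hInt : ∀ F : ℝ → ℝ, Continuous F → ∀ v : V → ℝ≥0, Measurable v → (∀ x, v x ≤ M) →
      Integrable (fun x => F (v x)) S.π := by
    intro F hF v hv hvM
    obtain ⟨K, hK⟩ := hbd F hF
    exact Integrable.of_bound (hF.measurable.comp hv.coe_nnreal_real).aestronglyMeasurable K
      (ae_of_all _ fun x => hK _ (hvM x))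
  have hmul : ∀ w : V → ℝ≥0, Measurable w → (∀ x, w x ≤ M) →
      Integrable (fun x => hS.truncDeriv ε (v x) * w x) S.π := by
    intro w hw hwM
    obtain ⟨K, hK⟩ := hbd _ (hS.continuous_truncDeriv hε')
    refine (hInt id continuous_id w hw hwM).bdd_mul (c := K)
      ((hS.continuous_truncDeriv hε').measurable.comp hv.coe_nnreal_real).aestronglyMeasurable
      (ae_of_all _ fun x => hK _ (hvM x))
  have hc : Continuous fun r => hS.truncEntropy ε r + β :=
    (hS.continuous_truncEntropy hε').add continuous_const
  have i1 := hInt _ hc v hv hvM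
  have i2 := hInt _ hc w hw hwM
  rw [← ofReal_integral_eq_lintegral_ofReal i1 (ae_of_all _ fun x => hβ _),
    ← ofReal_integral_eq_lintegral_ofReal i2 (ae_of_all _ fun x => hβ _)]
  refine le_trans (ENNReal.ofReal_le_ofReal ?_) ENNReal.ofReal_add_le
  have h1 : ∫ x, (hS.truncDeriv ε (v x) * w x - hS.truncDeriv ε (v x) * v x) ∂S.π
      ≤ ∫ x, ((hS.truncEntropy ε (w x) + β) - (hS.truncEntropy ε (v x) + β)) ∂S.π := by
    refine integral_mono ((hmul w hw hwM).sub (hmul v hv hvM)) (i2.sub i1) fun x => ?_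
    have := hS.truncEntropy_tangent (r := v x) (q := w x) hε'
    simp only
    linarith
  rw [integral_sub (hmul w hw hwM) (hmul v hv hvM), integral_sub i2 i1] at h1
  have h2 := neg_le_abs ((∫ x, hS.truncDeriv ε (v x) * w x ∂S.π)
          - ∫ x, hS.truncDeriv ε (v x) * v x ∂S.π)
  linarith

/-- Upper semicontinuity of the mobility-weighted energy of a fixed potential. -/
lemma DensityCurve.exists_lintegral_mobility_le (hc : DensityCurve S T u h) (hS : S.Assumptions)
    (hM : ∀ t x, u t x ≤ M) {f : V → ℝ} (hf : Measurable f) (hb : ∃ K, ∀ x, |f x| ≤ K)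
    (hfin : ∫⁻ e, ENNReal.ofReal (S.ψStar (graphGradient f e)) ∂S.θ ≠ ∞) {r : ℝ} (hr : r ∈ Icc 0 T)
    {η : ℝ≥0} (hη : η ≠ 0) : ∃ δ > 0, ∀ z ∈ Icc r (r + δ), z ≤ T →
      ∫⁻ e, 2⁻¹ * (ENNReal.ofReal (S.ψStar (graphGradient f e)) * S.α (u z e.1, u z e.2)) ∂S.θ
      ≤ (∫⁻ e, 2⁻¹ * (ENNReal.ofReal (S.ψStar (graphGradient f e)) * S.α (u r e.1, u r e.2)) ∂S.θ)
        + η := by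
  have hfin' := hS.finite_π
  by_contra! hcon
  choose z hz hzT hzlt using fun n : ℕ => hcon (1 / ((n : ℝ) + 1)) (by positivity)
  have hzmem : ∀ n, z n ∈ Icc 0 T := fun n => ⟨hr.1.trans (hz n).1, hzT n⟩
  have hzlim : Tendsto z atTop (𝓝 r) := by
    refine tendsto_of_tendsto_of_tendsto_of_le_of_le tendsto_const_nhds
      (h := fun n : ℕ => r + 1 / ((n : ℝ) + 1)) ?_ (fun n => (hz n).1) fun n => (hz n).2
    simpa using tendsto_const_nhds.add (tendsto_one_div_add_atTop_nhds_zero_nat (𝕜 := ℝ))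
  obtain ⟨hw1, hw2⟩ := hc.weakTendsto_edges hS hM hzmem hr hzlim
  set m : ℝ≥0 := S.α (M, M) with hm
  have hαm : ∀ t (e : V × V), S.α (u t e.1, u t e.2) ≤ m := fun t e =>
    hS.α_mono ⟨hM t _, hM t _⟩
  have hgm := measurable_graphGradient hf
  have hψm : Measurable fun e => S.ψStar (graphGradient f e) :=
    hS.ψStar_continuous.measurable.comp hgm
  have hut : ∀ t, Measurable (u t) := fun t => hc.measurable_u.comp measurable_prodMk_left
  have hαme : ∀ t, Measurable fun e : V × V => S.α (u t e.1, u t e.2) := fun t =>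
    hS.α_continuous.measurable.comp (((hut t).comp measurable_fst).prodMk ((hut t).comp measurable_snd))
  set w : V × V → ℝ := fun e => S.ψStar (graphGradient f e) / (2 * truncDist e ^ 2) with hw
  have hwm : Measurable w := hψm.div ((measurable_truncDist.pow_const 2).const_mul 2)
  have hw0 : ∀ e, 0 ≤ w e := fun e => div_nonneg (hS.ψStar_nonneg _) (by positivity)
  -- On the range of the densities `α ≤ m`, and `m - α` is convex. The weighted integrals of `m - α`
  -- and of `α` add up to the finite constant `K`, so lower semicontinuity of the former is upper
  -- semicontinuity of the latter.
  set F : ℝ≥0 × ℝ≥0 → ℝ≥0∞ := fun q => ENNReal.ofReal ((m : ℝ) - S.α q) with hF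
  have hFm : Continuous F := ENNReal.continuous_ofReal.comp
    (continuous_const.sub (NNReal.continuous_coe.comp hS.α_continuous))
  have hFc : ConvexOn ℝ≥0 univ F := by
    refine ⟨convex_univ, fun p _ q _ a b _ _ hab => ?_⟩
    have h1 := hS.α_concave_le p q hab
    have e1 : ∀ (c : ℝ≥0) (q : ℝ≥0 × ℝ≥0), c • F q = ENNReal.ofReal (c * ((m : ℝ) - S.α q)) := by
      intro c q
      rw [ENNReal.ofReal_mul c.coe_nonneg, ENNReal.ofReal_coe_nnreal]; rfl
    rw [e1, e1]
    refine le_trans (ENNReal.ofReal_le_ofReal ?_) ENNReal.ofReal_add_le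
    have h2 : ((a * S.α p + b * S.α q : ℝ≥0) : ℝ) ≤ S.α (a • p + b • q) := by exact_mod_cast h1
    have h3 : (a : ℝ) + b = 1 := by exact_mod_cast hab
    push_cast at h2
    nlinarith
  -- passing to the finite measure
  have hconv : ∀ G : V × V → ℝ≥0∞, Measurable G →
      ∫⁻ e, ENNReal.ofReal (w e) * G e ∂hS.finiteθ
        = ∫⁻ e, 2⁻¹ * (ENNReal.ofReal (S.ψStar (graphGradient f e)) * G e) ∂S.θ := by
    intro G hG
    have hwG : Measurable fun e => ENNReal.ofReal (w e) * G e := hwm.ennreal_ofReal.mul hG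
    rw [Assumptions.finiteθ, lintegral_withDensity_eq_lintegral_mul _
      Assumptions.measurable_ofReal_truncDist_sq hwG]
    refine lintegral_congr_ae ?_
    filter_upwards [hS.ae_ne] with e he
    simp only [Pi.mul_apply]
    rw [← mul_assoc, ← mul_assoc, ← ENNReal.ofReal_mul (by positivity)]
    congr 1
    rw [show (2⁻¹ : ℝ≥0∞) = ENNReal.ofReal 2⁻¹ by
      rw [ENNReal.ofReal_inv_of_pos two_pos, ENNReal.ofReal_ofNat], ← ENNReal.ofReal_mul (by norm_num)]
    congr 1
    simp only [hw]
    field_simp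
  set K : ℝ≥0∞ := ∫⁻ e, 2⁻¹ * (ENNReal.ofReal (S.ψStar (graphGradient f e)) * m) ∂S.θ with hK
  have hKfin : K ≠ ∞ := by
    rw [hK, lintegral_const_mul' _ _ (by simp), lintegral_mul_const' _ _ ENNReal.coe_ne_top]
    exact ENNReal.mul_ne_top (by simp) (ENNReal.mul_ne_top hfin ENNReal.coe_ne_top)
  set k : ℝ → ℝ≥0∞ := fun z =>
    ∫⁻ e, 2⁻¹ * (ENNReal.ofReal (S.ψStar (graphGradient f e)) * S.α (u z e.1, u z e.2)) ∂S.θ with hk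
  set I : ℝ → ℝ≥0∞ := fun z => ∫⁻ e, ENNReal.ofReal (w e) * F (u z e.1, u z e.2) ∂hS.finiteθ with hI
  have hFu : ∀ t, Measurable fun e : V × V => F (u t e.1, u t e.2) := fun t =>
    hFm.measurable.comp (((hut t).comp measurable_fst).prodMk ((hut t).comp measurable_snd))
  have hsum : ∀ z, I z + k z = K := by
    intro z
    simp only [hI, hk]
    rw [hconv _ (hFu z), ← lintegral_add_right]
    · refine lintegral_congr fun e => ?_
      rw [← mul_add, ← mul_add]
      congr 2
      simp only [hF]
      rw [← ENNReal.ofReal_coe_nnreal (p := S.α _), ← ENNReal.ofReal_add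
        (sub_nonneg.2 (by exact_mod_cast hαm z e)) (NNReal.coe_nonneg _), sub_add_cancel,
        ENNReal.ofReal_coe_nnreal]
    · exact (hψm.ennreal_ofReal.mul (hαme z).coe_nnreal_ennreal).const_mul _
  have hlsc : I r ≤ liminf (fun n => I (z n)) atTop := by
    refine lintegral_mul_comp_le_liminf hFc hFm.lowerSemicontinuous hw1 hw2 (w := fun _ => w) (w' := w)
      (fun _ => hwm) (fun _ => hw0) hwm hw0 (ae_of_all _ fun _ => tendsto_const_nhds)
      measurableSet_longEdges exists_mem_longEdges fun k => ?_
    obtain ⟨B, hB⟩ := hb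
    have hψB : ∀ e, S.ψStar (graphGradient f e) ≤ S.ψStar (2 * B) := fun e => by
      refine hS.ψStar_mono ?_
      have e1 := hB e.1
      have e2 := hB e.2
      have hB0 : 0 ≤ B := (abs_nonneg _).trans e1
      rw [abs_of_nonneg (by linarith : 0 ≤ 2 * B)]
      unfold graphGradient
      rw [abs_le] at *
      constructor <;> linarith [e1.1, e1.2, e2.1, e2.2]
    have hle : ∀ e, e ∈ longEdges V k → ‖w e‖ₑ ≤ (S.ψStar (2 * B) * (k + 1) ^ 2).toNNReal := by
      intro e he
      rw [← ofReal_norm, Real.norm_of_nonneg (hw0 e)]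
      refine ENNReal.ofReal_le_ofReal ?_
      have hψ0 := hS.ψStar_nonneg (2 * B)
      rcases he with h1 | h1
      · have h1' : 1 / ((k : ℝ) + 1) ≤ truncDist e := h1
        have hd : 0 < truncDist e := lt_of_lt_of_le (by positivity) h1'
        rw [div_le_iff₀' (by positivity)] at h1'
        simp only [hw]
        rw [div_le_iff₀ (by positivity)]
        have h2 : 1 ≤ ((k + 1) * truncDist e) ^ 2 := one_le_pow₀ h1'
        calc S.ψStar (graphGradient f e) ≤ S.ψStar (2 * B) * 1 := by rw [mul_one]; exact hψB e
          _ ≤ S.ψStar (2 * B) * (2 * ((k + 1) * truncDist e) ^ 2) := by gcongr; linarith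
          _ = _ := by ring
      · have h1' : e.1 = e.2 := h1
        simp only [hw, graphGradient, h1', sub_self, hS.ψStar_zero, zero_div]
        positivity
    exact ⟨_, fun _ => ae_of_all _ hle, ae_of_all _ hle⟩
  have hstep : ∀ n, I (z n) + η ≤ I r := by
    intro n
    have h1 := (hzlt n).le
    have hkr : k r ≠ ∞ := ne_top_of_le_ne_top hKfin ((hsum r) ▸ le_add_left le_rfl)
    refine (ENNReal.add_le_add_iff_right hkr).1 ?_
    rw [hsum r, ← hsum (z n), add_assoc, add_comm (η : ℝ≥0∞)]
    gcongr
  have hlim : liminf (fun n => I (z n)) atTop + η ≤ I r := by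
    have h2 : ∀ n, I (z n) ≤ I r - η := fun n => ENNReal.le_sub_of_add_le_right ENNReal.coe_ne_top (hstep n)
    have h3 : liminf (fun n => I (z n)) atTop ≤ I r - η :=
      liminf_le_of_le (by isBoundedDefault) fun b hb => by
        obtain ⟨n, hn⟩ := hb.exists
        exact hn.trans (h2 n)
    refine (add_le_add_left h3 _).trans (le_of_eq (tsub_add_cancel_of_le ?_))
    exact (le_add_left le_rfl).trans (hstep 0)
  have hIr : I r ≠ ∞ := ne_top_of_le_ne_top hKfin ((hsum r) ▸ le_add_right le_rfl)
  have h5 : I r + η ≤ I r := (add_le_add_left hlsc _).trans hlim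
  exact absurd h5 (not_le.2 (ENNReal.lt_add_right hIr (by exact_mod_cast hη)))

end JumpSystem

/-! ### The chain rule inequality for bounded reflecting curves -/

namespace JumpSystem

variable {V : Type*} [MetricSpace V] [SecondCountableTopology V] [MeasurableSpace V]
  [BorelSpace V] {S : JumpSystem V} {T : ℝ} {M : ℝ≥0} {u : ℝ → V → ℝ≥0} {h : ℝ → V × V → ℝ}

/-- Bounded solutions of the reflecting continuity equation with finite action and Fisher
information, in density form. -/
structure ReflectingCurve (S : JumpSystem V) (T : ℝ) (M : ℝ≥0) (u : ℝ → V → ℝ≥0)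
    (h : ℝ → V × V → ℝ) : Prop where
  curve : DensityCurve S T u h
  le : ∀ t x, u t x ≤ M
  equation : ReflectingEquation S T u h
  action : ∫⁻ p, S.actionDensity (fun _ => 1) u h p ∂S.timeθ T < ∞
  fisher : ∫⁻ p, S.fisherTerm (fun _ => 1) u p ∂S.timeθ T < ∞

/-- Young's inequality for `2 h`, halved. No constant is lost, which is why action and Fisher
information appear in the chain rule with coefficient one. -/
lemma Assumptions.enorm_mul_flux_le (hS : S.Assumptions) (u : ℝ → V → ℝ≥0) (h : ℝ → V × V → ℝ)
    (ξ : ℝ) (p : ℝ × V × V) : ‖ξ * h p.1 p.2‖ₑ ≤ S.actionDensity (fun _ => 1) u h p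
      + 2⁻¹ * (ENNReal.ofReal (S.ψStar ξ) * S.α (u p.1 p.2.1, u p.1 p.2.2)) := by
  have h1 := ofReal_abs_mul_le hS (2 * h p.1 p.2) ξ (S.α (u p.1 p.2.1, u p.1 p.2.2))
  have h2 : ‖ξ * h p.1 p.2‖ₑ = 2⁻¹ * ENNReal.ofReal (|2 * h p.1 p.2| * |ξ|) := by
    rw [show (2⁻¹ : ℝ≥0∞) = ENNReal.ofReal 2⁻¹ by
      rw [ENNReal.ofReal_inv_of_pos two_pos, ENNReal.ofReal_ofNat],
      ← ENNReal.ofReal_mul (by norm_num), ← ofReal_norm, Real.norm_eq_abs, abs_mul, abs_mul, abs_two]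
    congr 1
    ring
  rw [h2]
  refine (mul_le_mul_right h1 _).trans (le_of_eq ?_)
  rw [mul_add, actionDensity, mul_comm (S.α _ : ℝ), ENNReal.ofReal_mul (hS.ψStar_nonneg _),
    ENNReal.ofReal_coe_nnreal]
  simp

/-- The mobility is evaluated at a time other than that of the potential, so only a comparison up to
the factor `m / α(ε, ε)` is available. It furnishes the integrable majorant for averaging. -/
lemma Assumptions.ψStar_mul_mobility_le (hS : S.Assumptions)
    (hconv : ConvexOn ℝ≥0 univ S.fisherDensity) {ε : ℝ≥0} (hε : 0 < ε) {v : V → ℝ≥0}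
    (e : V × V) {c m : ℝ≥0} (hc : c ≤ m) :
    2⁻¹ * (ENNReal.ofReal (S.ψStar (graphGradient (fun x => hS.truncDeriv ε (v x)) e)) * c)
      ≤ (m / S.α (ε, ε) : ℝ≥0)
        * (2⁻¹ * (ENNReal.ofReal 1 * S.fisherDensity (v e.1, v e.2))) := by
  have h1 := hS.truncDeriv_mul_α_diag_le hconv hε (v e.1) (v e.2)
  have hα := hS.α_pos hε hε
  rw [ENNReal.ofReal_one, one_mul]
  calc _ ≤ 2⁻¹ * (ENNReal.ofReal (S.ψStar (graphGradient (fun x => hS.truncDeriv ε (v x)) e)) * m) := by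
        gcongr
    _ = (m / S.α (ε, ε) : ℝ≥0) * (2⁻¹ * (ENNReal.ofReal
          (S.ψStar (graphGradient (fun x => hS.truncDeriv ε (v x)) e)) * S.α (ε, ε))) := by
        have h3 : (m : ℝ≥0∞) = ((m / S.α (ε, ε) : ℝ≥0) : ℝ≥0∞) * (S.α (ε, ε) : ℝ≥0) := by
          rw [← ENNReal.coe_mul, div_mul_cancel₀ _ hα.ne']
        rw [h3]
        simp only [graphGradient]
        rw [← h3]
        conv_lhs => rw [h3]
        ring
    _ ≤ _ := by
        gcongr
        exact h1

lemma ReflectingCurve.ofReal_abs_sub_le (hc : ReflectingCurve S T M u h) (hS : S.Assumptions)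
    {f : V → ℝ} (hf : Measurable f) (hb : ∃ K, ∀ x, |f x| ≤ K)
    (hf2 : ∫⁻ e, ENNReal.ofReal (graphGradient f e ^ 2) ∂S.θ < ∞) {r q : ℝ} (hr : 0 ≤ r)
    (hrq : r ≤ q) (hq : q ≤ T) :
    ENNReal.ofReal |(∫ x, f x * u q x ∂S.π) - ∫ x, f x * u r x ∂S.π|
      ≤ ∫⁻ z in Icc r q, ((∫⁻ e, S.actionDensity (fun _ => 1) u h (z, e) ∂S.θ) + ∫⁻ e,
        2⁻¹ * (ENNReal.ofReal (S.ψStar (graphGradient f e)) * S.α (u z e.1, u z e.2)) ∂S.θ) := by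
  have hsf := hS.sigmaFinite_θ
  have hu := hc.curve.measurable_u
  have hAm := hS.measurable_actionDensity (a := fun _ => 1) measurable_const hu hc.curve.measurable_h
  have hRm : Measurable fun z => ∫⁻ e, S.actionDensity (fun _ => 1) u h (z, e) ∂S.θ :=
    Measurable.lintegral_prod_right' hAm
  have m1 : Measurable fun p : ℝ × V × V => ENNReal.ofReal (S.ψStar (graphGradient f p.2)) :=
    (hS.ψStar_continuous.measurable.comp
      ((measurable_graphGradient hf).comp measurable_snd)).ennreal_ofReal
  have m2 : Measurable fun p : ℝ × V × V => (S.α (u p.1 p.2.1, u p.1 p.2.2) : ℝ≥0∞) :=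
    (hS.α_continuous.measurable.comp (measurable_edge_values hu)).coe_nnreal_ennreal
  have hkm : Measurable fun p : ℝ × V × V => (2⁻¹ : ℝ≥0∞) * (ENNReal.ofReal (S.ψStar
      (graphGradient f p.2)) * S.α (u p.1 p.2.1, u p.1 p.2.2)) := (m1.mul m2).const_mul _
  rw [hc.equation f hf hb hf2 r q hr hrq hq, ← Real.norm_eq_abs, ofReal_norm]
  refine (enorm_integral_le_lintegral_enorm _).trans ?_
  refine (lintegral_mono fun p => hS.enorm_mul_flux_le u h (graphGradient f p.2) p).trans
    (le_of_eq ?_)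
  rw [lintegral_add_left hAm, hS.setLIntegral_timeθ hr hq hAm, hS.setLIntegral_timeθ hr hq hkm,
    ← lintegral_add_left hRm]

/-- The tangent inequality at time `r` bounds the loss of truncated entropy up to time `q` by the
increment of `∫ f_r u` with the fixed potential `f_r = φ'(max ε u_r)`. The reflecting equation and
Young's inequality turn this into action plus an energy of `f_r` weighted by the mobility at
intermediate times `z`, which is asymptotically at most `D(ρ_r)` as `z → r`. Admissibility of `f_r`
needs `D(ρ_r)` finite, true for almost every `r`, and this suffices for the averaging lemma. -/
lemma ReflectingCurve.lintegral_truncEntropy_le (hc : ReflectingCurve S T M u h)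
    (hS : S.Assumptions) (hconv : ConvexOn ℝ≥0 univ S.fisherDensity) {ε : ℝ≥0} (hε : 0 < ε) {β : ℝ}
    (hβ : ∀ r : ℝ≥0, 0 ≤ hS.truncEntropy ε r + β) {s t : ℝ} (hs : 0 ≤ s) (hst : s < t)
    (ht : t ≤ T) :
    ∫⁻ x, ENNReal.ofReal (hS.truncEntropy ε (u s x) + β) ∂S.π
      ≤ ∫⁻ x, ENNReal.ofReal (hS.truncEntropy ε (u t x) + β) ∂S.π
        + (S.actionOn T (fun _ => 1) u h s t + S.fisherOn T (fun _ => 1) u s t) := by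
  have hfin := hS.finite_π
  have hsf := hS.sigmaFinite_θ
  have hε' : (0 : ℝ) < ε := hε
  have hu := hc.curve.measurable_u
  have hAm := hS.measurable_actionDensity (a := fun _ => 1) measurable_const hu hc.curve.measurable_h
  have hDm := measurable_fisherTerm (S := S) (a := fun _ => 1) measurable_const hu
  have hut : ∀ t, Measurable (u t) := fun t => hu.comp measurable_prodMk_left
  have hTc := hS.continuous_truncDeriv hε'
  have hEc := (hS.continuous_truncEntropy hε').add (continuous_const (y := β))
  set e : ℝ → ℝ≥0∞ := fun r => ∫⁻ x, ENNReal.ofReal (hS.truncEntropy ε (u r x) + β) ∂S.π with he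
  set R : ℝ → ℝ≥0∞ := fun r => ∫⁻ e, S.actionDensity (fun _ => 1) u h (r, e) ∂S.θ with hR
  set D : ℝ → ℝ≥0∞ := fun r => ∫⁻ e, S.fisherTerm (fun _ => 1) u (r, e) ∂S.θ with hD
  set f : ℝ → V → ℝ := fun r x => hS.truncDeriv ε (u r x) with hf
  set k : ℝ → ℝ → ℝ≥0∞ := fun r z => ∫⁻ e,
    2⁻¹ * (ENNReal.ofReal (S.ψStar (graphGradient (f r) e)) * S.α (u z e.1, u z e.2)) ∂S.θ with hk
  have hfm : ∀ r, Measurable (f r) := fun r => hTc.measurable.comp (hut r).coe_nnreal_real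
  obtain ⟨K, hK⟩ := (isCompact_Icc (a := (0 : ℝ)) (b := M)).exists_bound_of_continuousOn
    hTc.continuousOn
  have hfK : ∀ r x, |f r x| ≤ K := fun r x =>
    hK _ ⟨(u r x).coe_nonneg, by exact_mod_cast hc.le r x⟩
  have hgK : ∀ r e, |graphGradient (f r) e| ≤ 2 * K := fun r e => by
    have e1 := hfK r e.1
    have e2 := hfK r e.2
    unfold graphGradient
    rw [abs_le] at *
    constructor <;> linarith [e1.1, e1.2, e2.1, e2.2]
  have hαpos := hS.α_pos hε hε
  have hkm3 : Measurable fun q : (ℝ × ℝ) × V × V => (2⁻¹ : ℝ≥0∞) * (ENNReal.ofReal (S.ψStar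
      (graphGradient (f q.1.1) q.2)) * S.α (u q.1.2 q.2.1, u q.1.2 q.2.2)) := by
    have hf2 : Measurable fun q : ℝ × V => f q.1 q.2 := hTc.measurable.comp hu.coe_nnreal_real
    have m1 : Measurable fun q : (ℝ × ℝ) × V × V => graphGradient (f q.1.1) q.2 :=
      (hf2.comp (by fun_prop : Measurable fun q : (ℝ × ℝ) × V × V => (q.1.1, q.2.2))).sub
        (hf2.comp (by fun_prop : Measurable fun q : (ℝ × ℝ) × V × V => (q.1.1, q.2.1)))
    have m2 : Measurable fun q : (ℝ × ℝ) × V × V => S.α (u q.1.2 q.2.1, u q.1.2 q.2.2) :=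
      hS.α_continuous.measurable.comp ((measurable_edge_values hu).comp
        (by fun_prop : Measurable fun q : (ℝ × ℝ) × V × V => (q.1.2, q.2)))
    exact ((hS.ψStar_continuous.measurable.comp m1).ennreal_ofReal.mul
      m2.coe_nnreal_ennreal).const_mul _
  -- The truncation at `ε` lets the positive constant `α(ε, ε)` stand in for the mobility, so the
  -- integrability holds without a weight.
  have hψfin : ∀ r, D r ≠ ∞ → ∫⁻ e, ENNReal.ofReal (S.ψStar (graphGradient (f r) e)) ∂S.θ ≠ ∞ := by
    intro r hr
    have h1 : (∫⁻ e, ENNReal.ofReal (S.ψStar (graphGradient (f r) e)) ∂S.θ) * (2⁻¹ * S.α (ε, ε))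
        ≤ D r := by
      rw [← lintegral_mul_const' _ _ (ENNReal.mul_ne_top (by simp) ENNReal.coe_ne_top)]
      refine lintegral_mono fun e => ?_
      have := hS.truncDeriv_mul_α_diag_le hconv hε (u r e.1) (u r e.2)
      simp only [fisherTerm, ENNReal.ofReal_one, one_mul]
      rw [mul_left_comm]
      exact mul_le_mul_right this _
    intro htop
    rw [htop, ENNReal.top_mul] at h1
    · exact hr (top_le_iff.1 h1)
    · refine mul_ne_zero (by simp) ?_
      exact_mod_cast hαpos.ne'
  -- The gradient of `f r` is bounded, and on bounded intervals `ψStar` dominates a multiple of the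
  -- square.
  have hg2 : ∀ r, D r ≠ ∞ → ∫⁻ e, ENNReal.ofReal (graphGradient (f r) e ^ 2) ∂S.θ < ∞ := by
    intro r hr
    obtain ⟨c, _, hc0, _, hcC⟩ := hS.exists_ψStar_bounds (2 * K)
    have h1 : ENNReal.ofReal c * ∫⁻ e, ENNReal.ofReal (graphGradient (f r) e ^ 2) ∂S.θ
        ≤ ∫⁻ e, ENNReal.ofReal (S.ψStar (graphGradient (f r) e)) ∂S.θ := by
      rw [← lintegral_const_mul' _ _ ENNReal.ofReal_ne_top]
      refine lintegral_mono fun e => ?_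
      simp only
      rw [← ENNReal.ofReal_mul hc0.le]
      exact ENNReal.ofReal_le_ofReal (hcC _ (hgK r e)).1
    refine lt_of_le_of_ne le_top fun htop => ?_
    rw [htop, ENNReal.mul_top (by simpa using hc0)] at h1
    exact hψfin r hr (top_le_iff.1 h1)
  have hest : ∀ r ∈ Icc 0 T, ∀ q ∈ Icc 0 T, e r ≤ e q
      + ENNReal.ofReal |(∫ x, f r x * u q x ∂S.π) - ∫ x, f r x * u r x ∂S.π| := fun r _ q _ =>
    hS.lintegral_truncEntropy_le hε hβ (hut r) (hut q) (hc.le r) (hc.le q)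
  obtain ⟨B, hB⟩ := (isCompact_Icc (a := (0 : ℝ)) (b := M)).exists_bound_of_continuousOn
    hEc.continuousOn
  have hRme : Measurable R := Measurable.lintegral_prod_right' hAm
  have hDme : Measurable D := Measurable.lintegral_prod_right' hDm
  have hkme : Measurable (Function.uncurry k) :=
    Measurable.lintegral_prod_right' (f := fun q : (ℝ × ℝ) × V × V => (2⁻¹ : ℝ≥0∞) * (ENNReal.ofReal
      (S.ψStar (graphGradient (f q.1.1) q.2)) * S.α (u q.1.2 q.2.1, u q.1.2 q.2.2))) hkm3
  have hRint : ∫⁻ r in Icc s t, R r = S.actionOn T (fun _ => 1) u h s t :=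
    (hS.setLIntegral_timeθ hs ht hAm).symm
  have hDint : ∫⁻ r in Icc s t, D r = S.fisherOn T (fun _ => 1) u s t :=
    (hS.setLIntegral_timeθ hs ht hDm).symm
  have hDi : ∫⁻ r in Icc s t, D r ≠ ∞ := by
    rw [hDint]
    exact ((setLIntegral_le_lintegral _ _).trans_lt hc.fisher).ne
  refine (le_add_setLIntegral_of_forall hst (e := e) (R := R) (D := D) (k := k)
    (B := B.toNNReal * (S.π univ).toNNReal) (C := S.α (M, M) / S.α (ε, ε))
    hRme hDme hkme (fun r => ?_) ?_ ?_ ?_ ?_ (fun r _ z _ => ?_) (fun r hr hDr η hη => ?_) (fun η hη => ?_)).trans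
    (le_of_eq ?_)
  · refine (lintegral_mono (g := fun _ => ENNReal.ofReal B) fun x => ?_).trans (le_of_eq ?_)
    · refine ENNReal.ofReal_le_ofReal ((le_abs_self _).trans (hB _ ?_))
      exact ⟨(u r x).coe_nonneg, by exact_mod_cast hc.le r x⟩
    · rw [lintegral_const]
      push_cast
      rw [ENNReal.coe_toNNReal (measure_ne_top _ _)]
      rfl
  · have hm : Measurable fun q : ℝ × V => ENNReal.ofReal (hS.truncEntropy ε (u q.1 q.2) + β) :=
      (hEc.measurable.comp hu.coe_nnreal_real).ennreal_ofReal
    exact Measurable.lintegral_prod_right' hm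
  · rw [hRint]
    exact ((setLIntegral_le_lintegral _ _).trans_lt hc.action).ne
  · exact hDi
  · filter_upwards [ae_lt_top hDme hDi,
      ae_restrict_mem measurableSet_Icc] with r hDr hr q hq
    have hr0 : 0 ≤ r := hs.trans hr.1
    have hqT : q ≤ T := hq.2.trans ht
    refine (hest r ⟨hr0, hr.2.trans ht⟩ q ⟨hr0.trans hq.1, hqT⟩).trans (add_le_add_right ?_ _)
    exact hc.ofReal_abs_sub_le hS (hfm r) ⟨K, hfK r⟩ (hg2 r hDr.ne) hr0 hq.1 hqT
  · simp only [hk, hD]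
    rw [← lintegral_const_mul' _ _ ENNReal.coe_ne_top]
    refine lintegral_mono fun e => ?_
    exact hS.ψStar_mul_mobility_le hconv hε e (hS.α_mono ⟨hc.le z _, hc.le z _⟩)
  · obtain ⟨δ, hδ, h1⟩ := hc.curve.exists_lintegral_mobility_le hS hc.le (hfm r) ⟨K, hfK r⟩
      (hψfin r hDr) ⟨hs.trans hr.1, hr.2.trans ht⟩ hη
    refine ⟨δ, hδ, fun z hz hzt => (h1 z hz (hzt.trans ht)).trans (add_le_add_left ?_ _)⟩
    refine lintegral_mono fun e => ?_
    have := hS.truncDeriv_mul_α_le hconv hε (u r e.1) (u r e.2)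
    simp only [fisherTerm, ENNReal.ofReal_one, one_mul]
    exact mul_le_mul_right this _
  · by_contra! hcon
    choose z hz hzt hzlt using fun n : ℕ => hcon (1 / ((n : ℝ) + 1)) (by positivity)
    have hzmem : ∀ n, z n ∈ Icc 0 T := fun n => ⟨hs.trans (hz n).1, (hzt n).trans ht⟩
    have hsmem : s ∈ Icc 0 T := ⟨hs, hst.le.trans ht⟩
    have hzlim : Tendsto z atTop (𝓝 s) := by
      refine tendsto_of_tendsto_of_tendsto_of_le_of_le tendsto_const_nhds
        (h := fun n : ℕ => s + 1 / ((n : ℝ) + 1)) ?_ (fun n => (hz n).1) fun n => (hz n).2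
      simpa using tendsto_const_nhds.add (tendsto_one_div_add_atTop_nhds_zero_nat (𝕜 := ℝ))
    have h1 := (hc.curve.weakTendsto hS hc.le hzmem hsmem hzlim).integral_mul (C := K.toNNReal)
      (b := fun _ => f s) (b' := f s) (fun _ => hfm s) (hfm s)
      (fun _ => ae_of_all _ fun x => by
        rw [← ofReal_norm]; exact ENNReal.ofReal_le_ofReal (hfK s x))
      (ae_of_all _ fun x => tendsto_const_nhds)
    have h2 := ENNReal.tendsto_ofReal (h1.sub_const (∫ x, f s x * u s x ∂S.π)).abs
    rw [sub_self, abs_zero, ENNReal.ofReal_zero] at h2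
    obtain ⟨n, hn⟩ := (h2.eventually (gt_mem_nhds (show (0 : ℝ≥0∞) < η by
      exact_mod_cast pos_iff_ne_zero.2 hη))).exists
    exact absurd ((hest s hsmem _ (hzmem n)).trans (add_le_add_right hn.le _)) (not_le.2 (hzlt n))
  · rw [hRint, hDint]

/-- The chain rule inequality along bounded reflecting curves. -/
theorem ReflectingCurve.densityEntropy_le (hc : ReflectingCurve S T M u h) (hS : S.Assumptions)
    (hconv : ConvexOn ℝ≥0 univ S.fisherDensity) {s t : ℝ} (hs : 0 ≤ s) (hst : s ≤ t)
    (ht : t ≤ T) : S.densityEntropy (u s) ≤ S.densityEntropy (u t)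
      + (S.actionOn T (fun _ => 1) u h s t + S.fisherOn T (fun _ => 1) u s t) := by
  rcases hst.eq_or_lt with rfl | hst
  · exact le_self_add
  have hfin := hS.finite_π
  have hut : ∀ t, Measurable (u t) := fun t => hc.curve.measurable_u.comp measurable_prodMk_left
  set ε : ℕ → ℝ≥0 := fun n => 1 / ((n : ℝ≥0) + 1) with hεd
  have hε : ∀ n, 0 < ε n := fun n => by positivity
  have hεc : ∀ n, ((ε n : ℝ≥0) : ℝ) = 1 / ((n : ℝ) + 1) := fun n => by simp [hεd]
  -- For `ε ≤ 1` the slope `φ'(ε)` is at most `φ'(1)`, so the tangent part of the truncated entropy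
  -- is at least `-β`; adding `β` makes all integrands nonnegative.
  set β : ℝ := max (deriv S.φ 1) 0 with hβd
  have hβ0 : 0 ≤ β := le_max_right _ _
  have hβ : ∀ n, ∀ r : ℝ≥0, 0 ≤ hS.truncEntropy (ε n) r + β := by
    intro n r
    have hε1 : ((ε n : ℝ≥0) : ℝ) ≤ 1 := by
      rw [hεc, div_le_one (by positivity)]
      have : (0 : ℝ) ≤ n := n.cast_nonneg
      linarith
    have hε0 : (0 : ℝ) < ε n := hε n
    have h1 : deriv S.φ (ε n) ≤ β := (hS.deriv_φ_mono hε0 hε1).trans (le_max_left _ _)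
    have h2 := hS.φ_nonneg (r := max (ε n) r) (hε0.le.trans (le_max_left _ _))
    have h3 : min ((ε n : ℝ≥0) : ℝ) r ≤ ε n := min_le_left _ _
    have h4 : 0 ≤ min ((ε n : ℝ≥0) : ℝ) r := le_min hε0.le r.coe_nonneg
    unfold Assumptions.truncEntropy
    nlinarith
  have hshift : ∀ v : V → ℝ≥0, Measurable v →
      ∫⁻ x, ENNReal.ofReal (S.φ (v x) + β) ∂S.π
        = S.densityEntropy v + ENNReal.ofReal β * S.π univ := by
    intro v hv
    rw [densityEntropy, ← lintegral_const, ← lintegral_add_right _ measurable_const]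
    exact lintegral_congr fun x => ENNReal.ofReal_add (hS.φ_nonneg (v x).coe_nonneg) hβ0
  have hm : ∀ n, Measurable fun x => ENNReal.ofReal (hS.truncEntropy (ε n) (u s x) + β) := fun n =>
    (((hS.continuous_truncEntropy (hε n)).measurable.comp (hut s).coe_nnreal_real).add_const
      β).ennreal_ofReal
  have hbe : ENNReal.ofReal β * S.π univ ≠ ∞ :=
    ENNReal.mul_ne_top ENNReal.ofReal_ne_top (measure_ne_top _ _)
  refine (ENNReal.add_le_add_iff_right hbe).1 ?_
  rw [← hshift _ (hut s), add_right_comm, ← hshift _ (hut t)]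
  -- Fatou's lemma removes the truncation at time `s`; at time `t` the truncated entropy lies below
  -- `φ`.
  calc ∫⁻ x, ENNReal.ofReal (S.φ (u s x) + β) ∂S.π
      = ∫⁻ x, liminf (fun n => ENNReal.ofReal (hS.truncEntropy (ε n) (u s x) + β)) atTop ∂S.π := by
        refine lintegral_congr fun x => ?_
        have h1 := ENNReal.tendsto_ofReal
          ((hS.tendsto_truncEntropy (q := u s x) (u s x).coe_nonneg).add_const β)
        simp only [← hεc] at h1
        exact h1.liminf_eq.symm
    _ ≤ liminf (fun n => ∫⁻ x, ENNReal.ofReal (hS.truncEntropy (ε n) (u s x) + β) ∂S.π) atTop :=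
        lintegral_liminf_le hm
    _ ≤ _ := by
        refine liminf_le_of_le (by isBoundedDefault) fun b hb => ?_
        obtain ⟨n, hn⟩ := hb.exists
        refine hn.trans ((hc.lintegral_truncEntropy_le hS hconv (hε n) (hβ n) hs hst ht).trans ?_)
        refine add_le_add_left (lintegral_mono fun x => ENNReal.ofReal_le_ofReal ?_) _
        have := hS.truncEntropy_le (show (0 : ℝ) < ε n from hε n) (u t x).coe_nonneg
        linarith

end JumpSystem

/-! ### Reflecting solutions in density form and the energy balance -/

namespace JumpSystem

variable {V : Type*} [MetricSpace V] [SecondCountableTopology V] [MeasurableSpace V]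
  [BorelSpace V] {S : JumpSystem V} {T : ℝ} {M : ℝ≥0}

lemma Assumptions.ae_timeθ_endpoints (hS : S.Assumptions) {P : ℝ × V → Prop}
    (hPm : MeasurableSet {q | P q}) (hP : ∀ t ∈ Icc 0 T, ∀ᵐ x ∂S.π, P (t, x)) :
    ∀ᵐ p ∂S.timeθ T, P (p.1, p.2.1) ∧ P (p.1, p.2.2) := by
  have hsf := hS.sigmaFinite_θ
  have hm1 : Measurable fun p : ℝ × V × V => (p.1, p.2.1) := by fun_prop
  have hm2 : Measurable fun p : ℝ × V × V => (p.1, p.2.2) := by fun_prop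
  have hm : MeasurableSet {p : ℝ × V × V | P (p.1, p.2.1) ∧ P (p.1, p.2.2)} :=
    (hm1 hPm).inter (hm2 hPm)
  refine (Measure.ae_prod_iff_ae_ae hm).2 ?_
  filter_upwards [ae_restrict_mem measurableSet_Icc] with t ht
  exact (hS.ae_fst (hP t ht)).and (hS.ae_snd (hP t ht))

/-- Reflecting solutions with bounded densities, in density form. -/
structure ReflectingSolution (S : JumpSystem V) (T : ℝ) (M : ℝ≥0) (a : V × V → ℝ) (u : ℝ → V → ℝ≥0)
    (h : ℝ → V × V → ℝ) : Prop where
  dissipative : DissipativeCurve S T a u h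
  le : ∀ t x, u t x ≤ M
  equation : ReflectingEquation S T u h
  balance : ∀ s t, 0 ≤ s → s ≤ t → t ≤ T →
    S.actionOn T a u h s t + S.fisherOn T a u s t + S.densityEntropy (u t) = S.densityEntropy (u s)

section Conversions

variable {ρ : ℝ → FiniteMeasure V} {j : ℝ → SigmaFiniteSignedMeasure (V × V)}
  {u u' : ℝ → V → ℝ≥0} {h : ℝ → V × V → ℝ} {a : V × V → ℝ}

lemma Represents.truncate (hR : Represents S T ρ j u h)
    (hM : ∀ t ∈ Icc 0 T, ∀ᵐ x ∂S.π, u t x ≤ M) :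
    Represents S T ρ j (fun t x => min (u t x) M) h := by
  refine ⟨hR.measurable_u.min measurable_const, hR.measurable_h, fun t ht => ?_, hR.pos_eq,
    hR.neg_eq, hR.moment⟩
  rw [hR.ρ_eq t ht]
  refine withDensity_congr_ae ?_
  filter_upwards [hM t ht] with x hx
  rw [min_eq_left hx]

lemma Represents.ae_eq (hR : Represents S T ρ j u h) (hR' : Represents S T ρ j u' h)
    (hS : S.Assumptions) {t : ℝ} (ht : t ∈ Icc 0 T) : u t =ᵐ[S.π] u' t := by
  have hfin := hS.finite_π
  have h1 : S.π.withDensity (fun x => (u t x : ℝ≥0∞)) = S.π.withDensity fun x => (u' t x : ℝ≥0∞) := by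
    rw [← hR.ρ_eq t ht, hR'.ρ_eq t ht]
  have h2 := (withDensity_eq_iff_of_sigmaFinite
    (hR.measurable_u.comp measurable_prodMk_left).coe_nnreal_ennreal.aemeasurable
    (hR'.measurable_u.comp measurable_prodMk_left).coe_nnreal_ennreal.aemeasurable).1 h1
  filter_upwards [h2] with x hx
  exact ENNReal.coe_injective hx

lemma lintegral_timeθ_eq (hS : S.Assumptions) (F : ℝ × V × V → ℝ≥0∞) :
    ∫⁻ p in Icc 0 T ×ˢ univ, F p ∂S.timeθ T = ∫⁻ p, F p ∂S.timeθ T := by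
  have hsf := hS.sigmaFinite_θ
  have : (S.timeθ T).restrict (Icc 0 T ×ˢ univ) = S.timeθ T := by
    rw [timeθ, ← Measure.prod_restrict, Measure.restrict_univ,
      Measure.restrict_restrict measurableSet_Icc, inter_self]
  rw [this]

lemma DissipativeCurve.lintegral_lt_top (hD : DissipativeCurve S T a u h) (hS : S.Assumptions)
    (hT : 0 ≤ T) : ∫⁻ p, S.actionDensity a u h p ∂S.timeθ T < ∞ ∧
      ∫⁻ p, S.fisherTerm a u p ∂S.timeθ T < ∞ := by
  have h1 := (hD.inequality T (right_mem_Icc.2 hT)).trans_lt hD.entropy_zero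
  rw [actionOn, fisherOn, lintegral_timeθ_eq hS, lintegral_timeθ_eq hS] at h1
  have h2 := ENNReal.add_lt_top.1 (ENNReal.add_lt_top.1 h1).1
  exact h2

lemma setLIntegral_timeθ_add (hS : S.Assumptions) {F : ℝ × V × V → ℝ≥0∞} (hF : Measurable F)
    {s t : ℝ} (hs : 0 ≤ s) (hst : s ≤ t) (ht : t ≤ T) :
    ∫⁻ p in Icc 0 t ×ˢ univ, F p ∂S.timeθ T = (∫⁻ p in Icc 0 s ×ˢ univ, F p ∂S.timeθ T)
      + ∫⁻ p in Icc s t ×ˢ univ, F p ∂S.timeθ T := by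
  rw [hS.setLIntegral_timeθ le_rfl ht hF, hS.setLIntegral_timeθ le_rfl (hst.trans ht) hF,
    hS.setLIntegral_timeθ hs ht hF, setLIntegral_congr (Ioc_ae_eq_Icc (a := s) (b := t)).symm,
    ← lintegral_union measurableSet_Ioc (Set.disjoint_left.2 fun r hr hr' =>
      absurd hr.2 (not_le.2 hr'.1)), Icc_union_Ioc_eq_Icc hs hst]

/-- Bounded dissipative solutions of the reflecting continuity equation satisfy the energy balance. -/
lemma DissipativeCurve.reflectingSolution (hD : DissipativeCurve S T (fun _ => 1) u h)
    (hS : S.Assumptions) (hconv : ConvexOn ℝ≥0 univ S.fisherDensity) (hT : 0 ≤ T)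
    (hM : ∀ t x, u t x ≤ M) (heq : ReflectingEquation S T u h) :
    ReflectingSolution S T M (fun _ => 1) u h := by
  obtain ⟨hA, hF⟩ := hD.lintegral_lt_top hS hT
  have hc : ReflectingCurve S T M u h := ⟨hD.curve, hM, heq, hA, hF⟩
  have hAm := hS.measurable_actionDensity (a := fun _ => 1) measurable_const hD.curve.measurable_u
    hD.curve.measurable_h
  have hDm := measurable_fisherTerm (S := S) (a := fun _ => 1) measurable_const hD.curve.measurable_u
  -- The dissipation inequality and the chain rule inequality are opposite, so the balance holds
  -- from time `0`; the balance on `[s,t]` follows by cancelling the finite dissipation on `[0,s]`.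
  have h0 : ∀ t ∈ Icc 0 T, S.actionOn T (fun _ => 1) u h 0 t + S.fisherOn T (fun _ => 1) u 0 t
      + S.densityEntropy (u t) = S.densityEntropy (u 0) := fun t ht =>
    le_antisymm (hD.inequality t ht) ((hc.densityEntropy_le hS hconv le_rfl ht.1 ht.2).trans
      (le_of_eq (add_comm _ _)))
  refine ⟨hD, hM, heq, fun s t hs hst ht => ?_⟩
  have hs' : s ∈ Icc 0 T := ⟨hs, hst.trans ht⟩
  have e1 := h0 s hs'
  have e2 := h0 t ⟨hs.trans hst, ht⟩
  rw [actionOn, fisherOn, setLIntegral_timeθ_add hS hAm hs hst ht,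
    setLIntegral_timeθ_add hS hDm hs hst ht, ← e1] at e2
  have hne : S.actionOn T (fun _ => 1) u h 0 s + S.fisherOn T (fun _ => 1) u 0 s ≠ ∞ :=
    ne_top_of_le_ne_top hD.entropy_zero.ne ((le_add_right le_rfl).trans (hD.inequality s hs'))
  refine (ENNReal.add_right_inj hne).1 (Eq.trans ?_ e2)
  unfold actionOn fisherOn
  ring

/-- Reflecting solutions of the reweighted system, in density form. -/
lemma Represents.reflectingSolution (hR : Represents S T ρ j u h) (hS : S.Assumptions)
    (ha : Multiplier a) {C : ℝ≥0} (haC : ∀ᵐ e ∂S.θ, a e ≤ C) (hT : 0 ≤ T)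
    (hr : (S.reweight a).IsReflecting T ρ j) (hM : ∀ t x, u t x ≤ M) :
    ReflectingSolution S T M a u h := by
  have hfin := hS.finite_π
  have he : ∀ t ∈ Icc 0 T, S.densityEntropy (u t) = (S.reweight a).entropy (ρ t) := fun t ht =>
    (hR.entropy_eq hS ht).symm
  have hD : DissipativeCurve S T a u h := hR.dissipativeCurve ⟨hr.entropy_zero,
    hr.reflecting.finiteAction.continuityEquation,
    fun t ht => (hr.energyBalance 0 t le_rfl ht.1 ht.2).le⟩ hS ha hT
  refine ⟨hD, hM, ?_, fun s t hs hst ht => ?_⟩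
  · rintro f hf ⟨K, hK⟩ hf2 s t hs hst ht
    have hgm := measurable_graphGradient hf
    have hint := hS.integrable_flux ha.measurable haC hR.measurable_u hR.measurable_h hM
      (hD.lintegral_lt_top hS hT).1 hf ⟨K, hK⟩ hf2
    rw [← hR.integral_eq ⟨hs.trans hst, ht⟩, ← hR.integral_eq ⟨hs, hst.trans ht⟩,
      ← hR.integral_flux_eq hS hs hst ht hgm hint.integrableOn]
    -- Because `a ≤ C`, a gradient square-integrable for `θ` is also square-integrable for the
    -- reweighted coupling; so the test functions of the limiting system are admissible for the
    -- approximating one.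
    refine hr.reflecting.equation f ⟨?_, ?_⟩ s t hs hst ht
    · exact memLp_top_of_bound hf.aestronglyMeasurable K (ae_of_all _ hK)
    · have hg2 : Measurable fun e => ENNReal.ofReal (graphGradient f e ^ 2) :=
        (hgm.pow_const 2).ennreal_ofReal
      rw [hS.θ_reweight ha, lintegral_withDensity_eq_lintegral_mul _ ha.measurable.ennreal_ofReal hg2]
      refine (lintegral_mono_ae (g := fun e => C * ENNReal.ofReal (graphGradient f e ^ 2)) ?_).trans_lt
        ?_
      · filter_upwards [haC] with e he
        simp only [Pi.mul_apply]
        gcongr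
        rw [← ENNReal.ofReal_coe_nnreal]
        exact ENNReal.ofReal_le_ofReal he
      · rw [lintegral_const_mul' _ _ ENNReal.coe_ne_top]
        exact ENNReal.mul_lt_top ENNReal.coe_lt_top hf2
  · rw [he t ⟨hs.trans hst, ht⟩, he s ⟨hs, hst.trans ht⟩, actionOn, fisherOn,
      ← hR.lintegral_add hS ha hs ht]
    exact hr.energyBalance s t hs hst ht

/-- A curve represented by a reflecting solution in density form is a reflecting solution. -/
lemma Represents.isReflecting (hR : Represents S T ρ j u h) (hS : S.Assumptions) (hT : 0 ≤ T)
    (hc : ContinuityEquation T ρ j) (hr : ReflectingSolution S T M (fun _ => 1) u h) :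
    S.IsReflecting T ρ j := by
  have hfin := hS.finite_π
  have hut : ∀ t, Measurable (u t) := fun t => hR.measurable_u.comp measurable_prodMk_left
  obtain ⟨hA, hD⟩ := hR.finiteActionCurve hc hr.dissipative hS hT
  refine ⟨hD.entropy_zero, ⟨hA, ⟨M, ?_⟩, ?_⟩, fun s t hs hst ht => ?_⟩
  · filter_upwards [ae_restrict_mem measurableSet_Icc] with t ht
    filter_upwards [hS.density_ae_eq (hut t) (hR.ρ_eq t ht)] with x hx
    rw [hx]
    exact_mod_cast hr.le t x
  · rintro f ⟨hf, hf2⟩ s t hs hst ht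
    -- Test functions in `X₂` are only a.e. measurable and essentially bounded. A measurable
    -- representative clipped at `K` is a bounded measurable function with the same integrals.
    set K : ℝ := (eLpNorm f ∞ S.π).toReal with hK
    set g₀ : V → ℝ := hf.1.mk f with hg₀
    have hg₀m : Measurable g₀ := hf.1.stronglyMeasurable_mk.measurable
    set g : V → ℝ := fun x => max (-K) (min (g₀ x) K) with hg
    have hgm : Measurable g := measurable_const.max (hg₀m.min measurable_const)
    have hgf : f =ᵐ[S.π] g := by
      have hb : ∀ᵐ x ∂S.π, ‖f x‖ₑ ≤ eLpNorm f ∞ S.π := by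
        rw [eLpNorm_exponent_top]; exact enorm_ae_le_eLpNormEssSup f S.π
      filter_upwards [hf.1.ae_eq_mk, hb] with x hx hbx
      have h1 : |f x| ≤ K := by
        rw [hK, ← Real.norm_eq_abs, ← toReal_enorm]
        exact ENNReal.toReal_mono hf.2.ne hbx
      rw [abs_le] at h1
      simp only [hg, hg₀]
      rw [← hx, min_eq_left h1.2, max_eq_right h1.1]
    have hK0 : 0 ≤ K := ENNReal.toReal_nonneg
    have hgb : ∀ x, |g x| ≤ K := fun x => by
      rw [abs_le]
      exact ⟨le_max_left _ _, max_le (by linarith) (min_le_right _ _)⟩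
    have hgrad : graphGradient f =ᵐ[S.θ] graphGradient g := by
      filter_upwards [hS.ae_fst hgf, hS.ae_snd hgf] with e h1 h2
      unfold graphGradient
      rw [h1, h2]
    have hg2 : ∫⁻ e, ENNReal.ofReal (graphGradient g e ^ 2) ∂S.θ < ∞ := by
      refine lt_of_le_of_lt (le_of_eq (lintegral_congr_ae ?_)) hf2
      filter_upwards [hgrad] with e h1
      rw [h1]
    have hρf : ∀ t ∈ Icc 0 T, ∫ x, f x ∂(ρ t : Measure V) = ∫ x, g x * u t x ∂S.π := by
      intro t ht
      rw [← hR.integral_eq ht]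
      refine integral_congr_ae ?_
      rw [hR.ρ_eq t ht]
      exact (withDensity_absolutelyContinuous _ _).ae_eq hgf
    have hint := hS.integrable_flux (C := 1) measurable_const (ae_of_all _ fun _ => by simp)
      hR.measurable_u hR.measurable_h hr.le (hr.dissipative.lintegral_lt_top hS hT).1 hgm ⟨K, hgb⟩ hg2
    rw [hρf t ⟨hs.trans hst, ht⟩, hρf s ⟨hs, hst.trans ht⟩,
      hr.equation g hgm ⟨K, hgb⟩ hg2 s t hs hst ht,
      ← hR.integral_flux_eq hS hs hst ht (measurable_graphGradient hgm) hint.integrableOn]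
    rw [intervalIntegral.integral_of_le hst, intervalIntegral.integral_of_le hst]
    refine integral_congr_ae ?_
    have hsub : Ioc s t ⊆ Icc 0 T := fun r hr => ⟨hs.trans hr.1.le, hr.2.trans ht⟩
    filter_upwards [ae_restrict_of_ae_restrict_of_subset hsub hR.pos_eq,
      ae_restrict_of_ae_restrict_of_subset hsub hR.neg_eq] with r hp hn
    unfold SigmaFiniteSignedMeasure.integral
    rw [hp, hn]
    congr 1
    · exact integral_congr_ae ((withDensity_absolutelyContinuous _ _).ae_eq hgrad.symm)
    · exact integral_congr_ae ((withDensity_absolutelyContinuous _ _).ae_eq hgrad.symm)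
  · have h1 := hR.lintegral_add hS multiplier_one hs ht
    rw [reweight_one] at h1
    rw [h1, hR.entropy_eq hS ⟨hs, hst.trans ht⟩, hR.entropy_eq hS ⟨hs.trans hst, ht⟩]
    exact hr.balance s t hs hst ht

end Conversions

lemma DensitiesTendsto.congr {hS : S.Assumptions} {un : ℕ → ℝ → V → ℝ≥0} {hn : ℕ → ℝ → V × V → ℝ}
    {u u' : ℝ → V → ℝ≥0} {h : ℝ → V × V → ℝ} (H : DensitiesTendsto hS T un hn u h)
    (hu : Measurable (Function.uncurry u)) (hu' : Measurable (Function.uncurry u'))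
    (heq : ∀ t ∈ Icc 0 T, u t =ᵐ[S.π] u' t) : DensitiesTendsto hS T un hn u' h := by
  have key : ∀ {X : Type _} [MeasurableSpace X] {m : Measure X} {g : ℕ → X → ℝ} {w w' : X → ℝ≥0},
      WeakTendsto m g (fun x => w x) → Measurable w' → w =ᵐ[m] w' →
      WeakTendsto m g fun x => (w' x : ℝ) := by
    intro X _ m g w w' hw hw' he
    have he' : (fun x => (w x : ℝ)) =ᵐ[m] fun x => (w' x : ℝ) := by
      filter_upwards [he] with x hx; rw [hx]
    refine ⟨hw.equi, hw'.coe_nnreal_real, hw.integrable.congr he', fun B hB => ?_⟩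
    rw [← integral_congr_ae (ae_restrict_of_ae he')]
    exact hw.tendsto B hB
  have hae := hS.ae_finiteTimeθ (hS.ae_timeθ_endpoints
    (P := fun q => u q.1 q.2 = u' q.1 q.2) (measurableSet_eq_fun hu hu') heq)
  exact ⟨fun t ht => key (H.density t ht) (hu'.comp measurable_prodMk_left) (heq t ht), H.flux,
    key H.fst (measurable_fst.comp (measurable_edge_values hu')) (hae.mono fun p hp => hp.1),
    key H.snd (measurable_snd.comp (measurable_edge_values hu')) (hae.mono fun p hp => hp.2)⟩

end JumpSystem

/-! ### Convergence of energies and compactness of reflecting solutions -/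

/-- If a sum converges to the sum of lower bounds for the inferior limits of its terms, then each
term converges. -/
lemma ENNReal.tendsto_of_le_liminf_of_tendsto_add {x y : ℕ → ℝ≥0∞} {a b : ℝ≥0∞}
    (hx : a ≤ liminf x atTop) (hy : b ≤ liminf y atTop)
    (hsum : Tendsto (fun n => x n + y n) atTop (𝓝 (a + b))) (hfin : a + b ≠ ∞) :
    Tendsto x atTop (𝓝 a) := by
  have hb : b ≠ ∞ := ne_top_of_le_ne_top hfin (le_add_left le_rfl)
  refine tendsto_of_le_liminf_of_limsup_le hx ?_
  refine ENNReal.le_of_forall_pos_le_add fun ε hε _ => ?_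
  have hε' : ((ε / 2 : ℝ≥0) : ℝ≥0∞) ≠ 0 := by exact_mod_cast (half_pos hε).ne'
  have h1 : ∀ᶠ n in atTop, x n + y n < a + b + (ε / 2 : ℝ≥0) :=
    hsum.eventually (gt_mem_nhds (ENNReal.lt_add_right hfin hε'))
  have h2 : ∀ᶠ n in atTop, b ≤ y n + (ε / 2 : ℝ≥0) := by
    rcases eq_or_ne b 0 with h0 | h0
    · exact Eventually.of_forall fun n => by rw [h0]; exact zero_le
    · have h3 : b - (ε / 2 : ℝ≥0) < liminf y atTop :=
        (ENNReal.sub_lt_self hb h0 hε').trans_le hy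
      filter_upwards [eventually_lt_of_lt_liminf h3] with n hn
      exact tsub_le_iff_right.1 hn.le
  refine limsup_le_of_le (by isBoundedDefault) ?_
  filter_upwards [h1, h2] with n e1 e2
  refine (ENNReal.add_le_add_iff_right hb).1 ?_
  calc x n + b ≤ x n + (y n + (ε / 2 : ℝ≥0)) := by gcongr
    _ = (x n + y n) + (ε / 2 : ℝ≥0) := by ring
    _ ≤ (a + b + (ε / 2 : ℝ≥0)) + (ε / 2 : ℝ≥0) := by gcongr
    _ = a + b + ((ε / 2 + ε / 2 : ℝ≥0) : ℝ≥0∞) := by push_cast; ring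
    _ = _ := by rw [add_halves]; ring

namespace JumpSystem

variable {V : Type*} [MetricSpace V] [SecondCountableTopology V] [MeasurableSpace V]
  [BorelSpace V] {S : JumpSystem V} {T : ℝ} {M C : ℝ≥0} {a : ℕ → V × V → ℝ}
  {un : ℕ → ℝ → V → ℝ≥0} {hn : ℕ → ℝ → V × V → ℝ} {u : ℝ → V → ℝ≥0} {h : ℝ → V × V → ℝ}

/-- Convergence of densities, fluxes, actions, Fisher informations and entropies. -/
structure SolutionsTendsto (S : JumpSystem V) (T : ℝ) (a : ℕ → V × V → ℝ) (un : ℕ → ℝ → V → ℝ≥0)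
    (hn : ℕ → ℝ → V × V → ℝ) (u : ℝ → V → ℝ≥0) (h : ℝ → V × V → ℝ) : Prop where
  density : ∀ t ∈ Icc 0 T, ∀ B, MeasurableSet B →
    Tendsto (fun n => ∫ x in B, (un n t x : ℝ) ∂S.π) atTop (𝓝 (∫ x in B, (u t x : ℝ) ∂S.π))
  flux : ∀ k B, MeasurableSet B → Tendsto
    (fun n => ∫ p in B ∩ univ ×ˢ longEdges V k, hn n p.1 p.2 ∂S.timeθ T) atTop
    (𝓝 (∫ p in B ∩ univ ×ˢ longEdges V k, h p.1 p.2 ∂S.timeθ T))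
  action : ∀ s t, 0 ≤ s → s ≤ t → t ≤ T →
    Tendsto (fun n => S.actionOn T (a n) (un n) (hn n) s t) atTop
      (𝓝 (S.actionOn T (fun _ => 1) u h s t))
  fisher : ∀ s t, 0 ≤ s → s ≤ t → t ≤ T →
    Tendsto (fun n => S.fisherOn T (a n) (un n) s t) atTop (𝓝 (S.fisherOn T (fun _ => 1) u s t))
  entropy : ∀ t ∈ Icc 0 T,
    Tendsto (fun n => S.densityEntropy (un n t)) atTop (𝓝 (S.densityEntropy (u t)))

lemma SolutionsTendsto.of_subseq (H : ∀ ns : ℕ → ℕ, Tendsto ns atTop atTop → ∃ ms : ℕ → ℕ,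
      SolutionsTendsto S T (fun n => a (ns (ms n))) (fun n => un (ns (ms n)))
        (fun n => hn (ns (ms n))) u h) : SolutionsTendsto S T a un hn u h := by
  choose! ms hms using H
  exact ⟨fun t ht B hB => tendsto_of_subseq_tendsto fun ns hns =>
      ⟨ms ns, (hms ns hns).density t ht B hB⟩,
    fun k B hB => tendsto_of_subseq_tendsto fun ns hns => ⟨ms ns, (hms ns hns).flux k B hB⟩,
    fun s t hs hst ht => tendsto_of_subseq_tendsto fun ns hns =>
      ⟨ms ns, (hms ns hns).action s t hs hst ht⟩,
    fun s t hs hst ht => tendsto_of_subseq_tendsto fun ns hns =>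
      ⟨ms ns, (hms ns hns).fisher s t hs hst ht⟩,
    fun t ht => tendsto_of_subseq_tendsto fun ns hns => ⟨ms ns, (hms ns hns).entropy t ht⟩⟩

lemma SolutionsTendsto.congr (H : SolutionsTendsto S T a un hn u h) (hS : S.Assumptions)
    {u' : ℝ → V → ℝ≥0} {h' : ℝ → V × V → ℝ}
    (hu : Measurable (Function.uncurry u)) (hu' : Measurable (Function.uncurry u'))
    (hueq : ∀ t ∈ Icc 0 T, u t =ᵐ[S.π] u' t)
    (hheq : ∀ᵐ p ∂S.timeθ T, h p.1 p.2 = h' p.1 p.2) :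
    SolutionsTendsto S T a un hn u' h' := by
  have hae := hS.ae_timeθ_endpoints
    (P := fun q => u q.1 q.2 = u' q.1 q.2) (measurableSet_eq_fun hu hu') hueq
  refine ⟨fun t ht B hB => ?_, fun k B hB => ?_, fun s t hs hst ht => ?_, fun s t hs hst ht => ?_,
    fun t ht => ?_⟩
  · convert H.density t ht B hB using 2
    refine integral_congr_ae (ae_restrict_of_ae ?_)
    filter_upwards [hueq t ht] with x hx
    rw [hx]
  · rw [← integral_congr_ae (ae_restrict_of_ae hheq)]
    exact H.flux k B hB
  · convert H.action s t hs hst ht using 2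
    refine lintegral_congr_ae (ae_restrict_of_ae ?_)
    filter_upwards [hae, hheq] with p hp hp'
    rw [actionDensity, actionDensity, hp.1, hp.2, hp']
  · convert H.fisher s t hs hst ht using 2
    refine lintegral_congr_ae (ae_restrict_of_ae ?_)
    filter_upwards [hae] with p hp
    rw [fisherTerm, fisherTerm, hp.1, hp.2]
  · convert H.entropy t ht using 2
    refine lintegral_congr_ae ?_
    filter_upwards [hueq t ht] with x hx
    rw [hx]

/-- Transfer of convergence to curves of measures. -/
lemma SolutionsTendsto.tendsto (H : SolutionsTendsto S T a un hn u h) (hS : S.Assumptions)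
    (hm : ∀ n, Multiplier (a n)) {ρn : ℕ → ℝ → FiniteMeasure V}
    {jn : ℕ → ℝ → SigmaFiniteSignedMeasure (V × V)}
    (hRn : ∀ n, Represents S T (ρn n) (jn n) (un n) (hn n))
    {ρ : ℝ → FiniteMeasure V} {j : ℝ → SigmaFiniteSignedMeasure (V × V)}
    (hR : Represents S T ρ j u h) : CurvesTendsto T ρn jn ρ j ∧
      EnergiesTendsto (fun n => S.reweight (a n)) S T ρn jn ρ j := by
  refine ⟨⟨fun t ht => ?_, hS.fluxTendsto hRn hR H.flux⟩, ⟨fun s t hs hst ht => ?_,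
    fun s t hs hst ht => ?_, fun t ht => ?_⟩⟩
  · exact (setwiseTendsto_of_density (fun n => (hRn n).measurable_u.comp measurable_prodMk_left)
      (hR.measurable_u.comp measurable_prodMk_left) (fun n => (hRn n).ρ_eq t ht) (hR.ρ_eq t ht)).2
      (H.density t ht)
  · have h1 := hR.lintegral_action hS multiplier_one hs ht
    rw [reweight_one] at h1
    rw [h1]
    simp_rw [fun n => (hRn n).lintegral_action hS (hm n) hs ht]
    exact H.action s t hs hst ht
  · have h1 := hR.lintegral_fisher hS multiplier_one hs ht
    rw [reweight_one] at h1
    rw [h1]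
    simp_rw [fun n => (hRn n).lintegral_fisher hS (hm n) hs ht]
    exact H.fisher s t hs hst ht
  · rw [hR.entropy_eq hS ht]
    exact (H.entropy t ht).congr fun n => ((hRn n).entropy_eq hS ht).symm

lemma MultiplierTendsto.comp (ha : MultiplierTendsto S C a) {σ : ℕ → ℕ}
    (hσ : Tendsto σ atTop atTop) : MultiplierTendsto S C fun n => a (σ n) :=
  ⟨fun n => ha.measurable _, fun n => ha.le _, by
    filter_upwards [ha.tendsto] with e he using he.comp hσ⟩

/-- Energies converge along convergent sequences of solutions satisfying the energy balance. -/
lemma DensitiesTendsto.solutionsTendsto {hS : S.Assumptions} (H : DensitiesTendsto hS T un hn u h)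
    (hconv : ConvexOn ℝ≥0 univ S.fisherDensity) (ha : MultiplierTendsto S C a)
    (hs : ∀ n, ReflectingSolution S T M (a n) (un n) (hn n))
    (hs' : ReflectingSolution S T M (fun _ => 1) u h)
    (hE : Tendsto (fun n => S.densityEntropy (un n 0)) atTop (𝓝 (S.densityEntropy (u 0)))) :
    SolutionsTendsto S T a un hn u h := by
  have hc := fun n => (hs n).dissipative.curve
  have hc' := hs'.dissipative.curve
  have hA := H.actionOn_le ha hc hc'
  have hF := H.fisherOn_le hconv ha hc hc'
  have hfin : ∀ t ∈ Icc 0 T, S.densityEntropy (u t) ≠ ∞ := fun t ht =>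
    ne_top_of_le_ne_top hs'.dissipative.entropy_zero.ne
      ((le_add_left le_rfl).trans (hs'.dissipative.inequality t ht))
  -- Entropies come first, from the balances on `[0,t]`: they are the right-hand sides of the
  -- balances on `[s,t]`, from which the action and Fisher terms are then separated.
  have hent : ∀ t ∈ Icc 0 T,
      Tendsto (fun n => S.densityEntropy (un n t)) atTop (𝓝 (S.densityEntropy (u t))) := by
    intro t ht
    refine ENNReal.tendsto_of_le_liminf_of_tendsto_add
      (y := fun n => S.actionOn T (a n) (un n) (hn n) 0 t + S.fisherOn T (a n) (un n) 0 t)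
      (b := S.actionOn T (fun _ => 1) u h 0 t + S.fisherOn T (fun _ => 1) u 0 t)
      (H.entropy_le ht) ((add_le_add (hA 0 t) (hF 0 t)).trans (ENNReal.liminf_add_liminf_le _ _)) ?_ ?_
    · simp_rw [add_comm (S.densityEntropy _), hs'.balance 0 t le_rfl ht.1 ht.2,
        fun n => (hs n).balance 0 t le_rfl ht.1 ht.2]
      exact hE
    · rw [add_comm, hs'.balance 0 t le_rfl ht.1 ht.2]
      exact hs'.dissipative.entropy_zero.ne
  refine ⟨fun t ht B hB => (H.density t ht).tendsto B hB, fun k B hB => H.tendsto_flux k hB,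
    fun s t hs0 hst ht => ?_, fun s t hs0 hst ht => ?_, hent⟩
  · have hst' : s ∈ Icc 0 T := ⟨hs0, hst.trans ht⟩
    refine ENNReal.tendsto_of_le_liminf_of_tendsto_add
      (y := fun n => S.fisherOn T (a n) (un n) s t + S.densityEntropy (un n t))
      (b := S.fisherOn T (fun _ => 1) u s t + S.densityEntropy (u t))
      (hA s t) ((add_le_add (hF s t) (H.entropy_le ⟨hs0.trans hst, ht⟩)).trans
        (ENNReal.liminf_add_liminf_le _ _)) ?_ ?_
    · simp_rw [← add_assoc, hs'.balance s t hs0 hst ht, fun n => (hs n).balance s t hs0 hst ht]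
      exact hent s hst'
    · rw [← add_assoc, hs'.balance s t hs0 hst ht]
      exact hfin s hst'
  · have hst' : s ∈ Icc 0 T := ⟨hs0, hst.trans ht⟩
    refine ENNReal.tendsto_of_le_liminf_of_tendsto_add
      (y := fun n => S.actionOn T (a n) (un n) (hn n) s t + S.densityEntropy (un n t))
      (b := S.actionOn T (fun _ => 1) u h s t + S.densityEntropy (u t))
      (hF s t) ((add_le_add (hA s t) (H.entropy_le ⟨hs0.trans hst, ht⟩)).trans
        (ENNReal.liminf_add_liminf_le _ _)) ?_ ?_
    · simp_rw [add_left_comm (S.fisherOn T _ _ s t), ← add_assoc, hs'.balance s t hs0 hst ht,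
        fun n => (hs n).balance s t hs0 hst ht]
      exact hent s hst'
    · rw [add_left_comm, ← add_assoc, hs'.balance s t hs0 hst ht]
      exact hfin s hst'

/-- Compactness and stability of reflecting solutions. -/
theorem exists_reflecting_limit (hS : S.Assumptions) (hconv : ConvexOn ℝ≥0 univ S.fisherDensity)
    (hT : 0 ≤ T) (hm : ∀ n, Multiplier (a n)) (ha : MultiplierTendsto S C a)
    (hs : ∀ n, ReflectingSolution S T M (a n) (un n) (hn n)) {u₀ : V → ℝ≥0} (hu₀ : Measurable u₀)
    (hu₀i : Integrable (fun x => (u₀ x : ℝ)) S.π)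
    (h0 : ∀ B, MeasurableSet B →
      Tendsto (fun n => ∫ x in B, (un n 0 x : ℝ) ∂S.π) atTop (𝓝 (∫ x in B, (u₀ x : ℝ) ∂S.π)))
    (hE : Tendsto (fun n => S.densityEntropy (un n 0)) atTop (𝓝 (S.densityEntropy u₀)))
    (hE₀ : S.densityEntropy u₀ < ∞) :
    ∃ (σ : ℕ → ℕ) (u : ℝ → V → ℝ≥0) (h : ℝ → V × V → ℝ), StrictMono σ ∧
      SolutionsTendsto S T (fun n => a (σ n)) (fun n => un (σ n)) (fun n => hn (σ n)) u h ∧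
      ReflectingSolution S T M (fun _ => 1) u h ∧ (u 0 =ᵐ[S.π] u₀) := by
  have hfin := hS.finite_π
  obtain ⟨σ, u', h', hσ, hH', hD', hu'0⟩ := exists_dissipative_limit hS hconv hT hm ha
    (fun n => (hs n).dissipative) hu₀ hu₀i h0 hE hE₀
  have h00 : (0 : ℝ) ∈ Icc 0 T := left_mem_Icc.2 hT
  -- The bound passes to the weak limit only almost everywhere; `min (u' t x) M` below restores it
  -- pointwise without changing the measures.
  have hle : ∀ t ∈ Icc 0 T, ∀ᵐ x ∂S.π, u' t x ≤ M := by
    intro t ht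
    have h1 : (fun x => (u' t x : ℝ)) ≤ᵐ[S.π] fun _ => (M : ℝ) := by
      refine ae_le_of_forall_setIntegral_le (hH'.density t ht).integrable (integrable_const _)
        fun B hB _ => ?_
      refine le_of_tendsto' ((hH'.density t ht).tendsto B hB) fun n => ?_
      refine setIntegral_mono ((hH'.density t ht).equi.integrable n).integrableOn
        (integrable_const _).integrableOn fun x => ?_
      exact_mod_cast (hs (σ n)).le t x
    filter_upwards [h1] with x hx
    exact_mod_cast hx
  obtain ⟨ρ, j, hR, hc⟩ := hD'.curve.exists_represents hS hT
  have hR' := hR.truncate hle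
  set u : ℝ → V → ℝ≥0 := fun t x => min (u' t x) M with hu
  have hueq : ∀ t ∈ Icc 0 T, u' t =ᵐ[S.π] u t := fun t ht => hR.ae_eq hR' hS ht
  have hH := hH'.congr hR.measurable_u hR'.measurable_u hueq
  have hdiss := (hR.finiteActionCurve hc hD' hS hT).2
  rw [← reweight_one S] at hdiss
  have hD : DissipativeCurve S T (fun _ => 1) u h' :=
    hR'.dissipativeCurve hdiss hS multiplier_one hT
  have hu0 : u 0 =ᵐ[S.π] u₀ := (hueq 0 h00).symm.trans hu'0
  have hent : S.densityEntropy (u 0) = S.densityEntropy u₀ := by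
    refine lintegral_congr_ae ?_
    filter_upwards [hu0] with x hx
    rw [hx]
  have hle' : ∀ t x, u t x ≤ M := fun t x => min_le_right _ _
  obtain ⟨E, hEle⟩ : ∃ E : ℝ≥0, ∀ n, S.densityEntropy (un n 0) ≤ E := by
    have h1 : Tendsto (fun n => (S.densityEntropy (un n 0)).toNNReal) atTop
        (𝓝 (S.densityEntropy u₀).toNNReal) := (ENNReal.tendsto_toNNReal hE₀.ne).comp hE
    obtain ⟨E, hE⟩ := h1.bddAbove_range
    refine ⟨E, fun n => ?_⟩
    rw [← ENNReal.coe_toNNReal (hs n).dissipative.entropy_zero.ne]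
    exact ENNReal.coe_le_coe.2 (hE ⟨n, rfl⟩)
  have hAct : ∀ {a : V × V → ℝ} {u : ℝ → V → ℝ≥0} {h : ℝ → V × V → ℝ},
      DissipativeCurve S T a u h →
      ∫⁻ p, S.actionDensity a u h p ∂S.timeθ T ≤ S.densityEntropy (u 0) := by
    intro a u h hD
    rw [← lintegral_timeθ_eq hS]
    refine le_trans ?_ (hD.inequality T (right_mem_Icc.2 hT))
    rw [add_assoc]
    exact le_self_add
  have hle₀ : S.densityEntropy u₀ ≤ E := le_of_tendsto' hE hEle
  have heq : ReflectingEquation S T u h' :=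
    hH.reflectingEquation (fun n => ha.measurable (σ n)) (fun n => ha.le (σ n))
      (fun n => (hs (σ n)).dissipative.curve.measurable_u)
      (fun n => (hs (σ n)).dissipative.curve.measurable_h) hR'.measurable_u hR'.measurable_h
      (fun n => (hs (σ n)).le) hle' (fun n => (hAct (hs (σ n)).dissipative).trans (hEle _))
      ((hAct hD).trans (by rw [hent]; exact hle₀)) fun n => (hs (σ n)).equation
  have hsol := hD.reflectingSolution hS hconv hT hle' heq
  refine ⟨σ, u, h', hσ, hH.solutionsTendsto hconv (ha.comp hσ.tendsto_atTop)
    (fun n => hs (σ n)) hsol ?_, hsol, hu0⟩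
  rw [hent]
  exact hE.comp hσ.tendsto_atTop

end JumpSystem

/-! ### Uniqueness of bounded reflecting solutions -/

namespace JumpSystem

variable {V : Type*} [MetricSpace V] [SecondCountableTopology V] [MeasurableSpace V]
  [BorelSpace V] {S : JumpSystem V} {T : ℝ} {M : ℝ≥0}
  {u₁ u₂ : ℝ → V → ℝ≥0} {h₁ h₂ : ℝ → V × V → ℝ}

/-- The midpoint of two densities. -/
def midDensity (u₁ u₂ : ℝ → V → ℝ≥0) (t : ℝ) (x : V) : ℝ≥0 := (u₁ t x + u₂ t x) / 2

/-- The midpoint of two fluxes. -/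
def midFlux (h₁ h₂ : ℝ → V × V → ℝ) (t : ℝ) (e : V × V) : ℝ := (h₁ t e + h₂ t e) / 2

lemma Assumptions.α_mid_le (hS : S.Assumptions) (p q : ℝ≥0 × ℝ≥0) :
    ((S.α p : ℝ) + S.α q) / 2 ≤ S.α ((p.1 + q.1) / 2, (p.2 + q.2) / 2) := by
  have h1 := hS.α_concave_le p q (a := 2⁻¹) (b := 2⁻¹)
    (by rw [← two_mul, mul_inv_cancel₀ two_ne_zero])
  have h2 : (2⁻¹ : ℝ≥0) • p + (2⁻¹ : ℝ≥0) • q = ((p.1 + q.1) / 2, (p.2 + q.2) / 2) := by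
    ext <;> simp <;> ring
  rw [h2] at h1
  have h3 : ((2⁻¹ * S.α p + 2⁻¹ * S.α q : ℝ≥0) : ℝ) ≤ S.α ((p.1 + q.1) / 2, (p.2 + q.2) / 2) := by
    exact_mod_cast h1
  push_cast at h3
  linarith

/-- Concavity of `α` puts the mobility of the midpoint above the mean of the mobilities, where the
jointly convex perspective is only smaller. -/
lemma Assumptions.actionDensity_mid_le (hS : S.Assumptions) (p : ℝ × V × V) :
    S.actionDensity (fun _ => 1) (midDensity u₁ u₂) (midFlux h₁ h₂) p
      ≤ 2⁻¹ * S.actionDensity (fun _ => 1) u₁ h₁ p + 2⁻¹ * S.actionDensity (fun _ => 1) u₂ h₂ p := by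
  unfold actionDensity
  rw [mul_left_comm, mul_left_comm (2⁻¹ : ℝ≥0∞) (2⁻¹ : ℝ≥0∞) (S.perspective (2 * h₂ p.1 p.2) _),
    ← mul_add, show 2 * midFlux h₁ h₂ p.1 p.2 = (2 * h₁ p.1 p.2 + 2 * h₂ p.1 p.2) / 2 by
      unfold midFlux; ring]
  refine mul_le_mul_right (perspective_le_half hS _ _ _ _ _ ?_) _
  have := hS.α_mid_le (u₁ p.1 p.2.1, u₁ p.1 p.2.2) (u₂ p.1 p.2.1, u₂ p.1 p.2.2)
  simpa [midDensity] using this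

lemma fisherTerm_mid_le (hconv : ConvexOn ℝ≥0 univ S.fisherDensity) (p : ℝ × V × V) :
    S.fisherTerm (fun _ => 1) (midDensity u₁ u₂) p
      ≤ 2⁻¹ * S.fisherTerm (fun _ => 1) u₁ p + 2⁻¹ * S.fisherTerm (fun _ => 1) u₂ p := by
  unfold fisherTerm
  simp only [ENNReal.ofReal_one, one_mul]
  rw [← mul_add]
  refine mul_le_mul_right ?_ _
  have h1 := hconv.2 (mem_univ (u₁ p.1 p.2.1, u₁ p.1 p.2.2)) (mem_univ (u₂ p.1 p.2.1, u₂ p.1 p.2.2))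
    (show (0 : ℝ≥0) ≤ 2⁻¹ from zero_le) (show (0 : ℝ≥0) ≤ 2⁻¹ from zero_le) (by rw [← two_mul, mul_inv_cancel₀ two_ne_zero])
  have h2 : (2⁻¹ : ℝ≥0) • (u₁ p.1 p.2.1, u₁ p.1 p.2.2) + (2⁻¹ : ℝ≥0) • (u₂ p.1 p.2.1, u₂ p.1 p.2.2)
      = (midDensity u₁ u₂ p.1 p.2.1, midDensity u₁ u₂ p.1 p.2.2) := by
    unfold midDensity
    ext <;> simp <;> ring
  rw [h2] at h1
  refine h1.trans (le_of_eq ?_)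
  rw [ENNReal.smul_def, ENNReal.smul_def, smul_eq_mul, smul_eq_mul,
    ENNReal.coe_inv two_ne_zero, ENNReal.coe_ofNat]

/-- Midpoints of reflecting solutions are reflecting curves. -/
lemma ReflectingSolution.reflectingCurve_mid (H₁ : ReflectingSolution S T M (fun _ => 1) u₁ h₁)
    (H₂ : ReflectingSolution S T M (fun _ => 1) u₂ h₂) (hS : S.Assumptions)
    (hconv : ConvexOn ℝ≥0 univ S.fisherDensity) (hT : 0 ≤ T) :
    ReflectingCurve S T M (midDensity u₁ u₂) (midFlux h₁ h₂) := by
  have hfin := hS.finite_π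
  have hsf := hS.sigmaFinite_θ
  have c₁ := H₁.dissipative.curve
  have c₂ := H₂.dissipative.curve
  obtain ⟨hA₁, hF₁⟩ := H₁.dissipative.lintegral_lt_top hS hT
  obtain ⟨hA₂, hF₂⟩ := H₂.dissipative.lintegral_lt_top hS hT
  have hmul : ∀ {u : ℝ → V → ℝ≥0}, Measurable (Function.uncurry u) → (∀ t x, u t x ≤ M) →
      ∀ {f : V → ℝ}, Measurable f → (∃ K, ∀ x, |f x| ≤ K) → ∀ t,
      Integrable (fun x => f x * u t x) S.π := by
    rintro u hu hM f hf ⟨K, hK⟩ t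
    have hi : Integrable (fun x => (u t x : ℝ)) S.π :=
      Integrable.of_bound (hu.comp measurable_prodMk_left).coe_nnreal_real.aestronglyMeasurable M
        (ae_of_all _ fun x => by
          rw [Real.norm_of_nonneg (u t x).coe_nonneg]; exact_mod_cast hM t x)
    exact hi.bdd_mul (c := K) hf.aestronglyMeasurable (ae_of_all _ hK)
  have hlin : ∀ f : V → ℝ, Measurable f → (∃ K, ∀ x, |f x| ≤ K) →
      Integrable (fun p => graphGradient f p.2 * h₁ p.1 p.2) (S.timeθ T) →
      Integrable (fun p => graphGradient f p.2 * h₂ p.1 p.2) (S.timeθ T) → ∀ s t,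
      ((∫ x, f x * u₁ t x ∂S.π) - ∫ x, f x * u₁ s x ∂S.π
        = ∫ p in Icc s t ×ˢ univ, graphGradient f p.2 * h₁ p.1 p.2 ∂S.timeθ T) →
      ((∫ x, f x * u₂ t x ∂S.π) - ∫ x, f x * u₂ s x ∂S.π
        = ∫ p in Icc s t ×ˢ univ, graphGradient f p.2 * h₂ p.1 p.2 ∂S.timeθ T) →
      (∫ x, f x * midDensity u₁ u₂ t x ∂S.π) - ∫ x, f x * midDensity u₁ u₂ s x ∂S.π
        = ∫ p in Icc s t ×ˢ univ, graphGradient f p.2 * midFlux h₁ h₂ p.1 p.2 ∂S.timeθ T := by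
    intro f hf hb hi₁ hi₂ s t e₁ e₂
    have k1 : ∀ t, ∫ x, f x * midDensity u₁ u₂ t x ∂S.π
        = ((∫ x, f x * u₁ t x ∂S.π) + ∫ x, f x * u₂ t x ∂S.π) / 2 := by
      intro t
      rw [← integral_add (hmul c₁.measurable_u H₁.le hf hb t) (hmul c₂.measurable_u H₂.le hf hb t),
        ← integral_div]
      refine integral_congr_ae (ae_of_all _ fun x => ?_)
      simp only [midDensity]
      push_cast
      ring
    have k2 : ∫ p in Icc s t ×ˢ univ, graphGradient f p.2 * midFlux h₁ h₂ p.1 p.2 ∂S.timeθ T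
        = ((∫ p in Icc s t ×ˢ univ, graphGradient f p.2 * h₁ p.1 p.2 ∂S.timeθ T)
          + ∫ p in Icc s t ×ˢ univ, graphGradient f p.2 * h₂ p.1 p.2 ∂S.timeθ T) / 2 := by
      rw [← integral_add hi₁.integrableOn hi₂.integrableOn, ← integral_div]
      refine integral_congr_ae (ae_of_all _ fun x => ?_)
      simp only [midFlux]
      ring
    rw [k1, k1, k2, ← e₁, ← e₂]
    ring
  refine ⟨⟨(c₁.measurable_u.add c₂.measurable_u).div_const 2,
    (c₁.measurable_h.add c₂.measurable_h).div_const 2, fun t ht => ?_, ?_,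
    fun f hf hb s t hs hst ht => ?_⟩, fun t x => ?_, fun f hf hb hf2 s t hs hst ht => ?_, ?_, ?_⟩
  · refine (lintegral_mono (g := fun _ => (M : ℝ≥0∞)) fun x => ?_).trans_lt ?_
    · rw [ENNReal.coe_le_coe, midDensity, div_le_iff₀ two_pos, mul_two]
      exact add_le_add (H₁.le t x) (H₂.le t x)
    · rw [lintegral_const]
      exact ENNReal.mul_lt_top ENNReal.coe_lt_top (measure_lt_top _ _)
  · have hdm : Measurable fun p : ℝ × V × V => ENNReal.ofReal (truncDist p.2) :=
      (measurable_truncDist.comp measurable_snd).ennreal_ofReal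
    have m₁ : Measurable fun p : ℝ × V × V => ‖h₁ p.1 p.2‖ₑ * ENNReal.ofReal (truncDist p.2) :=
      (Measurable.enorm c₁.measurable_h).mul hdm
    have m₂ : Measurable fun p : ℝ × V × V => ‖h₂ p.1 p.2‖ₑ * ENNReal.ofReal (truncDist p.2) :=
      (Measurable.enorm c₂.measurable_h).mul hdm
    have M₁ : Measurable fun t => ∫⁻ e, ‖h₁ t e‖ₑ * ENNReal.ofReal (truncDist e) ∂S.θ :=
      Measurable.lintegral_prod_right' m₁
    refine (lintegral_mono (g := fun t => (∫⁻ e, ‖h₁ t e‖ₑ * ENNReal.ofReal (truncDist e) ∂S.θ)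
      + ∫⁻ e, ‖h₂ t e‖ₑ * ENNReal.ofReal (truncDist e) ∂S.θ) fun t => ?_).trans_lt ?_
    · have m₁t : Measurable fun e => ‖h₁ t e‖ₑ * ENNReal.ofReal (truncDist e) :=
        m₁.comp measurable_prodMk_left
      simp only
      rw [← lintegral_add_left m₁t]
      refine lintegral_mono fun e => ?_
      simp only
      rw [← add_mul]
      gcongr
      refine le_trans ?_ (enorm_add_le _ _)
      rw [midFlux, ← ofReal_norm, ← ofReal_norm]
      refine ENNReal.ofReal_le_ofReal ?_
      rw [norm_div, Real.norm_ofNat]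
      exact div_le_self (norm_nonneg _) one_le_two
    · rw [lintegral_add_left M₁]
      exact ENNReal.add_lt_top.2 ⟨c₁.moment, c₂.moment⟩
  · have hfm : Measurable f := hf.choose_spec.continuous.measurable
    exact hlin f hfm hb (hS.integrable_graphGradient_mul c₁.measurable_h c₁.moment hf hb)
      (hS.integrable_graphGradient_mul c₂.measurable_h c₂.moment hf hb) s t
      (c₁.equation f hf hb s t hs hst ht) (c₂.equation f hf hb s t hs hst ht)
  · rw [midDensity, div_le_iff₀ two_pos, mul_two]
    exact add_le_add (H₁.le t x) (H₂.le t x)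
  · exact hlin f hf hb
      (hS.integrable_flux (C := 1) measurable_const (ae_of_all _ fun _ => by simp) c₁.measurable_u
        c₁.measurable_h H₁.le hA₁ hf hb hf2)
      (hS.integrable_flux (C := 1) measurable_const (ae_of_all _ fun _ => by simp) c₂.measurable_u
        c₂.measurable_h H₂.le hA₂ hf hb hf2) s t
      (H₁.equation f hf hb hf2 s t hs hst ht) (H₂.equation f hf hb hf2 s t hs hst ht)
  · refine (lintegral_mono fun p => hS.actionDensity_mid_le p).trans_lt ?_
    have m₁ := hS.measurable_actionDensity (a := fun _ => 1) measurable_const c₁.measurable_u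
      c₁.measurable_h
    rw [lintegral_add_left (m₁.const_mul _), lintegral_const_mul' _ _ (by simp),
      lintegral_const_mul' _ _ (by simp)]
    exact ENNReal.add_lt_top.2 ⟨ENNReal.mul_lt_top (by simp) hA₁, ENNReal.mul_lt_top (by simp) hA₂⟩
  · refine (lintegral_mono fun p => fisherTerm_mid_le hconv p).trans_lt ?_
    have m₁ := measurable_fisherTerm (S := S) (a := fun _ => 1) measurable_const c₁.measurable_u
    rw [lintegral_add_left (m₁.const_mul _), lintegral_const_mul' _ _ (by simp),
      lintegral_const_mul' _ _ (by simp)]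
    exact ENNReal.add_lt_top.2 ⟨ENNReal.mul_lt_top (by simp) hF₁, ENNReal.mul_lt_top (by simp) hF₂⟩

/-- Uniqueness of bounded reflecting solutions for strictly convex entropies. -/
theorem ReflectingSolution.unique (H₁ : ReflectingSolution S T M (fun _ => 1) u₁ h₁)
    (H₂ : ReflectingSolution S T M (fun _ => 1) u₂ h₂) (hS : S.Assumptions)
    (hconv : ConvexOn ℝ≥0 univ S.fisherDensity) (hT : 0 ≤ T)
    (hstrict : StrictConvexOn ℝ (Ici 0) S.φ) (h0 : u₁ 0 =ᵐ[S.π] u₂ 0) :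
    (∀ t ∈ Icc 0 T, u₁ t =ᵐ[S.π] u₂ t) ∧ ∀ᵐ p ∂S.timeθ T, h₁ p.1 p.2 = h₂ p.1 p.2 := by
  have hfin := hS.finite_π
  have hsf := hS.sigmaFinite_θ
  have c₁ := H₁.dissipative.curve
  have c₂ := H₂.dissipative.curve
  have hmid := H₁.reflectingCurve_mid H₂ hS hconv hT
  set u := midDensity u₁ u₂ with hu
  set h := midFlux h₁ h₂ with hh
  have ut : ∀ {u : ℝ → V → ℝ≥0}, Measurable (Function.uncurry u) → ∀ t, Measurable (u t) :=
    fun hu t => hu.comp measurable_prodMk_left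
  have m₁ := hS.measurable_actionDensity (a := fun _ => 1) measurable_const c₁.measurable_u
    c₁.measurable_h
  have m₂ := hS.measurable_actionDensity (a := fun _ => 1) measurable_const c₂.measurable_u
    c₂.measurable_h
  have n₁ := measurable_fisherTerm (S := S) (a := fun _ => 1) measurable_const c₁.measurable_u
  have hEcongr : ∀ {v w : V → ℝ≥0}, v =ᵐ[S.π] w → S.densityEntropy v = S.densityEntropy w := by
    intro v w hvw
    refine lintegral_congr_ae ?_
    filter_upwards [hvw] with x hx
    rw [hx]
  have hE2 : S.densityEntropy (u₂ 0) = S.densityEntropy (u₁ 0) := (hEcongr h0).symm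
  have hEm : S.densityEntropy (u 0) = S.densityEntropy (u₁ 0) := by
    refine hEcongr ?_
    filter_upwards [h0] with x hx
    rw [hu, midDensity, ← hx, add_self_div_two]
  have hE0 : S.densityEntropy (u₁ 0) ≠ ∞ := H₁.dissipative.entropy_zero.ne
  have hA : ∀ t, S.actionOn T (fun _ => 1) u h 0 t ≤ 2⁻¹ * S.actionOn T (fun _ => 1) u₁ h₁ 0 t
      + 2⁻¹ * S.actionOn T (fun _ => 1) u₂ h₂ 0 t := by
    intro t
    unfold actionOn
    rw [← lintegral_const_mul' _ _ (by simp), ← lintegral_const_mul' _ _ (by simp),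
      ← lintegral_add_left (m₁.const_mul _)]
    exact lintegral_mono fun p => hS.actionDensity_mid_le p
  have hF : ∀ t, S.fisherOn T (fun _ => 1) u 0 t ≤ 2⁻¹ * S.fisherOn T (fun _ => 1) u₁ 0 t
      + 2⁻¹ * S.fisherOn T (fun _ => 1) u₂ 0 t := by
    intro t
    unfold fisherOn
    rw [← lintegral_const_mul' _ _ (by simp), ← lintegral_const_mul' _ _ (by simp),
      ← lintegral_add_left (n₁.const_mul _)]
    exact lintegral_mono fun p => fisherTerm_mid_le hconv p
  have hφm : ∀ {v : V → ℝ≥0}, Measurable v → Measurable fun x => ENNReal.ofReal (S.φ (v x)) :=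
    fun hv => hS.measurable_ofReal_φ.comp hv
  have hφle : ∀ t x, ENNReal.ofReal (S.φ (u t x))
      ≤ 2⁻¹ * ENNReal.ofReal (S.φ (u₁ t x)) + 2⁻¹ * ENNReal.ofReal (S.φ (u₂ t x)) ∧
      (2⁻¹ * ENNReal.ofReal (S.φ (u₁ t x)) + 2⁻¹ * ENNReal.ofReal (S.φ (u₂ t x))
        ≤ ENNReal.ofReal (S.φ (u t x)) → u₁ t x = u₂ t x) := by
    intro t x
    have p₁ := hS.φ_nonneg (u₁ t x).coe_nonneg
    have p₂ := hS.φ_nonneg (u₂ t x).coe_nonneg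
    have e1 : 2⁻¹ * ENNReal.ofReal (S.φ (u₁ t x)) + 2⁻¹ * ENNReal.ofReal (S.φ (u₂ t x))
        = ENNReal.ofReal (2⁻¹ * S.φ (u₁ t x) + 2⁻¹ * S.φ (u₂ t x)) := by
      rw [ENNReal.ofReal_add (by positivity) (by positivity), ENNReal.ofReal_mul (by norm_num),
        ENNReal.ofReal_mul (by norm_num), ENNReal.ofReal_inv_of_pos two_pos, ENNReal.ofReal_ofNat]
    have e2 : ((u t x : ℝ≥0) : ℝ) = (2⁻¹ : ℝ) • (u₁ t x : ℝ) + (2⁻¹ : ℝ) • (u₂ t x : ℝ) := by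
      simp only [hu, midDensity, smul_eq_mul]
      push_cast
      ring
    rw [e1]
    constructor
    · refine ENNReal.ofReal_le_ofReal ?_
      rw [e2]
      exact hS.φ_convex.2 (mem_Ici.2 (u₁ t x).coe_nonneg) (mem_Ici.2 (u₂ t x).coe_nonneg)
        (by norm_num) (by norm_num) (by norm_num)
    · intro hle
      rw [ENNReal.ofReal_le_ofReal_iff (hS.φ_nonneg (u t x).coe_nonneg), e2] at hle
      by_contra hne
      refine absurd hle (not_le.2 ?_)
      exact hstrict.2 (mem_Ici.2 (u₁ t x).coe_nonneg) (mem_Ici.2 (u₂ t x).coe_nonneg)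
        (fun h => hne (NNReal.coe_injective h)) (by norm_num) (by norm_num) (by norm_num)
  have hEavg : ∀ t, ∫⁻ x, (2⁻¹ * ENNReal.ofReal (S.φ (u₁ t x)) + 2⁻¹ * ENNReal.ofReal (S.φ (u₂ t x)))
      ∂S.π = 2⁻¹ * S.densityEntropy (u₁ t) + 2⁻¹ * S.densityEntropy (u₂ t) := by
    intro t
    rw [lintegral_add_left ((hφm (ut c₁.measurable_u t)).const_mul _),
      lintegral_const_mul' _ _ (by simp), lintegral_const_mul' _ _ (by simp)]
    rfl
  have hE : ∀ t, S.densityEntropy (u t)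
      ≤ 2⁻¹ * S.densityEntropy (u₁ t) + 2⁻¹ * S.densityEntropy (u₂ t) := by
    intro t
    rw [← hEavg]
    exact lintegral_mono fun x => (hφle t x).1
  -- averaging the two energy balances
  have hbal : ∀ t ∈ Icc 0 T,
      (2⁻¹ * S.actionOn T (fun _ => 1) u₁ h₁ 0 t + 2⁻¹ * S.actionOn T (fun _ => 1) u₂ h₂ 0 t)
      + (2⁻¹ * S.fisherOn T (fun _ => 1) u₁ 0 t + 2⁻¹ * S.fisherOn T (fun _ => 1) u₂ 0 t)
      + (2⁻¹ * S.densityEntropy (u₁ t) + 2⁻¹ * S.densityEntropy (u₂ t))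
      = S.densityEntropy (u₁ 0) := by
    intro t ht
    have b₁ := H₁.balance 0 t le_rfl ht.1 ht.2
    have b₂ := H₂.balance 0 t le_rfl ht.1 ht.2
    rw [hE2] at b₂
    calc _ = 2⁻¹ * (S.actionOn T (fun _ => 1) u₁ h₁ 0 t + S.fisherOn T (fun _ => 1) u₁ 0 t
          + S.densityEntropy (u₁ t)) + 2⁻¹ * (S.actionOn T (fun _ => 1) u₂ h₂ 0 t
          + S.fisherOn T (fun _ => 1) u₂ 0 t + S.densityEntropy (u₂ t)) := by ring
      _ = S.densityEntropy (u₁ 0) := by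
        rw [b₁, b₂, ← add_mul, ENNReal.inv_two_add_inv_two, one_mul]
  -- For the midpoint only the chain rule inequality is known, which is enough: against the averaged
  -- balances, convexity of all three functionals leaves room for equalities only.
  have hchain : ∀ t ∈ Icc 0 T, S.densityEntropy (u₁ 0) ≤ S.densityEntropy (u t)
      + (S.actionOn T (fun _ => 1) u h 0 t + S.fisherOn T (fun _ => 1) u 0 t) := by
    intro t ht
    rw [← hEm]
    exact hmid.densityEntropy_le hS hconv le_rfl ht.1 ht.2
  have hu12 : ∀ t ∈ Icc 0 T, u₁ t =ᵐ[S.π] u₂ t := by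
    intro t ht
    have hb := hbal t ht
    set X := (2⁻¹ * S.actionOn T (fun _ => 1) u₁ h₁ 0 t + 2⁻¹ * S.actionOn T (fun _ => 1) u₂ h₂ 0 t)
      + (2⁻¹ * S.fisherOn T (fun _ => 1) u₁ 0 t + 2⁻¹ * S.fisherOn T (fun _ => 1) u₂ 0 t) with hX
    have hXfin : X ≠ ∞ := ne_top_of_le_ne_top hE0 (by rw [← hb]; exact le_self_add)
    have hge : 2⁻¹ * S.densityEntropy (u₁ t) + 2⁻¹ * S.densityEntropy (u₂ t)
        ≤ S.densityEntropy (u t) := by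
      refine (ENNReal.add_le_add_iff_left hXfin).1 ?_
      rw [hb, add_comm X]
      exact (hchain t ht).trans (add_le_add_right (add_le_add (hA t) (hF t)) _)
    have hEfin : S.densityEntropy (u t) ≠ ∞ := ne_top_of_le_ne_top hE0
      ((hE t).trans (by rw [← hb]; exact le_add_self))
    -- Equality of the integrals makes the pointwise convexity inequality an equality almost
    -- everywhere, and strict convexity of `φ` identifies the two densities.
    have hae := ae_eq_of_ae_le_of_lintegral_le (ae_of_all _ fun x => (hφle t x).1) hEfin
      (((hφm (ut c₁.measurable_u t)).const_mul _).add
        ((hφm (ut c₂.measurable_u t)).const_mul _)).aemeasurable ((hEavg t).trans_le hge)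
    filter_upwards [hae] with x hx
    exact (hφle t x).2 hx.ge
  refine ⟨hu12, ?_⟩
  have hTT : T ∈ Icc 0 T := right_mem_Icc.2 hT
  have hb := hbal T hTT
  set Y := 2⁻¹ * S.actionOn T (fun _ => 1) u₁ h₁ 0 T + 2⁻¹ * S.actionOn T (fun _ => 1) u₂ h₂ 0 T
    with hY
  set Z := (2⁻¹ * S.fisherOn T (fun _ => 1) u₁ 0 T + 2⁻¹ * S.fisherOn T (fun _ => 1) u₂ 0 T) with hZ
  set W := 2⁻¹ * S.densityEntropy (u₁ T) + 2⁻¹ * S.densityEntropy (u₂ T) with hW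
  have hZW : Z + W ≠ ∞ := ne_top_of_le_ne_top hE0 (by
    rw [← hb, add_assoc Y Z W]; exact le_add_left le_rfl)
  have hge : Y ≤ S.actionOn T (fun _ => 1) u h 0 T := by
    refine (ENNReal.add_le_add_iff_right hZW).1 ?_
    rw [← add_assoc _ Z W, hb]
    refine (hchain T hTT).trans ((add_le_add (hE T) (add_le_add_right (hF T) _)).trans (le_of_eq ?_))
    ring
  have hAfin : S.actionOn T (fun _ => 1) u h 0 T ≠ ∞ := by
    refine ne_top_of_le_ne_top hE0 ((hA T).trans ?_)
    rw [← hb, add_assoc Y Z W]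
    exact le_self_add
  have hYeq : ∫⁻ p, (2⁻¹ * S.actionDensity (fun _ => 1) u₁ h₁ p
      + 2⁻¹ * S.actionDensity (fun _ => 1) u₂ h₂ p) ∂S.timeθ T = Y := by
    rw [lintegral_add_left (m₁.const_mul _), lintegral_const_mul' _ _ (by simp),
      lintegral_const_mul' _ _ (by simp), hY, actionOn, actionOn, lintegral_timeθ_eq hS,
      lintegral_timeθ_eq hS]
  rw [actionOn, lintegral_timeθ_eq hS] at hge hAfin
  have hae := ae_eq_of_ae_le_of_lintegral_le (ae_of_all _ fun p => hS.actionDensity_mid_le p) hAfin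
    ((m₁.const_mul _).add (m₂.const_mul _)).aemeasurable (hYeq.trans_le hge)
  have hends := hS.ae_timeθ_endpoints
    (P := fun q => u₁ q.1 q.2 = u₂ q.1 q.2) (measurableSet_eq_fun c₁.measurable_u c₂.measurable_u) hu12
  filter_upwards [hae, hends, ae_lt_top m₁ (H₁.dissipative.lintegral_lt_top hS hT).1.ne,
    ae_lt_top m₂ (H₂.dissipative.lintegral_lt_top hS hT).1.ne] with p hp he l₁ l₂
  have hup : ∀ x, u₁ p.1 x = u₂ p.1 x → midDensity u₁ u₂ p.1 x = u₁ p.1 x := fun x hx => by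
    rw [midDensity, ← hx, add_self_div_two]
  unfold actionDensity at hp l₁ l₂
  rw [hup _ he.1, hup _ he.2, ← he.1, ← he.2] at hp
  rw [← he.1, ← he.2] at l₂
  have hn : ∀ {x : ℝ≥0∞}, 2⁻¹ * x < ∞ → x ≠ ∞ := by
    rintro x hx rfl
    simp at hx
  have h2 : 2 * h₁ p.1 p.2 = 2 * h₂ p.1 p.2 := by
    -- The densities already coincide, so both fluxes see the same mobility and strict convexity in
    -- the flux variable alone concludes.
    refine eq_of_perspective_half hS (r := ((1 : ℝ).toNNReal : ℝ) * S.α (u₁ p.1 p.2.1, u₁ p.1 p.2.2))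
      (by positivity) (hn l₁) (hn l₂) ?_
    rw [mul_left_comm, mul_left_comm (2⁻¹ : ℝ≥0∞) (2⁻¹ : ℝ≥0∞) (S.perspective (2 * h₂ p.1 p.2) _),
      ← mul_add] at hp
    have h3 := (ENNReal.mul_right_inj (a := (2⁻¹ : ℝ≥0∞)) (by simp) (by simp)).1 hp
    rw [← h3]
    refine le_of_eq ?_
    congr 1
    unfold midFlux
    ring
  linarith

end JumpSystem

/-! ### Convergence of the whole sequence and conclusion -/

namespace JumpSystem

variable {V : Type*} [MetricSpace V] [SecondCountableTopology V] [MeasurableSpace V]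
  [BorelSpace V] {S : JumpSystem V} {T : ℝ} {M C : ℝ≥0} {a : ℕ → V × V → ℝ}

lemma Assumptions.exists_density (hS : S.Assumptions) {ρ : FiniteMeasure V} (hρ : S.entropy ρ < ∞) :
    ∃ u : V → ℝ≥0, Measurable u ∧ Integrable (fun x => (u x : ℝ)) S.π ∧
      (ρ : Measure V) = S.π.withDensity fun x => u x := by
  have hfin := hS.finite_π
  have hac : (ρ : Measure V) ≪ S.π := by
    by_contra hne
    rw [entropy, if_neg hne] at hρ
    exact hρ.ne rfl
  set u : V → ℝ≥0 := fun x => ((ρ : Measure V).rnDeriv S.π x).toNNReal with hu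
  have hum : Measurable u := (Measure.measurable_rnDeriv _ _).ennreal_toNNReal
  have heq : (ρ : Measure V) = S.π.withDensity fun x => u x := by
    conv_lhs => rw [← Measure.withDensity_rnDeriv_eq _ _ hac]
    refine withDensity_congr_ae ?_
    filter_upwards [Measure.rnDeriv_lt_top (ρ : Measure V) S.π] with x hx
    rw [hu, ENNReal.coe_toNNReal hx.ne]
  refine ⟨u, hum, ⟨hum.coe_nnreal_real.aestronglyMeasurable, ?_⟩, heq⟩
  have h1 : ∫⁻ x, u x ∂S.π = (ρ : Measure V) univ := by
    rw [heq, withDensity_apply _ MeasurableSet.univ, setLIntegral_univ]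
  have h2 : ∀ x, ‖(u x : ℝ)‖ₑ = u x := fun x => by simp
  simp only [HasFiniteIntegral, h2, h1]
  exact measure_lt_top _ _

lemma IsApproximation.multiplierTendsto (ha : S.IsApproximation a) :
    ∃ C : ℝ≥0, MultiplierTendsto S C a := by
  obtain ⟨C, hC⟩ := ha.essBounded
  refine ⟨C.toNNReal, ha.measurable, fun n => ?_, ha.tendsto⟩
  filter_upwards [hC n] with e he
  exact he.trans (Real.le_coe_toNNReal C)

/-- Convergence of the whole sequence of reflecting solutions. -/
lemma ReflectingSolution.solutionsTendsto {un : ℕ → ℝ → V → ℝ≥0} {hn : ℕ → ℝ → V × V → ℝ}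
    {u : ℝ → V → ℝ≥0} {h : ℝ → V × V → ℝ}
    (H : ReflectingSolution S T M (fun _ => 1) u h) (hS : S.Assumptions)
    (hconv : ConvexOn ℝ≥0 univ S.fisherDensity) (hT : 0 ≤ T)
    (hstrict : StrictConvexOn ℝ (Ici 0) S.φ) (hm : ∀ n, Multiplier (a n))
    (ha : MultiplierTendsto S C a) (hs : ∀ n, ReflectingSolution S T M (a n) (un n) (hn n))
    {u₀ : V → ℝ≥0} (hu₀ : Measurable u₀) (hu₀i : Integrable (fun x => (u₀ x : ℝ)) S.π)
    (h0 : ∀ B, MeasurableSet B →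
      Tendsto (fun n => ∫ x in B, (un n 0 x : ℝ) ∂S.π) atTop (𝓝 (∫ x in B, (u₀ x : ℝ) ∂S.π)))
    (hE : Tendsto (fun n => S.densityEntropy (un n 0)) atTop (𝓝 (S.densityEntropy u₀)))
    (hE₀ : S.densityEntropy u₀ < ∞) (hu : u 0 =ᵐ[S.π] u₀) : SolutionsTendsto S T a un hn u h := by
  -- Every subsequence has a further one converging to a reflecting solution with the same initial
  -- datum; uniqueness identifies that limit with `(u, h)`.
  refine SolutionsTendsto.of_subseq fun ns hns => ?_
  obtain ⟨σ, u', h', -, hlim, H', hu'⟩ := exists_reflecting_limit hS hconv hT (fun n => hm (ns n))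
    (ha.comp hns) (fun n => hs (ns n)) hu₀ hu₀i (fun B hB => (h0 B hB).comp hns) (hE.comp hns) hE₀
  obtain ⟨e1, e2⟩ := H'.unique H hS hconv hT hstrict (hu'.trans hu.symm)
  exact ⟨σ, hlim.congr hS H'.dissipative.curve.measurable_u H.dissipative.curve.measurable_u e1 e2⟩

end JumpSystem

end

theorem mainTheorem2 {V : Type*} [MetricSpace V] [TopologicalSpace.SeparableSpace V]
    [MeasurableSpace V] [BorelSpace V]
    (S : JumpSystem V) (hS : S.Assumptions) (hconv : ConvexOn ℝ≥0 Set.univ S.fisherDensity)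
    (a : ℕ → V × V → ℝ) (ha : S.IsApproximation a)
    (T : ℝ) (hT : 0 < T)
    (ρ₀n : ℕ → FiniteMeasure V) (ρ₀ : FiniteMeasure V)
    (hdomn : ∀ n, S.entropy (ρ₀n n) < ∞) (hdom : S.entropy ρ₀ < ∞)
    (hsetwise : SetwiseTendsto ρ₀n ρ₀)
    (hentropy : Tendsto (fun n => S.entropy (ρ₀n n)) atTop (𝓝 (S.entropy ρ₀)))
    (ρn : ℕ → ℝ → FiniteMeasure V) (jn : ℕ → ℝ → SigmaFiniteSignedMeasure (V × V))
    (hinit : ∀ n, ρn n 0 = ρ₀n n) :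
    ((∀ n, (S.reweight (a n)).IsDissipative T (ρn n) (jn n)) →
      ∃ (σ : ℕ → ℕ) (ρ : ℝ → FiniteMeasure V) (j : ℝ → SigmaFiniteSignedMeasure (V × V)),
        StrictMono σ ∧ S.FiniteActionCurve T ρ j ∧
        JumpSystem.CurvesTendsto T (fun k => ρn (σ k)) (fun k => jn (σ k)) ρ j ∧
        S.IsDissipative T ρ j) ∧
    ((∀ n, (S.reweight (a n)).IsReflecting T (ρn n) (jn n)) →
      (∃ M : ℝ≥0, ∀ n, ∀ t ∈ Set.Icc 0 T, ∀ᵐ x ∂S.π, S.density (ρn n t) x ≤ M) →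
      ∃ (ρ : ℝ → FiniteMeasure V) (j : ℝ → SigmaFiniteSignedMeasure (V × V)),
        S.FiniteActionCurve T ρ j ∧ S.IsReflecting T ρ j ∧
        (∃ σ : ℕ → ℕ, StrictMono σ ∧
          JumpSystem.CurvesTendsto T (fun k => ρn (σ k)) (fun k => jn (σ k)) ρ j ∧
          JumpSystem.EnergiesTendsto (fun k => S.reweight (a (σ k))) S T
            (fun k => ρn (σ k)) (fun k => jn (σ k)) ρ j) ∧
        (StrictConvexOn ℝ (Set.Ici 0) S.φ →
          JumpSystem.CurvesTendsto T ρn jn ρ j ∧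
          JumpSystem.EnergiesTendsto (fun n => S.reweight (a n)) S T ρn jn ρ j)) := by
  have : SecondCountableTopology V := UniformSpace.secondCountable_of_separable V
  have hT' : 0 ≤ T := hT.le
  have h00 : (0 : ℝ) ∈ Icc 0 T := left_mem_Icc.2 hT'
  have hm := fun n => ha.multiplier n
  obtain ⟨C, hC⟩ := ha.multiplierTendsto
  obtain ⟨u₀, hu₀, hu₀i, hρ₀⟩ := hS.exists_density hdom
  have hent₀ : S.densityEntropy u₀ = S.entropy ρ₀ := (hS.entropy_eq hu₀ hρ₀).symm
  have hE₀ : S.densityEntropy u₀ < ∞ := by rwa [hent₀]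
  -- convergence of the initial data in terms of the densities
  have hinit0 : ∀ (un : ℕ → ℝ → V → ℝ≥0) (hn : ℕ → ℝ → V × V → ℝ),
      (∀ n, JumpSystem.Represents S T (ρn n) (jn n) (un n) (hn n)) →
      (∀ B, MeasurableSet B → Tendsto (fun n => ∫ x in B, (un n 0 x : ℝ) ∂S.π) atTop
        (𝓝 (∫ x in B, (u₀ x : ℝ) ∂S.π))) ∧
      Tendsto (fun n => S.densityEntropy (un n 0)) atTop (𝓝 (S.densityEntropy u₀)) := by
    intro un hn hRn
    refine ⟨(JumpSystem.setwiseTendsto_of_density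
      (fun n => (hRn n).measurable_u.comp measurable_prodMk_left) hu₀
      (fun n => ?_) hρ₀).1 hsetwise, ?_⟩
    · rw [← hinit n]; exact (hRn n).ρ_eq 0 h00
    · rw [hent₀]
      refine hentropy.congr fun n => ?_
      rw [← hinit n, (hRn n).entropy_eq hS h00]
      rfl
  refine ⟨fun hD => ?_, fun hr hbd => ?_⟩
  · choose un hn hRn using fun n => (hD n).exists_represents hS (hm n) hT'
    obtain ⟨h0, hE⟩ := hinit0 un hn hRn
    obtain ⟨σ, u, h, hσ, hlim, hdiss, -⟩ := JumpSystem.exists_dissipative_limit hS hconv hT' hm hC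
      (fun n => (hRn n).dissipativeCurve (hD n) hS (hm n) hT') hu₀ hu₀i h0 hE hE₀
    obtain ⟨ρ, j, hR, hc⟩ := hdiss.curve.exists_represents hS hT'
    obtain ⟨hA, hDis⟩ := hR.finiteActionCurve hc hdiss hS hT'
    exact ⟨σ, ρ, j, hσ, hA, hlim.curvesTendsto (fun n => hRn (σ n)) hR, hDis⟩
  · obtain ⟨M, hM⟩ := hbd
    have hex : ∀ n, ∃ u h, JumpSystem.Represents S T (ρn n) (jn n) u h ∧
        JumpSystem.ReflectingSolution S T M (a n) u h := by
      intro n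
      have hdis : (S.reweight (a n)).IsDissipative T (ρn n) (jn n) := ⟨(hr n).entropy_zero,
        (hr n).reflecting.finiteAction.continuityEquation,
        fun t ht => ((hr n).energyBalance 0 t le_rfl ht.1 ht.2).le⟩
      obtain ⟨u, h, hR⟩ := hdis.exists_represents hS (hm n) hT'
      -- One constant `M` bounds all curves of the sequence; truncating makes the bound hold at
      -- every point, as density-form solutions require.
      have hR' := hR.truncate (M := M) fun t ht => by
        filter_upwards [hM n t ht, hS.density_ae_eq (hR.measurable_u.comp measurable_prodMk_left)
          (hR.ρ_eq t ht)] with x h1 h2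
        rw [h2] at h1
        exact ENNReal.coe_le_coe.1 h1
      exact ⟨_, h, hR', hR'.reflectingSolution hS (hm n) (hC.le n) hT' (hr n)
        fun t x => min_le_right _ _⟩
    choose un hn hRn hsn using hex
    obtain ⟨h0, hE⟩ := hinit0 un hn hRn
    obtain ⟨σ, u, h, hσ, hlim, hsol, hu0⟩ := JumpSystem.exists_reflecting_limit hS hconv hT' hm hC
      hsn hu₀ hu₀i h0 hE hE₀
    obtain ⟨ρ, j, hR, hc⟩ := hsol.dissipative.curve.exists_represents hS hT'
    refine ⟨ρ, j, (hR.finiteActionCurve hc hsol.dissipative hS hT').1,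
      hR.isReflecting hS hT' hc hsol, ⟨σ, hσ, ?_⟩, fun hstrict => ?_⟩
    · exact hlim.tendsto hS (fun n => hm (σ n)) (fun n => hRn (σ n)) hR
    · exact (hsol.solutionsTendsto hS hconv hT' hstrict hm hC hsn hu₀ hu₀i h0 hE hE₀ hu0).tendsto hS
        hm hRn hR
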